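/- Let $\lambda,\mu$ be real constants with $\mu>0$ and $\lambda+\mu>0$. There is an integer $N$ (the amount of smoothness and decay that suffices) such that the following holds. Let $u_j,v_j,w_j$ ($j=0,1$) be real functions of $(x,y,z)$, $z\ge 0$, and $g_1,g_2,g_3$ real functions of $(x,y,t)$, $t\ge0$, all of class $C^N$ up to the boundary, whose derivatives of order at most $N$ are $O((1+|x|+|y|+|z|)^{-N})$, respectively $O((1+|x|+|y|)^{-N})$ uniformly on bounded time intervals. Let $(u,v,w)$ be a solution, for $x,y\in\mathbb R$, $z>0$, $t>0$, of the Lamé–Navier equations $$(\lambda+2\mu)u_{xx}+(\lambda+\mu)(v_{xy}+w_{xz})+\mu(u_{yy}+u_{zz})=u_{tt},$$ $$(\lambda+2\mu)v_{yy}+(\lambda+\mu)(w_{yz}+u_{yx})+\mu(v_{zz}+v_{xx})=v_{tt},$$ $$(\lambda+2\mu)w_{zz}+(\lambda+\mu)(u_{zx}+v_{zy})+\mu(w_{xx}+w_{yy})=w_{tt},$$ with the initial conditions $(u,v,w)|_{t=0}=(u_0,v_0,w_0)$, $(u_t,v_t,w_t)|_{t=0}=(u_1,v_1,w_1)$ and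 the stress boundary conditions at $z=0$, $t>0$, $$u_z+w_x=g_1,\qquad v_z+w_y=g_2,\qquad w_z+\tfrac{\lambda}{\lambda+2\mu}(u_x+v_y)=g_3,$$ which is $C^2$ on $\{z\ge0,t\ge0\}$ and decays for large $(x,y,z)$: its derivatives of order at most two are $O((1+|x|+|y|+|z|)^{-4})$ uniformly on bounded time intervals. Then $(u,v,w)$ is given by the following formulae in terms of the data. Let $\hat f(k,l,m)=\int_{\mathbb R}dx\int_{\mathbb R}dy\int_0^\infty dz\,e^{-ikx-ily-imz}f(x,y,z)$ and $\tilde g(k,l,t)=\int_{\mathbb R}dx\int_{\mathbb R}dy\,e^{-ikx-ily}g(x,y,t)$; for $j=0,1$ let $P_j=k\hat u_j+l\hat v_j+m\hat w_j$, $Q_j=m\hat v_j-l\hat w_j$, $R_j=k\hat w_j-m\hat u_j$. Let $\omega_1=\sqrt{\lambda+2\mu}\,(k^2+l^2+m^2)^{1/2}$ and $\omega_2=\sqrt{\mu}\,(k^2+l^2+m^2)^{1/2}$, where the root has its cut on the segment joining $\pm i\sqrt{k^2+l^2}$ and is $\sim m$ as $m\to\infty$. For $j=1,2$ let $G^{(j)},F^{(j)},E^{(j)}$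 be $$\frac1{2\omega_j}\Big(e^{-i\omega_jt}\int_0^te^{i\omega_js}\tilde g(k,l,s)\,ds-e^{i\omega_jt}\int_0^te^{-i\omega_js}\tilde g(k,l,s)\,ds\Big)$$ with $g=g_1,g_2,g_3$, respectively, and let $$N_P=-i\mu kG^{(1)}-i\mu lF^{(1)}-im(\lambda+2\mu)E^{(1)}+\big(\tfrac12P_0+\tfrac{i}{2\omega_1}P_1\big)e^{-i\omega_1t}+\big(\tfrac12P_0-\tfrac{i}{2\omega_1}P_1\big)e^{i\omega_1t},$$ $$N_Q=-i\mu mF^{(2)}+il(\lambda+2\mu)E^{(2)}+\big(\tfrac12Q_0+\tfrac{i}{2\omega_2}Q_1\big)e^{-i\omega_2t}+\big(\tfrac12Q_0-\tfrac{i}{2\omega_2}Q_1\big)e^{i\omega_2t},$$ $$N_R=i\mu mG^{(2)}-ik(\lambda+2\mu)E^{(2)}+\big(\tfrac12R_0+\tfrac{i}{2\omega_2}R_1\big)e^{-i\omega_2t}+\big(\tfrac12R_0-\tfrac{i}{2\omega_2}R_1\big)e^{i\omega_2t}.$$ Let $$m_{21}=-m\Big(\tfrac{\lambda+2\mu}{\mu}+\tfrac{\lambda+\mu}{\mu}\tfrac{k^2+l^2}{m^2}\Big)^{1/2},\qquad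 m_{12}=-m\Big(\tfrac{\mu}{\lambda+2\mu}-\tfrac{\lambda+\mu}{\lambda+2\mu}\tfrac{k^2+l^2}{m^2}\Big)^{1/2}$$ with principal roots, so that the cut of $m_{21}$ is the segment joining $\pm i\sqrt{k^2+l^2}\sqrt{(\lambda+\mu)/(\lambda+2\mu)}$ and that of $m_{12}$ is the segment joining $\pm\sqrt{k^2+l^2}\sqrt{(\lambda+\mu)/\mu}$. Let $$C=\begin{pmatrix}2\mu km_{12}&2\mu lm_{12}&\lambda(k^2+l^2)+(\lambda+2\mu)m_{12}^2\\-\mu kl&\mu(m^2-l^2)&2\mu ml\\-\mu(m^2-k^2)&\mu kl&-2\mu km\end{pmatrix},$$ $$D=\begin{pmatrix}-2\mu km&-2\mu lm&\lambda(k^2+l^2)+(\lambda+2\mu)m^2\\-\mu kl&\mu(m_{21}^2-l^2)&-2\mu lm_{21}\\\mu(k^2-m_{21}^2)&\mu kl&2\mu km_{21}\end{pmatrix},$$ $\Delta_1=\det C$, $\Delta_2=\det D$, and $$\begin{pmatrix}U_2\\V_2\\W_2\end{pmatrix}=-C^{-1}\begin{pmatrix}N_P(k,l,m_{12},t)\\N_Q(k,l,-m,t)\\N_R(k,l,-m,t)\end{pmatrix},\qquad\begin{pmatrix}U_1\\V_1\\W_1\end{pmatrix}=-D^{-1}\begin{pmatrix}N_P(k,l,-m,t)\\N_Q(k,l,m_{21},t)\\N_R(k,l,m_{21},t)\end{pmatrix}.$$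 For $k,l\in\mathbb R$ let $\gamma_{k,l}$ be a deformation of the real axis, i.e. a curve $s\mapsto s+ih(s)$ with $h\ge0$ continuous, of compact support, differentiable off a finite set and with integrable derivative, such that the zeros of $\Delta_1,\Delta_2$ and the branch points of $m_{12},m_{21}$ with the cuts joining them are all (strictly) below $\gamma_{k,l}$. Such contours exist for all $k,l$, and for every choice of them, every $x,y\in\mathbb R$, $z>0$, $t>0$, all the integrals below converge and $$u=\frac1{8\pi^3}\int_{\mathbb R}dk\int_{\mathbb R}dl\int_{\gamma_{k,l}}dm\,\frac{e^{ikx+ily+imz}}{k^2+l^2+m^2}\Big\{2k[\lambda(k^2+l^2)+m^2(\lambda+2\mu)]W_1-4\mu km^2W_2\Big\}$$ $$+\frac1{8\pi^3}\int_{\mathbb R^3}dk\,dl\,dm\,\frac{e^{ikx+ily+imz}}{k^2+l^2+m^2}\Big\{k[N_P(m)+N_P(-m)]-\frac{kl}{m}[N_Q(m)-N_Q(-m)]-\frac{m^2+l^2}{m}[N_R(m)-N_R(-m)]\Big\},$$ $$v=\frac1{8\pi^3}\int_{\mathbb R}dk\int_{\mathbb R}dl\int_{\gamma_{k,l}}dm\,\frac{e^{ikx+ily+imz}}{k^2+l^2+m^2}\Big\{2l[\lambda(k^2+l^2)+m^2(\lambda+2\mu)]W_1-4\mu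 lm^2W_2\Big\}$$ $$+\frac1{8\pi^3}\int_{\mathbb R^3}dk\,dl\,dm\,\frac{e^{ikx+ily+imz}}{k^2+l^2+m^2}\Big\{l[N_P(m)+N_P(-m)]+\frac{k^2+m^2}{m}[N_Q(m)-N_Q(-m)]+\frac{lk}{m}[N_R(m)-N_R(-m)]\Big\},$$ $$w=\frac1{8\pi^3}\int_{\mathbb R}dk\int_{\mathbb R}dl\int_{\gamma_{k,l}}dm\,\frac{e^{ikx+ily+imz}}{k^2+l^2+m^2}\Big\{4\mu km^2U_1+4\mu lm^2V_1+2\mu k(l^2+k^2-m^2)U_2+2\mu l(k^2+l^2-m^2)V_2\Big\}$$ $$+\frac1{8\pi^3}\int_{\mathbb R^3}dk\,dl\,dm\,\frac{e^{ikx+ily+imz}}{k^2+l^2+m^2}\Big\{m[N_P(m)-N_P(-m)]-l[N_Q(m)+N_Q(-m)]+k[N_R(m)+N_R(-m)]\Big\},$$ where $N_P(\pm m)=N_P(k,l,\pm m,t)$, and likewise for $N_Q,N_R$. The integer $N$ does not depend on $\lambda$, $\mu$ or the data. -/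

import Mathlib

open MeasureTheory Complex

noncomputable section

namespace HalfSpace

/-! ### The initial-boundary value problem -/

/-- The closed half-space `{(a, b, c) : c ≥ 0}`. It is used both for points `(x, y, z)` of the body
and for points `(x, y, t)` of the boundary at time `t`. -/
def halfSpace : Set (ℝ × ℝ × ℝ) := {p | 0 ≤ p.2.2}

/-- The closed space-time domain `{(x, y, z, t) : z ≥ 0, t ≥ 0}`. -/
def domain : Set (ℝ × ℝ × ℝ × ℝ) := {p | 0 ≤ p.2.2.1 ∧ 0 ≤ p.2.2.2}

/-- Partial derivative in the direction `e` on the closed domain (one-sided on its boundary). -/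
def pd (e : ℝ × ℝ × ℝ × ℝ) (f : ℝ × ℝ × ℝ × ℝ → ℝ) (p : ℝ × ℝ × ℝ × ℝ) : ℝ :=
  fderivWithin ℝ f domain p e

/-- `∂/∂x` -/
abbrev dx : (ℝ × ℝ × ℝ × ℝ → ℝ) → ℝ × ℝ × ℝ × ℝ → ℝ := pd (1, 0, 0, 0)
/-- `∂/∂y` -/
abbrev dy : (ℝ × ℝ × ℝ × ℝ → ℝ) → ℝ × ℝ × ℝ × ℝ → ℝ := pd (0, 1, 0, 0)
/-- `∂/∂z` -/
abbrev dz : (ℝ × ℝ × ℝ × ℝ → ℝ) → ℝ × ℝ × ℝ × ℝ → ℝ := pd (0, 0, 1, 0)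
/-- `∂/∂t` -/
abbrev dt : (ℝ × ℝ × ℝ × ℝ → ℝ) → ℝ × ℝ × ℝ × ℝ → ℝ := pd (0, 0, 0, 1)

/-- The given functions: initial displacements `u₀, v₀, w₀` and velocities `u₁, v₁, w₁` (functions of
`(x, y, z)`), and boundary stresses `g₁, g₂, g₃` (functions of `(x, y, t)`). -/
structure Data where
  u₀ : ℝ × ℝ × ℝ → ℝ
  v₀ : ℝ × ℝ × ℝ → ℝ
  w₀ : ℝ × ℝ × ℝ → ℝ
  u₁ : ℝ × ℝ × ℝ → ℝ
  v₁ : ℝ × ℝ × ℝ → ℝ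
  w₁ : ℝ × ℝ × ℝ → ℝ
  g₁ : ℝ × ℝ × ℝ → ℝ
  g₂ : ℝ × ℝ × ℝ → ℝ
  g₃ : ℝ × ℝ × ℝ → ℝ

/-- The Lamé-Navier equations (density one) for `z > 0`, `t > 0`. -/
def LameNavier (lam mu : ℝ) (u v w : ℝ × ℝ × ℝ × ℝ → ℝ) : Prop :=
  ∀ x y z t : ℝ, 0 < z → 0 < t →
    (lam + 2 * mu) * dx (dx u) (x, y, z, t)
        + (lam + mu) * (dy (dx v) (x, y, z, t) + dz (dx w) (x, y, z, t))
        + mu * (dy (dy u) (x, y, z, t) + dz (dz u) (x, y, z, t)) - dt (dt u) (x, y, z, t) = 0 ∧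
    (lam + 2 * mu) * dy (dy v) (x, y, z, t)
        + (lam + mu) * (dz (dy w) (x, y, z, t) + dx (dy u) (x, y, z, t))
        + mu * (dz (dz v) (x, y, z, t) + dx (dx v) (x, y, z, t)) - dt (dt v) (x, y, z, t) = 0 ∧
    (lam + 2 * mu) * dz (dz w) (x, y, z, t)
        + (lam + mu) * (dx (dz u) (x, y, z, t) + dy (dz v) (x, y, z, t))
        + mu * (dx (dx w) (x, y, z, t) + dy (dy w) (x, y, z, t)) - dt (dt w) (x, y, z, t) = 0

/-- The initial conditions. -/
def InitialConditions (d : Data) (u v w : ℝ × ℝ × ℝ × ℝ → ℝ) : Prop :=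
  ∀ x y z : ℝ, 0 < z →
    u (x, y, z, 0) = d.u₀ (x, y, z) ∧ dt u (x, y, z, 0) = d.u₁ (x, y, z) ∧
    v (x, y, z, 0) = d.v₀ (x, y, z) ∧ dt v (x, y, z, 0) = d.v₁ (x, y, z) ∧
    w (x, y, z, 0) = d.w₀ (x, y, z) ∧ dt w (x, y, z, 0) = d.w₁ (x, y, z)

/-- The stress boundary conditions on `z = 0`. -/
def StressConditions (lam mu : ℝ) (d : Data) (u v w : ℝ × ℝ × ℝ × ℝ → ℝ) : Prop :=
  ∀ x y t : ℝ, 0 < t →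
    dz u (x, y, 0, t) + dx w (x, y, 0, t) = d.g₁ (x, y, t) ∧
    dz v (x, y, 0, t) + dy w (x, y, 0, t) = d.g₂ (x, y, t) ∧
    dz w (x, y, 0, t) + lam / (lam + 2 * mu) * (dx u (x, y, 0, t) + dy v (x, y, 0, t))
      = d.g₃ (x, y, t)

/-- A displacement component of class `C²` up to the boundary which decays for large `(x, y, z)`,
together with its derivatives up to order two, uniformly on bounded time intervals. -/
def ClassicalDecaying (f : ℝ × ℝ × ℝ × ℝ → ℝ) : Prop :=
  ContDiffOn ℝ 2 f domain ∧
  ∀ T : ℝ, ∃ A : ℝ, ∀ x y z t : ℝ, 0 ≤ z → 0 ≤ t → t ≤ T → ∀ n : ℕ, n ≤ 2 →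
    ‖iteratedFDerivWithin ℝ n f domain (x, y, z, t)‖ ≤ A / (1 + |x| + |y| + |z|) ^ 4

/-- `(u, v, w)` is a classical decaying solution of the initial-boundary value problem. -/
structure IsDecayingSolution (lam mu : ℝ) (d : Data) (u v w : ℝ × ℝ × ℝ × ℝ → ℝ) : Prop where
  decay_u : ClassicalDecaying u
  decay_v : ClassicalDecaying v
  decay_w : ClassicalDecaying w
  equations : LameNavier lam mu u v w
  initial : InitialConditions d u v w
  stress : StressConditions lam mu d u v w

/-- Smoothness of order `N` and decay of order `N` of a function of `(x, y, z)`, `z ≥ 0`. -/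
def SmoothDecayingInitial (N : ℕ) (f : ℝ × ℝ × ℝ → ℝ) : Prop :=
  ContDiffOn ℝ N f halfSpace ∧
  ∃ A : ℝ, ∀ x y z : ℝ, 0 ≤ z → ∀ n : ℕ, n ≤ N →
    ‖iteratedFDerivWithin ℝ n f halfSpace (x, y, z)‖ ≤ A / (1 + |x| + |y| + |z|) ^ N

/-- Smoothness of order `N` of a function of `(x, y, t)`, `t ≥ 0`, and decay of order `N` in
`(x, y)`, uniformly on bounded time intervals. -/
def SmoothDecayingBoundary (N : ℕ) (g : ℝ × ℝ × ℝ → ℝ) : Prop :=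
  ContDiffOn ℝ N g halfSpace ∧
  ∀ T : ℝ, ∃ A : ℝ, ∀ x y t : ℝ, 0 ≤ t → t ≤ T → ∀ n : ℕ, n ≤ N →
    ‖iteratedFDerivWithin ℝ n g halfSpace (x, y, t)‖ ≤ A / (1 + |x| + |y|) ^ N

/-- All the given functions have smoothness and decay of order `N`. -/
structure Data.SmoothDecaying (d : Data) (N : ℕ) : Prop where
  u₀ : SmoothDecayingInitial N d.u₀
  v₀ : SmoothDecayingInitial N d.v₀
  w₀ : SmoothDecayingInitial N d.w₀
  u₁ : SmoothDecayingInitial N d.u₁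
  v₁ : SmoothDecayingInitial N d.v₁
  w₁ : SmoothDecayingInitial N d.w₁
  g₁ : SmoothDecayingBoundary N d.g₁
  g₂ : SmoothDecayingBoundary N d.g₂
  g₃ : SmoothDecayingBoundary N d.g₃

/-! ### Transforms of the data -/

/-- Fourier transform in `(x, y, z)` over the half-space; `k, l` real, `m` in the closed lower
half-plane. -/
def hat (f : ℝ × ℝ × ℝ → ℝ) (k l : ℝ) (m : ℂ) : ℂ :=
  ∫ x : ℝ, ∫ y : ℝ, ∫ z in Set.Ioi (0 : ℝ),
    exp (-(I * k * x) - I * l * y - I * m * z) * (f (x, y, z) : ℂ)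

/-- Fourier transform in `(x, y)` of a boundary function at time `t`. -/
def tilde (g : ℝ × ℝ × ℝ → ℝ) (k l t : ℝ) : ℂ :=
  ∫ x : ℝ, ∫ y : ℝ, exp (-(I * k * x) - I * l * y) * (g (x, y, t) : ℂ)

/-- The branch of `(k² + l² + m²)^{1/2}` with cut the segment joining `± i √(k² + l²)`, and
asymptotic to `m` at infinity. -/
def root (k l : ℝ) (m : ℂ) : ℂ :=
  m * (1 + ((k : ℂ) ^ 2 + (l : ℂ) ^ 2) / m ^ 2) ^ (1 / 2 : ℂ)

/-- `ω₁ = √(λ + 2μ) (k² + l² + m²)^{1/2}` -/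
def omega1 (lam mu k l : ℝ) (m : ℂ) : ℂ := (√(lam + 2 * mu) : ℝ) * root k l m

/-- `ω₂ = √μ (k² + l² + m²)^{1/2}` -/
def omega2 (mu k l : ℝ) (m : ℂ) : ℂ := (√mu : ℝ) * root k l m

/-- `(2ω)⁻¹ (e^{-iωt} ∫₀ᵗ e^{iωs} φ(s) ds - e^{iωt} ∫₀ᵗ e^{-iωs} φ(s) ds)`. For `φ` the transform of
`g₁`, `g₂`, `g₃` and `ω = ω_j` this is `G^{(j)}`, `F^{(j)}`, `E^{(j)}`, respectively. -/
def timeTransform (om : ℂ) (φ : ℝ → ℂ) (t : ℝ) : ℂ :=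
  1 / (2 * om) *
    (exp (-(I * om * t)) * (∫ s in (0 : ℝ)..t, exp (I * om * s) * φ s)
      - exp (I * om * t) * (∫ s in (0 : ℝ)..t, exp (-(I * om * s)) * φ s))

/-- `(X₀/2 + i X₁/(2ω)) e^{-iωt} + (X₀/2 - i X₁/(2ω)) e^{iωt}` -/
def freeEvolution (om X₀ X₁ : ℂ) (t : ℝ) : ℂ :=
  (1 / 2 * X₀ + I / (2 * om) * X₁) * exp (-(I * om * t))
    + (1 / 2 * X₀ - I / (2 * om) * X₁) * exp (I * om * t)

/-- `k â + l b̂ + m ĉ` -/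
def transP (a b c : ℝ × ℝ × ℝ → ℝ) (k l : ℝ) (m : ℂ) : ℂ :=
  k * hat a k l m + l * hat b k l m + m * hat c k l m

/-- `m b̂ - l ĉ` -/
def transQ (_a b c : ℝ × ℝ × ℝ → ℝ) (k l : ℝ) (m : ℂ) : ℂ :=
  m * hat b k l m - l * hat c k l m

/-- `k ĉ - m â` -/
def transR (a _b c : ℝ × ℝ × ℝ → ℝ) (k l : ℝ) (m : ℂ) : ℂ :=
  k * hat c k l m - m * hat a k l m

/-- The known function `N_P`. -/
def NP (lam mu : ℝ) (d : Data) (k l : ℝ) (m : ℂ) (t : ℝ) : ℂ :=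
  -(I * mu * k * timeTransform (omega1 lam mu k l m) (tilde d.g₁ k l) t)
    - I * mu * l * timeTransform (omega1 lam mu k l m) (tilde d.g₂ k l) t
    - I * m * (lam + 2 * mu) * timeTransform (omega1 lam mu k l m) (tilde d.g₃ k l) t
    + freeEvolution (omega1 lam mu k l m)
        (transP d.u₀ d.v₀ d.w₀ k l m) (transP d.u₁ d.v₁ d.w₁ k l m) t

/-- The known function `N_Q`. -/
def NQ (lam mu : ℝ) (d : Data) (k l : ℝ) (m : ℂ) (t : ℝ) : ℂ :=
  -(I * mu * m * timeTransform (omega2 mu k l m) (tilde d.g₂ k l) t)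
    + I * l * (lam + 2 * mu) * timeTransform (omega2 mu k l m) (tilde d.g₃ k l) t
    + freeEvolution (omega2 mu k l m)
        (transQ d.u₀ d.v₀ d.w₀ k l m) (transQ d.u₁ d.v₁ d.w₁ k l m) t

/-- The known function `N_R`. -/
def NR (lam mu : ℝ) (d : Data) (k l : ℝ) (m : ℂ) (t : ℝ) : ℂ :=
  I * mu * m * timeTransform (omega2 mu k l m) (tilde d.g₁ k l) t
    - I * k * (lam + 2 * mu) * timeTransform (omega2 mu k l m) (tilde d.g₃ k l) t
    + freeEvolution (omega2 mu k l m)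
        (transR d.u₀ d.v₀ d.w₀ k l m) (transR d.u₁ d.v₁ d.w₁ k l m) t

/-! ### The maps `m ↦ m₁₂`, `m ↦ m₂₁` and the matrices `C`, `D` -/

/-- `m₁₂`; with the principal square root its cut is the real segment joining
`± √(k² + l²) √((λ + μ)/μ)`, and `m₁₂ ∼ - m √(μ/(λ + 2μ))` at infinity. -/
def m12 (lam mu k l : ℝ) (m : ℂ) : ℂ :=
  -m * ((mu : ℂ) / (lam + 2 * mu)
    - ((lam : ℂ) + mu) / (lam + 2 * mu) * (((k : ℂ) ^ 2 + (l : ℂ) ^ 2) / m ^ 2)) ^ (1 / 2 : ℂ)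

/-- `m₂₁`; with the principal square root its cut is the imaginary segment joining
`± i √(k² + l²) √((λ + μ)/(λ + 2μ))`, and `m₂₁ ∼ - m √((λ + 2μ)/μ)` at infinity. -/
def m21 (lam mu k l : ℝ) (m : ℂ) : ℂ :=
  -m * (((lam : ℂ) + 2 * mu) / mu
    + ((lam : ℂ) + mu) / mu * (((k : ℂ) ^ 2 + (l : ℂ) ^ 2) / m ^ 2)) ^ (1 / 2 : ℂ)

/-- The matrix `C`. -/
def matC (lam mu k l : ℝ) (m : ℂ) : Matrix (Fin 3) (Fin 3) ℂ :=
  !![2 * mu * k * m12 lam mu k l m, 2 * mu * m12 lam mu k l m * l,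
      lam * (k ^ 2 + l ^ 2) + m12 lam mu k l m ^ 2 * (lam + 2 * mu);
    -(mu * k * l), mu * (m ^ 2 - l ^ 2), 2 * mu * m * l;
    -(mu * (m ^ 2 - k ^ 2)), mu * k * l, -(2 * mu * k * m)]

/-- The matrix `D`. -/
def matD (lam mu k l : ℝ) (m : ℂ) : Matrix (Fin 3) (Fin 3) ℂ :=
  !![-(2 * mu * k * m), -(2 * mu * m * l), lam * (k ^ 2 + l ^ 2) + m ^ 2 * (lam + 2 * mu);
    -(mu * k * l), mu * (m21 lam mu k l m ^ 2 - l ^ 2), -(2 * mu * l * m21 lam mu k l m);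
    mu * (k ^ 2 - m21 lam mu k l m ^ 2), mu * k * l, 2 * mu * k * m21 lam mu k l m]

/-- The vector `(U₁, V₁, W₁)`. -/
def vec1 (lam mu : ℝ) (d : Data) (k l : ℝ) (m : ℂ) (t : ℝ) : Fin 3 → ℂ :=
  -(Matrix.mulVec (matD lam mu k l m)⁻¹
    ![NP lam mu d k l (-m) t, NQ lam mu d k l (m21 lam mu k l m) t,
      NR lam mu d k l (m21 lam mu k l m) t])

/-- The vector `(U₂, V₂, W₂)`. -/
def vec2 (lam mu : ℝ) (d : Data) (k l : ℝ) (m : ℂ) (t : ℝ) : Fin 3 → ℂ :=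
  -(Matrix.mulVec (matC lam mu k l m)⁻¹
    ![NP lam mu d k l (m12 lam mu k l m) t, NQ lam mu d k l (-m) t, NR lam mu d k l (-m) t])

/-! ### Contours -/

/-- The curve `s ↦ s + i h(s)` is a deformation of the real axis into the closed upper half-plane:
it is piecewise differentiable of locally finite length, and it agrees with the real axis outside a
bounded set. -/
structure IsDeformation (h : ℝ → ℝ) : Prop where
  nonneg : ∀ s, 0 ≤ h s
  continuous : Continuous h
  compactSupport : HasCompactSupport h
  differentiable : ∃ S : Set ℝ, S.Finite ∧ ∀ s, s ∉ S → DifferentiableAt ℝ h s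
  integrable : Integrable (deriv h)

/-- The point `p` lies strictly below the curve `s ↦ s + i h(s)`. -/
def Below (h : ℝ → ℝ) (p : ℂ) : Prop := p.im < h p.re

/-- The requirement on the contour `γ_{k,l}`: it is a deformation of the real axis, and the zeros of
`Δ₁ = det C` and `Δ₂ = det D` and the branch points of `m₁₂` and `m₂₁`, with the cuts that join
them, are all below it. -/
structure IsAdmissible (lam mu k l : ℝ) (h : ℝ → ℝ) : Prop where
  deformation : IsDeformation h
  zeros_C : ∀ m : ℂ, (matC lam mu k l m).det = 0 → Below h m
  zeros_D : ∀ m : ℂ, (matD lam mu k l m).det = 0 → Below h m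
  cut_m12 : ∀ m ∈ segment ℝ (-((√(k ^ 2 + l ^ 2) * √((lam + mu) / mu) : ℝ) : ℂ))
    ((√(k ^ 2 + l ^ 2) * √((lam + mu) / mu) : ℝ) : ℂ), Below h m
  cut_m21 : ∀ m ∈ segment ℝ (-(I * (√(k ^ 2 + l ^ 2) * √((lam + mu) / (lam + 2 * mu)) : ℝ)))
    (I * (√(k ^ 2 + l ^ 2) * √((lam + mu) / (lam + 2 * mu)) : ℝ)), Below h m

/-- The integrand `f(γ(s)) γ'(s)` of the contour integral of `f` along `γ(s) = s + i h(s)`. -/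
def pullback (h : ℝ → ℝ) (f : ℂ → ℂ) (s : ℝ) : ℂ :=
  f (s + I * h s) * (1 + I * (deriv h s : ℝ))

/-- The contour integral of `f` along `γ(s) = s + i h(s)`. -/
def contourIntegral (h : ℝ → ℝ) (f : ℂ → ℂ) : ℂ := ∫ s : ℝ, pullback h f s

/-! ### The integrands of the solution formulae -/

/-- `e^{ikx + ily + imz} / (k² + l² + m²)` -/
def kernel (x y z k l : ℝ) (m : ℂ) : ℂ :=
  exp (I * k * x + I * l * y + I * m * z) / (k ^ 2 + l ^ 2 + m ^ 2)

/-- Contour integrand in the formula for `u`. -/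
def contourU (lam mu : ℝ) (d : Data) (x y z t k l : ℝ) (m : ℂ) : ℂ :=
  kernel x y z k l m *
    (2 * k * (lam * (k ^ 2 + l ^ 2) + m ^ 2 * (lam + 2 * mu)) * vec1 lam mu d k l m t 2
      - 4 * mu * k * m ^ 2 * vec2 lam mu d k l m t 2)

/-- Contour integrand in the formula for `v`. -/
def contourV (lam mu : ℝ) (d : Data) (x y z t k l : ℝ) (m : ℂ) : ℂ :=
  kernel x y z k l m *
    (2 * l * (lam * (k ^ 2 + l ^ 2) + m ^ 2 * (lam + 2 * mu)) * vec1 lam mu d k l m t 2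
      - 4 * mu * l * m ^ 2 * vec2 lam mu d k l m t 2)

/-- Contour integrand in the formula for `w`. -/
def contourW (lam mu : ℝ) (d : Data) (x y z t k l : ℝ) (m : ℂ) : ℂ :=
  kernel x y z k l m *
    (4 * mu * k * m ^ 2 * vec1 lam mu d k l m t 0 + 4 * mu * l * m ^ 2 * vec1 lam mu d k l m t 1
      + 2 * mu * k * (l ^ 2 + k ^ 2 - m ^ 2) * vec2 lam mu d k l m t 0
      + 2 * mu * l * (k ^ 2 + l ^ 2 - m ^ 2) * vec2 lam mu d k l m t 1)

/-- Integrand over the real `(k, l, m)` space in the formula for `u`. -/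
def realU (lam mu : ℝ) (d : Data) (x y z t k l m : ℝ) : ℂ :=
  kernel x y z k l m *
    (k * (NP lam mu d k l m t + NP lam mu d k l (-m) t)
      - 1 / m * k * l * (NQ lam mu d k l m t - NQ lam mu d k l (-m) t)
      - 1 / m * (m ^ 2 + l ^ 2) * (NR lam mu d k l m t - NR lam mu d k l (-m) t))

/-- Integrand over the real `(k, l, m)` space in the formula for `v`. -/
def realV (lam mu : ℝ) (d : Data) (x y z t k l m : ℝ) : ℂ :=
  kernel x y z k l m *
    (l * (NP lam mu d k l m t + NP lam mu d k l (-m) t)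
      + 1 / m * (k ^ 2 + m ^ 2) * (NQ lam mu d k l m t - NQ lam mu d k l (-m) t)
      + 1 / m * l * k * (NR lam mu d k l m t - NR lam mu d k l (-m) t))

/-- Integrand over the real `(k, l, m)` space in the formula for `w`. -/
def realW (lam mu : ℝ) (d : Data) (x y z t k l m : ℝ) : ℂ :=
  kernel x y z k l m *
    (m * (NP lam mu d k l m t - NP lam mu d k l (-m) t)
      - l * (NQ lam mu d k l m t + NQ lam mu d k l (-m) t)
      + k * (NR lam mu d k l m t + NR lam mu d k l (-m) t))

/-- The value `a` equals
`(8π³)⁻¹ ∫ dk ∫ dl ∫_{γ_{k,l}} f dm + (8π³)⁻¹ ∫ dk ∫ dl ∫ dm g`, all these integrals being convergent.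
Here `γ_{k,l}` is the curve `s ↦ s + i h(k,l,s)`. -/
structure IsGivenBy (h : ℝ → ℝ → ℝ → ℝ) (f : ℝ → ℝ → ℂ → ℂ) (g : ℝ → ℝ → ℝ → ℂ) (a : ℝ) :
    Prop where
  contour_integrable : ∀ k l : ℝ, Integrable (pullback (h k l) (f k l))
  outer_integrable : Integrable fun q : ℝ × ℝ => contourIntegral (h q.1 q.2) (f q.1 q.2)
  real_integrable : Integrable fun q : ℝ × ℝ × ℝ => g q.1 q.2.1 q.2.2
  formula : (a : ℂ) =
    1 / (8 * (Real.pi : ℂ) ^ 3) * (∫ k : ℝ, ∫ l : ℝ, contourIntegral (h k l) (f k l))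
      + 1 / (8 * (Real.pi : ℂ) ^ 3) * (∫ k : ℝ, ∫ l : ℝ, ∫ m : ℝ, g k l m)

end HalfSpace

end

noncomputable section

namespace HalfSpace

open Filter Topology Set

/-! ### Holomorphic dependence of integrals on a parameter -/

/-! The Fourier transform in `(x, y)` turns the problem, for each `(k, l)`, into a system on the
half-line `z ≥ 0`. A further transform in `z`, defined for `Im m ≤ 0` and analytic for `Im m < 0`,
turns that system into ordinary differential equations in `t`. The divergence `P = kU + lV + mW` and
the curl components `Q = mV - lW`, `R = kW - mU` decouple these: they oscillate with frequencies
`ω₁` and `ω₂`, forced by the given stresses and by the unknown values of `u, v, w` on `z = 0`.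
Duhamel's formula yields the global relations (`global_P`, `global_Q`, `global_R`): each combination
equals `N_P`, `N_Q` or `N_R` plus explicit coefficients times time transforms of the boundary
values.

A time transform depends on its frequency only through the square, and `ω₂(m₂₁)² = ω₁(m)²`,
`ω₁(m₁₂)² = ω₂(m)²`. So `P` at `-m` and `Q, R` at `m₂₁` contain the same three unknowns, with
coefficient matrix `D`; likewise `P` at `m₁₂` and `Q, R` at `-m`, with matrix `C`. Hence `(U₁, V₁,
W₁)` and `(U₂, V₂, W₂)` are the time transforms of the boundary values, minus `D⁻¹` and `C⁻¹`
applied to transforms of the solution at time `t` (`vec1_eq`, `vec2_eq`).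

The subtracted part is unknown but contributes nothing. The maps `-m`, `m₂₁`, `m₁₂` send the region
above the contour into the lower half-plane, so this part is holomorphic there; the inverse matrices
are `O(|m|⁻²)` and `e^{imz}` decays, so its contour integral vanishes
(`contourIntegral_form_eq_zero`). The other part agrees with an entire function of `m`, since only a
difference of time transforms, vanishing with `k² + l² + m²`, is divided by that quantity. Its
contour can be moved to the real axis (`contourIntegral_form_timeTransform`). There, by the global
relations, it combines with the real integrand to `e^{imz} (U(m) + U(-m))`, up to the factor `e^{ikx
+ ily}`, and this integrates to `2π U(z)` by inversion for the even extension of `U`. Inversion in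
`(k, l)` then recovers the solution.

Convergence has three sources. The planar transform of the solution is integrable in `(k, l)` by an
`L²` argument that needs only two derivatives (`integrable_planar_transform`). The integrals over
real `(k, l, m)` converge absolutely by estimates on the data (`norm_real_le`). The outer integral
of the contour integrals is then convergent as a difference of these two, so the contours need not
depend measurably on `(k, l)` (`isGivenBy_of_inversion`). -/

theorem hasDerivAt_integral_of_holomorphic {α : Type*} [MeasurableSpace α] {μ : Measure α}
    {F : ℂ → α → ℂ} {U : Set ℂ} (hU : IsOpen U)
    (hmeas : ∀ m ∈ U, AEStronglyMeasurable (F m) μ)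
    (hdiff : ∀ᵐ a ∂μ, DifferentiableOn ℂ (fun m => F m a) U) {m₀ : ℂ} (hm₀ : m₀ ∈ U)
    {bound : α → ℝ} (hb : Integrable bound μ) {s : Set ℂ} (hs : s ∈ 𝓝 m₀)
    (hle : ∀ᵐ a ∂μ, ∀ m ∈ s, ‖F m a‖ ≤ bound a) :
    HasDerivAt (fun m => ∫ a, F m a ∂μ) (∫ a, deriv (fun m => F m a) m₀ ∂μ) m₀ := by
  obtain ⟨r, hr, hball⟩ := Metric.nhds_basis_closedBall.mem_iff.1
    (inter_mem hs (hU.mem_nhds hm₀))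
  have hr2 : 0 < r / 2 := by positivity
  have hsub : ∀ x ∈ Metric.ball m₀ (r / 2), Metric.closedBall x (r / 2) ⊆ s ∩ U := by
    intro x hx y hy
    apply hball
    rw [Metric.mem_closedBall] at hy ⊢
    rw [Metric.mem_ball] at hx
    linarith [dist_triangle y x m₀]
  have hself : m₀ ∈ Metric.ball m₀ (r / 2) := Metric.mem_ball_self hr2
  refine (hasDerivAt_integral_of_dominated_loc_of_deriv_le (F := F)
    (F' := fun m a => deriv (fun m => F m a) m) (bound := fun a => bound a / (r / 2))
    (Metric.ball_mem_nhds m₀ hr2) ?_ ?_ ?_ ?_ (hb.div_const _) ?_).2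
  · filter_upwards [hU.mem_nhds hm₀] with m hm using hmeas m hm
  · refine Integrable.mono' hb (hmeas m₀ hm₀) ?_
    filter_upwards [hle] with a ha using ha m₀ (mem_of_mem_nhds hs)
  -- Measurability in `a` of the derivative at `m₀`: it is the pointwise limit of difference
  -- quotients with steps `r / 2 / (n + 1)`.
  · have hpt : ∀ n : ℕ, m₀ + (r / 2 / (n + 1) : ℝ) ∈ U := by
      intro n
      refine (hsub m₀ hself ?_).2
      rw [Metric.mem_closedBall, dist_eq, add_sub_cancel_left, norm_real, Real.norm_eq_abs,
        abs_of_nonneg (by positivity)]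
      exact div_le_self hr2.le (by linarith [Nat.cast_nonneg (α := ℝ) n])
    refine aestronglyMeasurable_of_tendsto_ae atTop
      (f := fun (n : ℕ) a => ((r / 2 / (n + 1) : ℝ) : ℂ)⁻¹ •
        (F (m₀ + (r / 2 / (n + 1) : ℝ)) a - F m₀ a)) ?_ ?_
    · intro n
      exact ((hmeas _ (hpt n)).sub (hmeas m₀ hm₀)).const_smul (((r / 2 / (n + 1) : ℝ) : ℂ)⁻¹)
    · filter_upwards [hdiff] with a ha
      have hd := (ha.differentiableAt (hU.mem_nhds hm₀)).hasDerivAt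
      rw [hasDerivAt_iff_tendsto_slope_zero] at hd
      have ht : Tendsto (fun n : ℕ => ((r / 2 / (n + 1) : ℝ) : ℂ)) atTop (𝓝[≠] 0) := by
        rw [tendsto_nhdsWithin_iff]
        constructor
        · have : Tendsto (fun n : ℕ => r / 2 / ((n : ℝ) + 1)) atTop (𝓝 0) := by
            apply Tendsto.const_div_atTop
            exact tendsto_atTop_add_const_right _ _ tendsto_natCast_atTop_atTop
          exact (continuous_ofReal.tendsto' 0 0 ofReal_zero).comp this
        · refine Eventually.of_forall fun n => ?_
          simp only [mem_compl_iff, mem_singleton_iff, ofReal_eq_zero]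
          positivity
      exact hd.comp ht
  -- Only `F` is assumed bounded; Cauchy's estimate on circles of radius `r / 2` bounds its
  -- derivative, whence the majorant `bound a / (r / 2)`.
  · filter_upwards [hdiff, hle] with a ha hba x hx
    refine norm_deriv_le_of_forall_mem_sphere_norm_le hr2 ?_ ?_
    · refine DifferentiableOn.diffContOnCl ?_
      refine ha.mono ?_
      exact (Metric.closure_ball_subset_closedBall).trans fun y hy => (hsub x hx hy).2
    · intro y hy
      exact hba y (hsub x hx (Metric.sphere_subset_closedBall hy)).1
  · filter_upwards [hdiff] with a ha x hx
    exact (ha.differentiableAt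
      (hU.mem_nhds (hsub x hx (Metric.mem_closedBall_self hr2.le)).2)).hasDerivAt

/-! ### Contour integrals over graphs -/

theorem IsDeformation.hasDerivAt {h : ℝ → ℝ} {s : ℝ} (hd : DifferentiableAt ℝ h s) (c : ℂ) :
    HasDerivAt (fun s : ℝ => (s : ℂ) + I * h s + c) (1 + I * (deriv h s : ℝ)) s := by
  have h1 : HasDerivAt (fun s : ℝ => (s : ℂ)) 1 s := by
    simpa using (hasDerivAt_id s).ofReal_comp
  exact ((h1.add (hd.hasDerivAt.ofReal_comp.const_mul I)).add_const c)

theorem IsDeformation.continuous_curve {h : ℝ → ℝ} (hh : IsDeformation h) :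
    Continuous fun s : ℝ => (s : ℂ) + I * h s := by
  have := hh.continuous
  fun_prop

theorem IsDeformation.intervalIntegrable {h : ℝ → ℝ} (hh : IsDeformation h) {f : ℝ → ℂ}
    (hf : Continuous f) (a b : ℝ) :
    IntervalIntegrable (fun s => f s * (1 + I * (deriv h s : ℝ))) volume a b := by
  have h1 : IntervalIntegrable (fun s => 1 + I * (deriv h s : ℝ)) volume a b := by
    refine IntervalIntegrable.add (by simp) ?_
    exact (hh.integrable.ofReal.const_mul I).intervalIntegrable
  exact h1.continuousOn_mul hf.continuousOn

/-- The fundamental theorem of calculus along the curve shifted by `c`; the corners of `h` form a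
countable exceptional set, harmless because the integrand is integrable. -/
theorem IsDeformation.integral_comp_deriv {h : ℝ → ℝ} (hh : IsDeformation h) {f F : ℂ → ℂ}
    {U : Set ℂ} (c : ℂ) (hU : ∀ s : ℝ, (s : ℂ) + I * h s + c ∈ U)
    (hF : ∀ m ∈ U, HasDerivAt F (f m) m) (hf : Continuous fun s : ℝ => f (s + I * h s + c))
    {a b : ℝ} (hab : a ≤ b) :
    ∫ s in a..b, f (s + I * h s + c) * (1 + I * (deriv h s : ℝ))
      = F (b + I * h b + c) - F (a + I * h a + c) := by
  obtain ⟨S, hS, hdS⟩ := hh.differentiable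
  refine MeasureTheory.integral_eq_of_hasDerivAt_off_countable_of_le
    (fun s : ℝ => F (s + I * h s + c)) _ hab hS.countable ?_ ?_ (hh.intervalIntegrable hf a b)
  · intro s _
    have h1 : ContinuousAt F (s + I * h s + c) := (hF _ (hU s)).continuousAt
    exact (ContinuousAt.comp (f := fun s : ℝ => (s : ℂ) + I * h s + c) h1
      (hh.continuous_curve.add continuous_const).continuousAt).continuousWithinAt
  · intro s hs
    exact (hF _ (hU s)).comp s (IsDeformation.hasDerivAt (hdS s hs.2) c)

theorem IsDeformation.exists_eq_zero {h : ℝ → ℝ} (hh : IsDeformation h) :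
    ∃ R : ℝ, 0 < R ∧ ∀ s, R ≤ |s| → h s = 0 ∧ deriv h s = 0 := by
  obtain ⟨R, hR⟩ := hh.compactSupport.isCompact.isBounded.subset_closedBall 0
  have hout : ∀ s, R < |s| → s ∉ tsupport h := by
    intro s hs hmem
    have := hR hmem
    rw [Metric.mem_closedBall, dist_zero_right, Real.norm_eq_abs] at this
    linarith
  refine ⟨max (R + 1) 1, by positivity, fun s hs => ?_⟩
  have hRs : R < |s| := by linarith [le_max_left (R + 1) 1]
  exact ⟨image_eq_zero_of_notMem_tsupport (hout s hRs),
    Function.notMem_support.1 fun hmem => hout s hRs (support_deriv_subset hmem)⟩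

/-- The contour integral of an entire function along a deformation of the real axis is the
integral along the real axis. -/
theorem IsDeformation.contourIntegral_of_differentiable {h : ℝ → ℝ} (hh : IsDeformation h)
    {f : ℂ → ℂ} (hf : Differentiable ℂ f) (hInt : Integrable fun s : ℝ => f s) :
    Integrable (pullback h f) ∧ contourIntegral h f = ∫ s : ℝ, f s := by
  obtain ⟨R, hR, hout⟩ := hh.exists_eq_zero
  -- Outside `[-R, R]` the curve is the real axis. Over `[-R, R]` both integrals are the same
  -- difference of values of the primitive `F`, because the endpoints are common.
  obtain ⟨F, hF⟩ := hf.isExactOn_univ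
  have hcont : Continuous fun s : ℝ => f (s + I * h s + 0) := by
    have := hh.continuous
    exact hf.continuous.comp (by fun_prop)
  have heq : ∀ s : ℝ, s ∉ Ioc (-R) R → pullback h f s = f s := by
    intro s hs
    have hs' : R ≤ |s| := by
      simp only [mem_Ioc, not_and, not_le] at hs
      by_contra! hlt
      rw [abs_lt] at hlt
      linarith [hs hlt.1]
    obtain ⟨h1, h2⟩ := hout s hs'
    simp [pullback, h1, h2]
  have hp : IntegrableOn (pullback h f) (Ioc (-R) R) := by
    have := hh.intervalIntegrable hcont (-R) R
    rw [intervalIntegrable_iff_integrableOn_Ioc_of_le (by linarith)] at this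
    refine this.congr_fun (fun s _ => ?_) measurableSet_Ioc
    simp [pullback]
  have hp' : IntegrableOn (pullback h f) (Ioc (-R) R)ᶜ :=
    (hInt.integrableOn (s := (Ioc (-R) R)ᶜ)).congr_fun (fun s hs => (heq s hs).symm)
      measurableSet_Ioc.compl
  have hpi : Integrable (pullback h f) := by
    rw [← integrableOn_univ, ← union_compl_self (Ioc (-R) R)]
    exact hp.union hp'
  refine ⟨hpi, ?_⟩
  rw [contourIntegral, ← integral_add_compl measurableSet_Ioc hpi,
    ← integral_add_compl (measurableSet_Ioc (a := -R) (b := R)) hInt]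
  congr 1
  · have e1 := hh.integral_comp_deriv (U := univ) (F := F) (f := f) 0 (fun _ => mem_univ _) hF hcont
      (a := -R) (b := R) (by linarith)
    have h0 : IsDeformation (fun _ => 0) :=
      ⟨fun _ => le_rfl, continuous_const, HasCompactSupport.zero,
        ⟨∅, finite_empty, fun _ _ => differentiableAt_const _⟩, by simp⟩
    have e2 := h0.integral_comp_deriv (U := univ) (F := F) (f := f) 0 (fun _ => mem_univ _) hF
      (hf.continuous.comp (by fun_prop)) (a := -R) (b := R) (by linarith)
    rw [intervalIntegral.integral_of_le (by linarith)] at e1 e2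
    have hRR := (hout R (le_abs_self R)).1
    have hRR' := (hout (-R) (by simp [le_abs_self])).1
    rw [hRR, hRR'] at e1
    rw [← e2] at e1
    simpa [pullback] using e1
  · exact setIntegral_congr_fun measurableSet_Ioc.compl heq

/-! ### The region above a contour and a primitive there -/

/-- The closed region above the curve `s ↦ s + i h(s)`. -/
def above (h : ℝ → ℝ) : Set ℂ := {m | h m.re ≤ m.im}

/-- The open region above the curve `s ↦ s + i h(s)`. -/
def strictAbove (h : ℝ → ℝ) : Set ℂ := {m | h m.re < m.im}

theorem strictAbove_subset (h : ℝ → ℝ) : strictAbove h ⊆ above h := by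
  intro m hm
  exact le_of_lt (mem_ofPred_eq ▸ hm : _ < _)

theorem isOpen_strictAbove {h : ℝ → ℝ} (hh : Continuous h) : IsOpen (strictAbove h) :=
  isOpen_lt (hh.comp continuous_re) continuous_im

theorem isClosed_above {h : ℝ → ℝ} (hh : Continuous h) : IsClosed (above h) :=
  isClosed_le (hh.comp continuous_re) continuous_im

theorem add_I_mul_mem_strictAbove {h : ℝ → ℝ} {m : ℂ} (hm : m ∈ strictAbove h) {y : ℝ}
    (hy : 0 ≤ y) : m + I * y ∈ strictAbove h := by
  simp only [strictAbove, mem_ofPred_eq, add_re, mul_re, I_re, I_im, ofReal_re, ofReal_im, add_im,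
    mul_im] at hm ⊢
  simp only [zero_mul, one_mul, mul_zero, sub_zero, zero_add, add_zero]
  linarith

/-- Integrating upwards gives a primitive with no appeal to simple connectedness: vertical
half-lines stay above the graph, and along them `∫ f'(m + iy) dy = i f(m)`. This primitive also
inherits the horizontal decay of `f`, which makes end contributions of contour integrals disappear.
-/
theorem hasDerivAt_vertical_primitive {h : ℝ → ℝ} (hh : Continuous h) {f : ℂ → ℂ}
    (hf : DifferentiableOn ℂ f (strictAbove h)) {C z : ℝ} (hz : 0 < z)
    (hbd : ∀ m ∈ strictAbove h, ‖f m‖ ≤ C * Real.exp (-z * m.im)) {m₀ : ℂ}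
    (hm₀ : m₀ ∈ strictAbove h) :
    HasDerivAt (fun m => -I * ∫ y in Ioi (0 : ℝ), f (m + I * y)) (f m₀) m₀ := by
  have hopen := isOpen_strictAbove hh
  have hInt : IntegrableOn (fun y : ℝ => Real.exp (-z * y)) (Ioi 0) := exp_neg_integrableOn_Ioi 0 hz
  have hC : 0 ≤ C := by
    have := (norm_nonneg _).trans (hbd m₀ hm₀)
    exact nonneg_of_mul_nonneg_left this (Real.exp_pos _)
  have hline : ∀ m ∈ strictAbove h, ContinuousOn (fun y : ℝ => f (m + I * y)) (Ici 0) := by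
    intro m hm
    refine hf.continuousOn.comp (by fun_prop) ?_
    intro y hy
    exact add_I_mul_mem_strictAbove hm hy
  have hd : ∀ y : ℝ, 0 ≤ y → HasDerivAt (fun m => f (m + I * y)) (deriv f (m₀ + I * y)) m₀ := by
    intro y hy
    have h1 := (hf.differentiableAt (hopen.mem_nhds
      (add_I_mul_mem_strictAbove hm₀ hy))).hasDerivAt
    simpa using HasDerivAt.comp_add_const m₀ (I * y) h1
  have key := hasDerivAt_integral_of_holomorphic (μ := volume.restrict (Ioi (0 : ℝ)))
    (F := fun m y => f (m + I * y)) (U := strictAbove h) hopen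
    (fun m hm => ((hline m hm).mono Ioi_subset_Ici_self).aestronglyMeasurable measurableSet_Ioi)
    ?_ hm₀ (bound := fun y => C * Real.exp (-z * (m₀.im - 1)) * Real.exp (-z * y))
    (hInt.const_mul _) (s := strictAbove h ∩ {m | m₀.im - 1 < m.im})
    (inter_mem (hopen.mem_nhds hm₀) ((isOpen_lt continuous_const continuous_im).mem_nhds
      (by simp))) ?_
  · have h2 : ∫ y in Ioi (0 : ℝ), deriv (fun m => f (m + I * y)) m₀ = I * f m₀ := by
      have e1 : ∫ y in Ioi (0 : ℝ), deriv (fun m => f (m + I * y)) m₀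
          = ∫ y in Ioi (0 : ℝ), deriv f (m₀ + I * y) :=
        setIntegral_congr_fun measurableSet_Ioi fun y hy => (hd y (le_of_lt hy)).deriv
      have hder : ∀ y ∈ Ioi (0 : ℝ),
          HasDerivAt (fun y : ℝ => -I * f (m₀ + I * y)) (deriv f (m₀ + I * y)) y := by
        intro y hy
        have h1 := (hf.differentiableAt (hopen.mem_nhds
          (add_I_mul_mem_strictAbove hm₀ (le_of_lt hy)))).hasDerivAt
        have h3 : HasDerivAt (fun y : ℝ => m₀ + I * y) I y := by
          simpa using ((hasDerivAt_id y).ofReal_comp.const_mul I).const_add m₀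
        have h4 := (h1.comp y h3).const_mul (-I)
        refine h4.congr_deriv ?_
        linear_combination (deriv f (m₀ + I * y)) * (-I_mul_I)
      have hdi : IntegrableOn (fun y : ℝ => deriv f (m₀ + I * y)) (Ioi 0) := by
        -- Discs of the fixed radius `r` remain above the curve when translated upwards, so Cauchy's
        -- estimate passes the exponential decay from `f` to `f'`.
        obtain ⟨r, hr, hball⟩ := Metric.nhds_basis_closedBall.mem_iff.1 (hopen.mem_nhds hm₀)
        refine Integrable.mono' ((hInt.const_mul (C * Real.exp (-z * (m₀.im - r)) / r))) ?_ ?_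
        · have hcd : ContinuousOn (deriv f) (strictAbove h) := (hf.deriv hopen).continuousOn
          refine ContinuousOn.aestronglyMeasurable ?_ measurableSet_Ioi
          refine hcd.comp (by fun_prop) ?_
          intro y hy
          exact add_I_mul_mem_strictAbove hm₀ (le_of_lt hy)
        · rw [ae_restrict_iff' measurableSet_Ioi]
          refine Eventually.of_forall fun y hy => ?_
          have hcb : Metric.closedBall (m₀ + I * y) r ⊆ strictAbove h := by
            intro w hw
            have : w - I * y ∈ Metric.closedBall m₀ r := by
              rw [Metric.mem_closedBall, dist_eq] at hw ⊢
              rwa [sub_sub, add_comm (I * (y : ℂ))]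
            have := add_I_mul_mem_strictAbove (hball this) (le_of_lt (mem_Ioi.1 hy))
            simpa using this
          refine (norm_deriv_le_of_forall_mem_sphere_norm_le hr
            (C := C * Real.exp (-z * (m₀.im - r)) * Real.exp (-z * y)) ?_ ?_).trans_eq (by ring)
          · exact (hf.mono (Metric.closure_ball_subset_closedBall.trans hcb)).diffContOnCl
          · intro w hw
            refine (hbd w (hcb (Metric.sphere_subset_closedBall hw))).trans ?_
            rw [mul_assoc, ← Real.exp_add]
            have h5 : |(w - (m₀ + I * y)).im| ≤ r :=
              (abs_im_le_norm _).trans_eq (mem_sphere_iff_norm.1 hw)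
            simp only [sub_im, add_im, mul_im, I_re, I_im, ofReal_re, ofReal_im, zero_mul, one_mul,
              zero_add] at h5
            gcongr
            nlinarith [(abs_le.1 h5).1]
      have hlim : Tendsto (fun y : ℝ => -I * f (m₀ + I * y)) atTop (𝓝 0) := by
        refine squeeze_zero_norm' (a := fun y => C * Real.exp (-z * m₀.im) * Real.exp (-z * y)) ?_ ?_
        · filter_upwards [eventually_ge_atTop 0] with y hy
          rw [norm_mul, norm_neg, norm_I, one_mul]
          refine (hbd _ (add_I_mul_mem_strictAbove hm₀ hy)).trans_eq ?_
          rw [mul_assoc, ← Real.exp_add]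
          simp only [add_im, mul_im, I_re, I_im, ofReal_re, ofReal_im, zero_mul, one_mul, zero_add]
          ring_nf
        · have : Tendsto (fun y : ℝ => Real.exp (-z * y)) atTop (𝓝 0) := by
            refine Real.tendsto_exp_atBot.comp ?_
            exact tendsto_id.const_mul_atTop_of_neg (by linarith)
          simpa using this.const_mul (C * Real.exp (-z * m₀.im))
      have hc0 : ContinuousWithinAt (fun y : ℝ => -I * f (m₀ + I * y)) (Ici 0) 0 :=
        (continuousOn_const.mul (hline m₀ hm₀)) 0 (by simp)
      rw [e1, integral_Ioi_of_hasDerivAt_of_tendsto hc0 hder hdi hlim]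
      simp
    rw [h2] at key
    have := key.const_mul (-I)
    refine this.congr_deriv ?_
    linear_combination (f m₀) * (-I_mul_I)
  · rw [ae_restrict_iff' measurableSet_Ioi]
    refine Eventually.of_forall fun y hy => ?_
    refine hf.comp (by fun_prop) ?_
    intro m hm
    exact add_I_mul_mem_strictAbove hm (le_of_lt (mem_Ioi.1 hy))
  · rw [ae_restrict_iff' measurableSet_Ioi]
    refine Eventually.of_forall fun y hy m hm => ?_
    refine (hbd _ (add_I_mul_mem_strictAbove hm.1 (le_of_lt (mem_Ioi.1 hy)))).trans ?_
    rw [mul_assoc, ← Real.exp_add]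
    have := hm.2
    simp only [mem_ofPred_eq] at this
    simp only [add_im, mul_im, I_re, I_im, ofReal_re, ofReal_im, zero_mul, one_mul, zero_add]
    gcongr
    nlinarith

end HalfSpace

end


noncomputable section

namespace HalfSpace

open Filter Topology Set

/-! ### Vanishing of contour integrals -/

theorem norm_vertical_integral_le {f : ℂ → ℂ} {C z : ℝ} (hz : 0 < z) {m : ℂ}
    (hbd : ∀ y : ℝ, 0 < y → ‖f (m + I * y)‖ ≤ C * Real.exp (-z * y)) :
    ‖∫ y in Ioi (0 : ℝ), f (m + I * y)‖ ≤ C / z := by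
  have hInt : IntegrableOn (fun y : ℝ => Real.exp (-z * y)) (Ioi 0) := exp_neg_integrableOn_Ioi 0 hz
  have h1 := norm_integral_le_of_norm_le (hInt.const_mul C)
    ((ae_restrict_iff' measurableSet_Ioi).2 (Eventually.of_forall fun y hy => hbd y hy))
  refine h1.trans_eq ?_
  rw [integral_const_mul, integral_exp_mul_Ioi (by linarith) 0]
  simp [div_eq_mul_inv]

/-- A contour integral over a deformation of the real axis vanishes if the integrand decays above
the contour. -/
theorem IsDeformation.contourIntegral_eq_zero {h : ℝ → ℝ} (hh : IsDeformation h) {f : ℂ → ℂ}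
    (hc : ContinuousOn f (above h)) (hf : DifferentiableOn ℂ f (strictAbove h)) {C z : ℝ}
    (hz : 0 < z)
    (hbd : ∀ m ∈ above h, ‖f m‖ ≤ C * Real.exp (-z * m.im) / (1 + m.re ^ 2)) :
    Integrable (pullback h f) ∧ contourIntegral h f = 0 := by
  have hmem : ∀ c : ℝ, 0 ≤ c → ∀ s : ℝ, (s : ℂ) + I * h s + I * c ∈ above h := by
    intro c hc s
    simp [above, hc]
  have hmem' : ∀ c : ℝ, 0 < c → ∀ s : ℝ, (s : ℂ) + I * h s + I * c ∈ strictAbove h := by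
    intro c hc s
    simp [strictAbove, hc]
  have hC : 0 ≤ C := by
    have h1 := (norm_nonneg _).trans (hbd _ (hmem 0 le_rfl 0))
    have h2 : (0 : ℝ) ≤ C * Real.exp (-z * ((0 : ℝ) + I * h 0 + I * (0 : ℝ) : ℂ).im) := by
      by_contra! hlt
      exact absurd (div_neg_of_neg_of_pos hlt (by positivity)) (not_lt.2 h1)
    exact nonneg_of_mul_nonneg_left h2 (Real.exp_pos _)
  have hbd0 : ∀ c : ℝ, 0 ≤ c → ∀ s : ℝ,
      ‖f (s + I * h s + I * c)‖ ≤ C * Real.exp (-z * c) / (1 + s ^ 2) := by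
    intro c hc s
    refine (hbd _ (hmem c hc s)).trans ?_
    have hre : ((s : ℂ) + I * h s + I * c).re = s := by simp
    have him : ((s : ℂ) + I * h s + I * c).im = h s + c := by simp
    rw [hre, him]
    gcongr C * Real.exp ?_ / _
    nlinarith [hh.nonneg s]
  have hcont : ∀ c : ℝ, 0 ≤ c → Continuous fun s : ℝ => f (s + I * h s + I * c) := by
    intro c hc'
    have h1 := hh.continuous
    exact hc.comp_continuous (by fun_prop) (hmem c hc')
  have hgint : Integrable fun s : ℝ => C / (1 + s ^ 2) * ‖(1 + I * (deriv h s : ℝ) : ℂ)‖ := by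
    have h1 : Integrable fun s : ℝ => C / (1 + s ^ 2) * (1 + |deriv h s|) := by
      simp only [mul_add, mul_one]
      refine Integrable.add ?_ ?_
      · simpa [div_eq_mul_inv] using integrable_inv_one_add_sq.const_mul C
      · refine hh.integrable.abs.bdd_mul (c := C) ?_ ?_
        · apply Continuous.aestronglyMeasurable
          exact continuous_const.div (by fun_prop) (fun s => by positivity)
        · refine Eventually.of_forall fun s => ?_
          rw [Real.norm_eq_abs, abs_of_nonneg (by positivity)]
          exact div_le_self hC (by nlinarith [sq_nonneg s])
    refine h1.mono' ?_ ?_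
    · have hm : Measurable fun s : ℝ => C / (1 + s ^ 2) * ‖(1 + I * (deriv h s : ℝ) : ℂ)‖ := by
        have := measurable_deriv h
        fun_prop
      exact hm.aestronglyMeasurable
    · refine Eventually.of_forall fun s => ?_
      rw [Real.norm_eq_abs, abs_of_nonneg (by positivity)]
      gcongr
      refine (norm_add_le _ _).trans ?_
      simp
  have hmeas : ∀ c : ℝ, 0 ≤ c → AEStronglyMeasurable
      (fun s : ℝ => f (s + I * h s + I * c) * (1 + I * (deriv h s : ℝ))) volume := by
    intro c hc
    have hm : Measurable fun s : ℝ => (1 + I * (deriv h s : ℝ) : ℂ) := by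
      have := measurable_deriv h
      fun_prop
    exact (hcont c hc).aestronglyMeasurable.mul hm.aestronglyMeasurable
  have hle : ∀ c : ℝ, 0 ≤ c → ∀ s : ℝ, ‖f (s + I * h s + I * c) * (1 + I * (deriv h s : ℝ))‖
      ≤ C / (1 + s ^ 2) * ‖(1 + I * (deriv h s : ℝ) : ℂ)‖ := by
    intro c hc s
    rw [norm_mul]
    gcongr
    refine (hbd0 c hc s).trans ?_
    gcongr
    refine mul_le_of_le_one_right hC (Real.exp_le_one_iff.2 ?_)
    nlinarith
  have hInt : ∀ c : ℝ, 0 ≤ c → Integrable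
      fun s : ℝ => f (s + I * h s + I * c) * (1 + I * (deriv h s : ℝ)) := fun c hc =>
    hgint.mono' (hmeas c hc) (Eventually.of_forall (hle c hc))
  -- The curve lifted by `c > 0` lies in the open region, where the vertical primitive `Φ` exists.
  -- The integral is a limit of differences of values of `Φ`, and these tend to zero at both ends
  -- thanks to the factor `1 / (1 + s²)`.
  have hzero : ∀ c : ℝ, 0 < c →
      ∫ s : ℝ, f (s + I * h s + I * c) * (1 + I * (deriv h s : ℝ)) = 0 := by
    intro c hc'
    have hbd1 : ∀ m ∈ strictAbove h, ‖f m‖ ≤ C * Real.exp (-z * m.im) := by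
      intro m hm
      refine (hbd m (strictAbove_subset h hm)).trans (div_le_self (by positivity) ?_)
      nlinarith [sq_nonneg m.re]
    set Φ : ℂ → ℂ := fun m => -I * ∫ y in Ioi (0 : ℝ), f (m + I * y) with hΦ
    have hΦd : ∀ m ∈ strictAbove h, HasDerivAt Φ (f m) m := fun m hm =>
      hasDerivAt_vertical_primitive hh.continuous hf hz hbd1 hm
    have hΦb : ∀ s : ℝ, ‖Φ (s + I * h s + I * c)‖ ≤ C / (1 + s ^ 2) / z := by
      intro s
      rw [hΦ, norm_mul, norm_neg, norm_I, one_mul]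
      refine norm_vertical_integral_le hz fun y hy => ?_
      have := hbd0 (c + y) (by linarith) s
      have e : (s : ℂ) + I * h s + I * c + I * y = s + I * h s + I * (c + y : ℝ) := by
        push_cast; ring
      rw [e]
      refine this.trans ?_
      rw [div_mul_eq_mul_div]
      gcongr C * Real.exp ?_ / _
      nlinarith
    have hlim : Tendsto (fun s : ℝ => Φ (s + I * h s + I * c)) (cocompact ℝ) (𝓝 0) := by
      refine squeeze_zero_norm hΦb ?_
      have h1 : Tendsto (fun s : ℝ => 1 + s ^ 2) (cocompact ℝ) atTop := by
        refine tendsto_atTop_add_const_left _ _ ?_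
        have := (tendsto_pow_atTop two_ne_zero).comp (tendsto_norm_cocompact_atTop (E := ℝ))
        refine this.congr fun s => ?_
        simp
      simpa using (h1.const_div_atTop C).div_const z
    rw [cocompact_eq_atBot_atTop] at hlim
    have ht := intervalIntegral_tendsto_integral (hInt c hc'.le)
      (tendsto_neg_atTop_atBot (G := ℝ)) tendsto_id
    have ht2 : Tendsto (fun r : ℝ => Φ (r + I * h r + I * c)
        - Φ ((-r : ℝ) + I * h (-r) + I * c)) atTop (𝓝 (0 - 0)) := by
      refine (hlim.mono_left le_sup_right).sub ?_
      exact (hlim.mono_left le_sup_left).comp tendsto_neg_atTop_atBot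
    rw [sub_zero] at ht2
    refine tendsto_nhds_unique ht (ht2.congr' ?_)
    filter_upwards [eventually_ge_atTop 0] with r hr
    exact (hh.integral_comp_deriv (I * c) (hmem' c hc') hΦd (hcont c hc'.le) (by simp; linarith)).symm
  have h0 : ∀ s : ℝ, f (s + I * h s + I * (0 : ℝ)) * (1 + I * (deriv h s : ℝ)) = pullback h f s := by
    intro s
    simp [pullback]
  refine ⟨(hInt 0 le_rfl).congr (Eventually.of_forall h0), ?_⟩
  -- On the curve itself `f` is only continuous, so the lift is removed by dominated convergence.
  have hlim : Tendsto (fun n : ℕ => ∫ s : ℝ, f (s + I * h s + I * ((1 / (n + 1 : ℝ) : ℝ) : ℂ))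
      * (1 + I * (deriv h s : ℝ))) atTop (𝓝 (∫ s : ℝ, f (s + I * h s + I * (0 : ℝ))
      * (1 + I * (deriv h s : ℝ)))) := by
    refine tendsto_integral_of_dominated_convergence _ (fun n => hmeas _ (by positivity)) hgint
      (fun n => Eventually.of_forall (hle _ (by positivity))) (Eventually.of_forall fun s => ?_)
    refine Tendsto.mul_const _ ?_
    have hca := hc _ (hmem 0 le_rfl s)
    refine hca.tendsto.comp (tendsto_nhdsWithin_iff.2 ⟨?_, Eventually.of_forall fun n =>
      hmem _ (by positivity) s⟩)
    refine Tendsto.const_add _ (Tendsto.const_mul _ ?_)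
    exact (continuous_ofReal.tendsto' 0 _ rfl).comp tendsto_one_div_add_atTop_nhds_zero_nat
  have h1 : ∀ n : ℕ, ∫ s : ℝ, f (s + I * h s + I * ((1 / (n + 1 : ℝ) : ℝ) : ℂ))
      * (1 + I * (deriv h s : ℝ)) = 0 := fun n => hzero _ (by positivity)
  simp_rw [h1] at hlim
  have := tendsto_nhds_unique hlim tendsto_const_nhds
  simp_rw [h0] at this
  exact this

/-! ### Fourier inversion on the line -/

theorem fourier_inversion_line {f : ℝ → ℂ} (hf : Continuous f) (hfi : Integrable f)
    (hF : Integrable fun m : ℝ => ∫ x : ℝ, exp (-(I * m * x)) * f x) (x : ℝ) :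
    ∫ m : ℝ, exp (I * m * x) * ∫ y : ℝ, exp (-(I * m * y)) * f y = 2 * Real.pi * f x := by
  set G : ℝ → ℂ := fun m => ∫ y : ℝ, exp (-(I * m * y)) * f y with hG
  have h1 : ∀ ξ : ℝ, FourierTransform.fourier f ξ = G (2 * Real.pi * ξ) := by
    intro ξ
    rw [Real.fourier_real_eq_integral_exp_smul]
    simp only [hG, smul_eq_mul]
    congr 1
    ext y
    congr 2
    push_cast
    ring
  have h2 : Integrable (FourierTransform.fourier f) := by
    have := hF.comp_mul_left' (R := 2 * Real.pi) (by positivity)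
    refine this.congr (Eventually.of_forall fun ξ => ?_)
    simp only [h1, hG]
  have h3 := congrFun (hf.fourierInv_fourier_eq hfi h2) x
  rw [Real.fourierInv_eq_fourier_neg, Real.fourier_real_eq_integral_exp_smul] at h3
  have h4 : ∀ ξ : ℝ, exp (↑(-2 * Real.pi * ξ * -x) * I) • FourierTransform.fourier f ξ
      = (fun m : ℝ => exp (I * m * x) * G m) (2 * Real.pi * ξ) := by
    intro ξ
    simp only [h1, smul_eq_mul]
    congr 2
    push_cast
    ring
  simp_rw [h4] at h3
  rw [Measure.integral_comp_mul_left (fun m : ℝ => exp (I * m * x) * G m)] at h3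
  rw [← h3, abs_of_pos (by positivity), real_smul]
  push_cast
  have : (Real.pi : ℂ) ≠ 0 := by exact_mod_cast Real.pi_ne_zero
  rw [← mul_assoc, mul_inv_cancel₀ (mul_ne_zero two_ne_zero this), one_mul]

end HalfSpace

end


noncomputable section

namespace HalfSpace

open Filter Topology Set

/-! ### The Fourier transform on the plane -/

/-- The Fourier transform on the plane. -/
def planar (f : ℝ × ℝ → ℂ) (k l : ℝ) : ℂ :=
  ∫ q : ℝ × ℝ, exp (-(I * k * q.1) - I * l * q.2) * f q

theorem norm_exp_planar (k l x y : ℝ) : ‖exp (-(I * k * x) - I * l * y)‖ = 1 := by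
  rw [norm_exp]
  simp

theorem integrable_planar {f : ℝ × ℝ → ℂ} (hf : Integrable f) (k l : ℝ) :
    Integrable fun q : ℝ × ℝ => exp (-(I * k * q.1) - I * l * q.2) * f q := by
  refine hf.bdd_mul (c := 1) ?_ (Eventually.of_forall fun q => (norm_exp_planar k l q.1 q.2).le)
  exact Continuous.aestronglyMeasurable (by fun_prop)

theorem norm_planar_le (f : ℝ × ℝ → ℂ) (k l : ℝ) : ‖planar f k l‖ ≤ ∫ q, ‖f q‖ := by
  refine (norm_integral_le_integral_norm _).trans_eq ?_
  simp [norm_exp_planar]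

theorem continuous_planar {f : ℝ × ℝ → ℂ} (hf : Integrable f) :
    Continuous fun q : ℝ × ℝ => planar f q.1 q.2 := by
  refine continuous_of_dominated (bound := fun q => ‖f q‖)
    (fun q => (integrable_planar hf q.1 q.2).aestronglyMeasurable) ?_ hf.norm ?_
  · refine fun p => Eventually.of_forall fun q => ?_
    simp [norm_exp_planar]
  · exact Eventually.of_forall fun q => by fun_prop

theorem integral_planar_gaussian {ε : ℝ} (hε : 0 < ε) (a b : ℝ) :
    ∫ ξ : ℝ × ℝ, exp (I * a * ξ.1 + I * b * ξ.2) * (Real.exp (-ε * (ξ.1 ^ 2 + ξ.2 ^ 2)) : ℂ)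
      = ((Real.pi / ε * Real.exp (-(1 / (4 * ε)) * (a ^ 2 + b ^ 2)) : ℝ) : ℂ) := by
  have h1 : ∀ ξ : ℝ × ℝ,
      exp (I * a * ξ.1 + I * b * ξ.2) * (Real.exp (-ε * (ξ.1 ^ 2 + ξ.2 ^ 2)) : ℂ)
      = (exp (I * a * ξ.1) * exp (-ε * (ξ.1 : ℂ) ^ 2)) *
        (exp (I * b * ξ.2) * exp (-ε * (ξ.2 : ℂ) ^ 2)) := by
    intro ξ
    push_cast
    rw [← exp_add, ← exp_add, ← exp_add, ← exp_add]
    congr 1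
    ring
  simp_rw [h1]
  rw [Measure.volume_eq_prod, integral_prod_mul (fun x : ℝ => exp (I * a * x) * exp (-ε * (x : ℂ) ^ 2))
    (fun x : ℝ => exp (I * b * x) * exp (-ε * (x : ℂ) ^ 2)),
    fourierIntegral_gaussian (by simpa using hε), fourierIntegral_gaussian (by simpa using hε)]
  have h2 : ((Real.pi : ℂ) / ε) ^ (1 / 2 : ℂ) * ((Real.pi : ℂ) / ε) ^ (1 / 2 : ℂ) = Real.pi / ε := by
    have h0 : (Real.pi : ℂ) / ε ≠ 0 := by
      rw [← ofReal_div]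
      exact ofReal_ne_zero.2 (by positivity)
    rw [← cpow_add _ _ h0]
    norm_num
  rw [mul_mul_mul_comm, h2, ← exp_add]
  push_cast
  congr 2
  ring

theorem integrable_planar_gaussian {ε : ℝ} (hε : 0 < ε) :
    Integrable fun ξ : ℝ × ℝ => Real.exp (-ε * (ξ.1 ^ 2 + ξ.2 ^ 2)) := by
  have := (integrable_exp_neg_mul_sq hε).mul_prod (integrable_exp_neg_mul_sq hε)
  refine this.congr (Eventually.of_forall fun ξ => ?_)
  simp only
  rw [← Real.exp_add]
  ring_nf

theorem integral_planar_gaussian_real {ε : ℝ} (hε : 0 < ε) :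
    ∫ ξ : ℝ × ℝ, Real.exp (-ε * (ξ.1 ^ 2 + ξ.2 ^ 2)) = Real.pi / ε := by
  have h := integral_planar_gaussian hε 0 0
  simp only [ofReal_zero, mul_zero, zero_mul, add_zero, exp_zero, one_mul] at h
  rw [integral_complex_ofReal] at h
  simpa using ofReal_injective h

/-- A Plancherel bound with Gaussian regularisation. Expanding `|f̂|²` as a double integral and
integrating in `ξ` first leaves the kernel `Γ(p - q)`, a Gaussian of total mass `4π²` for every `ε`;
one factor `f` is then bounded by `M`, and the estimate is uniform in `ε`. -/
theorem integral_norm_sq_planar_gaussian_le {f : ℝ × ℝ → ℂ} (hf : Integrable f) {M : ℝ}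
    (hM : ∀ q, ‖f q‖ ≤ M) {ε : ℝ} (hε : 0 < ε) :
    ∫ ξ : ℝ × ℝ, ‖planar f ξ.1 ξ.2‖ ^ 2 * Real.exp (-ε * (ξ.1 ^ 2 + ξ.2 ^ 2))
      ≤ 4 * Real.pi ^ 2 * M * ∫ q, ‖f q‖ := by
  set g : ℝ × ℝ → ℝ := fun ξ => Real.exp (-ε * (ξ.1 ^ 2 + ξ.2 ^ 2)) with hg
  set Γ : ℝ × ℝ → ℝ :=
    fun p => Real.pi / ε * Real.exp (-(1 / (4 * ε)) * (p.1 ^ 2 + p.2 ^ 2)) with hΓ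
  have hΓi : Integrable Γ := (integrable_planar_gaussian (by positivity)).const_mul _
  have hΓ0 : ∀ p, 0 ≤ Γ p := fun p => by positivity
  have hΓI : ∫ p, Γ p = 4 * Real.pi ^ 2 := by
    rw [hΓ, integral_const_mul, integral_planar_gaussian_real (by positivity)]
    field_simp
  have hM0 : 0 ≤ M := (norm_nonneg _).trans (hM 0)
  have hff : Integrable fun r : (ℝ × ℝ) × (ℝ × ℝ) => starRingEnd ℂ (f r.1) * f r.2 :=
    Integrable.mul_prod (μ := volume) (ν := volume)
      (hf.congr' (g := fun p => starRingEnd ℂ (f p))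
        (continuous_conj.comp_aestronglyMeasurable hf.aestronglyMeasurable)
        (Eventually.of_forall fun p => by simp)) hf
  have hsq : ∀ ξ : ℝ × ℝ, ((‖planar f ξ.1 ξ.2‖ ^ 2 * g ξ : ℝ) : ℂ)
      = ∫ r : (ℝ × ℝ) × (ℝ × ℝ), exp (I * (r.1.1 - r.2.1 : ℝ) * ξ.1 + I * (r.1.2 - r.2.2 : ℝ) * ξ.2)
        * (starRingEnd ℂ (f r.1) * f r.2) * g ξ := by
    intro ξ
    rw [integral_mul_const]
    push_cast
    congr 1
    rw [← conj_mul']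
    have hconj : starRingEnd ℂ (planar f ξ.1 ξ.2)
        = ∫ q : ℝ × ℝ, exp (I * ξ.1 * q.1 + I * ξ.2 * q.2) * starRingEnd ℂ (f q) := by
      rw [planar, ← integral_conj]
      congr 1
      ext q
      rw [map_mul, ← exp_conj]
      congr 2
      simp
    rw [hconj, planar, Measure.volume_eq_prod (ℝ × ℝ) (ℝ × ℝ),
      ← integral_prod_mul (μ := volume) (ν := volume)
      (fun q : ℝ × ℝ => exp (I * ξ.1 * q.1 + I * ξ.2 * q.2) * starRingEnd ℂ (f q))
      (fun q : ℝ × ℝ => exp (-(I * ξ.1 * q.1) - I * ξ.2 * q.2) * f q)]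
    congr 1
    ext r
    rw [mul_mul_mul_comm, ← exp_add]
    congr 2
    ring
  have hint3 : Integrable (fun s : (ℝ × ℝ) × ((ℝ × ℝ) × (ℝ × ℝ)) =>
      exp (I * (s.2.1.1 - s.2.2.1 : ℝ) * s.1.1 + I * (s.2.1.2 - s.2.2.2 : ℝ) * s.1.2)
        * (starRingEnd ℂ (f s.2.1) * f s.2.2) * g s.1) (volume.prod volume) := by
    have hgi : Integrable fun ξ : ℝ × ℝ => (g ξ : ℂ) := (integrable_planar_gaussian hε).ofReal
    have h1 := hgi.mul_prod hff
    have h2 := h1.bdd_mul (c := 1) (f := fun s : (ℝ × ℝ) × ((ℝ × ℝ) × (ℝ × ℝ)) =>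
      exp (I * (s.2.1.1 - s.2.2.1 : ℝ) * s.1.1 + I * (s.2.1.2 - s.2.2.2 : ℝ) * s.1.2))
      (Continuous.aestronglyMeasurable (by fun_prop)) (Eventually.of_forall fun s => by
        rw [norm_exp]; simp)
    refine h2.congr (Eventually.of_forall fun s => ?_)
    simp only
    ring
  -- Fubini: the oscillating factor, integrated against the Gaussian in `ξ`, becomes `Γ (p - q)`.
  have hmain : ((∫ ξ : ℝ × ℝ, ‖planar f ξ.1 ξ.2‖ ^ 2 * g ξ : ℝ) : ℂ)
      = ∫ r : (ℝ × ℝ) × (ℝ × ℝ), (Γ (r.1 - r.2) : ℂ) * (starRingEnd ℂ (f r.1) * f r.2) := by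
    rw [← integral_complex_ofReal]
    simp_rw [hsq]
    rw [integral_integral_swap hint3]
    congr 1
    ext r
    have := integral_planar_gaussian hε (r.1.1 - r.2.1) (r.1.2 - r.2.2)
    rw [hΓ]
    simp only [Prod.fst_sub, Prod.snd_sub]
    rw [← this, ← integral_mul_const]
    congr 1
    ext ξ
    ring
  have hΓc : Continuous Γ := by fun_prop
  have hΓb : ∀ p, ‖(Γ p : ℂ)‖ ≤ Real.pi / ε := by
    intro p
    rw [norm_real, Real.norm_of_nonneg (hΓ0 p)]
    refine mul_le_of_le_one_right (by positivity) (Real.exp_le_one_iff.2 ?_)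
    have : 0 ≤ 1 / (4 * ε) * (p.1 ^ 2 + p.2 ^ 2) := by positivity
    linarith
  have hint2 : Integrable fun r : (ℝ × ℝ) × (ℝ × ℝ) =>
      (Γ (r.1 - r.2) : ℂ) * (starRingEnd ℂ (f r.1) * f r.2) :=
    hff.bdd_mul (c := Real.pi / ε) (Continuous.aestronglyMeasurable (by fun_prop))
      (Eventually.of_forall fun r => hΓb _)
  have hnonneg : 0 ≤ ∫ ξ : ℝ × ℝ, ‖planar f ξ.1 ξ.2‖ ^ 2 * g ξ :=
    integral_nonneg fun ξ => by positivity
  have h5 : ∫ ξ : ℝ × ℝ, ‖planar f ξ.1 ξ.2‖ ^ 2 * g ξ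
      ≤ ∫ r : (ℝ × ℝ) × (ℝ × ℝ), ‖(Γ (r.1 - r.2) : ℂ) * (starRingEnd ℂ (f r.1) * f r.2)‖ := by
    have h6 := norm_integral_le_integral_norm (μ := volume)
      (fun r : (ℝ × ℝ) × (ℝ × ℝ) => (Γ (r.1 - r.2) : ℂ) * (starRingEnd ℂ (f r.1) * f r.2))
    rw [← hmain, norm_real, Real.norm_of_nonneg hnonneg] at h6
    exact h6
  refine h5.trans ?_
  rw [Measure.volume_eq_prod (ℝ × ℝ) (ℝ × ℝ)] at hint2 ⊢
  rw [integral_prod _ hint2.norm, mul_comm, ← integral_mul_const]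
  refine integral_mono hint2.norm.integral_prod_left (hf.norm.mul_const _) fun p => ?_
  have hΓp : Integrable fun q => Γ (p - q) := hΓi.comp_sub_left p
  calc ∫ q, ‖(Γ (p - q) : ℂ) * (starRingEnd ℂ (f p) * f q)‖
      ≤ ∫ q, Γ (p - q) * (‖f p‖ * M) := by
        refine integral_mono_of_nonneg (Eventually.of_forall fun q => norm_nonneg _)
          (hΓp.mul_const _) (Eventually.of_forall fun q => ?_)
        simp only [norm_mul, norm_real, RCLike.norm_conj, Real.norm_of_nonneg (hΓ0 _)]
        gcongr
        exact hM q
    _ = ‖f p‖ * (4 * Real.pi ^ 2 * M) := by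
        rw [integral_mul_const, integral_sub_left_eq_self Γ volume p, hΓI]
        ring

/-- The Fourier transform of a bounded integrable function on the plane is square integrable. -/
theorem integrable_norm_sq_planar {f : ℝ × ℝ → ℂ} (hf : Integrable f) {M : ℝ}
    (hM : ∀ q, ‖f q‖ ≤ M) : Integrable fun ξ : ℝ × ℝ => ‖planar f ξ.1 ξ.2‖ ^ 2 := by
  have hc : Continuous fun ξ : ℝ × ℝ => ‖planar f ξ.1 ξ.2‖ ^ 2 := (continuous_planar hf).norm.pow 2
  refine ⟨hc.aestronglyMeasurable, ?_⟩
  rw [hasFiniteIntegral_iff_ofReal (Eventually.of_forall fun ξ => by positivity)]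
  set C : ℝ := 4 * Real.pi ^ 2 * M * ∫ q, ‖f q‖
  let ε : ℕ → ℝ := fun n => 1 / ((n : ℝ) + 1)
  have hε : ∀ n, 0 < ε n := fun n => by positivity
  have hle : ∀ n, ∫⁻ ξ : ℝ × ℝ, ENNReal.ofReal (‖planar f ξ.1 ξ.2‖ ^ 2
      * Real.exp (-ε n * (ξ.1 ^ 2 + ξ.2 ^ 2))) ≤ ENNReal.ofReal C := by
    intro n
    rw [← ofReal_integral_eq_lintegral_ofReal]
    · exact ENNReal.ofReal_le_ofReal (integral_norm_sq_planar_gaussian_le hf hM (hε n))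
    · refine (integrable_planar_gaussian (hε n)).bdd_mul (c := (∫ q, ‖f q‖) ^ 2)
        hc.aestronglyMeasurable (Eventually.of_forall fun ξ => ?_)
      rw [Real.norm_of_nonneg (by positivity)]
      gcongr
      exact norm_planar_le f _ _
    · exact Eventually.of_forall fun ξ => by positivity
  have hlim : ∀ ξ : ℝ × ℝ, Tendsto (fun n => ENNReal.ofReal (‖planar f ξ.1 ξ.2‖ ^ 2
      * Real.exp (-ε n * (ξ.1 ^ 2 + ξ.2 ^ 2)))) atTop
      (𝓝 (ENNReal.ofReal (‖planar f ξ.1 ξ.2‖ ^ 2))) := by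
    intro ξ
    refine ENNReal.tendsto_ofReal ?_
    have h1 : Tendsto ε atTop (𝓝 0) := tendsto_one_div_add_atTop_nhds_zero_nat
    have h2 : Tendsto (fun n => Real.exp (-ε n * (ξ.1 ^ 2 + ξ.2 ^ 2))) atTop (𝓝 1) := by
      have := (Real.continuous_exp.tendsto _).comp (h1.neg.mul_const (ξ.1 ^ 2 + ξ.2 ^ 2))
      simpa [Function.comp_def] using this
    simpa using h2.const_mul (‖planar f ξ.1 ξ.2‖ ^ 2)
  -- Fatou's lemma as the Gaussian factor tends to `1`.
  have h3 : ∫⁻ ξ : ℝ × ℝ, ENNReal.ofReal (‖planar f ξ.1 ξ.2‖ ^ 2) ≤ ENNReal.ofReal C := by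
    calc ∫⁻ ξ : ℝ × ℝ, ENNReal.ofReal (‖planar f ξ.1 ξ.2‖ ^ 2)
        = ∫⁻ ξ : ℝ × ℝ, liminf (fun n => ENNReal.ofReal (‖planar f ξ.1 ξ.2‖ ^ 2
          * Real.exp (-ε n * (ξ.1 ^ 2 + ξ.2 ^ 2)))) atTop := by
          congr 1
          ext ξ
          exact (hlim ξ).liminf_eq.symm
      _ ≤ liminf (fun n => ∫⁻ ξ : ℝ × ℝ, ENNReal.ofReal (‖planar f ξ.1 ξ.2‖ ^ 2
          * Real.exp (-ε n * (ξ.1 ^ 2 + ξ.2 ^ 2)))) atTop := by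
          refine lintegral_liminf_le fun n => ?_
          have : Continuous fun ξ : ℝ × ℝ => ‖planar f ξ.1 ξ.2‖ ^ 2
              * Real.exp (-ε n * (ξ.1 ^ 2 + ξ.2 ^ 2)) := hc.mul (by fun_prop)
          exact this.measurable.ennreal_ofReal
      _ ≤ ENNReal.ofReal C := by
          refine liminf_le_of_le (by isBoundedDefault) fun b hb => ?_
          obtain ⟨n, hn⟩ := hb.exists
          exact hn.trans (hle n)
  exact h3.trans_lt ENNReal.ofReal_lt_top

/-- Fourier inversion on the plane. -/
theorem planar_inversion {f : ℝ × ℝ → ℂ} (hc : Continuous f) (hf : Integrable f)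
    (hline : ∀ y, Integrable fun x => f (x, y))
    (hcl : ∀ k : ℝ, Continuous fun y => ∫ x : ℝ, exp (-(I * k * x)) * f (x, y))
    (hF : Integrable fun q : ℝ × ℝ => planar f q.1 q.2) (x y : ℝ) :
    ∫ q : ℝ × ℝ, exp (I * q.1 * x + I * q.2 * y) * planar f q.1 q.2 = 4 * Real.pi ^ 2 * f (x, y) := by
  have hexp : Integrable fun q : ℝ × ℝ => exp (I * q.1 * x + I * q.2 * y) * planar f q.1 q.2 := by
    refine hF.bdd_mul (c := 1) (Continuous.aestronglyMeasurable (by fun_prop))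
      (Eventually.of_forall fun q => ?_)
    rw [norm_exp]; simp
  set g : ℝ → ℝ → ℂ := fun k y => ∫ x : ℝ, exp (-(I * k * x)) * f (x, y) with hg
  have hfk : ∀ k : ℝ, Integrable fun q : ℝ × ℝ => exp (-(I * k * q.1)) * f q := by
    intro k
    have := integrable_planar hf k 0
    simpa using this
  have hgi : ∀ k, Integrable (g k) := fun k => (hfk k).integral_prod_right
  have hplanar : ∀ k l : ℝ, planar f k l = ∫ y : ℝ, exp (-(I * l * y)) * g k y := by
    intro k l
    have h1 := integrable_planar hf k l
    rw [planar]
    rw [Measure.volume_eq_prod] at h1 ⊢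
    rw [integral_prod_symm _ h1]
    congr 1
    ext y
    rw [hg, ← integral_const_mul]
    congr 1
    ext x
    rw [← mul_assoc, ← exp_add]
    congr 2
    ring
  rw [Measure.volume_eq_prod] at hexp hF ⊢
  rw [integral_prod _ hexp]
  -- Fubini gives integrability in `l` for almost every `k` only, so the inner inversion holds
  -- almost everywhere, which is enough for the outer integral.
  have hinner : ∀ᵐ k : ℝ, ∫ l : ℝ, exp (I * k * x + I * l * y) * planar f k l
      = 2 * Real.pi * (exp (I * k * x) * g k y) := by
    filter_upwards [hF.prod_right_ae] with k hk
    have h1 := fourier_inversion_line (hcl k) (hgi k) (by simpa only [hplanar] using hk) y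
    rw [mul_left_comm, ← h1, ← integral_const_mul]
    congr 1
    ext l
    rw [hplanar, ← mul_assoc, ← exp_add]
  rw [integral_congr_ae hinner, integral_const_mul]
  have hgk : Integrable fun k => g k y := by
    have h1 : Integrable fun k : ℝ => (2 * Real.pi : ℂ) * (exp (I * k * x) * g k y) :=
      hexp.integral_prod_left.congr hinner
    have h2 := (h1.const_mul ((2 * Real.pi : ℂ)⁻¹)).bdd_mul (c := 1)
      (f := fun k : ℝ => exp (-(I * k * x))) (Continuous.aestronglyMeasurable (by fun_prop))
      (Eventually.of_forall fun q => by rw [norm_exp]; simp)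
    refine h2.congr (Eventually.of_forall fun k => ?_)
    have hpi : (2 * Real.pi : ℂ) ≠ 0 := mul_ne_zero two_ne_zero (ofReal_ne_zero.2 Real.pi_ne_zero)
    simp only
    rw [inv_mul_cancel_left₀ hpi, ← mul_assoc, ← exp_add]
    simp
  rw [fourier_inversion_line (f := fun x => f (x, y)) (by fun_prop) (hline y) hgk x]
  ring

end HalfSpace

end


noncomputable section

namespace HalfSpace

open Filter Topology Set

/-! ### The time transform -/

theorem timeTransform_neg (om : ℂ) (φ : ℝ → ℂ) (t : ℝ) :
    timeTransform (-om) φ t = timeTransform om φ t := by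
  simp only [timeTransform, mul_neg, neg_mul, neg_neg, div_neg]
  ring

/-- The frequency enters evenly. Hence the branch chosen in `root` is immaterial here, and `ω₁` at
`m` may be exchanged with `ω₂` at `m₂₁`. -/
theorem timeTransform_eq_of_sq {om om' : ℂ} (h : om ^ 2 = om' ^ 2) (φ : ℝ → ℂ) (t : ℝ) :
    timeTransform om φ t = timeTransform om' φ t := by
  rcases sq_eq_sq_iff_eq_or_eq_neg.1 h with h | h
  · rw [h]
  · rw [h, timeTransform_neg]

theorem freeEvolution_neg (om X₀ X₁ : ℂ) (t : ℝ) :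
    freeEvolution (-om) X₀ X₁ t = freeEvolution om X₀ X₁ t := by
  simp only [freeEvolution, mul_neg, neg_mul, neg_neg, div_neg]
  ring

theorem freeEvolution_eq_of_sq {om om' : ℂ} (h : om ^ 2 = om' ^ 2) (X₀ X₁ : ℂ) (t : ℝ) :
    freeEvolution om X₀ X₁ t = freeEvolution om' X₀ X₁ t := by
  rcases sq_eq_sq_iff_eq_or_eq_neg.1 h with h | h
  · rw [h]
  · rw [h, freeEvolution_neg]

theorem freeEvolution_eq (om X₀ X₁ : ℂ) (t : ℝ) :
    freeEvolution om X₀ X₁ t = cos (om * t) * X₀ + sin (om * t) / om * X₁ := by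
  rw [freeEvolution, cos, sin]
  have e1 : -(om * t) * I = -(I * om * t) := by ring
  have e2 : om * t * I = I * om * t := by ring
  rw [e1, e2, mul_comm 2 om, ← div_div]
  ring

theorem intervalIntegrable_mul_of_continuousOn {φ : ℝ → ℂ} {t : ℝ} (ht : 0 ≤ t)
    (hφ : ContinuousOn φ (Icc 0 t)) {c : ℝ → ℂ} (hc : Continuous c) :
    IntervalIntegrable (fun s => c s * φ s) volume 0 t := by
  apply ContinuousOn.intervalIntegrable
  rw [uIcc_of_le ht]
  exact hc.continuousOn.mul hφ

/-- The two exponentials combine into Duhamel's kernel `sin(ω(t - s)) / ω`, which for real `ω ≠ 0`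
is bounded by `t - s`. -/
theorem timeTransform_eq_integral {φ : ℝ → ℂ} {t : ℝ} (ht : 0 ≤ t)
    (hφ : ContinuousOn φ (Icc 0 t)) (om : ℂ) :
    timeTransform om φ t = -I * ∫ s in (0 : ℝ)..t, sin (om * (t - s)) / om * φ s := by
  rw [timeTransform, ← intervalIntegral.integral_const_mul, ← intervalIntegral.integral_const_mul,
    ← intervalIntegral.integral_sub, ← intervalIntegral.integral_const_mul,
    ← intervalIntegral.integral_const_mul]
  · refine intervalIntegral.integral_congr fun s _ => ?_
    simp only [← mul_assoc]
    rw [← sub_mul, ← mul_assoc]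
    congr 1
    rw [← exp_add, ← exp_add, sin]
    have e1 : -(om * (t - s)) * I = -(I * om * t) + I * om * s := by ring
    have e2 : om * (t - s) * I = I * om * t + -(I * om * s) := by ring
    rw [e1, e2, mul_comm 2 om, ← div_div]
    linear_combination ((cexp (-(I * om * t) + I * om * s) - cexp (I * om * t + -(I * om * s))) / (2 * om)) * I_sq
  · exact (intervalIntegrable_mul_of_continuousOn ht hφ (by fun_prop)).const_mul _
  · exact (intervalIntegrable_mul_of_continuousOn ht hφ (by fun_prop)).const_mul _

theorem timeTransform_add {φ ψ : ℝ → ℂ} {t : ℝ} (ht : 0 ≤ t)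
    (hφ : ContinuousOn φ (Icc 0 t)) (hψ : ContinuousOn ψ (Icc 0 t)) (om : ℂ) :
    timeTransform om (fun s => φ s + ψ s) t = timeTransform om φ t + timeTransform om ψ t := by
  rw [timeTransform_eq_integral ht hφ, timeTransform_eq_integral ht hψ,
    timeTransform_eq_integral ht (φ := fun s => φ s + ψ s) (hφ.add hψ), ← mul_add, ← intervalIntegral.integral_add]
  · simp only [mul_add]
  · exact intervalIntegrable_mul_of_continuousOn ht hφ (by fun_prop)
  · exact intervalIntegrable_mul_of_continuousOn ht hψ (by fun_prop)

theorem timeTransform_const_mul (c : ℂ) (φ : ℝ → ℂ) (t : ℝ) (om : ℂ) :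
    timeTransform om (fun s => c * φ s) t = c * timeTransform om φ t := by
  simp only [timeTransform, mul_left_comm _ c, intervalIntegral.integral_const_mul]
  ring

/-- The value at `s = 0` is negligible; this matters because the boundary conditions are available
for positive times only. -/
theorem timeTransform_congr {φ ψ : ℝ → ℂ} {t : ℝ} (ht : 0 ≤ t)
    (h : ∀ s, 0 < s → s ≤ t → φ s = ψ s) (om : ℂ) :
    timeTransform om φ t = timeTransform om ψ t := by
  have : ∀ c : ℝ → ℂ, ∫ s in (0 : ℝ)..t, c s * φ s = ∫ s in (0 : ℝ)..t, c s * ψ s := by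
    intro c
    refine intervalIntegral.integral_congr_ae (Eventually.of_forall fun s hs => ?_)
    rw [uIoc_of_le ht] at hs
    rw [h s hs.1 hs.2]
  rw [timeTransform, timeTransform, this, this]

/-- Duhamel's formula for `X'' + ω² X = F`. -/
theorem duhamel {X X' F : ℝ → ℂ} {t : ℝ} (ht : 0 ≤ t) {om : ℂ} (hom : om ≠ 0)
    (hX : ContinuousOn X (Icc 0 t)) (hX' : ContinuousOn X' (Icc 0 t))
    (hF : ContinuousOn F (Icc 0 t)) (hd : ∀ s ∈ Ioo 0 t, HasDerivAt X (X' s) s)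
    (hd' : ∀ s ∈ Ioo 0 t, HasDerivAt X' (-om ^ 2 * X s + F s) s) :
    X t = freeEvolution om (X 0) (X' 0) t + I * timeTransform om F t := by
  -- The differentiated expression is constant in `s` along solutions of the homogeneous equation,
  -- so its derivative retains only the forcing. It equals `X t` at `s = t` and the free evolution
  -- at `s = 0`.
  have key := intervalIntegral.integral_eq_sub_of_hasDerivAt_of_le ht
    (f := fun s => sin (om * (t - s)) / om * X' s + cos (om * (t - s)) * X s)
    (f' := fun s => sin (om * (t - s)) / om * F s) ?_ ?_
    (intervalIntegrable_mul_of_continuousOn ht hF (by fun_prop))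
  · rw [timeTransform_eq_integral ht hF, key, freeEvolution_eq]
    simp only [sub_self, mul_zero, sin_zero, cos_zero, zero_div, ofReal_zero, sub_zero]
    linear_combination (X t - (sin (om * t) / om * X' 0 + cos (om * t) * X 0)) * I_sq
  · have h1 : Continuous fun s : ℝ => sin (om * (t - s)) / om := by fun_prop
    have h2 : Continuous fun s : ℝ => cos (om * (t - s)) := by fun_prop
    exact (h1.continuousOn.mul hX').add (h2.continuousOn.mul hX)
  · intro s hs
    have hl : HasDerivAt (fun s : ℝ => om * (t - s)) (-om) s := by
      have := ((hasDerivAt_id s).ofReal_comp.const_sub (t : ℂ)).const_mul om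
      simpa using this
    have h1 := (((hasDerivAt_sin _).comp s hl).div_const om).mul (hd' s hs)
    have h2 := ((hasDerivAt_cos _).comp s hl).mul (hd s hs)
    refine (h1.add h2).congr_deriv ?_
    simp only [Function.comp_apply]
    field_simp
    ring

/-- Two estimates are added. The kernel is at most `t` in modulus, which gives `t² M`; one
integration by parts in `s` bounds `r²` times the integral by `(t + 2) M`. Together they give
quadratic decay in the frequency at the cost of one time derivative. -/
theorem norm_timeTransform_le {φ φ' : ℝ → ℂ} {t : ℝ} (ht : 0 ≤ t)
    (hφ : ContinuousOn φ (Icc 0 t)) (hφ' : ContinuousOn φ' (Icc 0 t))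
    (hd : ∀ s ∈ Ioo 0 t, HasDerivAt φ (φ' s) s) {M : ℝ} (hM : ∀ s ∈ Icc 0 t, ‖φ s‖ ≤ M)
    (hM' : ∀ s ∈ Icc 0 t, ‖φ' s‖ ≤ M) {r : ℝ} (hr : r ≠ 0) :
    ‖timeTransform r φ t‖ ≤ (t ^ 2 + t + 2) * M / (1 + r ^ 2) := by
  have hrc : (r : ℂ) ≠ 0 := ofReal_ne_zero.2 hr
  have hM0 : 0 ≤ M := (norm_nonneg _).trans (hM 0 ⟨le_rfl, ht⟩)
  rw [timeTransform_eq_integral ht hφ, norm_mul, norm_neg, norm_I, one_mul]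
  set J := ∫ s in (0 : ℝ)..t, sin (r * (t - s)) / r * φ s with hJ
  have hsin : ∀ s : ℝ, sin ((r : ℂ) * (t - s)) = (Real.sin (r * (t - s)) : ℂ) := by
    intro s; push_cast; rfl
  have hcos : ∀ s : ℝ, cos ((r : ℂ) * (t - s)) = (Real.cos (r * (t - s)) : ℂ) := by
    intro s; push_cast; rfl
  have b1 : ‖J‖ ≤ t ^ 2 * M := by
    have : ‖J‖ ≤ (t * M) * |t - 0| := by
      refine intervalIntegral.norm_integral_le_of_norm_le_const fun s hs => ?_
      rw [uIoc_of_le ht] at hs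
      rw [norm_mul, hsin, norm_div, norm_real, norm_real, Real.norm_eq_abs, Real.norm_eq_abs]
      refine mul_le_mul ?_ (hM s ⟨hs.1.le, hs.2⟩) (norm_nonneg _) ht
      rw [div_le_iff₀ (abs_pos.2 hr)]
      refine (Real.abs_sin_le_abs).trans ?_
      rw [abs_mul, abs_of_nonneg (by linarith [hs.2] : 0 ≤ t - s), mul_comm]
      gcongr
      linarith [hs.1]
    rw [sub_zero, abs_of_nonneg ht] at this
    linarith
  have b2 : r ^ 2 * ‖J‖ ≤ (t + 2) * M := by
    have key := intervalIntegral.integral_eq_sub_of_hasDerivAt_of_le ht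
      (f := fun s => cos (r * (t - s)) * φ s)
      (f' := fun s => (r : ℂ) ^ 2 * (sin (r * (t - s)) / r * φ s) + cos (r * (t - s)) * φ' s) ?_ ?_ ?_
    · rw [intervalIntegral.integral_add, intervalIntegral.integral_const_mul, ← hJ] at key
      · have e : (r : ℂ) ^ 2 * J = φ t - cos (r * t) * φ 0
            - ∫ s in (0 : ℝ)..t, cos (r * (t - s)) * φ' s := by
          have h0 : cos ((r : ℂ) * (t - t)) = 1 := by simp
          rw [eq_sub_iff_add_eq, key, h0]
          simp
        have b3 : ‖∫ s in (0 : ℝ)..t, cos (r * (t - s)) * φ' s‖ ≤ M * |t - 0| := by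
          refine intervalIntegral.norm_integral_le_of_norm_le_const fun s hs => ?_
          rw [uIoc_of_le ht] at hs
          rw [norm_mul, hcos, norm_real, Real.norm_eq_abs]
          exact (mul_le_of_le_one_left (norm_nonneg _) (Real.abs_cos_le_one _)).trans
            (hM' s ⟨hs.1.le, hs.2⟩)
        rw [sub_zero, abs_of_nonneg ht] at b3
        have b4 : ‖cos ((r : ℂ) * t) * φ 0‖ ≤ M := by
          have := hcos 0
          rw [ofReal_zero, sub_zero] at this
          rw [norm_mul, this, norm_real, Real.norm_eq_abs]
          exact (mul_le_of_le_one_left (norm_nonneg _) (Real.abs_cos_le_one _)).trans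
            (hM 0 ⟨le_rfl, ht⟩)
        have b5 := hM t ⟨ht, le_rfl⟩
        have b6 : r ^ 2 * ‖J‖ = ‖(r : ℂ) ^ 2 * J‖ := by
          rw [norm_mul, norm_pow, norm_real, Real.norm_eq_abs, sq_abs]
        rw [b6, e]
        refine (norm_sub_le _ _).trans ?_
        have := norm_sub_le (φ t) (cos ((r : ℂ) * t) * φ 0)
        linarith
      · exact (intervalIntegrable_mul_of_continuousOn ht hφ (by fun_prop)).const_mul _
      · exact intervalIntegrable_mul_of_continuousOn ht hφ' (by fun_prop)
    · exact (Continuous.continuousOn (by fun_prop)).mul hφ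
    · intro s hs
      have hl : HasDerivAt (fun s : ℝ => (r : ℂ) * (t - s)) (-r) s := by
        have := ((hasDerivAt_id s).ofReal_comp.const_sub (t : ℂ)).const_mul (r : ℂ)
        simpa using this
      refine (((hasDerivAt_cos _).comp s hl).mul (hd s hs)).congr_deriv ?_
      simp only [Function.comp_apply]
      field_simp
    · exact ((intervalIntegrable_mul_of_continuousOn ht hφ (by fun_prop)).const_mul _).add
        (intervalIntegrable_mul_of_continuousOn ht hφ' (by fun_prop))
  rw [le_div_iff₀ (by positivity)]
  nlinarith

/-! ### The time transform is an entire function of the square of the frequency -/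

theorem differentiable_integral_exp {φ : ℝ → ℂ} {t : ℝ} (ht : 0 ≤ t)
    (hφ : ContinuousOn φ (Icc 0 t)) (c : ℂ) :
    Differentiable ℂ fun om : ℂ => ∫ s in (0 : ℝ)..t, exp (c * om * s) * φ s := by
  intro om₀
  simp only [intervalIntegral.integral_of_le ht]
  obtain ⟨M, hM⟩ := isCompact_Icc.exists_bound_of_continuousOn hφ
  refine (hasDerivAt_integral_of_holomorphic (μ := volume.restrict (Ioc 0 t))
    (F := fun om s => exp (c * om * s) * φ s) (U := univ) isOpen_univ ?_ ?_ (mem_univ _)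
    (bound := fun _ => Real.exp (‖c‖ * (‖om₀‖ + 1) * t) * M) (integrable_const _)
    (s := Metric.ball om₀ 1) (Metric.ball_mem_nhds _ one_pos) ?_).differentiableAt
  · intro om _
    refine ContinuousOn.aestronglyMeasurable ?_ measurableSet_Ioc
    exact (Continuous.continuousOn (by fun_prop)).mul (hφ.mono Ioc_subset_Icc_self)
  · refine Eventually.of_forall fun s => ?_
    exact Differentiable.differentiableOn (by fun_prop)
  · rw [ae_restrict_iff' measurableSet_Ioc]
    refine Eventually.of_forall fun s hs om hom => ?_
    rw [norm_mul]
    refine mul_le_mul ?_ (hM s ⟨hs.1.le, hs.2⟩) (norm_nonneg _) (Real.exp_pos _).le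
    rw [norm_exp, Real.exp_le_exp]
    refine (re_le_norm _).trans ?_
    rw [norm_mul, norm_mul, norm_real, Real.norm_of_nonneg hs.1.le]
    have : ‖om‖ ≤ ‖om₀‖ + 1 := by
      have h1 := mem_ball_iff_norm.1 hom
      have := norm_add_le om₀ (om - om₀)
      rw [add_sub_cancel] at this
      linarith
    gcongr
    · exact hs.1.le
    · exact hs.2

/-- An even entire function is an entire function of the square. -/
theorem exists_differentiable_comp_sq {S : ℂ → ℂ} (hS : Differentiable ℂ S)
    (heven : ∀ w, S (-w) = S w) : ∃ g : ℂ → ℂ, Differentiable ℂ g ∧ ∀ w, g (w ^ 2) = S w := by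
  have hsq : ∀ {v w : ℂ}, v ^ 2 = w ^ 2 → S v = S w := by
    intro v w h
    rcases sq_eq_sq_iff_eq_or_eq_neg.1 h with h | h
    · rw [h]
    · rw [h, heven]
  have hcp : ∀ ζ : ℂ, (ζ ^ (1 / 2 : ℂ)) ^ 2 = ζ := by
    intro ζ
    rw [one_div]
    exact_mod_cast cpow_nat_inv_pow ζ two_ne_zero
  refine ⟨fun ζ => S (ζ ^ (1 / 2 : ℂ)), ?_, fun w => hsq (hcp _)⟩
  have hne : ∀ ζ₀ : ℂ, ζ₀ ≠ 0 → DifferentiableAt ℂ (fun ζ => S (ζ ^ (1 / 2 : ℂ))) ζ₀ := by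
    intro ζ₀ h0
    -- The principal root may jump by a sign near `ζ₀`. Replacing it by the root of `ζ₀` times the
    -- root of `ζ / ζ₀` changes at most the sign, invisible to the even function `S`, and gives a
    -- holomorphic root near `ζ₀`. The origin is a removable singularity.
    have h1 : (fun ζ => S (ζ ^ (1 / 2 : ℂ)))
        = fun ζ => S (ζ₀ ^ (1 / 2 : ℂ) * (ζ / ζ₀) ^ (1 / 2 : ℂ)) := by
      ext ζ
      refine hsq ?_
      rw [mul_pow, hcp, hcp, hcp]
      field_simp
    rw [h1]
    refine (hS _).comp ζ₀ (DifferentiableAt.const_mul ?_ _)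
    refine DifferentiableAt.cpow_const (by fun_prop) ?_
    rw [div_self h0]
    exact one_mem_slitPlane
  have hc0 : ContinuousAt (fun ζ => S (ζ ^ (1 / 2 : ℂ))) 0 := by
    refine ContinuousAt.comp (hS _).continuousAt ?_
    exact continuousAt_cpow_zero_of_re_pos (by norm_num) |>.comp
      (f := fun ζ : ℂ => (ζ, (1 / 2 : ℂ))) (by fun_prop)
  have := (differentiableOn_compl_singleton_and_continuousAt_iff (s := univ) (c := (0 : ℂ))
    univ_mem).1 ⟨fun ζ hζ => (hne ζ (by simpa using hζ)).differentiableWithinAt, hc0⟩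
  exact differentiableOn_univ.1 this

/-- Frequency times time transform is entire and vanishes at zero, so its slope at zero is entire;
being even, it is an entire function of the square of the frequency. -/
theorem exists_entire_timeTransform {φ : ℝ → ℂ} {t : ℝ} (ht : 0 ≤ t)
    (hφ : ContinuousOn φ (Icc 0 t)) :
    ∃ g : ℂ → ℂ, Differentiable ℂ g ∧ ∀ om : ℂ, om ≠ 0 → g (om ^ 2) = timeTransform om φ t := by
  set H : ℂ → ℂ := fun om => 1 / 2 *
    (exp (-(I * om * t)) * (∫ s in (0 : ℝ)..t, exp (I * om * s) * φ s)
      - exp (I * om * t) * (∫ s in (0 : ℝ)..t, exp (-I * om * s) * φ s)) with hH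
  have hHd : Differentiable ℂ H := by
    have h1 := differentiable_integral_exp ht hφ I
    have h2 := differentiable_integral_exp ht hφ (-I)
    fun_prop
  have hH0 : H 0 = 0 := by simp [hH]
  have hS : Differentiable ℂ (dslope H 0) := by
    rw [← differentiableOn_univ]
    exact (differentiableOn_dslope univ_mem).2 hHd.differentiableOn
  have hval : ∀ om : ℂ, om ≠ 0 → dslope H 0 om = timeTransform om φ t := by
    intro om hom
    rw [dslope_of_ne _ hom, slope_def_field, hH0, timeTransform, hH]
    simp only [neg_mul]
    field_simp
    ring
  obtain ⟨g, hg, hgs⟩ := exists_differentiable_comp_sq hS (fun w => by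
    by_cases hw : w = 0
    · simp [hw]
    · rw [hval w hw, hval (-w) (neg_ne_zero.2 hw), timeTransform_neg])
  exact ⟨g, hg, fun om hom => by rw [hgs, hval om hom]⟩

end HalfSpace

end


noncomputable section

namespace HalfSpace

open Filter Topology Set

/-! ### Branches of `(a m² + b)^{1/2}` -/

/-- The branch of `(a m² + b)^{1/2}` asymptotic to `√a m` at infinity. -/
def branch (a b : ℝ) (m : ℂ) : ℂ := m * ((a : ℂ) + b / m ^ 2) ^ (1 / 2 : ℂ)

theorem cpow_half_sq (ζ : ℂ) : (ζ ^ (1 / 2 : ℂ)) ^ 2 = ζ := by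
  rw [one_div]
  exact_mod_cast cpow_nat_inv_pow ζ two_ne_zero

theorem branch_sq (a b : ℝ) {m : ℂ} (hm : m ≠ 0) : branch a b m ^ 2 = a * m ^ 2 + b := by
  rw [branch, mul_pow, cpow_half_sq]
  field_simp

/-- The square root halves the argument, which in the slit plane lies in `(-π, π)`. -/
theorem re_cpow_half_pos {ζ : ℂ} (hζ : ζ ∈ slitPlane) : 0 < (ζ ^ (1 / 2 : ℂ)).re := by
  have h0 := slitPlane_ne_zero hζ
  rw [cpow_def_of_ne_zero h0, exp_re]
  refine mul_pos (Real.exp_pos _) (Real.cos_pos_of_mem_Ioo ?_)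
  have him : (log ζ * (1 / 2)).im = arg ζ / 2 := by
    rw [show (1 / 2 : ℂ) = ((1 / 2 : ℝ) : ℂ) by push_cast; rfl, im_mul_ofReal, log_im]
    ring
  rw [him]
  have h1 := arg_le_pi ζ
  have h2 := neg_pi_lt_arg ζ
  have h3 : arg ζ ≠ Real.pi := (mem_slitPlane_iff_arg.1 hζ).1
  have h4 := lt_of_le_of_ne h1 h3
  constructor <;> linarith

/-- In the cut plane, `m ↦ (a m² + b)^{1/2}` preserves the upper half-plane and the real axis. -/
theorem branch_im {a b : ℝ} (ha : 0 < a) {m : ℂ} (hm : m ≠ 0)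
    (hs : (a : ℂ) + b / m ^ 2 ∈ slitPlane) :
    (0 < m.im → 0 < (branch a b m).im) ∧ (m.im = 0 → (branch a b m).im = 0) := by
  set q := ((a : ℂ) + b / m ^ 2) ^ (1 / 2 : ℂ) with hq
  have hqr : 0 < q.re := re_cpow_half_pos hs
  set n := branch a b m with hn
  have hnm : n = m * q := rfl
  have hsq : n ^ 2 = a * m ^ 2 + b := branch_sq a b hm
  have h1 : n.re * n.im = a * (m.re * m.im) := by
    have := congrArg Complex.im hsq
    simp only [sq, mul_im, add_im, ofReal_re, ofReal_im, zero_mul, add_zero] at this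
    linarith
  have h2 : 0 < n.re * m.re + n.im * m.im := by
    have h3 : n.re * m.re + n.im * m.im = (m.re ^ 2 + m.im ^ 2) * q.re := by
      rw [hnm, mul_re, mul_im]; ring
    rw [h3]
    refine mul_pos ?_ hqr
    have := normSq_pos.2 hm
    rw [normSq_apply] at this
    nlinarith
  constructor
  · intro hy
    -- If `Im n ≤ 0`, then `h2` forces `Re n · Re m > 0`; but `h1` multiplied by `Re m` makes `(Re n
    -- · Re m) · Im n` positive, a contradiction.
    by_contra! hle
    have h4 : 0 < n.re * m.re := by nlinarith
    have hx : m.re ≠ 0 := by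
      intro h0; rw [h0, mul_zero] at h4; exact lt_irrefl _ h4
    have h5 : (n.re * m.re) * n.im = a * (m.re ^ 2 * m.im) := by
      linear_combination m.re * h1
    have h6 : 0 < a * (m.re ^ 2 * m.im) := by positivity
    nlinarith
  · intro hy
    rw [hy, mul_zero, add_zero] at h2
    rw [hy, mul_zero, mul_zero] at h1
    rcases mul_eq_zero.1 h1 with h | h
    · rw [h, zero_mul] at h2; exact absurd h2 (lt_irrefl _)
    · exact h

/-- If the radicand is a real number `-r ≤ 0`, then `m² = -b / (a + r)` is real and lies between `-b
/ a` and `0`; this places `m` on the cut, imaginary or real according to the sign of `b`. -/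
theorem exists_of_notMem_slitPlane {a b : ℝ} {m : ℂ} (ha : 0 < a) (hm : m ≠ 0)
    (hs : (a : ℂ) + b / m ^ 2 ∉ slitPlane) :
    ∃ β : ℝ, m ^ 2 = ((-β : ℝ) : ℂ) ∧ (0 ≤ b → 0 ≤ β ∧ β ≤ b / a) ∧ (b ≤ 0 → β ≤ 0 ∧ b / a ≤ β) := by
  rw [mem_slitPlane_iff, not_or, not_lt, not_not] at hs
  obtain ⟨hre, him⟩ := hs
  set w := (a : ℂ) + b / m ^ 2 with hw
  set r := -w.re with hr
  have hwr : w = ((-r : ℝ) : ℂ) := by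
    apply Complex.ext
    · simp [hr]
    · simpa using him
  have hr0 : 0 ≤ r := by linarith
  have har : 0 < a + r := by linarith
  have hm2 : m ^ 2 ≠ 0 := pow_ne_zero 2 hm
  have h1 : (b : ℂ) = -((a + r : ℝ) : ℂ) * m ^ 2 := by
    have : (b : ℂ) / m ^ 2 = -((a + r : ℝ) : ℂ) := by
      push_cast
      push_cast at hwr
      linear_combination hwr - hw
    rw [← this]
    field_simp
  have harc : ((a + r : ℝ) : ℂ) ≠ 0 := ofReal_ne_zero.2 har.ne'
  refine ⟨b / (a + r), ?_, ?_, ?_⟩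
  · push_cast
    push_cast at h1 harc
    rw [h1]
    field_simp
  · intro hb
    exact ⟨by positivity, div_le_div_of_nonneg_left hb ha (by linarith)⟩
  · intro hb
    refine ⟨div_nonpos_of_nonpos_of_nonneg hb har.le, ?_⟩
    rw [div_le_div_iff₀ ha har]
    nlinarith

theorem differentiableAt_branch {a b : ℝ} {m : ℂ} (hm : m ≠ 0)
    (hs : (a : ℂ) + b / m ^ 2 ∈ slitPlane) :
    DifferentiableAt ℂ (branch a b) m := by
  unfold branch
  refine DifferentiableAt.mul (by fun_prop) (DifferentiableAt.cpow_const ?_ hs)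
  have : m ^ 2 ≠ 0 := pow_ne_zero 2 hm
  fun_prop (disch := assumption)

theorem tendsto_const_div_sq_cobounded (b : ℂ) :
    Tendsto (fun m : ℂ => b / m ^ 2) (Bornology.cobounded ℂ) (𝓝 0) := by
  have h1 : Tendsto (fun m : ℂ => m⁻¹) (Bornology.cobounded ℂ) (𝓝 0) := tendsto_inv₀_cobounded
  have h2 := (h1.pow 2).const_mul b
  simpa [div_eq_mul_inv] using h2

theorem tendsto_branch_div {a : ℝ} (ha : 0 < a) (b : ℝ) :
    Tendsto (fun m => branch a b m / m) (Bornology.cobounded ℂ) (𝓝 ((√a : ℝ) : ℂ)) := by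
  have h1 : Tendsto (fun m : ℂ => (a : ℂ) + b / m ^ 2) (Bornology.cobounded ℂ) (𝓝 (a : ℂ)) := by
    simpa using (tendsto_const_div_sq_cobounded b).const_add (a : ℂ)
  have hca : ContinuousAt (fun w : ℂ => w ^ (1 / 2 : ℂ)) (a : ℂ) :=
    continuousAt_cpow_const (ofReal_mem_slitPlane.2 ha)
  have h2 := hca.tendsto.comp h1
  have h3 : (a : ℂ) ^ (1 / 2 : ℂ) = ((√a : ℝ) : ℂ) := by
    rw [Real.sqrt_eq_rpow, ofReal_cpow ha.le]
    push_cast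
    rfl
  simp only [h3] at h2
  refine h2.congr' ?_
  filter_upwards [(Bornology.eventually_ne_cobounded (0 : ℂ))] with m hm
  simp only [Function.comp_apply, branch]
  field_simp

/-! ### The maps `m₁₂`, `m₂₁` and the root as branches -/

theorem root_eq_branch (k l : ℝ) (m : ℂ) : root k l m = branch 1 (k ^ 2 + l ^ 2) m := by
  simp [root, branch]

theorem m12_eq_branch (lam mu k l : ℝ) (m : ℂ) :
    m12 lam mu k l m
      = -branch (mu / (lam + 2 * mu)) (-((lam + mu) / (lam + 2 * mu) * (k ^ 2 + l ^ 2))) m := by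
  rw [m12, branch, neg_mul]
  push_cast
  ring_nf

theorem m21_eq_branch (lam mu k l : ℝ) (m : ℂ) :
    m21 lam mu k l m
      = -branch ((lam + 2 * mu) / mu) ((lam + mu) / mu * (k ^ 2 + l ^ 2)) m := by
  rw [m21, branch, neg_mul]
  push_cast
  ring_nf

section

variable {lam mu : ℝ} (k l : ℝ)

theorem m12_sq (hmu : 0 < mu) (hlm : 0 < lam + mu) {m : ℂ} (hm : m ≠ 0) :
    ((lam : ℂ) + 2 * mu) * m12 lam mu k l m ^ 2 = mu * m ^ 2 - (lam + mu) * (k ^ 2 + l ^ 2) := by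
  have h : ((lam : ℂ) + 2 * mu) ≠ 0 := by
    have : lam + 2 * mu ≠ 0 := by linarith
    exact_mod_cast this
  rw [m12_eq_branch, neg_sq, branch_sq _ _ hm]
  push_cast
  field_simp
  ring

theorem m21_sq (hmu : 0 < mu) {m : ℂ} (hm : m ≠ 0) :
    (mu : ℂ) * m21 lam mu k l m ^ 2 = (lam + 2 * mu) * m ^ 2 + (lam + mu) * (k ^ 2 + l ^ 2) := by
  have h : (mu : ℂ) ≠ 0 := by exact_mod_cast hmu.ne'
  rw [m21_eq_branch, neg_sq, branch_sq _ _ hm]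
  push_cast
  field_simp

theorem root_sq {m : ℂ} (hm : m ≠ 0) : root k l m ^ 2 = k ^ 2 + l ^ 2 + m ^ 2 := by
  rw [root_eq_branch, branch_sq _ _ hm]
  push_cast
  ring

theorem omega1_sq (hmu : 0 < mu) (hlm : 0 < lam + mu) {m : ℂ} (hm : m ≠ 0) :
    omega1 lam mu k l m ^ 2 = (lam + 2 * mu) * (k ^ 2 + l ^ 2 + m ^ 2) := by
  rw [omega1, mul_pow, root_sq k l hm, ← ofReal_pow, Real.sq_sqrt (by linarith)]
  push_cast
  ring

theorem omega2_sq (hmu : 0 < mu) {m : ℂ} (hm : m ≠ 0) :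
    omega2 mu k l m ^ 2 = mu * (k ^ 2 + l ^ 2 + m ^ 2) := by
  rw [omega2, mul_pow, root_sq k l hm, ← ofReal_pow, Real.sq_sqrt hmu.le]

theorem det_matD (hmu : 0 < mu) {m : ℂ} (hm : m ≠ 0) :
    (matD lam mu k l m).det = mu ^ 3 * m21 lam mu k l m ^ 2 *
      ((k ^ 2 + l ^ 2 - m21 lam mu k l m ^ 2) ^ 2
        - 4 * (k ^ 2 + l ^ 2) * m * m21 lam mu k l m) := by
  have h := m21_sq (lam := lam) k l hmu hm
  rw [matD, Matrix.det_fin_three]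
  simp only [Matrix.of_apply, Matrix.cons_val', Matrix.cons_val_zero, Matrix.cons_val_one,
    Matrix.cons_val]
  linear_combination (-mu ^ 2 * m21 lam mu k l m ^ 2 * (m21 lam mu k l m ^ 2 - k ^ 2 - l ^ 2)) * h

/-- Where the denominator of the kernel vanishes, `m₂₁ = -m`, and the two terms of the determinant
cancel. The poles of the integrands are therefore among the zeros of `Δ₂`, and an admissible contour
passes above them without a separate requirement. -/
theorem det_matD_eq_zero (hmu : 0 < mu) {m : ℂ} (hm : m ≠ 0)
    (h : (k : ℂ) ^ 2 + l ^ 2 + m ^ 2 = 0) : (matD lam mu k l m).det = 0 := by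
  have hmuc : (mu : ℂ) ≠ 0 := by exact_mod_cast hmu.ne'
  have hK : (k : ℂ) ^ 2 + l ^ 2 = -m ^ 2 := by linear_combination h
  have h1 : m21 lam mu k l m = -m := by
    have h2 : ((lam : ℂ) + 2 * mu) / mu + ((lam : ℂ) + mu) / mu * (((k : ℂ) ^ 2 + (l : ℂ) ^ 2) / m ^ 2)
        = 1 := by
      rw [hK]
      field_simp
      ring
    rw [m21, h2]
    simp
  rw [det_matD k l hmu hm, h1, hK]
  ring

end

end HalfSpace

end


noncomputable section

namespace HalfSpace

open Filter Topology Set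

/-! ### The region above an admissible contour -/

theorem smul_mem_segment_neg (c : ℂ) {θ : ℝ} (hθ : |θ| ≤ 1) : (θ : ℂ) * c ∈ segment ℝ (-c) c := by
  rw [abs_le] at hθ
  refine ⟨(1 - θ) / 2, (1 + θ) / 2, by linarith, by linarith, by ring, ?_⟩
  simp only [real_smul]
  push_cast
  ring

theorem ofReal_mul_mem_segment {x C : ℝ} (hx : x ^ 2 ≤ C ^ 2) (hC : 0 ≤ C) (c : ℂ) :
    (x : ℂ) * c ∈ segment ℝ (-(c * C)) (c * C) := by
  have habs : |x| ≤ C := abs_le_of_sq_le_sq hx hC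
  have h1 : (x : ℂ) * c = ((x / C : ℝ) : ℂ) * (c * C) := by
    rcases hC.eq_or_lt with h0 | h0
    · rw [← h0] at habs ⊢
      have : x = 0 := abs_nonpos_iff.1 habs
      simp [this]
    · have : (C : ℂ) ≠ 0 := ofReal_ne_zero.2 h0.ne'
      push_cast
      field_simp
  rw [h1]
  refine smul_mem_segment_neg _ ?_
  rw [abs_div, abs_of_nonneg hC]
  exact div_le_one_of_le₀ habs hC

theorem eq_or_of_sq_eq_ofReal {m : ℂ} {β : ℝ} (h : m ^ 2 = (β : ℂ)) :
    (0 ≤ β → m = (m.re : ℂ) ∧ m.re ^ 2 = β) ∧ (β ≤ 0 → m = (m.im : ℂ) * I ∧ m.im ^ 2 = -β) := by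
  have hre := congrArg Complex.re h
  have him := congrArg Complex.im h
  simp only [sq, mul_re, mul_im, ofReal_re, ofReal_im] at hre him
  have hz : m.re = 0 ∨ m.im = 0 := by
    rw [← mul_eq_zero]; linarith
  constructor
  · intro hβ
    have him0 : m.im = 0 := by
      rcases hz with h0 | h0
      · rw [h0] at hre; nlinarith
      · exact h0
    refine ⟨Complex.ext (by simp) (by simp [him0]), by rw [him0] at hre; nlinarith⟩
  · intro hβ
    have hre0 : m.re = 0 := by
      rcases hz with h0 | h0
      · exact h0
      · rw [h0] at hre; nlinarith
    refine ⟨Complex.ext (by simp [hre0]) (by simp), by rw [hre0] at hre; nlinarith⟩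

section

variable {lam mu k l : ℝ} {h : ℝ → ℝ}

theorem not_below_of_mem_above {m : ℂ} (hm : m ∈ above h) : ¬Below h m := by
  rw [Below, not_lt]
  exact hm

theorem IsAdmissible.im_nonneg (hA : IsAdmissible lam mu k l h) {m : ℂ} (hm : m ∈ above h) :
    0 ≤ m.im := (hA.deformation.nonneg _).trans hm

theorem IsAdmissible.im_pos (hA : IsAdmissible lam mu k l h) {m : ℂ} (hm : m ∈ strictAbove h) :
    0 < m.im := (hA.deformation.nonneg _).trans_lt hm

/-- The origin is the midpoint of the cut of `m₁₂`, also when this cut degenerates to a point for `k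
= l = 0`. -/
theorem IsAdmissible.ne_zero (hA : IsAdmissible lam mu k l h) {m : ℂ} (hm : m ∈ above h) :
    m ≠ 0 := by
  rintro rfl
  refine not_below_of_mem_above hm (hA.cut_m12 0 ?_)
  have := ofReal_mul_mem_segment (x := 0) (C := √(k ^ 2 + l ^ 2) * √((lam + mu) / mu))
    (by rw [zero_pow two_ne_zero]; positivity) (by positivity) 1
  simpa only [ofReal_zero, zero_mul, one_mul] using this

/-- A radicand outside the slit plane would put `m` on the cut, and the cut is below the contour. -/
theorem IsAdmissible.mem_slitPlane_m12 (hA : IsAdmissible lam mu k l h) (hmu : 0 < mu)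
    (hlm : 0 < lam + mu) {m : ℂ} (hm : m ∈ above h) :
    ((mu / (lam + 2 * mu) : ℝ) : ℂ) + ((-((lam + mu) / (lam + 2 * mu) * (k ^ 2 + l ^ 2)) : ℝ) : ℂ)
      / m ^ 2 ∈ slitPlane := by
  by_contra hs
  have h2 : 0 < lam + 2 * mu := by linarith
  have hb : -((lam + mu) / (lam + 2 * mu) * (k ^ 2 + l ^ 2)) ≤ 0 := by
    have : 0 ≤ (lam + mu) / (lam + 2 * mu) * (k ^ 2 + l ^ 2) := by positivity
    linarith
  obtain ⟨β, hβ, -, hβ2⟩ := exists_of_notMem_slitPlane (by positivity) (hA.ne_zero hm) hs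
  obtain ⟨h0, h1⟩ := hβ2 hb
  obtain ⟨e1, e2⟩ := (eq_or_of_sq_eq_ofReal hβ).1 (by linarith)
  refine not_below_of_mem_above hm (hA.cut_m12 m ?_)
  have := ofReal_mul_mem_segment (x := m.re) (C := √(k ^ 2 + l ^ 2) * √((lam + mu) / mu)) ?_
    (by positivity) 1
  · rw [mul_one, one_mul, ← e1] at this
    exact this
  · rw [e2, mul_pow, Real.sq_sqrt (by positivity), Real.sq_sqrt (by positivity)]
    have e3 : -((lam + mu) / (lam + 2 * mu) * (k ^ 2 + l ^ 2)) / (mu / (lam + 2 * mu))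
        = -((k ^ 2 + l ^ 2) * ((lam + mu) / mu)) := by
      rw [neg_div, neg_inj, div_eq_iff (by positivity)]
      field_simp
    linarith

theorem IsAdmissible.mem_slitPlane_m21 (hA : IsAdmissible lam mu k l h) (hmu : 0 < mu)
    (hlm : 0 < lam + mu) {m : ℂ} (hm : m ∈ above h) :
    (((lam + 2 * mu) / mu : ℝ) : ℂ) + (((lam + mu) / mu * (k ^ 2 + l ^ 2) : ℝ) : ℂ)
      / m ^ 2 ∈ slitPlane := by
  by_contra hs
  have h2 : 0 < lam + 2 * mu := by linarith
  have hb : 0 ≤ (lam + mu) / mu * (k ^ 2 + l ^ 2) := by positivity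
  obtain ⟨β, hβ, hβ1, -⟩ := exists_of_notMem_slitPlane (by positivity) (hA.ne_zero hm) hs
  obtain ⟨h0, h1⟩ := hβ1 hb
  obtain ⟨e1, e2⟩ := (eq_or_of_sq_eq_ofReal hβ).2 (by linarith)
  refine not_below_of_mem_above hm (hA.cut_m21 m ?_)
  have := ofReal_mul_mem_segment (x := m.im)
    (C := √(k ^ 2 + l ^ 2) * √((lam + mu) / (lam + 2 * mu))) ?_ (by positivity) I
  · rw [← e1] at this
    exact this
  · rw [e2, mul_pow, Real.sq_sqrt (by positivity), Real.sq_sqrt (by positivity)]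
    have e3 : (lam + mu) / mu * (k ^ 2 + l ^ 2) / ((lam + 2 * mu) / mu)
        = (k ^ 2 + l ^ 2) * ((lam + mu) / (lam + 2 * mu)) := by
      field_simp
    linarith

theorem IsAdmissible.kernel_ne_zero (hA : IsAdmissible lam mu k l h) (hmu : 0 < mu) {m : ℂ}
    (hm : m ∈ above h) : (k : ℂ) ^ 2 + l ^ 2 + m ^ 2 ≠ 0 := fun h0 =>
  not_below_of_mem_above hm (hA.zeros_D m (det_matD_eq_zero k l hmu (hA.ne_zero hm) h0))

theorem IsAdmissible.det_matC_ne_zero (hA : IsAdmissible lam mu k l h) {m : ℂ}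
    (hm : m ∈ above h) : (matC lam mu k l m).det ≠ 0 := fun h0 =>
  not_below_of_mem_above hm (hA.zeros_C m h0)

theorem IsAdmissible.det_matD_ne_zero (hA : IsAdmissible lam mu k l h) {m : ℂ}
    (hm : m ∈ above h) : (matD lam mu k l m).det ≠ 0 := fun h0 =>
  not_below_of_mem_above hm (hA.zeros_D m h0)

theorem IsAdmissible.differentiableAt_m12 (hA : IsAdmissible lam mu k l h) (hmu : 0 < mu)
    (hlm : 0 < lam + mu) {m : ℂ} (hm : m ∈ above h) :
    DifferentiableAt ℂ (m12 lam mu k l) m := by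
  have := (differentiableAt_branch (hA.ne_zero hm) (hA.mem_slitPlane_m12 hmu hlm hm)).neg
  refine this.congr_of_eventuallyEq (Eventually.of_forall fun w => ?_)
  exact m12_eq_branch lam mu k l w

theorem IsAdmissible.differentiableAt_m21 (hA : IsAdmissible lam mu k l h) (hmu : 0 < mu)
    (hlm : 0 < lam + mu) {m : ℂ} (hm : m ∈ above h) :
    DifferentiableAt ℂ (m21 lam mu k l) m := by
  have := (differentiableAt_branch (hA.ne_zero hm) (hA.mem_slitPlane_m21 hmu hlm hm)).neg
  refine this.congr_of_eventuallyEq (Eventually.of_forall fun w => ?_)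
  exact m21_eq_branch lam mu k l w

theorem IsAdmissible.m12_im_neg (hA : IsAdmissible lam mu k l h) (hmu : 0 < mu)
    (hlm : 0 < lam + mu) {m : ℂ} (hm : m ∈ above h) (him : 0 < m.im) :
    (m12 lam mu k l m).im < 0 := by
  have h2 : 0 < lam + 2 * mu := by linarith
  rw [m12_eq_branch, neg_im]
  linarith [(branch_im (by positivity) (hA.ne_zero hm) (hA.mem_slitPlane_m12 hmu hlm hm)).1 him]

theorem IsAdmissible.m21_im_neg (hA : IsAdmissible lam mu k l h) (hmu : 0 < mu)
    (hlm : 0 < lam + mu) {m : ℂ} (hm : m ∈ above h) (him : 0 < m.im) :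
    (m21 lam mu k l m).im < 0 := by
  have h2 : 0 < lam + 2 * mu := by linarith
  rw [m21_eq_branch, neg_im]
  linarith [(branch_im (by positivity) (hA.ne_zero hm) (hA.mem_slitPlane_m21 hmu hlm hm)).1 him]

theorem IsAdmissible.m12_im_nonpos (hA : IsAdmissible lam mu k l h) (hmu : 0 < mu)
    (hlm : 0 < lam + mu) {m : ℂ} (hm : m ∈ above h) : (m12 lam mu k l m).im ≤ 0 := by
  have h2 : 0 < lam + 2 * mu := by linarith
  rcases (hA.im_nonneg hm).eq_or_lt with h0 | h0
  · rw [m12_eq_branch, neg_im,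
      (branch_im (by positivity) (hA.ne_zero hm) (hA.mem_slitPlane_m12 hmu hlm hm)).2 h0.symm,
      neg_zero]
  · exact (hA.m12_im_neg hmu hlm hm h0).le

theorem IsAdmissible.m21_im_nonpos (hA : IsAdmissible lam mu k l h) (hmu : 0 < mu)
    (hlm : 0 < lam + mu) {m : ℂ} (hm : m ∈ above h) : (m21 lam mu k l m).im ≤ 0 := by
  have h2 : 0 < lam + 2 * mu := by linarith
  rcases (hA.im_nonneg hm).eq_or_lt with h0 | h0
  · rw [m21_eq_branch, neg_im,
      (branch_im (by positivity) (hA.ne_zero hm) (hA.mem_slitPlane_m21 hmu hlm hm)).2 h0.symm,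
      neg_zero]
  · exact (hA.m21_im_neg hmu hlm hm h0).le

theorem branch_ne_zero {a b : ℝ} {m : ℂ} (hm : m ≠ 0) (hs : (a : ℂ) + b / m ^ 2 ∈ slitPlane) :
    branch a b m ≠ 0 := by
  refine mul_ne_zero hm fun h0 => ?_
  have := re_cpow_half_pos hs
  rw [h0] at this
  simp at this

theorem IsAdmissible.m12_ne_zero (hA : IsAdmissible lam mu k l h) (hmu : 0 < mu)
    (hlm : 0 < lam + mu) {m : ℂ} (hm : m ∈ above h) : m12 lam mu k l m ≠ 0 := by
  rw [m12_eq_branch]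
  exact neg_ne_zero.2 (branch_ne_zero (hA.ne_zero hm) (hA.mem_slitPlane_m12 hmu hlm hm))

theorem IsAdmissible.m21_ne_zero (hA : IsAdmissible lam mu k l h) (hmu : 0 < mu)
    (hlm : 0 < lam + mu) {m : ℂ} (hm : m ∈ above h) : m21 lam mu k l m ≠ 0 := by
  rw [m21_eq_branch]
  exact neg_ne_zero.2 (branch_ne_zero (hA.ne_zero hm) (hA.mem_slitPlane_m21 hmu hlm hm))

end

/-! ### Behaviour at infinity -/

section

variable {lam mu : ℝ} (k l : ℝ)

theorem tendsto_m12_div (hmu : 0 < mu) (hlm : 0 < lam + mu) :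
    Tendsto (fun m => m12 lam mu k l m / m) (Bornology.cobounded ℂ)
      (𝓝 (-(√(mu / (lam + 2 * mu)) : ℝ) : ℂ)) := by
  have h2 : 0 < lam + 2 * mu := by linarith
  refine (tendsto_branch_div (by positivity)
    (-((lam + mu) / (lam + 2 * mu) * (k ^ 2 + l ^ 2)))).neg.congr fun m => ?_
  rw [m12_eq_branch, neg_div]

theorem tendsto_m21_div (hmu : 0 < mu) (hlm : 0 < lam + mu) :
    Tendsto (fun m => m21 lam mu k l m / m) (Bornology.cobounded ℂ)
      (𝓝 (-(√((lam + 2 * mu) / mu) : ℝ) : ℂ)) := by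
  have h2 : 0 < lam + 2 * mu := by linarith
  refine (tendsto_branch_div (by positivity)
    ((lam + mu) / mu * (k ^ 2 + l ^ 2))).neg.congr fun m => ?_
  rw [m21_eq_branch, neg_div]

/-- The leading part of `C` at infinity. -/
def limC (mu : ℝ) : Matrix (Fin 3) (Fin 3) ℂ :=
  !![0, 0, mu; 0, mu, 0; -mu, 0, 0]

/-- The leading part of `D` at infinity. -/
def limD (lam mu : ℝ) : Matrix (Fin 3) (Fin 3) ℂ :=
  !![0, 0, lam + 2 * mu; 0, lam + 2 * mu, 0; -(lam + 2 * mu), 0, 0]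

theorem tendsto_matC (hmu : 0 < mu) (hlm : 0 < lam + mu) :
    Tendsto (fun m : ℂ => (m ^ 2)⁻¹ • matC lam mu k l m) (Bornology.cobounded ℂ)
      (𝓝 (limC mu)) := by
  have hn := tendsto_m12_div k l hmu hlm
  have h1 : Tendsto (fun m : ℂ => m⁻¹) (Bornology.cobounded ℂ) (𝓝 0) := tendsto_inv₀_cobounded
  have hne : ∀ᶠ m : ℂ in Bornology.cobounded ℂ, m ≠ 0 := Bornology.eventually_ne_cobounded 0
  have h2 := h1.mul h1
  have hn1 := hn.mul h1
  rw [mul_zero] at h2 hn1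
  refine tendsto_pi_nhds.2 fun i => tendsto_pi_nhds.2 fun j => ?_
  -- After division by `m²` each entry is its limit plus terms of these three kinds; `m₁₂²` is
  -- eliminated by `m12_sq`.
  have haux : ∀ (A B C : ℂ), Tendsto (fun m : ℂ => A * (m12 lam mu k l m / m * m⁻¹) + B * (m⁻¹ * m⁻¹)
      + C * m⁻¹) (Bornology.cobounded ℂ) (𝓝 0) := by
    intro A B C
    simpa using ((hn1.const_mul A).add (h2.const_mul B)).add (h1.const_mul C)
  fin_cases i <;> fin_cases j
  · refine (haux (2 * mu * k) 0 0).congr' ?_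
    filter_upwards [hne] with m hm
    simp [matC]; field_simp
  · refine (haux (2 * mu * l) 0 0).congr' ?_
    filter_upwards [hne] with m hm
    simp [matC]; field_simp
  · have := (haux 0 ((lam * (k ^ 2 + l ^ 2) - (lam + mu) * (k ^ 2 + l ^ 2) : ℂ)) 0).const_add (mu : ℂ)
    rw [add_zero] at this
    refine this.congr' ?_
    filter_upwards [hne] with m hm
    have e := m12_sq (lam := lam) k l hmu hlm hm
    simp [matC]; field_simp
    linear_combination -e
  · refine (haux 0 (-(mu * k * l)) 0).congr' ?_
    filter_upwards [hne] with m hm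
    simp [matC]; field_simp
  · have := (haux 0 (-(mu * l ^ 2 : ℂ)) 0).const_add (mu : ℂ)
    rw [add_zero] at this
    refine this.congr' ?_
    filter_upwards [hne] with m hm
    simp [matC]; field_simp; ring
  · refine (haux 0 0 (2 * mu * l)).congr' ?_
    filter_upwards [hne] with m hm
    simp [matC]; field_simp
  · have := (haux 0 ((mu * k ^ 2 : ℂ)) 0).const_add (-mu : ℂ)
    rw [add_zero] at this
    refine this.congr' ?_
    filter_upwards [hne] with m hm
    simp [matC]; field_simp; ring
  · refine (haux 0 (mu * k * l) 0).congr' ?_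
    filter_upwards [hne] with m hm
    simp [matC]; field_simp
  · refine (haux 0 0 (-(2 * mu * k))).congr' ?_
    filter_upwards [hne] with m hm
    simp [matC]; field_simp

theorem tendsto_matD (hmu : 0 < mu) (hlm : 0 < lam + mu) :
    Tendsto (fun m : ℂ => (m ^ 2)⁻¹ • matD lam mu k l m) (Bornology.cobounded ℂ)
      (𝓝 (limD lam mu)) := by
  have hn := tendsto_m21_div k l hmu hlm
  have h1 : Tendsto (fun m : ℂ => m⁻¹) (Bornology.cobounded ℂ) (𝓝 0) := tendsto_inv₀_cobounded
  have hne : ∀ᶠ m : ℂ in Bornology.cobounded ℂ, m ≠ 0 := Bornology.eventually_ne_cobounded 0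
  have h2 := h1.mul h1
  have hn1 := hn.mul h1
  rw [mul_zero] at h2 hn1
  refine tendsto_pi_nhds.2 fun i => tendsto_pi_nhds.2 fun j => ?_
  have haux : ∀ (A B C : ℂ), Tendsto (fun m : ℂ => A * (m21 lam mu k l m / m * m⁻¹) + B * (m⁻¹ * m⁻¹)
      + C * m⁻¹) (Bornology.cobounded ℂ) (𝓝 0) := by
    intro A B C
    simpa using ((hn1.const_mul A).add (h2.const_mul B)).add (h1.const_mul C)
  fin_cases i <;> fin_cases j
  · refine (haux 0 0 (-(2 * mu * k))).congr' ?_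
    filter_upwards [hne] with m hm
    simp [matD]; field_simp
  · refine (haux 0 0 (-(2 * mu * l))).congr' ?_
    filter_upwards [hne] with m hm
    simp [matD]; field_simp
  · have := (haux 0 ((lam * (k ^ 2 + l ^ 2) : ℂ)) 0).const_add (lam + 2 * mu : ℂ)
    rw [add_zero] at this
    refine this.congr' ?_
    filter_upwards [hne] with m hm
    simp [matD]; field_simp; ring
  · refine (haux 0 (-(mu * k * l)) 0).congr' ?_
    filter_upwards [hne] with m hm
    simp [matD]; field_simp
  · have := (haux 0 (((lam + mu) * (k ^ 2 + l ^ 2) - mu * l ^ 2 : ℂ)) 0).const_add (lam + 2 * mu : ℂ)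
    rw [add_zero] at this
    refine this.congr' ?_
    filter_upwards [hne] with m hm
    have e := m21_sq (lam := lam) k l hmu hm
    simp [matD]; field_simp
    linear_combination -e
  · refine (haux (-(2 * mu * l)) 0 0).congr' ?_
    filter_upwards [hne] with m hm
    simp [matD]; field_simp
  · have := (haux 0 ((mu * k ^ 2 - (lam + mu) * (k ^ 2 + l ^ 2) : ℂ)) 0).const_add
      (-(lam + 2 * mu) : ℂ)
    rw [add_zero] at this
    refine this.congr' ?_
    filter_upwards [hne] with m hm
    have e := m21_sq (lam := lam) k l hmu hm
    simp [matD]; field_simp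
    linear_combination e
  · refine (haux 0 (mu * k * l) 0).congr' ?_
    filter_upwards [hne] with m hm
    simp [matD]; field_simp
  · refine (haux (2 * mu * k) 0 0).congr' ?_
    filter_upwards [hne] with m hm
    simp [matD]; field_simp

theorem det_limC_ne_zero (hmu : 0 < mu) : (limC mu).det ≠ 0 := by
  have h : (mu : ℂ) ≠ 0 := by exact_mod_cast hmu.ne'
  rw [limC, Matrix.det_fin_three]
  simpa using h

theorem det_limD_ne_zero (hmu : 0 < mu) (hlm : 0 < lam + mu) : (limD lam mu).det ≠ 0 := by
  have h : (lam : ℂ) + 2 * mu ≠ 0 := by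
    have : lam + 2 * mu ≠ 0 := by linarith
    exact_mod_cast this
  have e : (limD lam mu).det = ((lam : ℂ) + 2 * mu) ^ 3 := by
    rw [limD, Matrix.det_fin_three]
    simp only [Matrix.of_apply, Matrix.cons_val', Matrix.cons_val_zero, Matrix.cons_val_one,
      Matrix.cons_val]
    ring
  rw [e]
  exact pow_ne_zero 3 h

/-- By homogeneity of the determinant, `m⁻⁶ det M` tends to `det L ≠ 0`. -/
theorem eventually_det_ne_zero {M : ℂ → Matrix (Fin 3) (Fin 3) ℂ} {L : Matrix (Fin 3) (Fin 3) ℂ}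
    (hM : Tendsto (fun m : ℂ => (m ^ 2)⁻¹ • M m) (Bornology.cobounded ℂ) (𝓝 L)) (hL : L.det ≠ 0) :
    ∀ᶠ m in Bornology.cobounded ℂ, (M m).det ≠ 0 := by
  have hdet : Continuous fun A : Matrix (Fin 3) (Fin 3) ℂ => A.det := continuous_id.matrix_det
  have h1 := (hdet.tendsto L).comp hM
  filter_upwards [h1.eventually_ne hL] with m hm h0
  simp only [Function.comp_apply, Matrix.det_smul, h0, mul_zero, ne_eq, not_true_eq_false] at hm

/-- Both determinants are nonzero for large `|m|`, and the cuts are bounded, so everything to be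
avoided lies in one disc; a sufficiently high and wide bump passes above it. -/
theorem exists_isAdmissible (hmu : 0 < mu) (hlm : 0 < lam + mu) :
    ∃ h : ℝ → ℝ, IsAdmissible lam mu k l h := by
  have hC := eventually_det_ne_zero (tendsto_matC k l hmu hlm) (det_limC_ne_zero hmu)
  have hD := eventually_det_ne_zero (tendsto_matD k l hmu hlm) (det_limD_ne_zero hmu hlm)
  have hev := hC.and hD
  rw [← comap_norm_atTop, eventually_comap] at hev
  obtain ⟨R₀, hR₀⟩ := eventually_atTop.1 hev
  set c₁ : ℂ := ((√(k ^ 2 + l ^ 2) * √((lam + mu) / mu) : ℝ) : ℂ)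
  set c₂ : ℂ := I * (√(k ^ 2 + l ^ 2) * √((lam + mu) / (lam + 2 * mu)) : ℝ)
  set R : ℝ := |R₀| + ‖c₁‖ + ‖c₂‖ + 1 with hR
  have hR1 : 0 < R := by positivity
  have n1 := norm_nonneg c₁
  have n2 := norm_nonneg c₂
  have n3 := le_abs_self R₀
  have n4 := abs_nonneg R₀
  -- The bump equals `1` on `[-R, R]`. Multiplied by `R + 1` it is strictly higher than every point
  -- of the disc of radius `R`.
  let f : ContDiffBump (0 : ℝ) := ⟨R, R + 1, hR1, by linarith⟩
  have hbelow : ∀ m : ℂ, ‖m‖ ≤ R → Below (fun s => (R + 1) * f s) m := by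
    intro m hm
    have h1 : f m.re = 1 := by
      refine f.one_of_mem_closedBall ?_
      rw [mem_closedBall_zero_iff]
      exact (abs_re_le_norm m).trans hm
    have h2 := (im_le_norm m).trans hm
    simp only [Below, h1]
    linarith
  have hseg : ∀ c : ℂ, ‖c‖ ≤ R → ∀ m ∈ segment ℝ (-c) c, ‖m‖ ≤ R := by
    intro c hc m hm
    have hsub := (convex_closedBall (0 : ℂ) R).segment_subset (x := -c) (y := c)
      (by simpa using hc) (by simpa using hc)
    simpa using hsub hm
  refine ⟨fun s => (R + 1) * f s, ⟨⟨fun s => ?_, ?_, ?_, ⟨∅, finite_empty, fun s _ => ?_⟩, ?_⟩,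
    ?_, ?_, ?_, ?_⟩⟩
  · exact mul_nonneg (by linarith) f.nonneg
  · exact continuous_const.mul f.continuous
  · exact f.hasCompactSupport.mul_left
  · exact ((f.contDiff (n := 1)).differentiable (by norm_num) s).const_mul _
  · have hcd : ContDiff ℝ 1 fun s => (R + 1) * f s := contDiff_const.mul f.contDiff
    exact (hcd.continuous_deriv le_rfl).integrable_of_hasCompactSupport
      (f.hasCompactSupport.mul_left (f := fun _ => R + 1)).deriv
  · intro m hm
    refine hbelow m ?_
    by_contra! hlt
    exact (hR₀ ‖m‖ (by linarith) m rfl).1 hm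
  · intro m hm
    refine hbelow m ?_
    by_contra! hlt
    exact (hR₀ ‖m‖ (by linarith) m rfl).2 hm
  · exact fun m hm => hbelow m (hseg c₁ (by linarith) m hm)
  · exact fun m hm => hbelow m (hseg c₂ (by linarith) m hm)

end

/-! ### Inverse matrices above the contour -/

theorem inv_apply_eq (A : Matrix (Fin 3) (Fin 3) ℂ) (i j : Fin 3) :
    A⁻¹ i j = A.det⁻¹ * A.adjugate i j := by
  rw [Matrix.inv_def, Ring.inverse_eq_inv', Matrix.smul_apply, smul_eq_mul]

theorem continuousAt_inv_apply {L : Matrix (Fin 3) (Fin 3) ℂ} (hL : L.det ≠ 0) (i j : Fin 3) :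
    ContinuousAt (fun A : Matrix (Fin 3) (Fin 3) ℂ => A⁻¹ i j) L := by
  simp only [inv_apply_eq]
  have h1 : Continuous fun A : Matrix (Fin 3) (Fin 3) ℂ => A.det := continuous_id.matrix_det
  have h2 : Continuous fun A : Matrix (Fin 3) (Fin 3) ℂ => A.adjugate i j :=
    continuous_id.matrix_adjugate.matrix_elem i j
  exact (h1.continuousAt.inv₀ hL).mul h2.continuousAt

theorem differentiableAt_inv_apply {M : ℂ → Matrix (Fin 3) (Fin 3) ℂ} {m : ℂ}
    (hM : ∀ i j, DifferentiableAt ℂ (fun m => M m i j) m) (hdet : (M m).det ≠ 0) (i j : Fin 3) :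
    DifferentiableAt ℂ (fun m => (M m)⁻¹ i j) m := by
  simp only [inv_apply_eq]
  refine DifferentiableAt.mul (DifferentiableAt.inv ?_ hdet) ?_
  · simp only [Matrix.det_fin_three]
    fun_prop
  · simp only [Matrix.adjugate_fin_three]
    fin_cases i <;> fin_cases j <;> simp <;> fun_prop

/-- At infinity `m² M⁻¹` tends to `L⁻¹`; on the rest of the closed set, which is compact, the
inverse is continuous. The resulting bound `1 / (1 + |m|²)` supplies all the horizontal decay needed
for the contour integrals. -/
theorem exists_bound_inv {M : ℂ → Matrix (Fin 3) (Fin 3) ℂ} {L : Matrix (Fin 3) (Fin 3) ℂ}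
    (hlim : Tendsto (fun m : ℂ => (m ^ 2)⁻¹ • M m) (Bornology.cobounded ℂ) (𝓝 L)) (hL : L.det ≠ 0)
    {s : Set ℂ} (hs : IsClosed s)
    (hM : ∀ m ∈ s, ∀ i j, DifferentiableAt ℂ (fun m => M m i j) m)
    (hdet : ∀ m ∈ s, (M m).det ≠ 0) :
    ∃ B : ℝ, 0 ≤ B ∧ ∀ m ∈ s, ∀ i j, ‖(M m)⁻¹ i j‖ ≤ B / (1 + ‖m‖ ^ 2) := by
  have key : ∀ i j, ∃ B : ℝ, 0 ≤ B ∧ ∀ m ∈ s, ‖(M m)⁻¹ i j‖ ≤ B / (1 + ‖m‖ ^ 2) := by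
    intro i j
    have h1 : Tendsto (fun m : ℂ => m ^ 2 * (M m)⁻¹ i j) (Bornology.cobounded ℂ) (𝓝 (L⁻¹ i j)) := by
      refine ((continuousAt_inv_apply hL i j).tendsto.comp hlim).congr' ?_
      filter_upwards [Bornology.eventually_ne_cobounded (0 : ℂ)] with m hm
      have hm2 : m ^ 2 ≠ 0 := pow_ne_zero 2 hm
      simp only [Function.comp_apply]
      rw [inv_apply_eq, inv_apply_eq, Matrix.det_smul, Matrix.adjugate_smul, Matrix.smul_apply]
      simp only [Fintype.card_fin, smul_eq_mul, Nat.add_one_sub_one]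
      rw [mul_inv]
      field_simp
    have h2 := h1.norm.eventually_le_const (u := ‖L⁻¹ i j‖ + 1) (by linarith)
    rw [← comap_norm_atTop, eventually_comap] at h2
    obtain ⟨R, hR⟩ := eventually_atTop.1 h2
    have hcomp : IsCompact (s ∩ Metric.closedBall 0 (max R 1)) :=
      (isCompact_closedBall _ _).inter_left hs
    obtain ⟨B₁, hB₁⟩ := hcomp.exists_bound_of_continuousOn
      (f := fun m => (1 + ‖m‖ ^ 2 : ℝ) * (M m)⁻¹ i j) (by
        intro m hm
        refine ContinuousAt.continuousWithinAt ?_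
        have hc := (differentiableAt_inv_apply (hM m hm.1) (hdet m hm.1) i j).continuousAt
        exact ContinuousAt.mul (by fun_prop) hc)
    refine ⟨max B₁ (2 * (‖L⁻¹ i j‖ + 1)), by positivity, fun m hm => ?_⟩
    rw [le_div_iff₀ (by positivity)]
    by_cases hmR : ‖m‖ ≤ max R 1
    · have := hB₁ m ⟨hm, by simpa using hmR⟩
      rw [norm_mul, norm_real, Real.norm_of_nonneg (by positivity)] at this
      rw [mul_comm]
      exact this.trans (le_max_left _ _)
    · push Not at hmR
      have hR1 : R ≤ ‖m‖ := (le_max_left R 1).trans hmR.le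
      have h3 := hR ‖m‖ hR1 m rfl
      rw [norm_mul, norm_pow] at h3
      have hm1 : 1 ≤ ‖m‖ := (le_max_right R 1).trans hmR.le
      refine le_trans ?_ (le_max_right _ _)
      have h4 : 1 + ‖m‖ ^ 2 ≤ 2 * ‖m‖ ^ 2 := by nlinarith
      have h5 := norm_nonneg ((M m)⁻¹ i j)
      nlinarith
  choose B hB0 hB using key
  refine ⟨∑ i, ∑ j, B i j, Finset.sum_nonneg fun i _ => Finset.sum_nonneg fun j _ => hB0 i j,
    fun m hm i j => (hB i j m hm).trans ?_⟩
  gcongr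
  calc B i j ≤ ∑ j, B i j := Finset.single_le_sum (fun j _ => hB0 i j) (Finset.mem_univ j)
    _ ≤ ∑ i, ∑ j, B i j := Finset.single_le_sum (f := fun i => ∑ j, B i j)
        (fun i _ => Finset.sum_nonneg fun j _ => hB0 i j) (Finset.mem_univ i)

end HalfSpace

end


noncomputable section

namespace HalfSpace

open Filter Topology Set

/-! ### The contour integrals in terms of the boundary values -/

/-- The frequency may be replaced by the positive root of `c (k² + l² + m²)`. Dropping `k` and `l`
and rescaling costs the factor `(1 + c) / c`, so the bound is uniform in `(k, l)`. -/
theorem norm_timeTransform_le_of_sq {φ φ' : ℝ → ℂ} {t : ℝ} (ht : 0 ≤ t)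
    (hφ : ContinuousOn φ (Icc 0 t)) (hφ' : ContinuousOn φ' (Icc 0 t))
    (hd : ∀ s ∈ Ioo 0 t, HasDerivAt φ (φ' s) s) {M : ℝ} (hM : ∀ s ∈ Icc 0 t, ‖φ s‖ ≤ M)
    (hM' : ∀ s ∈ Icc 0 t, ‖φ' s‖ ≤ M) {c k l m : ℝ} (hc : 0 < c) (hm : m ≠ 0) {om : ℂ}
    (hom : om ^ 2 = c * (k ^ 2 + l ^ 2 + m ^ 2)) :
    ‖timeTransform om φ t‖ ≤ (t ^ 2 + t + 2) * M * ((1 + c) / c) / (1 + m ^ 2) := by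
  have hpos : 0 < c * (k ^ 2 + l ^ 2 + m ^ 2) := by positivity
  have hr : om ^ 2 = ((√(c * (k ^ 2 + l ^ 2 + m ^ 2)) : ℝ) : ℂ) ^ 2 := by
    rw [hom, ← ofReal_pow (√_), Real.sq_sqrt hpos.le]
    push_cast
    rfl
  have hM0 : 0 ≤ M := (norm_nonneg _).trans (hM 0 ⟨le_rfl, ht⟩)
  rw [timeTransform_eq_of_sq hr]
  refine (norm_timeTransform_le ht hφ hφ' hd hM hM' (Real.sqrt_pos.2 hpos).ne').trans ?_
  rw [Real.sq_sqrt hpos.le, mul_div_assoc ((t ^ 2 + t + 2) * M), div_eq_mul_one_div]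
  refine mul_le_mul_of_nonneg_left ?_ (by positivity)
  rw [div_div, div_le_div_iff₀ (by positivity) (by positivity)]
  have h1 : c * (1 + m ^ 2) ≤ (1 + c) * (1 + c * (k ^ 2 + l ^ 2 + m ^ 2)) := by
    have : 0 ≤ c * (k ^ 2 + l ^ 2) := by positivity
    have : 0 ≤ c * (c * (k ^ 2 + l ^ 2 + m ^ 2)) := by positivity
    nlinarith
  nlinarith

/-- The linear form in the transforms of the boundary values which occurs in the contour
integrals. -/
def form (k l : ℝ) (a b c : Fin 3 → ℂ) (m : ℂ) (X Y : Fin 3 → ℂ) : ℂ :=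
  ∑ i, (a i * X i + c i * Y i + b i * (m ^ 2 / (k ^ 2 + l ^ 2 + m ^ 2)) * (X i - Y i))

theorem form_sub (k l : ℝ) (a b c : Fin 3 → ℂ) (m : ℂ) (X Y X' Y' : Fin 3 → ℂ) :
    form k l a b c m (X - X') (Y - Y') = form k l a b c m X Y - form k l a b c m X' Y' := by
  simp only [form, Pi.sub_apply, ← Finset.sum_sub_distrib]
  refine Finset.sum_congr rfl fun i _ => ?_
  ring

theorem norm_form_le (k l : ℝ) (a b c : Fin 3 → ℂ) {m : ℂ} {X Y : Fin 3 → ℂ} {B ρ : ℝ}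
    (hX : ∀ i, ‖X i‖ ≤ B) (hY : ∀ i, ‖Y i‖ ≤ B)
    (hρ : ‖m ^ 2 / ((k : ℂ) ^ 2 + l ^ 2 + m ^ 2)‖ ≤ ρ) :
    ‖form k l a b c m X Y‖ ≤ (∑ i, (‖a i‖ + ‖c i‖ + 2 * ‖b i‖ * ρ)) * B := by
  rw [form, Finset.sum_mul]
  refine (norm_sum_le _ _).trans (Finset.sum_le_sum fun i _ => ?_)
  have hB : 0 ≤ B := (norm_nonneg _).trans (hX i)
  have hρ0 : 0 ≤ ρ := (norm_nonneg _).trans hρ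
  refine (norm_add₃_le).trans ?_
  rw [norm_mul, norm_mul, norm_mul, norm_mul]
  have h1 := mul_le_mul_of_nonneg_left (hX i) (norm_nonneg (a i))
  have h2 := mul_le_mul_of_nonneg_left (hY i) (norm_nonneg (c i))
  have h3 : ‖X i - Y i‖ ≤ B + B := (norm_sub_le _ _).trans (add_le_add (hX i) (hY i))
  have h4 : ‖b i‖ * ‖m ^ 2 / ((k : ℂ) ^ 2 + l ^ 2 + m ^ 2)‖ * ‖X i - Y i‖ ≤ ‖b i‖ * ρ * (B + B) := by
    gcongr
  linarith

theorem exists_bound_ratio {k l : ℝ} {s : Set ℂ} (hs : IsClosed s)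
    (h0 : ∀ m ∈ s, (k : ℂ) ^ 2 + l ^ 2 + m ^ 2 ≠ 0) :
    ∃ ρ : ℝ, ∀ m ∈ s, ‖m ^ 2 / ((k : ℂ) ^ 2 + l ^ 2 + m ^ 2)‖ ≤ ρ := by
  set R : ℝ := 1 + 2 * (k ^ 2 + l ^ 2) with hR
  have hR1 : 1 ≤ R := by nlinarith [sq_nonneg k, sq_nonneg l]
  have hcomp : IsCompact (s ∩ Metric.closedBall 0 R) := (isCompact_closedBall _ _).inter_left hs
  obtain ⟨B, hB⟩ := hcomp.exists_bound_of_continuousOn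
    (f := fun m => m ^ 2 / ((k : ℂ) ^ 2 + l ^ 2 + m ^ 2)) (by
      intro m hm
      refine ContinuousAt.continuousWithinAt ?_
      exact ContinuousAt.div (by fun_prop) (by fun_prop) (h0 m hm.1))
  refine ⟨max B 2, fun m hm => ?_⟩
  by_cases hmR : ‖m‖ ≤ R
  · exact (hB m ⟨hm, by simpa using hmR⟩).trans (le_max_left _ _)
  · push Not at hmR
    refine le_trans ?_ (le_max_right _ _)
    rw [norm_div, norm_pow]
    have h1 : ‖m‖ ^ 2 / 2 ≤ ‖(k : ℂ) ^ 2 + l ^ 2 + m ^ 2‖ := by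
      have h2 : ‖(k : ℂ) ^ 2 + l ^ 2‖ = k ^ 2 + l ^ 2 := by
        rw [← ofReal_pow, ← ofReal_pow, ← ofReal_add, norm_real, Real.norm_of_nonneg (by positivity)]
      have h3 := norm_sub_le ((k : ℂ) ^ 2 + l ^ 2 + m ^ 2) ((k : ℂ) ^ 2 + l ^ 2)
      rw [add_sub_cancel_left, norm_pow, h2] at h3
      nlinarith
    have h4 : 0 < ‖m‖ ^ 2 / 2 := by
      have : 0 < ‖m‖ := by linarith
      positivity
    rw [div_le_iff₀ (by linarith)]
    linarith

theorem IsAdmissible.differentiableAt_matC {lam mu k l : ℝ} {h : ℝ → ℝ}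
    (hA : IsAdmissible lam mu k l h) (hmu : 0 < mu) (hlm : 0 < lam + mu) {m : ℂ}
    (hm : m ∈ above h) (i j : Fin 3) : DifferentiableAt ℂ (fun m => matC lam mu k l m i j) m := by
  have := hA.differentiableAt_m12 hmu hlm hm
  fin_cases i <;> fin_cases j <;> simp [matC] <;> fun_prop

theorem IsAdmissible.differentiableAt_matD {lam mu k l : ℝ} {h : ℝ → ℝ}
    (hA : IsAdmissible lam mu k l h) (hmu : 0 < mu) (hlm : 0 < lam + mu) {m : ℂ}
    (hm : m ∈ above h) (i j : Fin 3) : DifferentiableAt ℂ (fun m => matD lam mu k l m i j) m := by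
  have := hA.differentiableAt_m21 hmu hlm hm
  fin_cases i <;> fin_cases j <;> simp [matD] <;> fun_prop

/-- The contour integral of a form in bounded holomorphic solutions of the linear systems with
matrices `D` and `C` vanishes. -/
theorem IsAdmissible.contourIntegral_form_eq_zero {lam mu k l : ℝ} {h : ℝ → ℝ}
    (hA : IsAdmissible lam mu k l h) (hmu : 0 < mu) (hlm : 0 < lam + mu) {p q : ℂ → Fin 3 → ℂ}
    (hp : ∀ j, ContinuousOn (fun m => p m j) (above h))
    (hq : ∀ j, ContinuousOn (fun m => q m j) (above h))
    (hpd : ∀ j, DifferentiableOn ℂ (fun m => p m j) (strictAbove h))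
    (hqd : ∀ j, DifferentiableOn ℂ (fun m => q m j) (strictAbove h)) {B : ℝ}
    (hpB : ∀ m ∈ above h, ∀ j, ‖p m j‖ ≤ B) (hqB : ∀ m ∈ above h, ∀ j, ‖q m j‖ ≤ B)
    (a b c : Fin 3 → ℂ) {z : ℝ} (hz : 0 < z) :
    Integrable (pullback h fun m => exp (I * m * z) *
      form k l a b c m (Matrix.mulVec (matD lam mu k l m)⁻¹ (p m))
        (Matrix.mulVec (matC lam mu k l m)⁻¹ (q m))) ∧
    contourIntegral h (fun m => exp (I * m * z) *
      form k l a b c m (Matrix.mulVec (matD lam mu k l m)⁻¹ (p m))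
        (Matrix.mulVec (matC lam mu k l m)⁻¹ (q m))) = 0 := by
  have hclosed := isClosed_above hA.deformation.continuous
  obtain ⟨BD, hBD0, hBD⟩ := exists_bound_inv (tendsto_matD k l hmu hlm) (det_limD_ne_zero hmu hlm)
    hclosed (fun m hm => hA.differentiableAt_matD hmu hlm hm) (fun m hm => hA.det_matD_ne_zero hm)
  obtain ⟨BC, hBC0, hBC⟩ := exists_bound_inv (tendsto_matC k l hmu hlm) (det_limC_ne_zero hmu)
    hclosed (fun m hm => hA.differentiableAt_matC hmu hlm hm) (fun m hm => hA.det_matC_ne_zero hm)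
  obtain ⟨ρ, hρ⟩ := exists_bound_ratio hclosed (fun m hm => hA.kernel_ne_zero hmu hm)
  have hDd : ∀ m ∈ above h, ∀ i j, DifferentiableAt ℂ (fun m => (matD lam mu k l m)⁻¹ i j) m :=
    fun m hm => differentiableAt_inv_apply (hA.differentiableAt_matD hmu hlm hm)
      (hA.det_matD_ne_zero hm)
  have hCd : ∀ m ∈ above h, ∀ i j, DifferentiableAt ℂ (fun m => (matC lam mu k l m)⁻¹ i j) m :=
    fun m hm => differentiableAt_inv_apply (hA.differentiableAt_matC hmu hlm hm)
      (hA.det_matC_ne_zero hm)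
  have hrat : ∀ m ∈ above h,
      DifferentiableAt ℂ (fun m : ℂ => m ^ 2 / ((k : ℂ) ^ 2 + l ^ 2 + m ^ 2)) m := fun m hm =>
    DifferentiableAt.div (by fun_prop) (by fun_prop) (hA.kernel_ne_zero hmu hm)
  have hmv : ∀ (M : Matrix (Fin 3) (Fin 3) ℂ) (v : Fin 3 → ℂ) (β E : ℝ), 0 ≤ β →
      (∀ i j, ‖M i j‖ ≤ β) → (∀ j, ‖v j‖ ≤ E) → ∀ i, ‖Matrix.mulVec M v i‖ ≤ 3 * (β * E) := by
    intro M v β E hβ h1 h2 i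
    rw [Matrix.mulVec, dotProduct]
    refine (norm_sum_le _ _).trans ?_
    have h3 : ∀ j ∈ Finset.univ, ‖M i j * v j‖ ≤ β * E := by
      intro j _
      rw [norm_mul]
      exact mul_le_mul (h1 i j) (h2 j) (norm_nonneg _) hβ
    refine (Finset.sum_le_sum h3).trans_eq ?_
    simp
  set A : ℝ := ∑ i, (‖a i‖ + ‖c i‖ + 2 * ‖b i‖ * ρ) with hAdef
  refine hA.deformation.contourIntegral_eq_zero
    (C := A * (3 * ((BD + BC) * B))) (z := z) ?_ ?_ hz ?_
  · refine ContinuousOn.mul (Continuous.continuousOn (by fun_prop)) ?_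
    simp only [form, Matrix.mulVec, dotProduct]
    have hratc : ContinuousOn (fun m : ℂ => m ^ 2 / ((k : ℂ) ^ 2 + l ^ 2 + m ^ 2)) (above h) :=
      fun m hm => (hrat m hm).continuousAt.continuousWithinAt
    have hDc : ∀ i j, ContinuousOn (fun m => (matD lam mu k l m)⁻¹ i j) (above h) :=
      fun i j m hm => (hDd m hm i j).continuousAt.continuousWithinAt
    have hCc : ∀ i j, ContinuousOn (fun m => (matC lam mu k l m)⁻¹ i j) (above h) :=
      fun i j m hm => (hCd m hm i j).continuousAt.continuousWithinAt
    have s1 : ∀ i, ContinuousOn (fun m => ∑ j, (matD lam mu k l m)⁻¹ i j * p m j) (above h) :=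
      fun i => continuousOn_finsetSum _ fun j _ => (hDc i j).mul (hp j)
    have s2 : ∀ i, ContinuousOn (fun m => ∑ j, (matC lam mu k l m)⁻¹ i j * q m j) (above h) :=
      fun i => continuousOn_finsetSum _ fun j _ => (hCc i j).mul (hq j)
    exact continuousOn_finsetSum _ fun i _ => ((continuousOn_const.mul (s1 i)).add
      (continuousOn_const.mul (s2 i))).add ((continuousOn_const.mul hratc).mul ((s1 i).sub (s2 i)))
  · refine DifferentiableOn.mul (Differentiable.differentiableOn (by fun_prop)) ?_
    simp only [form, Matrix.mulVec, dotProduct]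
    have hsub := strictAbove_subset h
    have hratc : DifferentiableOn ℂ (fun m : ℂ => m ^ 2 / ((k : ℂ) ^ 2 + l ^ 2 + m ^ 2))
        (strictAbove h) := fun m hm => (hrat m (hsub hm)).differentiableWithinAt
    have hDc : ∀ i j, DifferentiableOn ℂ (fun m => (matD lam mu k l m)⁻¹ i j) (strictAbove h) :=
      fun i j m hm => (hDd m (hsub hm) i j).differentiableWithinAt
    have hCc : ∀ i j, DifferentiableOn ℂ (fun m => (matC lam mu k l m)⁻¹ i j) (strictAbove h) :=
      fun i j m hm => (hCd m (hsub hm) i j).differentiableWithinAt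
    have s1 : ∀ i, DifferentiableOn ℂ (fun m => ∑ j, (matD lam mu k l m)⁻¹ i j * p m j)
        (strictAbove h) := fun i => DifferentiableOn.fun_sum fun j _ => (hDc i j).mul (hpd j)
    have s2 : ∀ i, DifferentiableOn ℂ (fun m => ∑ j, (matC lam mu k l m)⁻¹ i j * q m j)
        (strictAbove h) := fun i => DifferentiableOn.fun_sum fun j _ => (hCc i j).mul (hqd j)
    exact DifferentiableOn.fun_sum fun i _ => (((differentiableOn_const _).mul (s1 i)).add
      ((differentiableOn_const _).mul (s2 i))).add
      (((differentiableOn_const _).mul hratc).mul ((s1 i).sub (s2 i)))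
  · intro m hm
    have hB : 0 ≤ B := (norm_nonneg _).trans (hpB m hm 0)
    have hρ0 : 0 ≤ ρ := (norm_nonneg _).trans (hρ m hm)
    have hA0 : 0 ≤ A := Finset.sum_nonneg fun i _ => by positivity
    have hnorm : ‖exp (I * m * z)‖ = Real.exp (-z * m.im) := by
      rw [norm_exp]
      congr 1
      simp
      ring
    -- Boundedness of `p` and `q` suffices: the inverse matrices contribute `1 / (1 + |m|²)`, and
    -- the ratio `m² / (k² + l² + m²)` is bounded above the contour.
    have f1 := norm_form_le k l a b c (m := m)
      (X := Matrix.mulVec (matD lam mu k l m)⁻¹ (p m)) (Y := Matrix.mulVec (matC lam mu k l m)⁻¹ (q m))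
      (B := 3 * ((BD + BC) / (1 + ‖m‖ ^ 2) * B)) (ρ := ρ)
      (hmv _ _ _ _ (by positivity) (fun i j => (hBD m hm i j).trans (by gcongr; linarith)) (hpB m hm))
      (hmv _ _ _ _ (by positivity) (fun i j => (hBC m hm i j).trans (by gcongr; linarith)) (hqB m hm))
      (hρ m hm)
    rw [norm_mul, hnorm]
    have hre : m.re ^ 2 ≤ ‖m‖ ^ 2 := by
      rw [← sq_abs m.re]
      exact pow_le_pow_left₀ (abs_nonneg _) (abs_re_le_norm m) 2
    calc Real.exp (-z * m.im) * ‖form k l a b c m _ _‖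
        ≤ Real.exp (-z * m.im) * (A * (3 * ((BD + BC) / (1 + ‖m‖ ^ 2) * B))) := by gcongr
      _ = A * (3 * ((BD + BC) * B)) * Real.exp (-z * m.im) / (1 + ‖m‖ ^ 2) := by ring
      _ ≤ A * (3 * ((BD + BC) * B)) * Real.exp (-z * m.im) / (1 + m.re ^ 2) := by gcongr

/-- The form in the time transforms of functions `φᵢ` is integrable on the real axis, and its
contour integral is the integral along the real axis. -/
theorem IsDeformation.contourIntegral_form_timeTransform {lam mu k l : ℝ} {h : ℝ → ℝ}
    (hh : IsDeformation h) (h0 : ∀ s : ℝ, (s : ℂ) + I * h s ≠ 0 ∧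
      (k : ℂ) ^ 2 + l ^ 2 + ((s : ℂ) + I * h s) ^ 2 ≠ 0)
    (hmu : 0 < mu) (hlm : 0 < lam + mu) {φ φ' : Fin 3 → ℝ → ℂ} {t : ℝ}
    (ht : 0 ≤ t) (hφ : ∀ i, ContinuousOn (φ i) (Icc 0 t)) (hφ' : ∀ i, ContinuousOn (φ' i) (Icc 0 t))
    (hd : ∀ i, ∀ s ∈ Ioo 0 t, HasDerivAt (φ i) (φ' i s) s) (a b c : Fin 3 → ℂ) (z : ℝ) :
    Integrable (pullback h fun m => exp (I * m * z) * form k l a b c m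
      (fun i => timeTransform (omega1 lam mu k l m) (φ i) t)
      (fun i => timeTransform (omega2 mu k l m) (φ i) t)) ∧
    Integrable (fun s : ℝ => exp (I * s * z) * form k l a b c s
      (fun i => timeTransform (omega1 lam mu k l s) (φ i) t)
      (fun i => timeTransform (omega2 mu k l s) (φ i) t)) ∧
    contourIntegral h (fun m => exp (I * m * z) * form k l a b c m
      (fun i => timeTransform (omega1 lam mu k l m) (φ i) t)
      (fun i => timeTransform (omega2 mu k l m) (φ i) t))
    = ∫ s : ℝ, exp (I * s * z) * form k l a b c s
      (fun i => timeTransform (omega1 lam mu k l s) (φ i) t)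
      (fun i => timeTransform (omega2 mu k l s) (φ i) t) := by
  have h2 : 0 < lam + 2 * mu := by linarith
  have hc1 : ((lam : ℂ) + 2 * mu) ≠ 0 := by exact_mod_cast h2.ne'
  have hc2 : (mu : ℂ) ≠ 0 := by exact_mod_cast hmu.ne'
  choose g hg hgt using fun i => exists_entire_timeTransform ht (hφ i)
  -- As functions of `ζ = k² + l² + m²`, the transforms for `ω₁` and `ω₂` take the same value at `ζ
  -- = 0`. Their difference divided by `ζ` thus extends to an entire function, which removes the
  -- poles at `k² + l² + m² = 0`.
  set τ : Fin 3 → ℂ → ℂ := fun i =>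
    dslope (fun ζ => g i (((lam : ℂ) + 2 * mu) * ζ) - g i (mu * ζ)) 0 with hτ
  have hτd : ∀ i, Differentiable ℂ (τ i) := by
    intro i
    rw [← differentiableOn_univ]
    refine (differentiableOn_dslope univ_mem).2 (Differentiable.differentiableOn ?_)
    have := hg i
    fun_prop
  set F : ℂ → ℂ := fun m => exp (I * m * z) *
    ∑ i, (a i * g i (((lam : ℂ) + 2 * mu) * (k ^ 2 + l ^ 2 + m ^ 2))
      + c i * g i (mu * (k ^ 2 + l ^ 2 + m ^ 2))
      + b i * m ^ 2 * τ i (k ^ 2 + l ^ 2 + m ^ 2)) with hF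
  have hFd : Differentiable ℂ F := by
    have h3 : ∀ i, Differentiable ℂ fun m : ℂ =>
        g i (((lam : ℂ) + 2 * mu) * (k ^ 2 + l ^ 2 + m ^ 2)) := fun i => by
      have := hg i; fun_prop
    have h4 : ∀ i, Differentiable ℂ fun m : ℂ => g i (mu * (k ^ 2 + l ^ 2 + m ^ 2)) := fun i => by
      have := hg i; fun_prop
    have h5 : ∀ i, Differentiable ℂ fun m : ℂ => τ i (k ^ 2 + l ^ 2 + m ^ 2) := fun i => by
      have := hτd i; fun_prop
    refine Differentiable.mul (by fun_prop) (Differentiable.fun_sum fun i _ => ?_)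
    have h3' := h3 i
    have h4' := h4 i
    have h5' := h5 i
    fun_prop
  have heq : ∀ m : ℂ, m ≠ 0 → (k : ℂ) ^ 2 + l ^ 2 + m ^ 2 ≠ 0 →
      exp (I * m * z) * form k l a b c m (fun i => timeTransform (omega1 lam mu k l m) (φ i) t)
        (fun i => timeTransform (omega2 mu k l m) (φ i) t) = F m := by
    intro m hm hk
    have e1 := omega1_sq k l hmu hlm hm
    have e2 := omega2_sq k l hmu hm
    have n1 : omega1 lam mu k l m ≠ 0 := by
      intro h; rw [h] at e1
      exact mul_ne_zero hc1 hk (by rw [← e1]; simp)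
    have n2 : omega2 mu k l m ≠ 0 := by
      intro h; rw [h] at e2
      exact mul_ne_zero hc2 hk (by rw [← e2]; simp)
    simp only [hF, form]
    congr 1
    refine Finset.sum_congr rfl fun i _ => ?_
    have g1 := hgt i _ n1
    have g2 := hgt i _ n2
    rw [e1] at g1
    rw [e2] at g2
    have e3 : τ i (k ^ 2 + l ^ 2 + m ^ 2) = (timeTransform (omega1 lam mu k l m) (φ i) t
        - timeTransform (omega2 mu k l m) (φ i) t) / (k ^ 2 + l ^ 2 + m ^ 2) := by
      rw [hτ]
      simp only
      rw [dslope_of_ne _ hk, slope_def_field, g1, g2]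
      simp
    rw [e3, g1, g2]
    ring
  have hbound : ∀ i, ∃ B : ℝ, ∀ s : ℝ, s ≠ 0 →
      ‖timeTransform (omega1 lam mu k l s) (φ i) t‖ ≤ B / (1 + s ^ 2) ∧
      ‖timeTransform (omega2 mu k l s) (φ i) t‖ ≤ B / (1 + s ^ 2) := by
    intro i
    obtain ⟨M₁, hM₁⟩ := isCompact_Icc.exists_bound_of_continuousOn (hφ i)
    obtain ⟨M₂, hM₂⟩ := isCompact_Icc.exists_bound_of_continuousOn (hφ' i)
    set M := max M₁ M₂
    have b1 : ∀ s ∈ Icc 0 t, ‖φ i s‖ ≤ M := fun s hs => (hM₁ s hs).trans (le_max_left _ _)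
    have b2 : ∀ s ∈ Icc 0 t, ‖φ' i s‖ ≤ M := fun s hs => (hM₂ s hs).trans (le_max_right _ _)
    refine ⟨max ((t ^ 2 + t + 2) * M * ((1 + (lam + 2 * mu)) / (lam + 2 * mu)))
      ((t ^ 2 + t + 2) * M * ((1 + mu) / mu)), fun s hs => ⟨?_, ?_⟩⟩
    · refine (norm_timeTransform_le_of_sq ht (hφ i) (hφ' i) (hd i) b1 b2 h2 hs
        (k := k) (l := l) ?_).trans ?_
      · rw [omega1_sq k l hmu hlm (ofReal_ne_zero.2 hs)]
        push_cast
        ring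
      · gcongr
        exact le_max_left _ _
    · refine (norm_timeTransform_le_of_sq ht (hφ i) (hφ' i) (hd i) b1 b2 hmu hs
        (k := k) (l := l) ?_).trans ?_
      · rw [omega2_sq k l hmu (ofReal_ne_zero.2 hs)]
      · gcongr
        exact le_max_right _ _
  have hne : ∀ s : ℝ, s ≠ 0 → (k : ℂ) ^ 2 + l ^ 2 + (s : ℂ) ^ 2 ≠ 0 := by
    intro s hs
    have : k ^ 2 + l ^ 2 + s ^ 2 ≠ 0 := by positivity
    exact_mod_cast this
  -- At `m = 0` the definition of `root` returns `0` by the convention on division, so agreement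
  -- with the entire function `F` may fail there.
  have hae : ∀ᵐ s : ℝ, s ≠ 0 := by
    simp [ae_iff, measure_singleton]
  have haeeq : (fun s : ℝ => F s) =ᵐ[volume] fun s : ℝ => exp (I * s * z) * form k l a b c s
      (fun i => timeTransform (omega1 lam mu k l s) (φ i) t)
      (fun i => timeTransform (omega2 mu k l s) (φ i) t) := by
    filter_upwards [hae] with s hs
    exact (heq s (ofReal_ne_zero.2 hs) (hne s hs)).symm
  have hFint : Integrable fun s : ℝ => F s := by
    choose B hB using hbound
    have hB0 : ∀ i, 0 ≤ B i := fun i => by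
      have := (norm_nonneg _).trans (hB i 1 one_ne_zero).1
      by_contra! hneg
      exact absurd (div_neg_of_neg_of_pos hneg (by positivity)) (not_lt.2 this)
    refine Integrable.mono' (g := fun s : ℝ => ((∑ i, (‖a i‖ + ‖c i‖ + 2 * ‖b i‖ * 1)) * ∑ i, B i)
      * (1 + s ^ 2)⁻¹) (integrable_inv_one_add_sq.const_mul _)
      (hFd.continuous.comp continuous_ofReal).aestronglyMeasurable ?_
    filter_upwards [hae] with s hs
    rw [← heq s (ofReal_ne_zero.2 hs) (hne s hs), norm_mul]
    have e1 : ‖exp (I * s * z)‖ = 1 := by rw [norm_exp]; simp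
    have hle : ∀ i, B i / (1 + s ^ 2) ≤ (∑ i, B i) / (1 + s ^ 2) := by
      intro i
      gcongr
      exact Finset.single_le_sum (fun j _ => hB0 j) (Finset.mem_univ i)
    rw [e1, one_mul]
    refine (norm_form_le k l a b c (B := (∑ i, B i) / (1 + s ^ 2)) (ρ := 1)
      (fun i => ((hB i s hs).1).trans (hle i))
      (fun i => ((hB i s hs).2).trans (hle i)) ?_).trans_eq (by ring)
    rw [norm_div]
    refine div_le_one_of_le₀ ?_ (norm_nonneg _)
    have e2 : (k : ℂ) ^ 2 + l ^ 2 + (s : ℂ) ^ 2 = ((k ^ 2 + l ^ 2 + s ^ 2 : ℝ) : ℂ) := by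
      push_cast; rfl
    rw [e2, ← ofReal_pow, norm_real, norm_real, Real.norm_of_nonneg (by positivity),
      Real.norm_of_nonneg (by positivity)]
    nlinarith [sq_nonneg k, sq_nonneg l]
  obtain ⟨r1, r2⟩ := hh.contourIntegral_of_differentiable hFd hFint
  have hpb : (pullback h fun m => exp (I * m * z) * form k l a b c m
      (fun i => timeTransform (omega1 lam mu k l m) (φ i) t)
      (fun i => timeTransform (omega2 mu k l m) (φ i) t)) = pullback h F := by
    ext s
    simp only [pullback]
    rw [heq _ (h0 s).1 (h0 s).2]
  refine ⟨by rw [hpb]; exact r1, hFint.congr haeeq, ?_⟩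
  rw [contourIntegral, hpb, ← integral_congr_ae haeeq]
  exact r2

end HalfSpace

end


noncomputable section

namespace HalfSpace

open Filter Topology Set

/-! ### Functions on the half-line and their transforms -/

/-- The weight that controls the decay of functions on the half-line. -/
def weight (z : ℝ) : ℝ := (1 + |z|) ^ (-(4 / 3) : ℝ)

theorem weight_pos (z : ℝ) : 0 < weight z := Real.rpow_pos_of_pos (by positivity) _

theorem weight_le_one (z : ℝ) : weight z ≤ 1 :=
  Real.rpow_le_one_of_one_le_of_nonpos (by linarith [abs_nonneg z]) (by norm_num)

/-- The exponent `4/3` exceeds `1`, and a product of three weights matches decay of order `4` in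
three variables. -/
theorem integrable_weight : Integrable weight := by
  have := integrable_one_add_norm (E := ℝ) (μ := volume) (r := 4 / 3) (by norm_num)
  simp only [Real.norm_eq_abs] at this
  exact this

theorem tendsto_weight : Tendsto weight atTop (𝓝 0) := by
  have h1 : Tendsto (fun z : ℝ => 1 + |z|) atTop atTop :=
    tendsto_atTop_add_const_left _ _ tendsto_abs_atTop_atTop
  exact (tendsto_rpow_neg_atTop (by norm_num)).comp h1

/-- A complex function `f` of `(z, t)`, `z, t ≥ 0`, with its derivatives, which are continuous up to
the boundary and decay as `z → ∞`. -/
structure HalfLineFunction where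
  f : ℝ → ℝ → ℂ
  fz : ℝ → ℝ → ℂ
  fzz : ℝ → ℝ → ℂ
  ft : ℝ → ℝ → ℂ
  ftt : ℝ → ℝ → ℂ
  bound : ∀ T : ℝ, ∃ A : ℝ, ∀ z t : ℝ, 0 ≤ z → 0 ≤ t → t ≤ T →
    ‖f z t‖ ≤ A * weight z ∧ ‖fz z t‖ ≤ A * weight z ∧ ‖fzz z t‖ ≤ A * weight z ∧
    ‖ft z t‖ ≤ A * weight z ∧ ‖ftt z t‖ ≤ A * weight z
  cont_z : ∀ t, 0 ≤ t → ContinuousOn (fun z => f z t) (Ici 0)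
  cont_z_fz : ∀ t, 0 ≤ t → ContinuousOn (fun z => fz z t) (Ici 0)
  cont_z_fzz : ∀ t, 0 ≤ t → ContinuousOn (fun z => fzz z t) (Ici 0)
  cont_z_ft : ∀ t, 0 ≤ t → ContinuousOn (fun z => ft z t) (Ici 0)
  cont_z_ftt : ∀ t, 0 ≤ t → ContinuousOn (fun z => ftt z t) (Ici 0)
  cont_t : ∀ z, 0 ≤ z → ContinuousOn (fun t => f z t) (Ici 0)
  cont_t_fz : ∀ z, 0 ≤ z → ContinuousOn (fun t => fz z t) (Ici 0)
  cont_t_ft : ∀ z, 0 ≤ z → ContinuousOn (fun t => ft z t) (Ici 0)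
  deriv_z : ∀ z t, 0 < z → 0 ≤ t → HasDerivAt (fun z => f z t) (fz z t) z
  deriv_z_fz : ∀ z t, 0 < z → 0 ≤ t → HasDerivAt (fun z => fz z t) (fzz z t) z
  deriv_t : ∀ z t, 0 ≤ z → 0 < t → HasDerivAt (fun t => f z t) (ft z t) t
  deriv_t_ft : ∀ z t, 0 ≤ z → 0 < t → HasDerivAt (fun t => ft z t) (ftt z t) t

/-- The transform `∫₀^∞ e^{-imz} f(z) dz`. -/
def lap (f : ℝ → ℂ) (m : ℂ) : ℂ := ∫ z in Ioi (0 : ℝ), exp (-(I * m * z)) * f z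

theorem norm_exp_lap {m : ℂ} (hm : m.im ≤ 0) {z : ℝ} (hz : 0 ≤ z) :
    ‖exp (-(I * m * z))‖ ≤ 1 := by
  rw [norm_exp, Real.exp_le_one_iff]
  simp
  exact mul_nonpos_of_nonpos_of_nonneg hm hz

section lap

variable {f f' : ℝ → ℂ} {A : ℝ}

theorem integrableOn_lap (hc : ContinuousOn f (Ici 0)) (hb : ∀ z, 0 ≤ z → ‖f z‖ ≤ A * weight z)
    {m : ℂ} (hm : m.im ≤ 0) : IntegrableOn (fun z : ℝ => exp (-(I * m * z)) * f z) (Ioi 0) := by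
  refine Integrable.mono' ((integrable_weight.const_mul A).integrableOn) ?_ ?_
  · refine ContinuousOn.aestronglyMeasurable ?_ measurableSet_Ioi
    exact (Continuous.continuousOn (by fun_prop)).mul (hc.mono Ioi_subset_Ici_self)
  · rw [ae_restrict_iff' measurableSet_Ioi]
    refine Eventually.of_forall fun z hz => ?_
    rw [norm_mul]
    exact (mul_le_of_le_one_left (norm_nonneg _) (norm_exp_lap hm (le_of_lt hz))).trans
      (hb z (le_of_lt hz))

theorem norm_lap_le (hb : ∀ z, 0 ≤ z → ‖f z‖ ≤ A * weight z) {m : ℂ} (hm : m.im ≤ 0) :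
    ‖lap f m‖ ≤ A * ∫ z in Ioi (0 : ℝ), weight z := by
  rw [← integral_const_mul]
  refine norm_integral_le_of_norm_le ((integrable_weight.const_mul A).integrableOn) ?_
  rw [ae_restrict_iff' measurableSet_Ioi]
  refine Eventually.of_forall fun z hz => ?_
  rw [norm_mul]
  exact (mul_le_of_le_one_left (norm_nonneg _) (norm_exp_lap hm (le_of_lt hz))).trans
    (hb z (le_of_lt hz))

theorem continuousOn_lap (hc : ContinuousOn f (Ici 0)) (hb : ∀ z, 0 ≤ z → ‖f z‖ ≤ A * weight z) :
    ContinuousOn (lap f) {m | m.im ≤ 0} := by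
  refine continuousOn_of_dominated (bound := fun z => A * weight z)
    (fun m hm => (integrableOn_lap hc hb hm).aestronglyMeasurable) (fun m hm => ?_)
    ((integrable_weight.const_mul A).integrableOn) ?_
  · rw [ae_restrict_iff' measurableSet_Ioi]
    refine Eventually.of_forall fun z hz => ?_
    rw [norm_mul]
    exact (mul_le_of_le_one_left (norm_nonneg _) (norm_exp_lap hm (le_of_lt hz))).trans
      (hb z (le_of_lt hz))
  · exact Eventually.of_forall fun z => Continuous.continuousOn (by fun_prop)

theorem differentiableOn_lap (hc : ContinuousOn f (Ici 0))
    (hb : ∀ z, 0 ≤ z → ‖f z‖ ≤ A * weight z) : DifferentiableOn ℂ (lap f) {m | m.im < 0} := by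
  intro m₀ hm₀
  have hopen : IsOpen {m : ℂ | m.im < 0} := isOpen_lt continuous_im continuous_const
  refine DifferentiableAt.differentiableWithinAt ?_
  refine (hasDerivAt_integral_of_holomorphic (μ := volume.restrict (Ioi (0 : ℝ)))
    (F := fun m z => exp (-(I * m * z)) * f z) hopen
    (fun m hm => (integrableOn_lap hc hb (le_of_lt hm)).aestronglyMeasurable) ?_ hm₀
    (bound := fun z => A * weight z) ((integrable_weight.const_mul A).integrableOn)
    (hopen.mem_nhds hm₀) ?_).differentiableAt
  · refine Eventually.of_forall fun z => Differentiable.differentiableOn (by fun_prop)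
  · rw [ae_restrict_iff' measurableSet_Ioi]
    refine Eventually.of_forall fun z hz m hm => ?_
    rw [norm_mul]
    exact (mul_le_of_le_one_left (norm_nonneg _) (norm_exp_lap (le_of_lt hm) (le_of_lt hz))).trans
      (hb z (le_of_lt hz))

theorem lap_deriv (hc : ContinuousOn f (Ici 0)) (hb : ∀ z, 0 ≤ z → ‖f z‖ ≤ A * weight z)
    (hc' : ContinuousOn f' (Ici 0)) (hb' : ∀ z, 0 ≤ z → ‖f' z‖ ≤ A * weight z)
    (hd : ∀ z, 0 < z → HasDerivAt f (f' z) z) {m : ℂ} (hm : m.im ≤ 0) :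
    lap f' m = -f 0 + I * m * lap f m := by
  have key := integral_Ioi_of_hasDerivAt_of_tendsto (a := (0 : ℝ)) (m := (0 : ℂ))
    (f := fun z : ℝ => exp (-(I * m * z)) * f z)
    (f' := fun z : ℝ => exp (-(I * m * z)) * f' z - I * m * (exp (-(I * m * z)) * f z)) ?_ ?_ ?_ ?_
  · rw [integral_sub (integrableOn_lap hc' hb' hm) ((integrableOn_lap hc hb hm).const_mul _),
      integral_const_mul] at key
    simp only [ofReal_zero, mul_zero, neg_zero, exp_zero, one_mul, zero_sub] at key
    rw [lap, lap]
    linear_combination key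
  · exact ((Continuous.continuousOn (by fun_prop)).mul hc) 0 (by simp)
  · intro z hz
    have h1 : HasDerivAt (fun z : ℝ => -(I * m * z)) (-(I * m)) z := by
      have := ((hasDerivAt_id z).ofReal_comp.const_mul (I * m)).fun_neg
      simpa using this
    refine (((hasDerivAt_exp _).comp z h1).mul (hd z hz)).congr_deriv ?_
    simp only [Function.comp_apply]
    ring
  · exact (integrableOn_lap hc' hb' hm).sub ((integrableOn_lap hc hb hm).const_mul _)
  · refine squeeze_zero_norm' (a := fun z => A * weight z) ?_ ?_
    · filter_upwards [eventually_ge_atTop 0] with z hz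
      rw [norm_mul]
      exact (mul_le_of_le_one_left (norm_nonneg _) (norm_exp_lap hm hz)).trans (hb z hz)
    · simpa using tendsto_weight.const_mul A

theorem lap_eq_sum {n : ℕ} {g : Fin n → ℝ → ℂ} {c : Fin n → ℂ} {m : ℂ}
    (hg : ∀ i, IntegrableOn (fun z : ℝ => exp (-(I * m * z)) * g i z) (Ioi 0))
    (hf : ∀ z, 0 < z → f z = ∑ i, c i * g i z) : lap f m = ∑ i, c i * lap (g i) m := by
  rw [lap]
  have h1 : ∫ z in Ioi (0 : ℝ), exp (-(I * m * z)) * f z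
      = ∫ z in Ioi (0 : ℝ), ∑ i, c i * (exp (-(I * m * z)) * g i z) := by
    refine setIntegral_congr_fun measurableSet_Ioi fun z hz => ?_
    simp only [hf z hz, Finset.mul_sum]
    refine Finset.sum_congr rfl fun i _ => ?_
    ring
  rw [h1, integral_finsetSum _ fun i _ => (hg i).const_mul _]
  refine Finset.sum_congr rfl fun i _ => ?_
  rw [integral_const_mul]
  rfl

/-- Fourier inversion for the even extension of a function on the half-line. -/
theorem even_inversion (hc : ContinuousOn f (Ici 0)) (hb : ∀ z, 0 ≤ z → ‖f z‖ ≤ A * weight z)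
    {f'' : ℝ → ℂ} (hc' : ContinuousOn f' (Ici 0)) (hb' : ∀ z, 0 ≤ z → ‖f' z‖ ≤ A * weight z)
    (hc'' : ContinuousOn f'' (Ici 0)) (hb'' : ∀ z, 0 ≤ z → ‖f'' z‖ ≤ A * weight z)
    (hd : ∀ z, 0 < z → HasDerivAt f (f' z) z) (hd' : ∀ z, 0 < z → HasDerivAt f' (f'' z) z)
    {z : ℝ} (hz : 0 ≤ z) :
    Integrable (fun m : ℝ => exp (I * m * z) * (lap f m + lap f (-m))) ∧
    ∫ m : ℝ, exp (I * m * z) * (lap f m + lap f (-m)) = 2 * Real.pi * f z := by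
  have hcont : Continuous fun x : ℝ => f |x| := hc.comp_continuous continuous_abs fun x => abs_nonneg x
  have hInt : Integrable fun x : ℝ => f |x| := by
    refine (integrable_weight.const_mul A).mono' hcont.aestronglyMeasurable
      (Eventually.of_forall fun x => ?_)
    have := hb |x| (abs_nonneg x)
    simpa [weight] using this
  have hexp : ∀ m : ℝ, Integrable fun x : ℝ => exp (-(I * m * x)) * f |x| := by
    intro m
    refine hInt.bdd_mul (c := 1) (Continuous.aestronglyMeasurable (by fun_prop))
      (Eventually.of_forall fun x => ?_)
    rw [norm_exp]; simp
  -- The two half-lines of the even extension contribute the half-line transforms at `m` and at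
  -- `-m`.
  have hFT : ∀ m : ℝ, ∫ x : ℝ, exp (-(I * m * x)) * f |x| = lap f m + lap f (-m) := by
    intro m
    rw [← intervalIntegral.integral_Iic_add_Ioi (b := 0) (hexp m).integrableOn (hexp m).integrableOn,
      add_comm]
    congr 1
    · refine setIntegral_congr_fun measurableSet_Ioi fun x hx => ?_
      simp only [abs_of_pos (mem_Ioi.1 hx)]
    · have := integral_comp_neg_Ioi (0 : ℝ) fun x : ℝ => exp (-(I * m * x)) * f |x|
      rw [neg_zero] at this
      rw [← this]
      refine setIntegral_congr_fun measurableSet_Ioi fun x hx => ?_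
      simp only [abs_neg, abs_of_pos (mem_Ioi.1 hx)]
      push_cast
      ring_nf
  have him : ∀ m : ℝ, (m : ℂ).im ≤ 0 := fun m => by simp
  have him' : ∀ m : ℝ, (-m : ℂ).im ≤ 0 := fun m => by simp
  have hcl : Continuous fun m : ℝ => lap f m + lap f (-m) := by
    have h1 := continuousOn_lap hc hb
    exact (h1.comp_continuous continuous_ofReal him).add
      (h1.comp_continuous continuous_ofReal.neg him')
  set W : ℝ := ∫ z in Ioi (0 : ℝ), weight z
  have hA : 0 ≤ A := nonneg_of_mul_nonneg_left ((norm_nonneg _).trans (hb 0 le_rfl)) (weight_pos 0)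
  have hW : 0 ≤ W := setIntegral_nonneg measurableSet_Ioi fun z _ => (weight_pos z).le
  have hli : Integrable fun m : ℝ => lap f m + lap f (-m) := by
    refine Integrable.mono' (g := fun m : ℝ => (4 * A * W + 2 * A) * (1 + m ^ 2)⁻¹)
      (integrable_inv_one_add_sq.const_mul _) hcl.aestronglyMeasurable
      (Eventually.of_forall fun m => ?_)
    -- The boundary value `f 0` carries a factor odd in `m` and cancels, because the even extension
    -- has no jump. Only the corner term `f' 0` is left, so the transform decays quadratically.
    have e1 : (m : ℂ) ^ 2 * (lap f m + lap f (-m)) = -(2 * f' 0 + (lap f'' m + lap f'' (-m))) := by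
      have a1 := lap_deriv hc hb hc' hb' hd (him m)
      have a2 := lap_deriv hc hb hc' hb' hd (him' m)
      have a3 := lap_deriv hc' hb' hc'' hb'' hd' (him m)
      have a4 := lap_deriv hc' hb' hc'' hb'' hd' (him' m)
      rw [a3, a4, a1, a2]
      linear_combination ((m : ℂ) ^ 2 * (lap f m + lap f (-m))) * I_sq
    have b1 : ‖lap f m + lap f (-m)‖ ≤ 2 * (A * W) :=
      (norm_add_le _ _).trans (by linarith [norm_lap_le hb (him m), norm_lap_le hb (him' m)])
    have b2 : m ^ 2 * ‖lap f m + lap f (-m)‖ ≤ 2 * A + 2 * (A * W) := by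
      have : m ^ 2 * ‖lap f m + lap f (-m)‖ = ‖(m : ℂ) ^ 2 * (lap f m + lap f (-m))‖ := by
        rw [norm_mul, norm_pow, norm_real, Real.norm_eq_abs, sq_abs]
      rw [this, e1, norm_neg]
      refine (norm_add_le _ _).trans ?_
      have c1 : ‖2 * f' 0‖ ≤ 2 * A := by
        rw [norm_mul]
        have := hb' 0 le_rfl
        have h1 : A * weight 0 ≤ A := mul_le_of_le_one_right hA (weight_le_one 0)
        simp only [Complex.norm_ofNat]
        linarith
      have c2 := norm_add_le (lap f'' m) (lap f'' (-m))
      linarith [norm_lap_le hb'' (him m), norm_lap_le hb'' (him' m)]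
    rw [← div_eq_mul_inv, le_div_iff₀ (by positivity)]
    nlinarith
  refine ⟨?_, ?_⟩
  · refine hli.bdd_mul (c := 1) (Continuous.aestronglyMeasurable (by fun_prop))
      (Eventually.of_forall fun x => ?_)
    rw [norm_exp]; simp
  · have := fourier_inversion_line hcont hInt (by simpa only [hFT] using hli) z
    simpa only [hFT, abs_of_nonneg hz] using this

end lap

namespace HalfLineFunction

variable (U : HalfLineFunction)

theorem exists_bound (t : ℝ) (ht : 0 ≤ t) : ∃ A : ℝ, ∀ z, 0 ≤ z →
    ‖U.f z t‖ ≤ A * weight z ∧ ‖U.fz z t‖ ≤ A * weight z ∧ ‖U.fzz z t‖ ≤ A * weight z ∧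
    ‖U.ft z t‖ ≤ A * weight z ∧ ‖U.ftt z t‖ ≤ A * weight z := by
  obtain ⟨A, hA⟩ := U.bound t
  exact ⟨A, fun z hz => hA z t hz ht le_rfl⟩

theorem lap_fz {t : ℝ} (ht : 0 ≤ t) {m : ℂ} (hm : m.im ≤ 0) :
    lap (fun z => U.fz z t) m = -U.f 0 t + I * m * lap (fun z => U.f z t) m := by
  obtain ⟨A, hA⟩ := U.exists_bound t ht
  exact lap_deriv (U.cont_z t ht) (fun z hz => (hA z hz).1) (U.cont_z_fz t ht)
    (fun z hz => (hA z hz).2.1) (fun z hz => U.deriv_z z t hz ht) hm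

theorem lap_fzz {t : ℝ} (ht : 0 ≤ t) {m : ℂ} (hm : m.im ≤ 0) :
    lap (fun z => U.fzz z t) m = -U.fz 0 t + I * m * lap (fun z => U.fz z t) m := by
  obtain ⟨A, hA⟩ := U.exists_bound t ht
  exact lap_deriv (U.cont_z_fz t ht) (fun z hz => (hA z hz).2.1) (U.cont_z_fzz t ht)
    (fun z hz => (hA z hz).2.2.1) (fun z hz => U.deriv_z_fz z t hz ht) hm

theorem integrable_f {t : ℝ} (ht : 0 ≤ t) {m : ℂ} (hm : m.im ≤ 0) :
    IntegrableOn (fun z : ℝ => exp (-(I * m * z)) * U.f z t) (Ioi 0) := by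
  obtain ⟨A, hA⟩ := U.exists_bound t ht
  exact integrableOn_lap (U.cont_z t ht) (fun z hz => (hA z hz).1) hm

theorem integrable_fz {t : ℝ} (ht : 0 ≤ t) {m : ℂ} (hm : m.im ≤ 0) :
    IntegrableOn (fun z : ℝ => exp (-(I * m * z)) * U.fz z t) (Ioi 0) := by
  obtain ⟨A, hA⟩ := U.exists_bound t ht
  exact integrableOn_lap (U.cont_z_fz t ht) (fun z hz => (hA z hz).2.1) hm

theorem integrable_fzz {t : ℝ} (ht : 0 ≤ t) {m : ℂ} (hm : m.im ≤ 0) :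
    IntegrableOn (fun z : ℝ => exp (-(I * m * z)) * U.fzz z t) (Ioi 0) := by
  obtain ⟨A, hA⟩ := U.exists_bound t ht
  exact integrableOn_lap (U.cont_z_fzz t ht) (fun z hz => (hA z hz).2.2.1) hm

theorem integrable_ft {t : ℝ} (ht : 0 ≤ t) {m : ℂ} (hm : m.im ≤ 0) :
    IntegrableOn (fun z : ℝ => exp (-(I * m * z)) * U.ft z t) (Ioi 0) := by
  obtain ⟨A, hA⟩ := U.exists_bound t ht
  exact integrableOn_lap (U.cont_z_ft t ht) (fun z hz => (hA z hz).2.2.2.1) hm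

theorem integrable_ftt {t : ℝ} (ht : 0 ≤ t) {m : ℂ} (hm : m.im ≤ 0) :
    IntegrableOn (fun z : ℝ => exp (-(I * m * z)) * U.ftt z t) (Ioi 0) := by
  obtain ⟨A, hA⟩ := U.exists_bound t ht
  exact integrableOn_lap (U.cont_z_ftt t ht) (fun z hz => (hA z hz).2.2.2.2) hm

theorem continuousOn_lap_time {g : ℝ → ℝ → ℂ}
    (hg : ∀ z, 0 ≤ z → ContinuousOn (fun t => g z t) (Ici 0))
    (hb : ∀ T : ℝ, ∃ A : ℝ, ∀ z t : ℝ, 0 ≤ z → 0 ≤ t → t ≤ T → ‖g z t‖ ≤ A * weight z) {m : ℂ}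
    (hm : m.im ≤ 0) (hInt : ∀ t, 0 ≤ t →
      IntegrableOn (fun z : ℝ => exp (-(I * m * z)) * g z t) (Ioi 0)) (T : ℝ) :
    ContinuousOn (fun t => lap (fun z => g z t) m) (Icc 0 T) := by
  obtain ⟨A, hA⟩ := hb T
  refine continuousOn_of_dominated (bound := fun z => A * weight z)
    (fun t ht => (hInt t ht.1).aestronglyMeasurable) (fun t ht => ?_)
    ((integrable_weight.const_mul A).integrableOn) ?_
  · rw [ae_restrict_iff' measurableSet_Ioi]
    refine Eventually.of_forall fun z hz => ?_
    rw [norm_mul]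
    exact (mul_le_of_le_one_left (norm_nonneg _) (norm_exp_lap hm (le_of_lt hz))).trans
      (hA z t (le_of_lt hz) ht.1 ht.2)
  · rw [ae_restrict_iff' measurableSet_Ioi]
    refine Eventually.of_forall fun z hz => ?_
    exact continuousOn_const.mul ((hg z (le_of_lt hz)).mono Icc_subset_Ici_self)

theorem hasDerivAt_lap_time {g g' : ℝ → ℝ → ℂ}
    (hd : ∀ z t, 0 ≤ z → 0 < t → HasDerivAt (fun t => g z t) (g' z t) t)
    (hb : ∀ T : ℝ, ∃ A : ℝ, ∀ z t : ℝ, 0 ≤ z → 0 ≤ t → t ≤ T → ‖g' z t‖ ≤ A * weight z) {m : ℂ}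
    (hm : m.im ≤ 0)
    (hInt : ∀ t, 0 ≤ t → IntegrableOn (fun z : ℝ => exp (-(I * m * z)) * g z t) (Ioi 0))
    (hInt' : ∀ t, 0 ≤ t → IntegrableOn (fun z : ℝ => exp (-(I * m * z)) * g' z t) (Ioi 0))
    {t : ℝ} (ht : 0 < t) :
    HasDerivAt (fun t => lap (fun z => g z t) m) (lap (fun z => g' z t) m) t := by
  obtain ⟨A, hA⟩ := hb (t + 1)
  refine (hasDerivAt_integral_of_dominated_loc_of_deriv_le (s := Ioo 0 (t + 1))
    (F := fun t z => exp (-(I * m * z)) * g z t) (F' := fun t z => exp (-(I * m * z)) * g' z t)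
    (bound := fun z => A * weight z) (Ioo_mem_nhds ht (by linarith)) ?_
    (hInt t ht.le) (hInt' t ht.le).aestronglyMeasurable ?_
    ((integrable_weight.const_mul A).integrableOn) ?_).2
  · filter_upwards [Ioi_mem_nhds ht] with s hs using (hInt s (le_of_lt hs)).aestronglyMeasurable
  · rw [ae_restrict_iff' measurableSet_Ioi]
    refine Eventually.of_forall fun z hz s hs => ?_
    rw [norm_mul]
    exact (mul_le_of_le_one_left (norm_nonneg _) (norm_exp_lap hm (le_of_lt hz))).trans
      (hA z s (le_of_lt hz) hs.1.le hs.2.le)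
  · rw [ae_restrict_iff' measurableSet_Ioi]
    refine Eventually.of_forall fun z hz s hs => ?_
    exact (hd z s (le_of_lt hz) hs.1).const_mul _

theorem bound_f (T : ℝ) : ∃ A : ℝ, ∀ z t : ℝ, 0 ≤ z → 0 ≤ t → t ≤ T → ‖U.f z t‖ ≤ A * weight z := by
  obtain ⟨A, hA⟩ := U.bound T
  exact ⟨A, fun z t h1 h2 h3 => (hA z t h1 h2 h3).1⟩

theorem bound_ft (T : ℝ) : ∃ A : ℝ, ∀ z t : ℝ, 0 ≤ z → 0 ≤ t → t ≤ T →
    ‖U.ft z t‖ ≤ A * weight z := by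
  obtain ⟨A, hA⟩ := U.bound T
  exact ⟨A, fun z t h1 h2 h3 => (hA z t h1 h2 h3).2.2.2.1⟩

theorem bound_ftt (T : ℝ) : ∃ A : ℝ, ∀ z t : ℝ, 0 ≤ z → 0 ≤ t → t ≤ T →
    ‖U.ftt z t‖ ≤ A * weight z := by
  obtain ⟨A, hA⟩ := U.bound T
  exact ⟨A, fun z t h1 h2 h3 => (hA z t h1 h2 h3).2.2.2.2⟩

/-- The transform of `f` at time `t`. -/
def L (m : ℂ) (t : ℝ) : ℂ := lap (fun z => U.f z t) m

/-- The transform of `∂f/∂t` at time `t`. -/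
def Lt (m : ℂ) (t : ℝ) : ℂ := lap (fun z => U.ft z t) m

/-- The transform of `∂²f/∂t²` at time `t`. -/
def Ltt (m : ℂ) (t : ℝ) : ℂ := lap (fun z => U.ftt z t) m

theorem continuousOn_L {m : ℂ} (hm : m.im ≤ 0) (T : ℝ) : ContinuousOn (U.L m) (Icc 0 T) :=
  continuousOn_lap_time U.cont_t U.bound_f hm (fun _ ht => U.integrable_f ht hm) T

theorem continuousOn_Lt {m : ℂ} (hm : m.im ≤ 0) (T : ℝ) : ContinuousOn (U.Lt m) (Icc 0 T) :=
  continuousOn_lap_time U.cont_t_ft U.bound_ft hm (fun _ ht => U.integrable_ft ht hm) T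

theorem hasDerivAt_L {m : ℂ} (hm : m.im ≤ 0) {t : ℝ} (ht : 0 < t) :
    HasDerivAt (U.L m) (U.Lt m t) t :=
  hasDerivAt_lap_time U.deriv_t U.bound_ft hm (fun _ ht => U.integrable_f ht hm)
    (fun _ ht => U.integrable_ft ht hm) ht

theorem hasDerivAt_Lt {m : ℂ} (hm : m.im ≤ 0) {t : ℝ} (ht : 0 < t) :
    HasDerivAt (U.Lt m) (U.Ltt m t) t :=
  hasDerivAt_lap_time U.deriv_t_ft U.bound_ftt hm (fun _ ht => U.integrable_ft ht hm)
    (fun _ ht => U.integrable_ftt ht hm) ht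

end HalfLineFunction

end HalfSpace

end


noncomputable section

namespace HalfSpace

open Filter Topology Set

/-! ### The problem on the half-line for fixed `(k, l)` -/

/-- The problem satisfied by the Fourier transforms in `(x, y)` of a solution. -/
structure IsHalfLineSolution (lam mu : ℝ) (d : Data) (k l : ℝ) (U V W : HalfLineFunction) :
    Prop where
  eq_u : ∀ z t, 0 < z → 0 < t → U.ftt z t = (lam + 2 * mu) * (-k ^ 2) * U.f z t
    + (lam + mu) * (-(k * l)) * V.f z t + (lam + mu) * (I * k) * W.fz z t
    + mu * (-l ^ 2) * U.f z t + mu * U.fzz z t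
  eq_v : ∀ z t, 0 < z → 0 < t → V.ftt z t = (lam + 2 * mu) * (-l ^ 2) * V.f z t
    + (lam + mu) * (I * l) * W.fz z t + (lam + mu) * (-(k * l)) * U.f z t
    + mu * V.fzz z t + mu * (-k ^ 2) * V.f z t
  eq_w : ∀ z t, 0 < z → 0 < t → W.ftt z t = (lam + 2 * mu) * W.fzz z t
    + (lam + mu) * (I * k) * U.fz z t + (lam + mu) * (I * l) * V.fz z t
    + mu * (-k ^ 2) * W.f z t + mu * (-l ^ 2) * W.f z t
  bc_u : ∀ t, 0 < t → U.fz 0 t + I * k * W.f 0 t = tilde d.g₁ k l t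
  bc_v : ∀ t, 0 < t → V.fz 0 t + I * l * W.f 0 t = tilde d.g₂ k l t
  bc_w : ∀ t, 0 < t →
    W.fz 0 t + lam / (lam + 2 * mu) * (I * k * U.f 0 t + I * l * V.f 0 t) = tilde d.g₃ k l t
  init_u : ∀ m : ℂ, m.im ≤ 0 → hat d.u₀ k l m = U.L m 0
  init_v : ∀ m : ℂ, m.im ≤ 0 → hat d.v₀ k l m = V.L m 0
  init_w : ∀ m : ℂ, m.im ≤ 0 → hat d.w₀ k l m = W.L m 0
  init_ut : ∀ m : ℂ, m.im ≤ 0 → hat d.u₁ k l m = U.Lt m 0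
  init_vt : ∀ m : ℂ, m.im ≤ 0 → hat d.v₁ k l m = V.Lt m 0
  init_wt : ∀ m : ℂ, m.im ≤ 0 → hat d.w₁ k l m = W.Lt m 0

theorem timeTransform_sum {n : ℕ} {φ : Fin n → ℝ → ℂ} {c : Fin n → ℂ} {t : ℝ} (ht : 0 ≤ t)
    (hφ : ∀ i, ContinuousOn (φ i) (Icc 0 t)) (om : ℂ) :
    timeTransform om (fun s => ∑ i, c i * φ i s) t = ∑ i, c i * timeTransform om (φ i) t := by
  have key : ∀ S : Finset (Fin n), timeTransform om (fun s => ∑ i ∈ S, c i * φ i s) t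
      = ∑ i ∈ S, c i * timeTransform om (φ i) t := by
    intro S
    induction S using Finset.induction_on with
    | empty => simp [timeTransform]
    | insert i S hi ih =>
      simp only [Finset.sum_insert hi]
      rw [timeTransform_add ht (φ := fun s => c i * φ i s) (ψ := fun s => ∑ j ∈ S, c j * φ j s)
        (continuousOn_const.mul (hφ i)) (continuousOn_finsetSum _ fun j _ => continuousOn_const.mul (hφ j)), ih,
        timeTransform_const_mul]
  exact key _

namespace IsHalfLineSolution

variable {lam mu : ℝ} {d : Data} {k l : ℝ} {U V W : HalfLineFunction}

/-- Each `z`-derivative of the equation leaves a boundary value at `z = 0`; these are the terms that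
become the forcing in Duhamel's formula. -/
theorem Ltt_u (h : IsHalfLineSolution lam mu d k l U V W) {m : ℂ} (hm : m.im ≤ 0) {t : ℝ}
    (ht : 0 < t) : U.Ltt m t = (lam + 2 * mu) * (-k ^ 2) * U.L m t
      + (lam + mu) * (-(k * l)) * V.L m t
      + (lam + mu) * (I * k) * (-W.f 0 t + I * m * W.L m t)
      + mu * (-l ^ 2) * U.L m t
      + mu * (-U.fz 0 t + I * m * (-U.f 0 t + I * m * U.L m t)) := by
  have h1 := lap_eq_sum (n := 5) (f := fun z => U.ftt z t) (m := m)
    (g := ![fun z => U.f z t, fun z => V.f z t, fun z => W.fz z t, fun z => U.f z t,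
      fun z => U.fzz z t])
    (c := ![(lam + 2 * mu) * (-k ^ 2), (lam + mu) * (-(k * l)), (lam + mu) * (I * k),
      mu * (-l ^ 2), mu]) ?_ ?_
  · simp only [Fin.sum_univ_five, Matrix.cons_val_zero, Matrix.cons_val_one, Matrix.cons_val] at h1
    rw [W.lap_fz ht.le hm, U.lap_fzz ht.le hm, U.lap_fz ht.le hm] at h1
    exact h1
  · intro i
    fin_cases i
    exacts [U.integrable_f ht.le hm, V.integrable_f ht.le hm, W.integrable_fz ht.le hm,
      U.integrable_f ht.le hm, U.integrable_fzz ht.le hm]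
  · intro z hz
    simp only [Fin.sum_univ_five, Matrix.cons_val_zero, Matrix.cons_val_one, Matrix.cons_val]
    exact h.eq_u z t hz ht

theorem Ltt_v (h : IsHalfLineSolution lam mu d k l U V W) {m : ℂ} (hm : m.im ≤ 0) {t : ℝ}
    (ht : 0 < t) : V.Ltt m t = (lam + 2 * mu) * (-l ^ 2) * V.L m t
      + (lam + mu) * (I * l) * (-W.f 0 t + I * m * W.L m t)
      + (lam + mu) * (-(k * l)) * U.L m t
      + mu * (-V.fz 0 t + I * m * (-V.f 0 t + I * m * V.L m t))
      + mu * (-k ^ 2) * V.L m t := by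
  have h1 := lap_eq_sum (n := 5) (f := fun z => V.ftt z t) (m := m)
    (g := ![fun z => V.f z t, fun z => W.fz z t, fun z => U.f z t, fun z => V.fzz z t,
      fun z => V.f z t])
    (c := ![(lam + 2 * mu) * (-l ^ 2), (lam + mu) * (I * l), (lam + mu) * (-(k * l)),
      mu, mu * (-k ^ 2)]) ?_ ?_
  · simp only [Fin.sum_univ_five, Matrix.cons_val_zero, Matrix.cons_val_one, Matrix.cons_val] at h1
    rw [W.lap_fz ht.le hm, V.lap_fzz ht.le hm, V.lap_fz ht.le hm] at h1
    exact h1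
  · intro i
    fin_cases i
    exacts [V.integrable_f ht.le hm, W.integrable_fz ht.le hm, U.integrable_f ht.le hm,
      V.integrable_fzz ht.le hm, V.integrable_f ht.le hm]
  · intro z hz
    simp only [Fin.sum_univ_five, Matrix.cons_val_zero, Matrix.cons_val_one, Matrix.cons_val]
    exact h.eq_v z t hz ht

theorem Ltt_w (h : IsHalfLineSolution lam mu d k l U V W) {m : ℂ} (hm : m.im ≤ 0) {t : ℝ}
    (ht : 0 < t) : W.Ltt m t =
      (lam + 2 * mu) * (-W.fz 0 t + I * m * (-W.f 0 t + I * m * W.L m t))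
      + (lam + mu) * (I * k) * (-U.f 0 t + I * m * U.L m t)
      + (lam + mu) * (I * l) * (-V.f 0 t + I * m * V.L m t)
      + mu * (-k ^ 2) * W.L m t + mu * (-l ^ 2) * W.L m t := by
  have h1 := lap_eq_sum (n := 5) (f := fun z => W.ftt z t) (m := m)
    (g := ![fun z => W.fzz z t, fun z => U.fz z t, fun z => V.fz z t, fun z => W.f z t,
      fun z => W.f z t])
    (c := ![(lam + 2 * mu), (lam + mu) * (I * k), (lam + mu) * (I * l),
      mu * (-k ^ 2), mu * (-l ^ 2)]) ?_ ?_
  · simp only [Fin.sum_univ_five, Matrix.cons_val_zero, Matrix.cons_val_one, Matrix.cons_val] at h1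
    rw [U.lap_fz ht.le hm, V.lap_fz ht.le hm, W.lap_fzz ht.le hm, W.lap_fz ht.le hm] at h1
    exact h1
  · intro i
    fin_cases i
    exacts [W.integrable_fzz ht.le hm, U.integrable_fz ht.le hm, V.integrable_fz ht.le hm,
      W.integrable_f ht.le hm, W.integrable_f ht.le hm]
  · intro z hz
    simp only [Fin.sum_univ_five, Matrix.cons_val_zero, Matrix.cons_val_one, Matrix.cons_val]
    exact h.eq_w z t hz ht

/-- Duhamel's formula for a combination of the transforms of `u, v, w`, in which the
inhomogeneity is expressed by the boundary data and the boundary values. -/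
theorem duhamel_combination (h : IsHalfLineSolution lam mu d k l U V W) {m : ℂ} (hm : m.im ≤ 0)
    {t : ℝ} (ht : 0 ≤ t) {om : ℂ} (hom : om ≠ 0) (α : Fin 3 → ℂ) (c : Fin 6 → ℂ)
    (heq : ∀ s, 0 < s → α 0 * U.Ltt m s + α 1 * V.Ltt m s + α 2 * W.Ltt m s
      = -om ^ 2 * (α 0 * U.L m s + α 1 * V.L m s + α 2 * W.L m s)
        + ∑ i, c i * (![fun s => U.fz 0 s + I * k * W.f 0 s, fun s => V.fz 0 s + I * l * W.f 0 s,
          fun s => W.fz 0 s + lam / (lam + 2 * mu) * (I * k * U.f 0 s + I * l * V.f 0 s),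
          U.f 0, V.f 0, W.f 0] : Fin 6 → ℝ → ℂ) i s) :
    α 0 * U.L m t + α 1 * V.L m t + α 2 * W.L m t
      = freeEvolution om (α 0 * U.L m 0 + α 1 * V.L m 0 + α 2 * W.L m 0)
          (α 0 * U.Lt m 0 + α 1 * V.Lt m 0 + α 2 * W.Lt m 0) t
        + I * (c 0 * timeTransform om (tilde d.g₁ k l) t + c 1 * timeTransform om (tilde d.g₂ k l) t
          + c 2 * timeTransform om (tilde d.g₃ k l) t + c 3 * timeTransform om (U.f 0) t
          + c 4 * timeTransform om (V.f 0) t + c 5 * timeTransform om (W.f 0) t) := by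
  set φ : Fin 6 → ℝ → ℂ := ![fun s => U.fz 0 s + I * k * W.f 0 s,
    fun s => V.fz 0 s + I * l * W.f 0 s,
    fun s => W.fz 0 s + lam / (lam + 2 * mu) * (I * k * U.f 0 s + I * l * V.f 0 s),
    U.f 0, V.f 0, W.f 0] with hφ
  have hsub : Icc 0 t ⊆ Ici (0 : ℝ) := Icc_subset_Ici_self
  have cU := (U.cont_t 0 le_rfl).mono hsub
  have cV := (V.cont_t 0 le_rfl).mono hsub
  have cW := (W.cont_t 0 le_rfl).mono hsub
  have cUz := (U.cont_t_fz 0 le_rfl).mono hsub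
  have cVz := (V.cont_t_fz 0 le_rfl).mono hsub
  have cWz := (W.cont_t_fz 0 le_rfl).mono hsub
  have hφc : ∀ i, ContinuousOn (φ i) (Icc 0 t) := by
    intro i
    fin_cases i
    · exact cUz.add (continuousOn_const.mul cW)
    · exact cVz.add (continuousOn_const.mul cW)
    · exact cWz.add (continuousOn_const.mul
        ((continuousOn_const.mul cU).add (continuousOn_const.mul cV)))
    · exact cU
    · exact cV
    · exact cW
  have key := duhamel ht hom (X := fun s => α 0 * U.L m s + α 1 * V.L m s + α 2 * W.L m s)
    (X' := fun s => α 0 * U.Lt m s + α 1 * V.Lt m s + α 2 * W.Lt m s)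
    (F := fun s => ∑ i, c i * φ i s)
    (((continuousOn_const.mul (U.continuousOn_L hm t)).add
      (continuousOn_const.mul (V.continuousOn_L hm t))).add
      (continuousOn_const.mul (W.continuousOn_L hm t)))
    (((continuousOn_const.mul (U.continuousOn_Lt hm t)).add
      (continuousOn_const.mul (V.continuousOn_Lt hm t))).add
      (continuousOn_const.mul (W.continuousOn_Lt hm t)))
    (continuousOn_finsetSum _ fun i _ => continuousOn_const.mul (hφc i))
    (fun s hs => (((U.hasDerivAt_L hm hs.1).const_mul _).add
      ((V.hasDerivAt_L hm hs.1).const_mul _)).add ((W.hasDerivAt_L hm hs.1).const_mul _))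
    (fun s hs => ((((U.hasDerivAt_Lt hm hs.1).const_mul _).add
      ((V.hasDerivAt_Lt hm hs.1).const_mul _)).add
      ((W.hasDerivAt_Lt hm hs.1).const_mul _)).congr_deriv (heq s hs.1))
  rw [timeTransform_sum ht hφc] at key
  rw [key]
  congr 2
  simp only [Fin.sum_univ_six, hφ, Matrix.cons_val_zero, Matrix.cons_val_one, Matrix.cons_val]
  -- The first three inhomogeneities are the stresses at `z = 0`, known from the data for `s > 0`.
  rw [timeTransform_congr ht (fun s hs _ => h.bc_u s hs), timeTransform_congr ht (fun s hs _ => h.bc_v s hs),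
    timeTransform_congr ht (fun s hs _ => h.bc_w s hs)]

/-- Pairing the transformed equations with `(k, l, m)` isolates the pressure waves: all interior
terms collapse to `-ω₁² P`. The boundary terms split into stresses, which enter `N_P`, and the
unknown values of `u, v, w`. -/
theorem global_P (h : IsHalfLineSolution lam mu d k l U V W) (hmu : 0 < mu) (hlm : 0 < lam + mu)
    {m : ℂ} (hm : m.im ≤ 0) (hm0 : m ≠ 0) (hk : (k : ℂ) ^ 2 + l ^ 2 + m ^ 2 ≠ 0) {t : ℝ}
    (ht : 0 ≤ t) :
    k * U.L m t + l * V.L m t + m * W.L m t = NP lam mu d k l m t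
      + 2 * mu * k * m * timeTransform (omega1 lam mu k l m) (U.f 0) t
      + 2 * mu * l * m * timeTransform (omega1 lam mu k l m) (V.f 0) t
      + (lam * (k ^ 2 + l ^ 2) + m ^ 2 * (lam + 2 * mu)) *
        timeTransform (omega1 lam mu k l m) (W.f 0) t := by
  have hc1 : ((lam : ℂ) + 2 * mu) ≠ 0 := by
    have : lam + 2 * mu ≠ 0 := by linarith
    exact_mod_cast this
  have e1 := omega1_sq k l hmu hlm hm0
  have n1 : omega1 lam mu k l m ≠ 0 := by
    intro h; rw [h] at e1
    exact mul_ne_zero hc1 hk (by rw [← e1]; simp)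
  -- The six coefficients belong, in order, to the three stresses and to the boundary values of `u,
  -- v, w`. Normal derivatives no longer appear: they are absorbed into the stresses, at the price
  -- of extra tangential terms in the last three coefficients.
  have key := h.duhamel_combination hm ht n1 ![(k : ℂ), l, m]
    ![-(mu * k), -(mu * l), -((lam + 2 * mu) * m), -(I * (2 * mu * k * m)), -(I * (2 * mu * l * m)),
      -(I * (lam * (k ^ 2 + l ^ 2) + m ^ 2 * (lam + 2 * mu)))] (by
      intro s hs
      rw [h.Ltt_u hm hs, h.Ltt_v hm hs, h.Ltt_w hm hs, e1]
      simp only [Fin.sum_univ_six, Matrix.cons_val_zero, Matrix.cons_val_one, Matrix.cons_val]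
      field_simp
      ring_nf
      simp only [I_sq]
      ring)
  simp only [Matrix.cons_val_zero, Matrix.cons_val_one, Matrix.cons_val] at key
  rw [key, NP, transP, transP, h.init_u m hm, h.init_v m hm, h.init_w m hm, h.init_ut m hm,
    h.init_vt m hm, h.init_wt m hm]
  ring_nf
  simp only [I_sq]
  ring

/-- The curl combinations see only shear waves, because the gradient part of the operator drops out;
hence the frequency `ω₂`. -/
theorem global_Q (h : IsHalfLineSolution lam mu d k l U V W) (hmu : 0 < mu) (hlm : 0 < lam + mu)
    {m : ℂ} (hm : m.im ≤ 0) (hm0 : m ≠ 0) (hk : (k : ℂ) ^ 2 + l ^ 2 + m ^ 2 ≠ 0) {t : ℝ}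
    (ht : 0 ≤ t) :
    m * V.L m t - l * W.L m t = NQ lam mu d k l m t
      - mu * k * l * timeTransform (omega2 mu k l m) (U.f 0) t
      + mu * (m ^ 2 - l ^ 2) * timeTransform (omega2 mu k l m) (V.f 0) t
      - 2 * mu * m * l * timeTransform (omega2 mu k l m) (W.f 0) t := by
  have hc1 : ((lam : ℂ) + 2 * mu) ≠ 0 := by
    have : lam + 2 * mu ≠ 0 := by linarith
    exact_mod_cast this
  have hc2 : (mu : ℂ) ≠ 0 := by exact_mod_cast hmu.ne'
  have e1 := omega2_sq k l hmu hm0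
  have n1 : omega2 mu k l m ≠ 0 := by
    intro h; rw [h] at e1
    exact mul_ne_zero hc2 hk (by rw [← e1]; simp)
  have key := h.duhamel_combination hm ht n1 ![0, m, -(l : ℂ)]
    ![0, -(mu * m), (lam + 2 * mu) * l, I * (mu * k * l), -(I * (mu * (m ^ 2 - l ^ 2))),
      I * (2 * mu * m * l)] (by
      intro s hs
      rw [h.Ltt_u hm hs, h.Ltt_v hm hs, h.Ltt_w hm hs, e1]
      simp only [Fin.sum_univ_six, Matrix.cons_val_zero, Matrix.cons_val_one, Matrix.cons_val]
      field_simp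
      ring_nf
      simp only [I_sq]
      ring)
  simp only [Matrix.cons_val_zero, Matrix.cons_val_one, Matrix.cons_val] at key
  simp only [zero_mul, zero_add, neg_mul, ← sub_eq_add_neg] at key
  rw [key, NQ, transQ, transQ, h.init_v m hm, h.init_w m hm, h.init_vt m hm, h.init_wt m hm]
  ring_nf
  simp only [I_sq]
  ring

theorem global_R (h : IsHalfLineSolution lam mu d k l U V W) (hmu : 0 < mu) (hlm : 0 < lam + mu)
    {m : ℂ} (hm : m.im ≤ 0) (hm0 : m ≠ 0) (hk : (k : ℂ) ^ 2 + l ^ 2 + m ^ 2 ≠ 0) {t : ℝ}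
    (ht : 0 ≤ t) :
    k * W.L m t - m * U.L m t = NR lam mu d k l m t
      + mu * (k ^ 2 - m ^ 2) * timeTransform (omega2 mu k l m) (U.f 0) t
      + mu * k * l * timeTransform (omega2 mu k l m) (V.f 0) t
      + 2 * mu * k * m * timeTransform (omega2 mu k l m) (W.f 0) t := by
  have hc1 : ((lam : ℂ) + 2 * mu) ≠ 0 := by
    have : lam + 2 * mu ≠ 0 := by linarith
    exact_mod_cast this
  have hc2 : (mu : ℂ) ≠ 0 := by exact_mod_cast hmu.ne'
  have e1 := omega2_sq k l hmu hm0
  have n1 : omega2 mu k l m ≠ 0 := by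
    intro h; rw [h] at e1
    exact mul_ne_zero hc2 hk (by rw [← e1]; simp)
  have key := h.duhamel_combination hm ht n1 ![-m, 0, (k : ℂ)]
    ![mu * m, 0, -((lam + 2 * mu) * k), -(I * (mu * (k ^ 2 - m ^ 2))), -(I * (mu * k * l)),
      -(I * (2 * mu * k * m))] (by
      intro s hs
      rw [h.Ltt_u hm hs, h.Ltt_v hm hs, h.Ltt_w hm hs, e1]
      simp only [Fin.sum_univ_six, Matrix.cons_val_zero, Matrix.cons_val_one, Matrix.cons_val]
      field_simp
      ring_nf
      simp only [I_sq]
      ring)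
  simp only [Matrix.cons_val_zero, Matrix.cons_val_one, Matrix.cons_val] at key
  simp only [zero_mul, add_zero, neg_mul, neg_add_eq_sub] at key
  rw [key, NR, transR, transR, h.init_u m hm, h.init_w m hm, h.init_ut m hm, h.init_wt m hm]
  ring_nf
  simp only [I_sq]
  ring

end IsHalfLineSolution

end HalfSpace

end


noncomputable section

namespace HalfSpace

open Filter Topology Set

/-! ### Elimination of the unknown boundary values -/

namespace HalfLineFunction

variable (U : HalfLineFunction)

theorem continuousOn_L_param {t : ℝ} (ht : 0 ≤ t) :
    ContinuousOn (fun m => U.L m t) {m | m.im ≤ 0} := by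
  obtain ⟨A, hA⟩ := U.exists_bound t ht
  exact continuousOn_lap (U.cont_z t ht) (fun z hz => (hA z hz).1)

theorem differentiableOn_L_param {t : ℝ} (ht : 0 ≤ t) :
    DifferentiableOn ℂ (fun m => U.L m t) {m | m.im < 0} := by
  obtain ⟨A, hA⟩ := U.exists_bound t ht
  exact differentiableOn_lap (U.cont_z t ht) (fun z hz => (hA z hz).1)

/-- Integration by parts expresses `m` times the transform by the transform of the `z`-derivative
and the value at `z = 0`. This keeps the divergence and curl combinations bounded although they
contain the factor `m`. -/
theorem exists_bound_L {t : ℝ} (ht : 0 ≤ t) : ∃ B : ℝ, ∀ m : ℂ, m.im ≤ 0 →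
    ‖U.L m t‖ ≤ B ∧ ‖m * U.L m t‖ ≤ B := by
  obtain ⟨A, hA⟩ := U.exists_bound t ht
  refine ⟨A * (∫ z in Ioi (0 : ℝ), weight z) + ‖U.f 0 t‖, fun m hm => ⟨?_, ?_⟩⟩
  · have := norm_lap_le (fun z hz => (hA z hz).1) hm
    rw [L]
    linarith [norm_nonneg (U.f 0 t)]
  · have e : m * U.L m t = -I * (lap (fun z => U.fz z t) m + U.f 0 t) := by
      rw [U.lap_fz ht hm, L]
      linear_combination (m * lap (fun z => U.f z t) m) * I_sq
    rw [e, norm_mul, norm_neg, norm_I, one_mul]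
    have := norm_lap_le (fun z hz => (hA z hz).2.1) hm
    exact (norm_add_le _ _).trans (by linarith)

theorem even_inversion {t : ℝ} (ht : 0 ≤ t) {z : ℝ} (hz : 0 ≤ z) :
    Integrable (fun m : ℝ => exp (I * m * z) * (U.L m t + U.L (-m) t)) ∧
    ∫ m : ℝ, exp (I * m * z) * (U.L m t + U.L (-m) t) = 2 * Real.pi * U.f z t := by
  obtain ⟨A, hA⟩ := U.exists_bound t ht
  exact HalfSpace.even_inversion (U.cont_z t ht) (fun z hz => (hA z hz).1) (U.cont_z_fz t ht)
    (fun z hz => (hA z hz).2.1) (U.cont_z_fzz t ht) (fun z hz => (hA z hz).2.2.1)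
    (fun z hz => U.deriv_z z t hz ht) (fun z hz => U.deriv_z_fz z t hz ht) hz

end HalfLineFunction

namespace IsHalfLineSolution

variable {lam mu : ℝ} {d : Data} {k l : ℝ} {U V W : HalfLineFunction}

/-- The boundary values of `u, v, w`. -/
def trace (U V W : HalfLineFunction) : Fin 3 → ℝ → ℂ := ![U.f 0, V.f 0, W.f 0]

/-- The transforms of divergence and curl at time `t`. -/
def divCurl (k l : ℝ) (U V W : HalfLineFunction) (t : ℝ) (m : ℂ) : Fin 3 → ℂ :=
  ![k * U.L m t + l * V.L m t + m * W.L m t, m * V.L m t - l * W.L m t,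
    k * W.L m t - m * U.L m t]

theorem continuousOn_divCurl (k l : ℝ) (U V W : HalfLineFunction) {t : ℝ} (ht : 0 ≤ t) (j : Fin 3) :
    ContinuousOn (fun m => divCurl k l U V W t m j) {m | m.im ≤ 0} := by
  have hU := U.continuousOn_L_param ht
  have hV := V.continuousOn_L_param ht
  have hW := W.continuousOn_L_param ht
  have hid : ContinuousOn (fun m : ℂ => m) {m | m.im ≤ 0} := continuousOn_id
  fin_cases j
  · exact ((continuousOn_const.mul hU).add (continuousOn_const.mul hV)).add (hid.mul hW)
  · exact (hid.mul hV).sub (continuousOn_const.mul hW)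
  · exact (continuousOn_const.mul hW).sub (hid.mul hU)

theorem differentiableOn_divCurl (k l : ℝ) (U V W : HalfLineFunction) {t : ℝ} (ht : 0 ≤ t)
    (j : Fin 3) : DifferentiableOn ℂ (fun m => divCurl k l U V W t m j) {m | m.im < 0} := by
  have hU := U.differentiableOn_L_param ht
  have hV := V.differentiableOn_L_param ht
  have hW := W.differentiableOn_L_param ht
  have hid : DifferentiableOn ℂ (fun m : ℂ => m) {m | m.im < 0} := differentiableOn_id
  have hconst : ∀ c : ℂ, DifferentiableOn ℂ (fun _ : ℂ => c) {m | m.im < 0} :=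
    fun c => differentiableOn_const c
  fin_cases j
  · exact (((hconst k).mul hU).add ((hconst l).mul hV)).add (hid.mul hW)
  · exact (hid.mul hV).sub ((hconst l).mul hW)
  · exact ((hconst k).mul hW).sub (hid.mul hU)

theorem exists_bound_divCurl (k l : ℝ) (U V W : HalfLineFunction) {t : ℝ} (ht : 0 ≤ t) :
    ∃ B : ℝ, ∀ m : ℂ, m.im ≤ 0 → ∀ j, ‖divCurl k l U V W t m j‖ ≤ B := by
  obtain ⟨A₁, h₁⟩ := U.exists_bound_L ht
  obtain ⟨A₂, h₂⟩ := V.exists_bound_L ht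
  obtain ⟨A₃, h₃⟩ := W.exists_bound_L ht
  refine ⟨(|k| + |l| + 1) * (A₁ + A₂ + A₃), fun m hm j => ?_⟩
  have a1 := (norm_nonneg _).trans (h₁ m hm).1
  have a2 := (norm_nonneg _).trans (h₂ m hm).1
  have a3 := (norm_nonneg _).trans (h₃ m hm).1
  have hc : ∀ (c : ℝ) (X : HalfLineFunction) (A : ℝ), ‖X.L m t‖ ≤ A → ‖(c : ℂ) * X.L m t‖ ≤ |c| * A := by
    intro c X A hX
    rw [norm_mul, norm_real, Real.norm_eq_abs]
    gcongr
  have k0 := abs_nonneg k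
  have l0 := abs_nonneg l
  fin_cases j
  · refine (norm_add₃_le).trans ?_
    have := hc k U A₁ (h₁ m hm).1
    have := hc l V A₂ (h₂ m hm).1
    have := (h₃ m hm).2
    nlinarith [mul_nonneg k0 a2, mul_nonneg k0 a3, mul_nonneg l0 a1, mul_nonneg l0 a3]
  · refine (norm_sub_le _ _).trans ?_
    have := hc l W A₃ (h₃ m hm).1
    have := (h₂ m hm).2
    nlinarith [mul_nonneg k0 a1, mul_nonneg k0 a2, mul_nonneg k0 a3, mul_nonneg l0 a1,
      mul_nonneg l0 a2]
  · refine (norm_sub_le _ _).trans ?_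
    have := hc k W A₃ (h₃ m hm).1
    have := (h₁ m hm).2
    nlinarith [mul_nonneg k0 a1, mul_nonneg k0 a2, mul_nonneg l0 a1,
      mul_nonneg l0 a2, mul_nonneg l0 a3]

/-- Since `ω₂(m₂₁)² = ω₁(m)²`, the global relations for `P` at `-m` and for `Q, R` at `m₂₁` involve
the same three time transforms of the boundary values. They form a linear system with matrix `D`,
solved here. Both arguments have nonpositive imaginary part, so the half-line transforms converge.
-/
theorem vec1_eq (hs : IsHalfLineSolution lam mu d k l U V W) (hmu : 0 < mu) (hlm : 0 < lam + mu)
    {h : ℝ → ℝ} (hA : IsAdmissible lam mu k l h) {m : ℂ} (hm : m ∈ above h) {t : ℝ} (ht : 0 ≤ t) :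
    vec1 lam mu d k l m t
      = (fun i => timeTransform (omega1 lam mu k l m) (trace U V W i) t)
        - Matrix.mulVec (matD lam mu k l m)⁻¹ ![divCurl k l U V W t (-m) 0,
          divCurl k l U V W t (m21 lam mu k l m) 1, divCurl k l U V W t (m21 lam mu k l m) 2] := by
  have hm0 := hA.ne_zero hm
  have hk := hA.kernel_ne_zero hmu hm
  have hc2 : (mu : ℂ) ≠ 0 := by exact_mod_cast hmu.ne'
  have hc1 : ((lam : ℂ) + 2 * mu) ≠ 0 := by
    have : lam + 2 * mu ≠ 0 := by linarith
    exact_mod_cast this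
  have hn0 := hA.m21_ne_zero hmu hlm hm
  have hnim := hA.m21_im_nonpos hmu hlm hm
  have hnsq := m21_sq (lam := lam) k l hmu hm0
  set n := m21 lam mu k l m with hn
  have hkn : (mu : ℂ) * (k ^ 2 + l ^ 2 + n ^ 2) = (lam + 2 * mu) * (k ^ 2 + l ^ 2 + m ^ 2) := by
    linear_combination hnsq
  have hkn0 : (k : ℂ) ^ 2 + l ^ 2 + n ^ 2 ≠ 0 := by
    intro h0
    rw [h0, mul_zero] at hkn
    exact mul_ne_zero hc1 hk hkn.symm
  have hom : omega2 mu k l n ^ 2 = omega1 lam mu k l m ^ 2 := by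
    rw [omega2_sq k l hmu hn0, omega1_sq k l hmu hlm hm0, hkn]
  have hom' : omega1 lam mu k l (-m) ^ 2 = omega1 lam mu k l m ^ 2 := by
    rw [omega1_sq k l hmu hlm (neg_ne_zero.2 hm0), omega1_sq k l hmu hlm hm0, neg_sq]
  have hmneg : (-m).im ≤ 0 := by
    rw [neg_im]; linarith [hA.im_nonneg hm]
  have gP := hs.global_P hmu hlm hmneg (neg_ne_zero.2 hm0) (by rwa [neg_sq]) ht
  have gQ := hs.global_Q hmu hlm hnim hn0 hkn0 ht
  have gR := hs.global_R hmu hlm hnim hn0 hkn0 ht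
  rw [timeTransform_eq_of_sq hom', timeTransform_eq_of_sq hom', timeTransform_eq_of_sq hom'] at gP
  rw [timeTransform_eq_of_sq hom, timeTransform_eq_of_sq hom, timeTransform_eq_of_sq hom] at gQ gR
  have hD : IsUnit (matD lam mu k l m).det := isUnit_iff_ne_zero.2 (hA.det_matD_ne_zero hm)
  -- The rows of `D` are the coefficients of the boundary values in `gP`, `gQ`, `gR`, all now at the
  -- frequency `ω₁(m)`.
  have hmul : Matrix.mulVec (matD lam mu k l m)
      (fun i => timeTransform (omega1 lam mu k l m) (trace U V W i) t)
      = ![divCurl k l U V W t (-m) 0, divCurl k l U V W t n 1, divCurl k l U V W t n 2]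
        - ![NP lam mu d k l (-m) t, NQ lam mu d k l n t, NR lam mu d k l n t] := by
    ext i
    fin_cases i
    · simp [matD, Matrix.mulVec, dotProduct, Fin.sum_univ_three, trace, divCurl] 
      linear_combination -gP
    · simp [matD, Matrix.mulVec, dotProduct, Fin.sum_univ_three, trace, divCurl, ← hn]
      linear_combination -gQ
    · simp [matD, Matrix.mulVec, dotProduct, Fin.sum_univ_three, trace, divCurl, ← hn]
      linear_combination -gR
  have h1 := congrArg (Matrix.mulVec (matD lam mu k l m)⁻¹) hmul
  rw [Matrix.mulVec_mulVec, Matrix.nonsing_inv_mul _ hD, Matrix.one_mulVec, Matrix.mulVec_sub] at h1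
  rw [vec1, h1]
  simp only [← hn]
  abel

/-- The same elimination at the common frequency `ω₂(m)`: `m₁₂` is chosen so that `ω₁(m₁₂)² =
ω₂(m)²`, and the system has matrix `C`. -/
theorem vec2_eq (hs : IsHalfLineSolution lam mu d k l U V W) (hmu : 0 < mu) (hlm : 0 < lam + mu)
    {h : ℝ → ℝ} (hA : IsAdmissible lam mu k l h) {m : ℂ} (hm : m ∈ above h) {t : ℝ} (ht : 0 ≤ t) :
    vec2 lam mu d k l m t
      = (fun i => timeTransform (omega2 mu k l m) (trace U V W i) t)
        - Matrix.mulVec (matC lam mu k l m)⁻¹ ![divCurl k l U V W t (m12 lam mu k l m) 0,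
          divCurl k l U V W t (-m) 1, divCurl k l U V W t (-m) 2] := by
  have hm0 := hA.ne_zero hm
  have hk := hA.kernel_ne_zero hmu hm
  have hc2 : (mu : ℂ) ≠ 0 := by exact_mod_cast hmu.ne'
  have hc1 : ((lam : ℂ) + 2 * mu) ≠ 0 := by
    have : lam + 2 * mu ≠ 0 := by linarith
    exact_mod_cast this
  have hn0 := hA.m12_ne_zero hmu hlm hm
  have hnim := hA.m12_im_nonpos hmu hlm hm
  have hnsq := m12_sq (lam := lam) k l hmu hlm hm0
  set n := m12 lam mu k l m with hn
  have hkn : ((lam : ℂ) + 2 * mu) * (k ^ 2 + l ^ 2 + n ^ 2) = mu * (k ^ 2 + l ^ 2 + m ^ 2) := by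
    linear_combination hnsq
  have hkn0 : (k : ℂ) ^ 2 + l ^ 2 + n ^ 2 ≠ 0 := by
    intro h0
    rw [h0, mul_zero] at hkn
    exact mul_ne_zero hc2 hk hkn.symm
  have hom : omega1 lam mu k l n ^ 2 = omega2 mu k l m ^ 2 := by
    rw [omega2_sq k l hmu hm0, omega1_sq k l hmu hlm hn0, hkn]
  have hom' : omega2 mu k l (-m) ^ 2 = omega2 mu k l m ^ 2 := by
    rw [omega2_sq k l hmu (neg_ne_zero.2 hm0), omega2_sq k l hmu hm0, neg_sq]
  have hmneg : (-m).im ≤ 0 := by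
    rw [neg_im]; linarith [hA.im_nonneg hm]
  have gP := hs.global_P hmu hlm hnim hn0 hkn0 ht
  have gQ := hs.global_Q hmu hlm hmneg (neg_ne_zero.2 hm0) (by rwa [neg_sq]) ht
  have gR := hs.global_R hmu hlm hmneg (neg_ne_zero.2 hm0) (by rwa [neg_sq]) ht
  rw [timeTransform_eq_of_sq hom', timeTransform_eq_of_sq hom', timeTransform_eq_of_sq hom'] at gQ gR
  rw [timeTransform_eq_of_sq hom, timeTransform_eq_of_sq hom, timeTransform_eq_of_sq hom] at gP
  have hC : IsUnit (matC lam mu k l m).det := isUnit_iff_ne_zero.2 (hA.det_matC_ne_zero hm)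
  have hmul : Matrix.mulVec (matC lam mu k l m)
      (fun i => timeTransform (omega2 mu k l m) (trace U V W i) t)
      = ![divCurl k l U V W t n 0, divCurl k l U V W t (-m) 1, divCurl k l U V W t (-m) 2]
        - ![NP lam mu d k l n t, NQ lam mu d k l (-m) t, NR lam mu d k l (-m) t] := by
    ext i
    fin_cases i
    · simp [matC, Matrix.mulVec, dotProduct, Fin.sum_univ_three, trace, divCurl, ← hn]
      linear_combination -gP
    · simp [matC, Matrix.mulVec, dotProduct, Fin.sum_univ_three, trace, divCurl]
      linear_combination -gQ
    · simp [matC, Matrix.mulVec, dotProduct, Fin.sum_univ_three, trace, divCurl]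
      linear_combination -gR
  have h1 := congrArg (Matrix.mulVec (matC lam mu k l m)⁻¹) hmul
  rw [Matrix.mulVec_mulVec, Matrix.nonsing_inv_mul _ hC, Matrix.one_mulVec, Matrix.mulVec_sub] at h1
  rw [vec2, h1]
  simp only [← hn]
  abel

/-- The contour integrals are integrals along the real axis of the boundary values of the
solution. -/
theorem contour_form (hs : IsHalfLineSolution lam mu d k l U V W) (hmu : 0 < mu)
    (hlm : 0 < lam + mu) {h : ℝ → ℝ} (hA : IsAdmissible lam mu k l h) (a b c : Fin 3 → ℂ)
    {z t : ℝ} (hz : 0 < z) (ht : 0 ≤ t) :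
    Integrable (pullback h fun m => exp (I * m * z) * form k l a b c m
      (vec1 lam mu d k l m t) (vec2 lam mu d k l m t)) ∧
    Integrable (fun s : ℝ => exp (I * s * z) * form k l a b c s
      (fun i => timeTransform (omega1 lam mu k l s) (trace U V W i) t)
      (fun i => timeTransform (omega2 mu k l s) (trace U V W i) t)) ∧
    contourIntegral h (fun m => exp (I * m * z) * form k l a b c m
      (vec1 lam mu d k l m t) (vec2 lam mu d k l m t))
    = ∫ s : ℝ, exp (I * s * z) * form k l a b c s
      (fun i => timeTransform (omega1 lam mu k l s) (trace U V W i) t)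
      (fun i => timeTransform (omega2 mu k l s) (trace U V W i) t) := by
  have hmem : ∀ s : ℝ, (s : ℂ) + I * h s ∈ above h := by
    intro s
    simp [above]
  have hsub : Icc 0 t ⊆ Ici (0 : ℝ) := Icc_subset_Ici_self
  obtain ⟨r1, r2, r3⟩ := hA.deformation.contourIntegral_form_timeTransform (lam := lam) (mu := mu)
    (k := k) (l := l) (fun s => ⟨hA.ne_zero (hmem s), hA.kernel_ne_zero hmu (hmem s)⟩) hmu hlm
    (φ := trace U V W) (φ' := ![U.ft 0, V.ft 0, W.ft 0]) ht
    (fun i => by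
      fin_cases i
      exacts [(U.cont_t 0 le_rfl).mono hsub, (V.cont_t 0 le_rfl).mono hsub,
        (W.cont_t 0 le_rfl).mono hsub])
    (fun i => by
      fin_cases i
      exacts [(U.cont_t_ft 0 le_rfl).mono hsub, (V.cont_t_ft 0 le_rfl).mono hsub,
        (W.cont_t_ft 0 le_rfl).mono hsub])
    (fun i s hs => by
      fin_cases i
      exacts [U.deriv_t 0 s le_rfl hs.1, V.deriv_t 0 s le_rfl hs.1, W.deriv_t 0 s le_rfl hs.1])
    a b c z
  obtain ⟨B, hB⟩ := exists_bound_divCurl k l U V W ht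
  have c21 : ContinuousOn (m21 lam mu k l) (above h) := fun m hm =>
    (hA.differentiableAt_m21 hmu hlm hm).continuousAt.continuousWithinAt
  have c12 : ContinuousOn (m12 lam mu k l) (above h) := fun m hm =>
    (hA.differentiableAt_m12 hmu hlm hm).continuousAt.continuousWithinAt
  have d21 : DifferentiableOn ℂ (m21 lam mu k l) (strictAbove h) := fun m hm =>
    (hA.differentiableAt_m21 hmu hlm (strictAbove_subset h hm)).differentiableWithinAt
  have d12 : DifferentiableOn ℂ (m12 lam mu k l) (strictAbove h) := fun m hm =>
    (hA.differentiableAt_m12 hmu hlm (strictAbove_subset h hm)).differentiableWithinAt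
  have t0 : MapsTo (fun m : ℂ => -m) (above h) {m | m.im ≤ 0} := fun m hm => by
    simpa using hA.im_nonneg hm
  have t0' : MapsTo (fun m : ℂ => -m) (strictAbove h) {m | m.im < 0} := fun m hm => by
    simpa using hA.im_pos hm
  have t21 : MapsTo (m21 lam mu k l) (above h) {m | m.im ≤ 0} := fun m hm =>
    hA.m21_im_nonpos hmu hlm hm
  have t21' : MapsTo (m21 lam mu k l) (strictAbove h) {m | m.im < 0} := fun m hm =>
    hA.m21_im_neg hmu hlm (strictAbove_subset h hm) (hA.im_pos hm)
  have t12 : MapsTo (m12 lam mu k l) (above h) {m | m.im ≤ 0} := fun m hm =>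
    hA.m12_im_nonpos hmu hlm hm
  have t12' : MapsTo (m12 lam mu k l) (strictAbove h) {m | m.im < 0} := fun m hm =>
    hA.m12_im_neg hmu hlm (strictAbove_subset h hm) (hA.im_pos hm)
  have cneg : ContinuousOn (fun m : ℂ => -m) (above h) := continuousOn_neg
  have dneg : DifferentiableOn ℂ (fun m : ℂ => -m) (strictAbove h) :=
    Differentiable.differentiableOn (by fun_prop)
  have cd := continuousOn_divCurl k l U V W ht
  have dd := differentiableOn_divCurl k l U V W ht
  obtain ⟨q1, q2⟩ := hA.contourIntegral_form_eq_zero hmu hlm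
    (p := fun m => ![divCurl k l U V W t (-m) 0, divCurl k l U V W t (m21 lam mu k l m) 1,
      divCurl k l U V W t (m21 lam mu k l m) 2])
    (q := fun m => ![divCurl k l U V W t (m12 lam mu k l m) 0, divCurl k l U V W t (-m) 1,
      divCurl k l U V W t (-m) 2])
    (fun j => by
      fin_cases j
      exacts [(cd 0).comp cneg t0, (cd 1).comp c21 t21, (cd 2).comp c21 t21])
    (fun j => by
      fin_cases j
      exacts [(cd 0).comp c12 t12, (cd 1).comp cneg t0, (cd 2).comp cneg t0])
    (fun j => by
      fin_cases j
      exacts [(dd 0).comp dneg t0', (dd 1).comp d21 t21', (dd 2).comp d21 t21'])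
    (fun j => by
      fin_cases j
      exacts [(dd 0).comp d12 t12', (dd 1).comp dneg t0', (dd 2).comp dneg t0'])
    (B := B)
    (fun m hm j => by
      fin_cases j
      exacts [hB _ (t0 hm) 0, hB _ (t21 hm) 1, hB _ (t21 hm) 2])
    (fun m hm j => by
      fin_cases j
      exacts [hB _ (t12 hm) 0, hB _ (t0 hm) 1, hB _ (t0 hm) 2])
    a b c hz
  -- By linearity of the form, the integrand is that of the time transforms of the boundary values
  -- minus that of the bounded holomorphic part; the latter has integral zero.
  have hpb : (pullback h fun m => exp (I * m * z) * form k l a b c m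
      (vec1 lam mu d k l m t) (vec2 lam mu d k l m t))
      = (pullback h fun m => exp (I * m * z) * form k l a b c m
        (fun i => timeTransform (omega1 lam mu k l m) (trace U V W i) t)
        (fun i => timeTransform (omega2 mu k l m) (trace U V W i) t))
      - pullback h (fun m => exp (I * m * z) * form k l a b c m
        (Matrix.mulVec (matD lam mu k l m)⁻¹ ![divCurl k l U V W t (-m) 0,
          divCurl k l U V W t (m21 lam mu k l m) 1, divCurl k l U V W t (m21 lam mu k l m) 2])
        (Matrix.mulVec (matC lam mu k l m)⁻¹ ![divCurl k l U V W t (m12 lam mu k l m) 0,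
          divCurl k l U V W t (-m) 1, divCurl k l U V W t (-m) 2])) := by
    ext s
    simp only [pullback, Pi.sub_apply]
    rw [hs.vec1_eq hmu hlm hA (hmem s) ht, hs.vec2_eq hmu hlm hA (hmem s) ht, form_sub]
    ring
  refine ⟨by rw [hpb]; exact r1.sub q1, r2, ?_⟩
  rw [contourIntegral, hpb]
  simp only [Pi.sub_apply]
  rw [integral_sub r1 q1]
  rw [contourIntegral] at q2 r3
  rw [q2, r3, sub_zero]

end IsHalfLineSolution

end HalfSpace

end


noncomputable section

namespace HalfSpace

open Filter Topology Set

/-! ### Recovery of the solution for fixed `(k, l)` -/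

namespace IsHalfLineSolution

variable {lam mu : ℝ} {d : Data} {k l : ℝ} {U V W : HalfLineFunction}

/-- Reconstruction of a component `X` of the solution from the contour integral of `f` and the real
integral of `g`. -/
theorem inversion_of (hs : IsHalfLineSolution lam mu d k l U V W) (hmu : 0 < mu)
    (hlm : 0 < lam + mu) {h : ℝ → ℝ} (hA : IsAdmissible lam mu k l h) (a b c : Fin 3 → ℂ)
    {z t : ℝ} (hz : 0 < z) (ht : 0 ≤ t) (X : HalfLineFunction) (e : ℂ) {f : ℂ → ℂ} {g : ℝ → ℂ}
    (hf : ∀ m : ℂ, (k : ℂ) ^ 2 + l ^ 2 + m ^ 2 ≠ 0 →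
      f m = e * (exp (I * m * z) * form k l a b c m
      (vec1 lam mu d k l m t) (vec2 lam mu d k l m t)))
    (hg : ∀ s : ℝ, s ≠ 0 → g s = e * (exp (I * s * z) * (X.L s t + X.L (-s) t)
      - exp (I * s * z) * form k l a b c s
      (fun i => timeTransform (omega1 lam mu k l s) (trace U V W i) t)
      (fun i => timeTransform (omega2 mu k l s) (trace U V W i) t))) :
    Integrable (pullback h f) ∧ Integrable g ∧
      contourIntegral h f + ∫ s, g s = e * (2 * Real.pi * X.f z t) := by
  obtain ⟨c1, c2, c3⟩ := hs.contour_form hmu hlm hA a b c hz ht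
  obtain ⟨i1, i2⟩ := X.even_inversion ht hz.le
  have hmem : ∀ s : ℝ, (s : ℂ) + I * h s ∈ above h := by
    intro s
    simp [above]
  -- The hypothesis on `f` excludes the zeros of `k² + l² + m²`, and there are none on the contour.
  have hpb : pullback h f = fun s => e * pullback h (fun m => exp (I * m * z) * form k l a b c m
      (vec1 lam mu d k l m t) (vec2 lam mu d k l m t)) s := by
    ext s
    simp only [pullback]
    rw [hf _ (hA.kernel_ne_zero hmu (hmem s))]
    ring
  have hgae : g =ᵐ[volume] fun s : ℝ => e * (exp (I * s * z) * (X.L s t + X.L (-s) t)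
      - exp (I * s * z) * form k l a b c s
      (fun i => timeTransform (omega1 lam mu k l s) (trace U V W i) t)
      (fun i => timeTransform (omega2 mu k l s) (trace U V W i) t)) := by
    filter_upwards [compl_mem_ae_iff.2 (measure_singleton (0 : ℝ))] with s hs0
    exact hg s hs0
  have ig := (i1.sub c2).const_mul e
  refine ⟨by rw [hpb]; exact c1.const_mul e, ig.congr hgae.symm, ?_⟩
  rw [contourIntegral, hpb, integral_const_mul, integral_congr_ae hgae, integral_const_mul,
    integral_sub i1 c2, i2]
  rw [contourIntegral] at c3
  rw [c3]
  ring

/-- The divergence and curl combinations at `s` and at `-s`. -/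
theorem global_pm (hs : IsHalfLineSolution lam mu d k l U V W) (hmu : 0 < mu)
    (hlm : 0 < lam + mu) {t : ℝ} (ht : 0 ≤ t) {s : ℝ} (hs0 : s ≠ 0) :
    (k : ℂ) ^ 2 + l ^ 2 + s ^ 2 ≠ 0 ∧
    NP lam mu d k l s t = k * U.L s t + l * V.L s t + s * W.L s t
      - (2 * mu * k * s * timeTransform (omega1 lam mu k l s) (U.f 0) t
      + 2 * mu * l * s * timeTransform (omega1 lam mu k l s) (V.f 0) t
      + (lam * (k ^ 2 + l ^ 2) + s ^ 2 * (lam + 2 * mu)) *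
        timeTransform (omega1 lam mu k l s) (W.f 0) t) ∧
    NP lam mu d k l (-s) t = k * U.L (-s) t + l * V.L (-s) t - s * W.L (-s) t
      - (-(2 * mu * k * s * timeTransform (omega1 lam mu k l s) (U.f 0) t)
      - 2 * mu * l * s * timeTransform (omega1 lam mu k l s) (V.f 0) t
      + (lam * (k ^ 2 + l ^ 2) + s ^ 2 * (lam + 2 * mu)) *
        timeTransform (omega1 lam mu k l s) (W.f 0) t) ∧
    NQ lam mu d k l s t = s * V.L s t - l * W.L s t
      - (-(mu * k * l * timeTransform (omega2 mu k l s) (U.f 0) t)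
      + mu * (s ^ 2 - l ^ 2) * timeTransform (omega2 mu k l s) (V.f 0) t
      - 2 * mu * s * l * timeTransform (omega2 mu k l s) (W.f 0) t) ∧
    NQ lam mu d k l (-s) t = -(s * V.L (-s) t) - l * W.L (-s) t
      - (-(mu * k * l * timeTransform (omega2 mu k l s) (U.f 0) t)
      + mu * (s ^ 2 - l ^ 2) * timeTransform (omega2 mu k l s) (V.f 0) t
      + 2 * mu * s * l * timeTransform (omega2 mu k l s) (W.f 0) t) ∧
    NR lam mu d k l s t = k * W.L s t - s * U.L s t
      - (mu * (k ^ 2 - s ^ 2) * timeTransform (omega2 mu k l s) (U.f 0) t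
      + mu * k * l * timeTransform (omega2 mu k l s) (V.f 0) t
      + 2 * mu * k * s * timeTransform (omega2 mu k l s) (W.f 0) t) ∧
    NR lam mu d k l (-s) t = k * W.L (-s) t + s * U.L (-s) t
      - (mu * (k ^ 2 - s ^ 2) * timeTransform (omega2 mu k l s) (U.f 0) t
      + mu * k * l * timeTransform (omega2 mu k l s) (V.f 0) t
      - 2 * mu * k * s * timeTransform (omega2 mu k l s) (W.f 0) t) := by
  have hsc : (s : ℂ) ≠ 0 := by exact_mod_cast hs0
  have hk : (k : ℂ) ^ 2 + l ^ 2 + s ^ 2 ≠ 0 := by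
    have : k ^ 2 + l ^ 2 + s ^ 2 ≠ 0 := by positivity
    exact_mod_cast this
  have hk' : (k : ℂ) ^ 2 + l ^ 2 + (-s : ℂ) ^ 2 ≠ 0 := by rwa [neg_sq]
  have i1 : (s : ℂ).im ≤ 0 := by simp
  have i2 : (-s : ℂ).im ≤ 0 := by simp
  have o1 : omega1 lam mu k l (-s) ^ 2 = omega1 lam mu k l s ^ 2 := by
    rw [omega1_sq k l hmu hlm (neg_ne_zero.2 hsc), omega1_sq k l hmu hlm hsc, neg_sq]
  have o2 : omega2 mu k l (-s) ^ 2 = omega2 mu k l s ^ 2 := by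
    rw [omega2_sq k l hmu (neg_ne_zero.2 hsc), omega2_sq k l hmu hsc, neg_sq]
  have p1 := hs.global_P hmu hlm i1 hsc hk ht
  have q1 := hs.global_Q hmu hlm i1 hsc hk ht
  have r1 := hs.global_R hmu hlm i1 hsc hk ht
  have p2 := hs.global_P hmu hlm i2 (neg_ne_zero.2 hsc) hk' ht
  have q2 := hs.global_Q hmu hlm i2 (neg_ne_zero.2 hsc) hk' ht
  have r2 := hs.global_R hmu hlm i2 (neg_ne_zero.2 hsc) hk' ht
  simp only [timeTransform_eq_of_sq o1] at p2
  simp only [timeTransform_eq_of_sq o2] at q2 r2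
  refine ⟨hk, ?_, ?_, ?_, ?_, ?_, ?_⟩
  · linear_combination -p1
  · linear_combination -p2
  · linear_combination -q1
  · linear_combination -q2
  · linear_combination -r1
  · linear_combination -r2

/-- Let `κ = k² + l² + m²` and let `S = lU - kV` be the third curl component. Then `κU = kP + lS -
mR`, and `kQ + lR + mS = 0` eliminates `S`, whence `κU = kP - (kl/m) Q - ((m² + l²)/m) R`. Adding
the same identity at `-m` gives the combinations in the real integrand; the boundary terms produced
are exactly those carried by the contour integrand. -/
theorem inversion_u (hs : IsHalfLineSolution lam mu d k l U V W) (hmu : 0 < mu)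
    (hlm : 0 < lam + mu) {h : ℝ → ℝ} (hA : IsAdmissible lam mu k l h) (x y : ℝ)
    {z t : ℝ} (hz : 0 < z) (ht : 0 ≤ t) :
    Integrable (pullback h (contourU lam mu d x y z t k l)) ∧
      Integrable (realU lam mu d x y z t k l) ∧
      contourIntegral h (contourU lam mu d x y z t k l) + ∫ s, realU lam mu d x y z t k l s
        = exp (I * k * x + I * l * y) * (2 * Real.pi * U.f z t) := by
  -- These coefficients come from `λ(k² + l²) + (λ + 2μ)m² = λκ + 2μm²` with `κ = k² + l² + m²`:
  -- after division by `κ`, only `W₁ - W₂` has the factor `m² / κ`.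
  refine hs.inversion_of hmu hlm hA ![0, 0, 2 * k * lam] ![0, 0, 4 * mu * k] 0 hz ht U _ ?_ ?_
  · intro m hm
    rw [contourU, kernel, exp_add]
    simp only [form, Fin.sum_univ_three, Matrix.cons_val_zero, Matrix.cons_val_one, Matrix.cons_val,
      Pi.zero_apply]
    field_simp
    ring
  · intro s hs0
    obtain ⟨hk, p1, p2, q1, q2, r1, r2⟩ := hs.global_pm hmu hlm ht hs0
    have hsc : (s : ℂ) ≠ 0 := by exact_mod_cast hs0
    rw [realU, kernel, exp_add, p1, p2, q1, q2, r1, r2]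
    simp only [form, Fin.sum_univ_three, Matrix.cons_val_zero, Matrix.cons_val_one, Matrix.cons_val,
      Pi.zero_apply, trace]
    field_simp
    ring

/-- As for `u`, starting from `κV = lP + mQ - kS` with `κ = k² + l² + m²`, and eliminating `S = lU -
kV` in the same way. -/
theorem inversion_v (hs : IsHalfLineSolution lam mu d k l U V W) (hmu : 0 < mu)
    (hlm : 0 < lam + mu) {h : ℝ → ℝ} (hA : IsAdmissible lam mu k l h) (x y : ℝ)
    {z t : ℝ} (hz : 0 < z) (ht : 0 ≤ t) :
    Integrable (pullback h (contourV lam mu d x y z t k l)) ∧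
      Integrable (realV lam mu d x y z t k l) ∧
      contourIntegral h (contourV lam mu d x y z t k l) + ∫ s, realV lam mu d x y z t k l s
        = exp (I * k * x + I * l * y) * (2 * Real.pi * V.f z t) := by
  refine hs.inversion_of hmu hlm hA ![0, 0, 2 * l * lam] ![0, 0, 4 * mu * l] 0 hz ht V _ ?_ ?_
  · intro m hm
    rw [contourV, kernel, exp_add]
    simp only [form, Fin.sum_univ_three, Matrix.cons_val_zero, Matrix.cons_val_one, Matrix.cons_val,
      Pi.zero_apply]
    field_simp
    ring
  · intro s hs0
    obtain ⟨hk, p1, p2, q1, q2, r1, r2⟩ := hs.global_pm hmu hlm ht hs0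
    have hsc : (s : ℂ) ≠ 0 := by exact_mod_cast hs0
    rw [realV, kernel, exp_add, p1, p2, q1, q2, r1, r2]
    simp only [form, Fin.sum_univ_three, Matrix.cons_val_zero, Matrix.cons_val_one, Matrix.cons_val,
      Pi.zero_apply, trace]
    field_simp
    ring

/-- With `κ = k² + l² + m²`, the identity `κW = mP - lQ + kR` does not involve the third curl
component, so no factor `1/m` occurs. The splitting of the contour integrand uses `k² + l² - m² = κ
- 2m²`. -/
theorem inversion_w (hs : IsHalfLineSolution lam mu d k l U V W) (hmu : 0 < mu)
    (hlm : 0 < lam + mu) {h : ℝ → ℝ} (hA : IsAdmissible lam mu k l h) (x y : ℝ)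
    {z t : ℝ} (hz : 0 < z) (ht : 0 ≤ t) :
    Integrable (pullback h (contourW lam mu d x y z t k l)) ∧
      Integrable (realW lam mu d x y z t k l) ∧
      contourIntegral h (contourW lam mu d x y z t k l) + ∫ s, realW lam mu d x y z t k l s
        = exp (I * k * x + I * l * y) * (2 * Real.pi * W.f z t) := by
  refine hs.inversion_of hmu hlm hA 0 ![4 * mu * k, 4 * mu * l, 0] ![2 * mu * k, 2 * mu * l, 0]
    hz ht W _ ?_ ?_
  · intro m hm
    rw [contourW, kernel, exp_add]
    simp only [form, Fin.sum_univ_three, Matrix.cons_val_zero, Matrix.cons_val_one, Matrix.cons_val,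
      Pi.zero_apply]
    field_simp
    ring
  · intro s hs0
    obtain ⟨hk, p1, p2, q1, q2, r1, r2⟩ := hs.global_pm hmu hlm ht hs0
    have hsc : (s : ℂ) ≠ 0 := by exact_mod_cast hs0
    rw [realW, kernel, exp_add, p1, p2, q1, q2, r1, r2]
    simp only [form, Fin.sum_univ_three, Matrix.cons_val_zero, Matrix.cons_val_one, Matrix.cons_val,
      Pi.zero_apply, trace]
    field_simp
    ring

end IsHalfLineSolution

end HalfSpace

end


noncomputable section

namespace HalfSpace

open Filter Topology Set

/-! ### Planar transforms of decaying functions -/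

/-- The weight on the plane. -/
def weight₂ (q : ℝ × ℝ) : ℝ := weight q.1 * weight q.2

theorem weight₂_pos (q : ℝ × ℝ) : 0 < weight₂ q := mul_pos (weight_pos _) (weight_pos _)

theorem weight₂_le_one (q : ℝ × ℝ) : weight₂ q ≤ 1 :=
  mul_le_one₀ (weight_le_one _) (weight_pos _).le (weight_le_one _)

theorem integrable_weight₂ : Integrable weight₂ := integrable_weight.mul_prod integrable_weight

theorem integral_weight₂_nonneg : 0 ≤ ∫ q, weight₂ q :=
  integral_nonneg fun q => (weight₂_pos q).le

section planar

variable {F F' : ℝ × ℝ → ℂ} {A : ℝ}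

theorem integrable_of_le_weight₂ (hc : Continuous F) (hb : ∀ q, ‖F q‖ ≤ A * weight₂ q) :
    Integrable F :=
  (integrable_weight₂.const_mul A).mono' hc.aestronglyMeasurable (Eventually.of_forall hb)

theorem norm_planar_le_of_le_weight₂ (hb : ∀ q, ‖F q‖ ≤ A * weight₂ q) (k l : ℝ) :
    ‖planar F k l‖ ≤ A * ∫ q, weight₂ q := by
  rw [← integral_const_mul, planar]
  refine norm_integral_le_of_norm_le (integrable_weight₂.const_mul A)
    (Eventually.of_forall fun q => ?_)
  rw [norm_mul, norm_exp_planar, one_mul]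
  exact hb q

theorem planar_swap (F : ℝ × ℝ → ℂ) (k l : ℝ) : planar (F ∘ Prod.swap) k l = planar F l k := by
  rw [planar, planar, Measure.volume_eq_prod, ← integral_prod_swap]
  refine integral_congr_ae (Eventually.of_forall fun q => ?_)
  simp only [Function.comp_apply, Prod.swap_swap, Prod.fst_swap, Prod.snd_swap]
  ring_nf

theorem integrable_line (hc : Continuous F) (hb : ∀ q, ‖F q‖ ≤ A * weight₂ q) (y : ℝ) :
    Integrable fun x => F (x, y) := by
  refine (integrable_weight.const_mul (A * weight y)).mono'
    (Continuous.aestronglyMeasurable (by fun_prop)) (Eventually.of_forall fun x => ?_)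
  refine (hb (x, y)).trans_eq ?_
  rw [weight₂]; ring

theorem planar_deriv_fst (hc : Continuous F) (hc' : Continuous F')
    (hb : ∀ q, ‖F q‖ ≤ A * weight₂ q) (hb' : ∀ q, ‖F' q‖ ≤ A * weight₂ q)
    (hd : ∀ x y : ℝ, HasDerivAt (fun x => F (x, y)) (F' (x, y)) x) (k l : ℝ) :
    planar F' k l = I * k * planar F k l := by
  have i1 := integrable_planar (integrable_of_le_weight₂ hc hb) k l
  have i2 := integrable_planar (integrable_of_le_weight₂ hc' hb') k l
  rw [planar, planar, ← integral_const_mul]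
  rw [Measure.volume_eq_prod] at i1 i2 ⊢
  rw [integral_prod_symm _ i2, integral_prod_symm _ (i1.const_mul _)]
  congr 1
  ext y
  have hE : ∀ x : ℝ, HasDerivAt (fun x : ℝ => exp (-(I * k * x) - I * l * y))
      (exp (-(I * k * x) - I * l * y) * (-(I * k))) x := by
    intro x
    have h1 : HasDerivAt (fun x : ℝ => -(I * k * (x : ℂ)) - I * l * y) (-(I * k)) x := by
      have := (((hasDerivAt_id x).ofReal_comp).const_mul (I * k)).fun_neg.sub_const (I * l * y)
      simpa using this
    exact h1.cexp
  have hbd : ∀ x : ℝ, ‖exp (-(I * k * x) - I * l * y)‖ ≤ 1 := fun x => (norm_exp_planar k l x y).le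
  have hm : AEStronglyMeasurable (fun x : ℝ => exp (-(I * k * x) - I * l * y)) :=
    Continuous.aestronglyMeasurable (by fun_prop)
  have l1 := integrable_line hc hb y
  have l2 := integrable_line hc' hb' y
  have j1 : Integrable fun x : ℝ => exp (-(I * k * x) - I * l * y) * F (x, y) :=
    l1.bdd_mul hm (Eventually.of_forall hbd)
  have j2 : Integrable fun x : ℝ => exp (-(I * k * x) - I * l * y) * F' (x, y) :=
    l2.bdd_mul hm (Eventually.of_forall hbd)
  have := integral_mul_deriv_eq_deriv_mul_of_integrable
    (u := fun x : ℝ => exp (-(I * k * x) - I * l * y)) (v := fun x => F (x, y))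
    (u' := fun x : ℝ => exp (-(I * k * x) - I * l * y) * (-(I * k))) (v' := fun x => F' (x, y))
    (fun x _ => hE x) (fun x _ => hd x y) j2 ((j1.const_mul (-(I * k))).congr (Eventually.of_forall fun x => by
      simp only [Pi.mul_apply]; ring)) j1
  rw [this, ← integral_neg]
  congr 1
  ext x
  ring

theorem planar_deriv_snd (hc : Continuous F) (hc' : Continuous F')
    (hb : ∀ q, ‖F q‖ ≤ A * weight₂ q) (hb' : ∀ q, ‖F' q‖ ≤ A * weight₂ q)
    (hd : ∀ x y : ℝ, HasDerivAt (fun y => F (x, y)) (F' (x, y)) y) (k l : ℝ) :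
    planar F' k l = I * l * planar F k l := by
  have hw : ∀ q : ℝ × ℝ, weight₂ q.swap = weight₂ q := fun q => mul_comm _ _
  have := planar_deriv_fst (F := F ∘ Prod.swap) (F' := F' ∘ Prod.swap) (A := A)
    (hc.comp continuous_swap) (hc'.comp continuous_swap)
    (fun q => (hb q.swap).trans_eq (by rw [hw])) (fun q => (hb' q.swap).trans_eq (by rw [hw]))
    (fun x y => hd y x) l k
  rwa [planar_swap, planar_swap] at this

theorem planar_eq_iterated (hF : Integrable F) (k l : ℝ) :
    planar F k l = ∫ x : ℝ, ∫ y : ℝ, exp (-(I * k * x) - I * l * y) * F (x, y) := by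
  have := integrable_planar hF k l
  rw [planar, Measure.volume_eq_prod]
  rw [Measure.volume_eq_prod] at this
  exact integral_prod _ this

theorem planar_sub {G : ℝ × ℝ → ℂ} (hF : Integrable F) (hG : Integrable G) (k l : ℝ) :
    planar (fun q => F q - G q) k l = planar F k l - planar G k l := by
  simp only [planar, mul_sub]
  exact integral_sub (integrable_planar hF k l) (integrable_planar hG k l)

theorem continuousOn_planar_param {G : ℝ → ℝ × ℝ → ℂ} {S : Set ℝ}
    (hG : ∀ q, ContinuousOn (fun τ => G τ q) S) (hc : ∀ τ ∈ S, Continuous (G τ))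
    (hb : ∀ T : ℝ, ∃ A : ℝ, ∀ τ ∈ S, τ ≤ T → ∀ q, ‖G τ q‖ ≤ A * weight₂ q) (k l : ℝ) :
    ContinuousOn (fun τ => planar (G τ) k l) S := by
  intro τ₀ h₀
  obtain ⟨A, hA⟩ := hb (τ₀ + 1)
  have hev : ∀ᶠ τ in 𝓝[S] τ₀, τ ∈ S ∧ τ ≤ τ₀ + 1 :=
    eventually_mem_nhdsWithin.and (mem_nhdsWithin_of_mem_nhds (Iic_mem_nhds (by linarith)))
  refine continuousWithinAt_of_dominated (bound := fun q => A * weight₂ q) ?_ ?_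
    (integrable_weight₂.const_mul A) ?_
  · filter_upwards [hev] with τ hτ
    have := hc τ hτ.1
    exact Continuous.aestronglyMeasurable (by fun_prop)
  · filter_upwards [hev] with τ hτ
    refine Eventually.of_forall fun q => ?_
    rw [norm_mul, norm_exp_planar, one_mul]
    exact hA τ hτ.1 hτ.2 q
  · exact Eventually.of_forall fun q => (hG q τ₀ h₀).const_mul _

theorem hasDerivAt_planar_param {G G' : ℝ → ℝ × ℝ → ℂ} {S : Set ℝ} {τ₀ : ℝ} (hS : S ∈ 𝓝 τ₀)
    (hd : ∀ τ ∈ S, ∀ q, HasDerivAt (fun τ => G τ q) (G' τ q) τ)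
    (hc : ∀ τ ∈ S, Continuous (G τ)) (hc' : Continuous (G' τ₀))
    (hb : ∀ q, ‖G τ₀ q‖ ≤ A * weight₂ q)
    (hb' : ∀ τ ∈ S, ∀ q, ‖G' τ q‖ ≤ A * weight₂ q) (k l : ℝ) :
    HasDerivAt (fun τ => planar (G τ) k l) (planar (G' τ₀) k l) τ₀ := by
  have h₀ := mem_of_mem_nhds hS
  refine (hasDerivAt_integral_of_dominated_loc_of_deriv_le (bound := fun q => A * weight₂ q)
    (F := fun τ (q : ℝ × ℝ) => exp (-(I * k * q.1) - I * l * q.2) * G τ q)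
    (F' := fun τ (q : ℝ × ℝ) => exp (-(I * k * q.1) - I * l * q.2) * G' τ q)
    hS ?_ ?_ ?_ ?_ (integrable_weight₂.const_mul A) ?_).2
  · filter_upwards [hS] with τ hτ
    have := hc τ hτ
    exact Continuous.aestronglyMeasurable (by fun_prop)
  · exact integrable_planar (integrable_of_le_weight₂ (hc τ₀ h₀) hb) k l
  · exact Continuous.aestronglyMeasurable (by fun_prop)
  · refine Eventually.of_forall fun q τ hτ => ?_
    rw [norm_mul, norm_exp_planar, one_mul]
    exact hb' τ hτ q
  · exact Eventually.of_forall fun q τ hτ => (hd τ hτ q).const_mul _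

/-- The planar transform of a function with two derivatives is integrable. -/
theorem integrable_planar_transform {Fx Fxx Fy Fyy : ℝ × ℝ → ℂ}
    (hc : Continuous F) (hcx : Continuous Fx) (hcxx : Continuous Fxx) (hcy : Continuous Fy)
    (hcyy : Continuous Fyy) (hb : ∀ q, ‖F q‖ ≤ A * weight₂ q) (hbx : ∀ q, ‖Fx q‖ ≤ A * weight₂ q)
    (hbxx : ∀ q, ‖Fxx q‖ ≤ A * weight₂ q) (hby : ∀ q, ‖Fy q‖ ≤ A * weight₂ q)
    (hbyy : ∀ q, ‖Fyy q‖ ≤ A * weight₂ q)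
    (hdx : ∀ x y : ℝ, HasDerivAt (fun x => F (x, y)) (Fx (x, y)) x)
    (hdxx : ∀ x y : ℝ, HasDerivAt (fun x => Fx (x, y)) (Fxx (x, y)) x)
    (hdy : ∀ x y : ℝ, HasDerivAt (fun y => F (x, y)) (Fy (x, y)) y)
    (hdyy : ∀ x y : ℝ, HasDerivAt (fun y => Fy (x, y)) (Fyy (x, y)) y) :
    Integrable fun ξ : ℝ × ℝ => planar F ξ.1 ξ.2 := by
  have iF := integrable_of_le_weight₂ hc hb
  have ixx := integrable_of_le_weight₂ hcxx hbxx
  have iyy := integrable_of_le_weight₂ hcyy hbyy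
  -- Two derivatives give only the pointwise bound `O(|ξ|⁻²)`, not integrable on the plane. Instead,
  -- the transform of `G` is `(1 + |ξ|²)` times that of `F` and is square integrable, as is `(1 +
  -- |ξ|²)⁻¹`.
  set G : ℝ × ℝ → ℂ := fun q => F q - Fxx q - Fyy q with hG
  have hGb : ∀ q, ‖G q‖ ≤ 3 * A * weight₂ q := fun q => by
    have h1 := norm_sub_le (F q - Fxx q) (Fyy q)
    have h2 := norm_sub_le (F q) (Fxx q)
    linarith [hb q, hbxx q, hbyy q]
  have hGc : Continuous G := (hc.sub hcxx).sub hcyy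
  have iG := integrable_of_le_weight₂ hGc hGb
  have hA0 : 0 ≤ A := by
    have := (norm_nonneg _).trans (hb 0)
    exact nonneg_of_mul_nonneg_left this (weight₂_pos 0)
  have hsq := integrable_norm_sq_planar iG (M := 3 * A) fun q => (hGb q).trans (by
    nlinarith [weight₂_le_one q])
  have hrel : ∀ k l : ℝ, planar G k l = (1 + (k : ℂ) ^ 2 + l ^ 2) * planar F k l := by
    intro k l
    rw [hG, planar_sub (F := fun q => F q - Fxx q) (iF.sub ixx) iyy, planar_sub iF ixx,
      planar_deriv_fst hcx hcxx hbx hbxx hdxx, planar_deriv_fst hc hcx hb hbx hdx,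
      planar_deriv_snd hcy hcyy hby hbyy hdyy, planar_deriv_snd hc hcy hb hby hdy]
    linear_combination (-((k : ℂ) ^ 2 + l ^ 2) * planar F k l) * I_sq
  have hker : Integrable fun ξ : ℝ × ℝ => (1 + ξ.1 ^ 2)⁻¹ * (1 + ξ.2 ^ 2)⁻¹ :=
    integrable_inv_one_add_sq.mul_prod integrable_inv_one_add_sq
  refine (hsq.add hker).mono' (continuous_planar iF).aestronglyMeasurable
    (Eventually.of_forall fun ξ => ?_)
  have e1 : ‖planar G ξ.1 ξ.2‖ = (1 + ξ.1 ^ 2 + ξ.2 ^ 2) * ‖planar F ξ.1 ξ.2‖ := by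
    rw [hrel, norm_mul]
    congr 1
    have : (1 + (ξ.1 : ℂ) ^ 2 + (ξ.2 : ℂ) ^ 2) = ((1 + ξ.1 ^ 2 + ξ.2 ^ 2 : ℝ) : ℂ) := by push_cast; ring
    rw [this, norm_real, Real.norm_of_nonneg (by positivity)]
  have e2 : ‖planar F ξ.1 ξ.2‖ = ‖planar G ξ.1 ξ.2‖ * (1 + ξ.1 ^ 2 + ξ.2 ^ 2)⁻¹ := by
    rw [e1]; field_simp
  -- Square integrability of the multiplier by comparison with a product; the conclusion then
  -- follows from `ab ≤ a² + b²`.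
  have e3 : ((1 + ξ.1 ^ 2 + ξ.2 ^ 2)⁻¹) ^ 2 ≤ (1 + ξ.1 ^ 2)⁻¹ * (1 + ξ.2 ^ 2)⁻¹ := by
    rw [← mul_inv, inv_pow]
    apply inv_anti₀ (by positivity)
    nlinarith [sq_nonneg ξ.1, sq_nonneg ξ.2, mul_nonneg (sq_nonneg ξ.1) (sq_nonneg ξ.2), sq_nonneg (ξ.1^2), sq_nonneg (ξ.2^2)]
  rw [e2]
  simp only [Pi.add_apply]
  nlinarith [sq_nonneg (‖planar G ξ.1 ξ.2‖ - (1 + ξ.1 ^ 2 + ξ.2 ^ 2)⁻¹), sq_nonneg ‖planar G ξ.1 ξ.2‖,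
    sq_nonneg ((1 + ξ.1 ^ 2 + ξ.2 ^ 2)⁻¹)]

end planar

end HalfSpace

end


noncomputable section

namespace HalfSpace

open Filter Topology Set

/-! ### Decaying functions and their partial derivatives -/

section decays

variable {E : Type*} [NormedAddCommGroup E] [NormedSpace ℝ E] {s r : Set E} {ρ : E → ℝ} {n : ℕ}
  {A B : ℝ} {f g : E → ℝ}

/-- `f` is of class `C^n` on `s`, and on `s ∩ r` its derivatives are bounded by `A ρ`. -/
structure Decays (s r : Set E) (ρ : E → ℝ) (n : ℕ) (A : ℝ) (f : E → ℝ) : Prop where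
  contDiffOn : ContDiffOn ℝ n f s
  bound : ∀ j ≤ n, ∀ p ∈ s, p ∈ r → ‖iteratedFDerivWithin ℝ j f s p‖ ≤ A * ρ p

theorem Decays.abs_le (h : Decays s r ρ n A f) {p : E} (hp : p ∈ s) (hr : p ∈ r) :
    |f p| ≤ A * ρ p := by
  have := h.bound 0 (Nat.zero_le _) p hp hr
  rwa [norm_iteratedFDerivWithin_zero] at this

theorem Decays.mono (h : Decays s r ρ n A f) {m : ℕ} (hm : m ≤ n) : Decays s r ρ m A f :=
  ⟨h.contDiffOn.of_le (by exact_mod_cast hm), fun j hj => h.bound j (hj.trans hm)⟩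

theorem Decays.sub (hs : UniqueDiffOn ℝ s) (hf : Decays s r ρ n A f) (hg : Decays s r ρ n B g) :
    Decays s r ρ n (A + B) (fun p => f p - g p) := by
  refine ⟨hf.contDiffOn.sub hg.contDiffOn, fun j hj p hp hr => ?_⟩
  have hj' : (j : WithTop ℕ∞) ≤ n := by exact_mod_cast hj
  rw [fun_iteratedFDerivWithin_sub_apply ((hf.contDiffOn.of_le hj') p hp)
    ((hg.contDiffOn.of_le hj') p hp) hs hp, add_mul]
  exact (norm_sub_le _ _).trans (add_le_add (hf.bound j hj p hp hr) (hg.bound j hj p hp hr))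

theorem Decays.deriv (hs : UniqueDiffOn ℝ s) (h : Decays s r ρ (n + 1) A f) {e : E}
    (he : ‖e‖ ≤ 1) : Decays s r ρ n A (fun p => fderivWithin ℝ f s p e) := by
  have hd : ContDiffOn ℝ n (fderivWithin ℝ f s) s :=
    h.contDiffOn.fderivWithin hs (by norm_cast)
  refine ⟨hd.clm_apply contDiffOn_const, fun j hj p hp hr => ?_⟩
  refine (norm_iteratedFDerivWithin_clm_apply_const (hd p hp) hs hp (by exact_mod_cast hj)).trans ?_
  rw [norm_iteratedFDerivWithin_fderivWithin hs hp]
  exact (mul_le_of_le_one_left (norm_nonneg _) he).trans (h.bound (j + 1) (by omega) p hp hr)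

theorem Decays.differentiableOn (h : Decays s r ρ (n + 1) A f) : DifferentiableOn ℝ f s :=
  h.contDiffOn.differentiableOn (by simp)

/-- The derivative of `f` along a curve in `s`. -/
theorem hasDerivAt_comp_line (hf : DifferentiableOn ℝ f s) {γ : ℝ → E} {e : E} {τ : ℝ}
    (hγ : HasDerivAt γ e τ) (hmem : ∀ᶠ σ in 𝓝 τ, γ σ ∈ s) :
    HasDerivAt (fun σ => f (γ σ)) (fderivWithin ℝ f s (γ τ) e) τ := by
  have h1 := (hf _ hmem.self_of_nhds).hasFDerivWithinAt
  have h2 : HasDerivWithinAt (f ∘ γ) _ {σ | γ σ ∈ s} τ :=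
    h1.comp_hasDerivWithinAt τ hγ.hasDerivWithinAt (fun σ hσ => hσ)
  exact h2.hasDerivAt hmem

end decays

/-! ### Splitting the decay into weights, and calculus on the space-time domain -/

/-- The weight is controlled by any larger argument. -/
theorem rpow_le_weight {x S : ℝ} (h : |x| ≤ S) : (1 + S) ^ (-(4 / 3) : ℝ) ≤ weight x :=
  Real.rpow_le_rpow_of_nonpos (by positivity) (by linarith) (by norm_num)

/-- Decay of order `4n` is decay by `3n` factors of exponent `4/3`; these can be distributed over
the variables, one factor per variable being enough for integrability. -/
theorem inv_pow_eq_rpow {S : ℝ} (hS : 0 ≤ S) (n : ℕ) :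
    1 / (1 + S) ^ (4 * n) = ((1 + S) ^ (-(4 / 3) : ℝ)) ^ (3 * n) := by
  rw [← Real.rpow_natCast ((1 + S) ^ (-(4 / 3) : ℝ)), ← Real.rpow_mul (by positivity),
    one_div, ← Real.rpow_natCast, ← Real.rpow_neg (by positivity)]
  congr 1
  push_cast
  ring

theorem convex_domain : Convex ℝ domain := by
  intro p hp q hq a b ha hb _
  simp only [domain, mem_ofPred_eq] at *
  constructor
  · simp only [Prod.snd_add, Prod.smul_snd, Prod.fst_add, Prod.smul_fst, smul_eq_mul]
    nlinarith [mul_nonneg ha hp.1, mul_nonneg hb hq.1]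
  · simp only [Prod.snd_add, Prod.smul_snd, smul_eq_mul]
    nlinarith [mul_nonneg ha hp.2, mul_nonneg hb hq.2]

theorem uniqueDiffOn_domain : UniqueDiffOn ℝ domain := by
  refine uniqueDiffOn_convex convex_domain ⟨(0, 0, 1, 1), ?_⟩
  refine mem_interior.2 ⟨{p : ℝ × ℝ × ℝ × ℝ | 0 < p.2.2.1 ∧ 0 < p.2.2.2}, ?_, ?_, ?_⟩
  · intro p hp
    exact ⟨le_of_lt hp.1, le_of_lt hp.2⟩
  · exact (isOpen_lt continuous_const
      (f := fun _ => (0 : ℝ)) (g := fun p : ℝ × ℝ × ℝ × ℝ => p.2.2.1) (by fun_prop)).inter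
      (isOpen_lt continuous_const
      (f := fun _ => (0 : ℝ)) (g := fun p : ℝ × ℝ × ℝ × ℝ => p.2.2.2) (by fun_prop))
  · simp

/-- Continuity up to the boundary and decay of a function on the domain. -/
def Tame (g : ℝ × ℝ × ℝ × ℝ → ℝ) : Prop :=
  ContinuousOn g domain ∧ ∀ T : ℝ, ∃ A : ℝ, 0 ≤ A ∧ ∀ x y z t : ℝ, 0 ≤ z → 0 ≤ t → t ≤ T →
    |g (x, y, z, t)| ≤ A * weight z * weight₂ (x, y)

/-- The weight on the domain. -/
def weight₄ (p : ℝ × ℝ × ℝ × ℝ) : ℝ := weight p.2.2.1 * weight₂ (p.1, p.2.1)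

theorem ClassicalDecaying.decays {f : ℝ × ℝ × ℝ × ℝ → ℝ} (hf : ClassicalDecaying f) (T : ℝ) :
    ∃ A : ℝ, 0 ≤ A ∧ Decays domain {p | p.2.2.2 ≤ T} weight₄ 2 A f := by
  obtain ⟨A, hA⟩ := hf.2 T
  refine ⟨max A 0, le_max_right _ _, hf.1, fun j hj p hp hr => ?_⟩
  obtain ⟨x, y, z, t⟩ := p
  refine (hA x y z t hp.1 hp.2 hr j hj).trans ?_
  have h1 := inv_pow_eq_rpow (S := |x| + |y| + |z|) (by positivity) 1
  have hx := rpow_le_weight (x := x) (S := |x| + |y| + |z|) (by linarith [abs_nonneg y, abs_nonneg z])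
  have hy := rpow_le_weight (x := y) (S := |x| + |y| + |z|) (by linarith [abs_nonneg x, abs_nonneg z])
  have hz := rpow_le_weight (x := z) (S := |x| + |y| + |z|) (by linarith [abs_nonneg y, abs_nonneg x])
  have hσ : 0 < (1 + (|x| + |y| + |z|)) ^ (-(4 / 3) : ℝ) := by positivity
  set σ := (1 + (|x| + |y| + |z|)) ^ (-(4 / 3) : ℝ)
  have h2 : 1 / (1 + |x| + |y| + |z|) ^ 4 = σ ^ 3 := by
    rw [← show 4 * 1 = 4 from rfl, ← show 3 * 1 = 3 from rfl, ← h1]; congr 2; ring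
  rw [div_eq_mul_one_div, h2]
  -- One of the three factors is given to each of `x`, `y` and `z`.
  have h3 : σ ^ 3 ≤ weight₄ (x, y, z, t) := by
    have : σ ^ 3 = σ * (σ * σ) := by ring
    rw [this, weight₄, weight₂]
    exact mul_le_mul hz (mul_le_mul hx hy hσ.le (weight_pos _).le) (by positivity) (weight_pos _).le
  exact mul_le_mul (le_max_left _ _) h3 (by positivity) (le_max_right _ _)

theorem Decays.tame {n : ℕ} {g : ℝ × ℝ × ℝ × ℝ → ℝ}
    (h : ∀ T : ℝ, ∃ A : ℝ, 0 ≤ A ∧ Decays domain {p | p.2.2.2 ≤ T} weight₄ n A g) : Tame g := by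
  refine ⟨(h 0).choose_spec.2.contDiffOn.continuousOn, fun T => ?_⟩
  obtain ⟨A, hA, hd⟩ := h T
  refine ⟨A, hA, fun x y z t hz ht htT => ?_⟩
  have := hd.abs_le (p := (x, y, z, t)) ⟨hz, ht⟩ htT
  rwa [weight₄, ← mul_assoc] at this

namespace ClassicalDecaying

variable {f : ℝ × ℝ × ℝ × ℝ → ℝ} {e e' : ℝ × ℝ × ℝ × ℝ}

theorem decays_pd (hf : ClassicalDecaying f) (he : ‖e‖ ≤ 1) (T : ℝ) :
    ∃ A : ℝ, 0 ≤ A ∧ Decays domain {p | p.2.2.2 ≤ T} weight₄ 1 A (pd e f) := by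
  obtain ⟨A, hA, h⟩ := hf.decays T
  exact ⟨A, hA, h.deriv uniqueDiffOn_domain he⟩

theorem decays_pd_pd (hf : ClassicalDecaying f) (he : ‖e‖ ≤ 1) (he' : ‖e'‖ ≤ 1) (T : ℝ) :
    ∃ A : ℝ, 0 ≤ A ∧ Decays domain {p | p.2.2.2 ≤ T} weight₄ 0 A (pd e' (pd e f)) := by
  obtain ⟨A, hA, h⟩ := hf.decays_pd he T
  exact ⟨A, hA, h.deriv uniqueDiffOn_domain he'⟩

theorem tame (hf : ClassicalDecaying f) : Tame f := Decays.tame hf.decays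

theorem tame_pd (hf : ClassicalDecaying f) (he : ‖e‖ ≤ 1) : Tame (pd e f) := Decays.tame
    (hf.decays_pd he)

theorem tame_pd_pd (hf : ClassicalDecaying f) (he : ‖e‖ ≤ 1) (he' : ‖e'‖ ≤ 1) : Tame
    (pd e' (pd e f)) :=
  Decays.tame (hf.decays_pd_pd he he')

theorem differentiableOn (hf : ClassicalDecaying f) : DifferentiableOn ℝ f domain :=
    hf.1.differentiableOn (by norm_num)

theorem differentiableOn_pd (hf : ClassicalDecaying f) (he : ‖e‖ ≤ 1) : DifferentiableOn ℝ
    (pd e f) domain :=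
  (hf.decays_pd he 0).choose_spec.2.differentiableOn

end ClassicalDecaying

theorem norm_e₁ : ‖((1, 0, 0, 0) : ℝ × ℝ × ℝ × ℝ)‖ ≤ 1 := by simp [Prod.norm_def]
theorem norm_e₂ : ‖((0, 1, 0, 0) : ℝ × ℝ × ℝ × ℝ)‖ ≤ 1 := by simp [Prod.norm_def]
theorem norm_e₃ : ‖((0, 0, 1, 0) : ℝ × ℝ × ℝ × ℝ)‖ ≤ 1 := by simp [Prod.norm_def]
theorem norm_e₄ : ‖((0, 0, 0, 1) : ℝ × ℝ × ℝ × ℝ)‖ ≤ 1 := by simp [Prod.norm_def]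

section partial_derivatives

variable {g : ℝ × ℝ × ℝ × ℝ → ℝ} {x y z t : ℝ}

theorem hasDerivAt_dx (hg : DifferentiableOn ℝ g domain) (hz : 0 ≤ z) (ht : 0 ≤ t) :
    HasDerivAt (fun x => g (x, y, z, t)) (dx g (x, y, z, t)) x :=
  hasDerivAt_comp_line hg (γ := fun x => (x, y, z, t))
    ((hasDerivAt_id x).prodMk (hasDerivAt_const x (y, z, t))) (Eventually.of_forall fun _ => ⟨hz, ht⟩)

theorem hasDerivAt_dy (hg : DifferentiableOn ℝ g domain) (hz : 0 ≤ z) (ht : 0 ≤ t) :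
    HasDerivAt (fun y => g (x, y, z, t)) (dy g (x, y, z, t)) y :=
  hasDerivAt_comp_line hg (γ := fun y => (x, y, z, t))
    ((hasDerivAt_const y x).prodMk ((hasDerivAt_id y).prodMk (hasDerivAt_const y (z, t))))
    (Eventually.of_forall fun _ => ⟨hz, ht⟩)

theorem hasDerivAt_dz (hg : DifferentiableOn ℝ g domain) (hz : 0 < z) (ht : 0 ≤ t) :
    HasDerivAt (fun z => g (x, y, z, t)) (dz g (x, y, z, t)) z :=
  hasDerivAt_comp_line hg (γ := fun z => (x, y, z, t))
    ((hasDerivAt_const z x).prodMk ((hasDerivAt_const z y).prodMk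
      ((hasDerivAt_id z).prodMk (hasDerivAt_const z t))))
    ((lt_mem_nhds hz).mono fun _ h => ⟨h.le, ht⟩)

theorem hasDerivAt_dt (hg : DifferentiableOn ℝ g domain) (hz : 0 ≤ z) (ht : 0 < t) :
    HasDerivAt (fun t => g (x, y, z, t)) (dt g (x, y, z, t)) t :=
  hasDerivAt_comp_line hg (γ := fun t => (x, y, z, t))
    ((hasDerivAt_const t x).prodMk ((hasDerivAt_const t y).prodMk
      ((hasDerivAt_const t z).prodMk (hasDerivAt_id t))))
    ((lt_mem_nhds ht).mono fun _ h => ⟨hz, h.le⟩)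

end partial_derivatives

/-- The Fourier transform in `(x, y)` of a function on the domain. -/
def layer (g : ℝ × ℝ × ℝ × ℝ → ℝ) (k l z t : ℝ) : ℂ :=
  planar (fun q => (g (q.1, q.2, z, t) : ℂ)) k l

namespace Tame

variable {g : ℝ × ℝ × ℝ × ℝ → ℝ} {k l z t : ℝ}

theorem continuous_slice (hg : Tame g) (hz : 0 ≤ z) (ht : 0 ≤ t) :
    Continuous fun q : ℝ × ℝ => (g (q.1, q.2, z, t) : ℂ) :=
  continuous_ofReal.comp (hg.1.comp_continuous (f := fun q : ℝ × ℝ => (q.1, q.2, z, t))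
    (by fun_prop) fun _ => ⟨hz, ht⟩)

theorem norm_slice_le (hg : Tame g) (T : ℝ) : ∃ A : ℝ, 0 ≤ A ∧ ∀ z t : ℝ, 0 ≤ z → 0 ≤ t → t ≤ T →
    ∀ q : ℝ × ℝ, ‖(g (q.1, q.2, z, t) : ℂ)‖ ≤ A * weight z * weight₂ q := by
  obtain ⟨A, hA, h⟩ := hg.2 T
  refine ⟨A, hA, fun z t hz ht htT q => ?_⟩
  rw [norm_real]
  exact h q.1 q.2 z t hz ht htT

theorem norm_slice_le' (hg : Tame g) (T : ℝ) : ∃ A : ℝ, 0 ≤ A ∧ ∀ z t : ℝ, 0 ≤ z → 0 ≤ t → t ≤ T →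
    ∀ q : ℝ × ℝ, ‖(g (q.1, q.2, z, t) : ℂ)‖ ≤ A * weight₂ q := by
  obtain ⟨A, hA, h⟩ := hg.norm_slice_le T
  refine ⟨A, hA, fun z t hz ht htT q => (h z t hz ht htT q).trans ?_⟩
  have := weight₂_pos q
  gcongr
  exact mul_le_of_le_one_right hA (weight_le_one z)

theorem integrable_slice (hg : Tame g) (hz : 0 ≤ z) (ht : 0 ≤ t) :
    Integrable fun q : ℝ × ℝ => (g (q.1, q.2, z, t) : ℂ) := by
  obtain ⟨A, _, h⟩ := hg.norm_slice_le t
  exact integrable_of_le_weight₂ (hg.continuous_slice hz ht) (h z t hz ht le_rfl)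

theorem exists_norm_layer_le (hg : Tame g) (T : ℝ) : ∃ A : ℝ, 0 ≤ A ∧ ∀ k l z t :
    ℝ, 0 ≤ z → 0 ≤ t → t ≤ T →
    ‖layer g k l z t‖ ≤ A * weight z := by
  obtain ⟨A, hA, h⟩ := hg.norm_slice_le T
  refine ⟨A * ∫ q, weight₂ q, mul_nonneg hA integral_weight₂_nonneg, fun k l z t hz ht htT => ?_⟩
  refine (norm_planar_le_of_le_weight₂ (h z t hz ht htT) k l).trans_eq ?_
  ring

theorem continuousOn_layer_z (hg : Tame g) (ht : 0 ≤ t) : ContinuousOn (fun z => layer g k l z t)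
    (Ici 0) := by
  obtain ⟨A, _, h⟩ := hg.norm_slice_le' t
  refine continuousOn_planar_param (fun q => ?_) (fun z hz => hg.continuous_slice hz ht)
    (fun _ => ⟨A, fun z hz _ => h z t hz ht le_rfl⟩) k l
  exact continuous_ofReal.comp_continuousOn (hg.1.comp (f := fun z : ℝ => (q.1, q.2, z, t))
    (Continuous.continuousOn (by fun_prop)) fun z hz => ⟨hz, ht⟩)

theorem continuousOn_layer_t (hg : Tame g) (hz : 0 ≤ z) : ContinuousOn (fun t => layer g k l z t)
    (Ici 0) := by
  refine continuousOn_planar_param (fun q => ?_) (fun t ht => hg.continuous_slice hz ht)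
    (fun T => ?_) k l
  · exact continuous_ofReal.comp_continuousOn (hg.1.comp (f := fun t : ℝ => (q.1, q.2, z, t))
      (Continuous.continuousOn (by fun_prop)) fun t ht => ⟨hz, ht⟩)
  · obtain ⟨A, _, h⟩ := hg.norm_slice_le' T
    exact ⟨A, fun t ht htT => h z t hz ht htT⟩

theorem layer_dx (hg : Tame g) (hd : DifferentiableOn ℝ g domain) (hgx : Tame (dx g)) (hz : 0 ≤ z)
    (ht : 0 ≤ t) :
    layer (dx g) k l z t = I * k * layer g k l z t := by
  obtain ⟨A, hA, h⟩ := hg.norm_slice_le' t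
  obtain ⟨A', hA', h'⟩ := hgx.norm_slice_le' t
  refine planar_deriv_fst (A := A + A') (hg.continuous_slice hz ht) (hgx.continuous_slice hz ht)
    (fun q => (h z t hz ht le_rfl q).trans ?_) (fun q => (h' z t hz ht le_rfl q).trans ?_)
    (fun x y => (hasDerivAt_dx hd hz ht).ofReal_comp) k l
  · have := weight₂_pos q; gcongr; linarith
  · have := weight₂_pos q; gcongr; linarith

theorem layer_dy (hg : Tame g) (hd : DifferentiableOn ℝ g domain) (hgy : Tame (dy g)) (hz : 0 ≤ z)
    (ht : 0 ≤ t) :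
    layer (dy g) k l z t = I * l * layer g k l z t := by
  obtain ⟨A, hA, h⟩ := hg.norm_slice_le' t
  obtain ⟨A', hA', h'⟩ := hgy.norm_slice_le' t
  refine planar_deriv_snd (A := A + A') (hg.continuous_slice hz ht) (hgy.continuous_slice hz ht)
    (fun q => (h z t hz ht le_rfl q).trans ?_) (fun q => (h' z t hz ht le_rfl q).trans ?_)
    (fun x y => (hasDerivAt_dy hd hz ht).ofReal_comp) k l
  · have := weight₂_pos q; gcongr; linarith
  · have := weight₂_pos q; gcongr; linarith

theorem hasDerivAt_layer_z (hg : Tame g) (hd : DifferentiableOn ℝ g domain) (hgz : Tame (dz g))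
    (hz : 0 < z) (ht : 0 ≤ t) :
    HasDerivAt (fun z => layer g k l z t) (layer (dz g) k l z t) z := by
  obtain ⟨A, hA, h⟩ := hg.norm_slice_le' t
  obtain ⟨A', hA', h'⟩ := hgz.norm_slice_le' t
  refine hasDerivAt_planar_param (A := A + A') (Ioi_mem_nhds hz)
    (G := fun z (q : ℝ × ℝ) => (g (q.1, q.2, z, t) : ℂ))
    (G' := fun z (q : ℝ × ℝ) => (dz g (q.1, q.2, z, t) : ℂ))
    (fun ζ hζ q => (hasDerivAt_dz hd hζ ht).ofReal_comp)
    (fun ζ hζ => hg.continuous_slice (le_of_lt hζ) ht) (hgz.continuous_slice hz.le ht)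
    (fun q => (h z t hz.le ht le_rfl q).trans ?_)
    (fun ζ hζ q => (h' ζ t (le_of_lt hζ) ht le_rfl q).trans ?_) k l
  · have := weight₂_pos q; gcongr; linarith
  · have := weight₂_pos q; gcongr; linarith

theorem hasDerivAt_layer_t (hg : Tame g) (hd : DifferentiableOn ℝ g domain) (hgt : Tame (dt g))
    (hz : 0 ≤ z) (ht : 0 < t) :
    HasDerivAt (fun t => layer g k l z t) (layer (dt g) k l z t) t := by
  obtain ⟨A, hA, h⟩ := hg.norm_slice_le' (t + 1)
  obtain ⟨A', hA', h'⟩ := hgt.norm_slice_le' (t + 1)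
  refine hasDerivAt_planar_param (A := A + A') (Ioo_mem_nhds ht (lt_add_one t))
    (G := fun t (q : ℝ × ℝ) => (g (q.1, q.2, z, t) : ℂ))
    (G' := fun t (q : ℝ × ℝ) => (dt g (q.1, q.2, z, t) : ℂ))
    (fun τ hτ q => (hasDerivAt_dt hd hz hτ.1).ofReal_comp)
    (fun τ hτ => hg.continuous_slice hz hτ.1.le) (hgt.continuous_slice hz ht.le)
    (fun q => (h z t hz ht.le (by linarith) q).trans ?_)
    (fun τ hτ q => (h' z τ hz hτ.1.le hτ.2.le q).trans ?_) k l
  · have := weight₂_pos q; gcongr; linarith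
  · have := weight₂_pos q; gcongr; linarith

end Tame

end HalfSpace

end


noncomputable section

namespace HalfSpace

open Filter Topology Set

/-! ### Transforms of the data as planar transforms -/

/-- Only `z > 0` is seen by the transform, which matches the range in which the initial conditions
are stated. -/
theorem hat_congr {f g : ℝ × ℝ × ℝ → ℝ} (h : ∀ x y z, 0 < z → f (x, y, z) = g (x, y, z)) (k l : ℝ)
    (m : ℂ) : hat f k l m = hat g k l m := by
  simp only [hat]
  congr 1; ext x; congr 1; ext y
  refine setIntegral_congr_fun measurableSet_Ioi fun z hz => ?_
  simp only [h x y z hz]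

/-- Fubini: the product of the weights is an integrable majorant, because the exponential in `z` has
modulus at most one for `Im m ≤ 0`. -/
theorem hat_eq_lap {f : ℝ × ℝ × ℝ → ℝ} {A : ℝ} (hc : ContinuousOn f halfSpace)
    (hb : ∀ x y z, 0 ≤ z → |f (x, y, z)| ≤ A * weight z * weight₂ (x, y)) (k l : ℝ) {m : ℂ}
    (hm : m.im ≤ 0) :
    hat f k l m = lap (fun z => planar (fun q => (f (q.1, q.2, z) : ℂ)) k l) m := by
  set H : ℝ × ℝ → ℝ → ℂ := fun q z =>
    exp (-(I * k * q.1) - I * l * q.2 - I * m * z) * (f (q.1, q.2, z) : ℂ) with hH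
  have hHint : Integrable (Function.uncurry H)
      ((volume : Measure (ℝ × ℝ)).prod (volume.restrict (Ioi (0 : ℝ)))) := by
    have hdom : Integrable (fun p : (ℝ × ℝ) × ℝ => weight₂ p.1 * (A * weight p.2))
        ((volume : Measure (ℝ × ℝ)).prod (volume.restrict (Ioi (0 : ℝ)))) :=
      integrable_weight₂.mul_prod (integrable_weight.const_mul A).integrableOn
    have hrestr : (volume : Measure (ℝ × ℝ)).prod (volume.restrict (Ioi (0 : ℝ)))
        = ((volume : Measure (ℝ × ℝ)).prod volume).restrict (univ ×ˢ Ioi 0) := by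
      rw [← Measure.prod_restrict, Measure.restrict_univ]
    have hms : MeasurableSet (univ ×ˢ Ioi 0 : Set ((ℝ × ℝ) × ℝ)) :=
      MeasurableSet.univ.prod measurableSet_Ioi
    refine hdom.mono' ?_ ?_
    · rw [hrestr]
      refine ContinuousOn.aestronglyMeasurable ?_ hms
      refine ContinuousOn.mul (Continuous.continuousOn (by fun_prop)) ?_
      exact continuous_ofReal.comp_continuousOn (hc.comp
        (f := fun p : (ℝ × ℝ) × ℝ => (p.1.1, p.1.2, p.2)) (Continuous.continuousOn (by fun_prop))
        fun p hp => (le_of_lt hp.2 : (0 : ℝ) ≤ p.2))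
    · rw [hrestr, ae_restrict_iff' hms]
      refine Eventually.of_forall fun p hp => ?_
      have hz : 0 ≤ p.2 := le_of_lt hp.2
      simp only [Function.uncurry, hH]
      rw [sub_eq_add_neg, exp_add, norm_mul, norm_mul, norm_exp_planar, one_mul, norm_real]
      calc _ ≤ 1 * |f (p.1.1, p.1.2, p.2)| :=
            mul_le_mul_of_nonneg_right (norm_exp_lap hm hz) (abs_nonneg _)
        _ ≤ _ := by
            rw [one_mul]
            refine (hb p.1.1 p.1.2 p.2 hz).trans_eq ?_
            ring
  have h1 : hat f k l m = ∫ q : ℝ × ℝ, ∫ z in Ioi (0 : ℝ), H q z := by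
    have : Integrable (fun q => ∫ z in Ioi (0 : ℝ), H q z) := hHint.integral_prod_left
    rw [Measure.volume_eq_prod] at this ⊢
    rw [integral_prod _ this]
    rfl
  rw [h1, integral_integral_swap hHint, lap]
  congr 1
  ext z
  rw [planar, ← integral_const_mul]
  congr 1
  ext q
  simp only [hH]
  rw [sub_eq_add_neg, exp_add]
  ring

theorem tilde_eq_planar {g : ℝ × ℝ × ℝ → ℝ} {G : ℝ × ℝ → ℂ} {t : ℝ}
    (h : ∀ x y, (g (x, y, t) : ℂ) = G (x, y)) (hG : Integrable G) (k l : ℝ) :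
    tilde g k l t = planar G k l := by
  rw [planar_eq_iterated hG, tilde]
  simp only [h]

/-! ### The half-line problem satisfied by the planar transform of a solution -/

theorem layer_eq_sum {n : ℕ} {g : ℝ × ℝ × ℝ × ℝ → ℝ} {c : Fin n → ℝ}
    {F : Fin n → ℝ × ℝ × ℝ × ℝ → ℝ} (hF : ∀ i, Tame (F i)) {z t : ℝ} (hz : 0 ≤ z) (ht : 0 ≤ t)
    (h : ∀ x y, g (x, y, z, t) = ∑ i, c i * F i (x, y, z, t)) (k l : ℝ) :
    layer g k l z t = ∑ i, c i * layer (F i) k l z t := by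
  simp only [layer, planar]
  simp only [← integral_const_mul]
  rw [← integral_finsetSum _ fun i _ =>
    (integrable_planar ((hF i).integrable_slice hz ht) k l).const_mul _]
  congr 1
  ext q
  rw [h]
  push_cast
  rw [Finset.mul_sum]
  refine Finset.sum_congr rfl fun i _ => ?_
  ring

namespace ClassicalDecaying

variable {f : ℝ × ℝ × ℝ × ℝ → ℝ} {z t : ℝ}

/-- The planar transform of a decaying function of class `C²`. -/
def halfLine (hf : ClassicalDecaying f) (k l : ℝ) : HalfLineFunction where
  f := layer f k l
  fz := layer (dz f) k l
  fzz := layer (dz (dz f)) k l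
  ft := layer (dt f) k l
  ftt := layer (dt (dt f)) k l
  bound T := by
    obtain ⟨A₁, a₁, h₁⟩ := hf.tame.exists_norm_layer_le T
    obtain ⟨A₂, a₂, h₂⟩ := (hf.tame_pd norm_e₃).exists_norm_layer_le T
    obtain ⟨A₃, a₃, h₃⟩ := (hf.tame_pd_pd norm_e₃ norm_e₃).exists_norm_layer_le T
    obtain ⟨A₄, a₄, h₄⟩ := (hf.tame_pd norm_e₄).exists_norm_layer_le T
    obtain ⟨A₅, a₅, h₅⟩ := (hf.tame_pd_pd norm_e₄ norm_e₄).exists_norm_layer_le T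
    refine ⟨A₁ + A₂ + A₃ + A₄ + A₅, fun z t hz ht htT => ?_⟩
    have hw := (weight_pos z).le
    refine ⟨(h₁ k l z t hz ht htT).trans ?_, (h₂ k l z t hz ht htT).trans ?_,
      (h₃ k l z t hz ht htT).trans ?_, (h₄ k l z t hz ht htT).trans ?_,
      (h₅ k l z t hz ht htT).trans ?_⟩ <;>
    exact mul_le_mul_of_nonneg_right (by linarith) hw
  cont_z t ht := hf.tame.continuousOn_layer_z ht
  cont_z_fz t ht := (hf.tame_pd norm_e₃).continuousOn_layer_z ht
  cont_z_fzz t ht := (hf.tame_pd_pd norm_e₃ norm_e₃).continuousOn_layer_z ht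
  cont_z_ft t ht := (hf.tame_pd norm_e₄).continuousOn_layer_z ht
  cont_z_ftt t ht := (hf.tame_pd_pd norm_e₄ norm_e₄).continuousOn_layer_z ht
  cont_t z hz := hf.tame.continuousOn_layer_t hz
  cont_t_fz z hz := (hf.tame_pd norm_e₃).continuousOn_layer_t hz
  cont_t_ft z hz := (hf.tame_pd norm_e₄).continuousOn_layer_t hz
  deriv_z z t hz ht := hf.tame.hasDerivAt_layer_z hf.differentiableOn (hf.tame_pd norm_e₃) hz ht
  deriv_z_fz z t hz ht := (hf.tame_pd norm_e₃).hasDerivAt_layer_z (hf.differentiableOn_pd norm_e₃)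
    (hf.tame_pd_pd norm_e₃ norm_e₃) hz ht
  deriv_t z t hz ht := hf.tame.hasDerivAt_layer_t hf.differentiableOn (hf.tame_pd norm_e₄) hz ht
  deriv_t_ft z t hz ht := (hf.tame_pd norm_e₄).hasDerivAt_layer_t (hf.differentiableOn_pd norm_e₄)
    (hf.tame_pd_pd norm_e₄ norm_e₄) hz ht

theorem layer_dx (hf : ClassicalDecaying f) (k l : ℝ) (hz : 0 ≤ z) (ht : 0 ≤ t) :
    layer (dx f) k l z t = I * k * layer f k l z t :=
  hf.tame.layer_dx hf.differentiableOn (hf.tame_pd norm_e₁) hz ht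

theorem layer_dy (hf : ClassicalDecaying f) (k l : ℝ) (hz : 0 ≤ z) (ht : 0 ≤ t) :
    layer (dy f) k l z t = I * l * layer f k l z t :=
  hf.tame.layer_dy hf.differentiableOn (hf.tame_pd norm_e₂) hz ht

theorem layer_dx_pd (hf : ClassicalDecaying f) {e : ℝ × ℝ × ℝ × ℝ} (he : ‖e‖ ≤ 1) (k l : ℝ)
    (hz : 0 ≤ z) (ht : 0 ≤ t) :
    layer (dx (pd e f)) k l z t = I * k * layer (pd e f) k l z t :=
  (hf.tame_pd he).layer_dx (hf.differentiableOn_pd he) (hf.tame_pd_pd he norm_e₁) hz ht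

theorem layer_dy_pd (hf : ClassicalDecaying f) {e : ℝ × ℝ × ℝ × ℝ} (he : ‖e‖ ≤ 1) (k l : ℝ)
    (hz : 0 ≤ z) (ht : 0 ≤ t) :
    layer (dy (pd e f)) k l z t = I * l * layer (pd e f) k l z t :=
  (hf.tame_pd he).layer_dy (hf.differentiableOn_pd he) (hf.tame_pd_pd he norm_e₂) hz ht

/-- The identity for `∂f/∂x` is differentiated in `z` after the planar transform, so symmetry of the
mixed second derivatives of `f` is not needed. -/
theorem layer_dz_dx (hf : ClassicalDecaying f) (k l : ℝ) (hz : 0 < z) (ht : 0 ≤ t) :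
    layer (dz (dx f)) k l z t = I * k * layer (dz f) k l z t := by
  have h1 := (hf.tame_pd norm_e₁).hasDerivAt_layer_z (k := k) (l := l)
    (hf.differentiableOn_pd norm_e₁) (hf.tame_pd_pd norm_e₁ norm_e₃) hz ht
  have h2 := (hf.tame.hasDerivAt_layer_z (k := k) (l := l) hf.differentiableOn
    (hf.tame_pd norm_e₃) hz ht).const_mul (I * k)
  refine h1.unique (h2.congr_of_eventuallyEq ?_)
  filter_upwards [lt_mem_nhds hz] with ζ hζ
  exact hf.layer_dx k l hζ.le ht

theorem layer_dz_dy (hf : ClassicalDecaying f) (k l : ℝ) (hz : 0 < z) (ht : 0 ≤ t) :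
    layer (dz (dy f)) k l z t = I * l * layer (dz f) k l z t := by
  have h1 := (hf.tame_pd norm_e₂).hasDerivAt_layer_z (k := k) (l := l)
    (hf.differentiableOn_pd norm_e₂) (hf.tame_pd_pd norm_e₂ norm_e₃) hz ht
  have h2 := (hf.tame.hasDerivAt_layer_z (k := k) (l := l) hf.differentiableOn
    (hf.tame_pd norm_e₃) hz ht).const_mul (I * l)
  refine h1.unique (h2.congr_of_eventuallyEq ?_)
  filter_upwards [lt_mem_nhds hz] with ζ hζ
  exact hf.layer_dy k l hζ.le ht

/-- The planar transform of a decaying `C²` function is integrable. -/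
theorem integrable_layer (hf : ClassicalDecaying f) (hz : 0 ≤ z) (ht : 0 ≤ t) :
    Integrable fun ξ : ℝ × ℝ => layer f ξ.1 ξ.2 z t := by
  obtain ⟨A₁, a₁, h₁⟩ := hf.tame.norm_slice_le' t
  obtain ⟨A₂, a₂, h₂⟩ := (hf.tame_pd norm_e₁).norm_slice_le' t
  obtain ⟨A₃, a₃, h₃⟩ := (hf.tame_pd_pd norm_e₁ norm_e₁).norm_slice_le' t
  obtain ⟨A₄, a₄, h₄⟩ := (hf.tame_pd norm_e₂).norm_slice_le' t
  obtain ⟨A₅, a₅, h₅⟩ := (hf.tame_pd_pd norm_e₂ norm_e₂).norm_slice_le' t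
  have hw := fun q => (weight₂_pos q).le
  exact integrable_planar_transform (A := A₁ + A₂ + A₃ + A₄ + A₅)
    (hf.tame.continuous_slice hz ht) ((hf.tame_pd norm_e₁).continuous_slice hz ht)
    ((hf.tame_pd_pd norm_e₁ norm_e₁).continuous_slice hz ht)
    ((hf.tame_pd norm_e₂).continuous_slice hz ht)
    ((hf.tame_pd_pd norm_e₂ norm_e₂).continuous_slice hz ht)
    (fun q => (h₁ z t hz ht le_rfl q).trans (mul_le_mul_of_nonneg_right (by linarith) (hw q)))
    (fun q => (h₂ z t hz ht le_rfl q).trans (mul_le_mul_of_nonneg_right (by linarith) (hw q)))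
    (fun q => (h₃ z t hz ht le_rfl q).trans (mul_le_mul_of_nonneg_right (by linarith) (hw q)))
    (fun q => (h₄ z t hz ht le_rfl q).trans (mul_le_mul_of_nonneg_right (by linarith) (hw q)))
    (fun q => (h₅ z t hz ht le_rfl q).trans (mul_le_mul_of_nonneg_right (by linarith) (hw q)))
    (fun x y => (hasDerivAt_dx hf.differentiableOn hz ht).ofReal_comp)
    (fun x y => (hasDerivAt_dx (hf.differentiableOn_pd norm_e₁) hz ht).ofReal_comp)
    (fun x y => (hasDerivAt_dy hf.differentiableOn hz ht).ofReal_comp)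
    (fun x y => (hasDerivAt_dy (hf.differentiableOn_pd norm_e₂) hz ht).ofReal_comp)

theorem layer_inversion (hf : ClassicalDecaying f) (hz : 0 ≤ z) (ht : 0 ≤ t) (x y : ℝ) :
    ∫ q : ℝ × ℝ, exp (I * q.1 * x + I * q.2 * y) * layer f q.1 q.2 z t
      = 4 * Real.pi ^ 2 * (f (x, y, z, t) : ℂ) := by
  obtain ⟨A, a, h⟩ := hf.tame.norm_slice_le' t
  have hc := hf.tame.continuous_slice hz ht
  have hb := h z t hz ht le_rfl
  refine planar_inversion hc (hf.tame.integrable_slice hz ht) (fun y => integrable_line hc hb y)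
    (fun k => ?_) (hf.integrable_layer hz ht) x y
  refine continuous_of_dominated (bound := fun x => A * weight x) (fun y => ?_)
    (fun y => Eventually.of_forall fun x => ?_) (integrable_weight.const_mul A)
    (Eventually.of_forall fun x => ?_)
  · exact ((Continuous.mul (by fun_prop) (hc.comp (Continuous.prodMk_left y)) :
      Continuous fun x : ℝ => exp (-(I * k * x)) * (f (x, y, z, t) : ℂ))).aestronglyMeasurable
  · have e1 : ‖exp (-(I * k * x))‖ = 1 := by rw [norm_exp]; simp
    rw [norm_mul, e1, one_mul]
    refine (hb (x, y)).trans (mul_le_mul_of_nonneg_left ?_ a)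
    exact mul_le_of_le_one_right (weight_pos x).le (weight_le_one y)
  · exact continuous_const.mul (hc.comp (Continuous.prodMk_right x))

theorem init_eq (hf : ClassicalDecaying f) {f₀ : ℝ × ℝ × ℝ → ℝ}
    (h : ∀ x y z, 0 < z → f (x, y, z, 0) = f₀ (x, y, z)) (k l : ℝ)
    {m : ℂ} (hm : m.im ≤ 0) : hat f₀ k l m = lap (fun z => layer f k l z 0) m := by
  obtain ⟨A, -, hA⟩ := hf.tame.2 0
  rw [← hat_congr (f := fun p => f (p.1, p.2.1, p.2.2, 0)) (fun x y z hz => h x y z hz)]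
  exact hat_eq_lap (f := fun p => f (p.1, p.2.1, p.2.2, 0))
    (hf.tame.1.comp (f := fun p : ℝ × ℝ × ℝ => (p.1, p.2.1, p.2.2, (0 : ℝ)))
      (Continuous.continuousOn (by fun_prop)) fun p hp => ⟨hp, le_rfl⟩)
    (fun x y z hz => hA x y z 0 hz le_rfl le_rfl) k l hm

theorem init_dt_eq (hf : ClassicalDecaying f) {f₁ : ℝ × ℝ × ℝ → ℝ}
    (h : ∀ x y z, 0 < z → dt f (x, y, z, 0) = f₁ (x, y, z))
    (k l : ℝ) {m : ℂ} (hm : m.im ≤ 0) :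
    hat f₁ k l m = lap (fun z => layer (dt f) k l z 0) m := by
  have hft := hf.tame_pd norm_e₄
  obtain ⟨A, -, hA⟩ := hft.2 0
  rw [← hat_congr (f := fun p => dt f (p.1, p.2.1, p.2.2, 0)) (fun x y z hz => h x y z hz)]
  exact hat_eq_lap (f := fun p => dt f (p.1, p.2.1, p.2.2, 0))
    (hft.1.comp (f := fun p : ℝ × ℝ × ℝ => (p.1, p.2.1, p.2.2, (0 : ℝ)))
      (Continuous.continuousOn (by fun_prop)) fun p hp => ⟨hp, le_rfl⟩)
    (fun x y z hz => hA x y z 0 hz le_rfl le_rfl) k l hm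

end ClassicalDecaying

theorem tilde_eq_layer_sum {n : ℕ} {g : ℝ × ℝ × ℝ → ℝ} {c : Fin n → ℝ}
    {F : Fin n → ℝ × ℝ × ℝ × ℝ → ℝ} (hF : ∀ i, Tame (F i)) {t : ℝ} (ht : 0 ≤ t)
    (h : ∀ x y, g (x, y, t) = ∑ i, c i * F i (x, y, 0, t)) (k l : ℝ) :
    tilde g k l t = ∑ i, c i * layer (F i) k l 0 t := by
  rw [← layer_eq_sum hF le_rfl ht (g := fun p => ∑ i, c i * F i p) (fun x y => rfl)]
  refine tilde_eq_planar (fun x y => by rw [h]) ?_ k l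
  push_cast
  exact integrable_finsetSum _ fun i _ => ((hF i).integrable_slice le_rfl ht).const_mul _

theorem IsDecayingSolution.isHalfLineSolution {lam mu : ℝ} {d : Data}
    {u v w : ℝ × ℝ × ℝ × ℝ → ℝ} (h : IsDecayingSolution lam mu d u v w) (k l : ℝ) :
    IsHalfLineSolution lam mu d k l (h.decay_u.halfLine k l) (h.decay_v.halfLine k l)
      (h.decay_w.halfLine k l) where
  eq_u z t hz ht := by
    have := layer_eq_sum (n := 5) (g := dt (dt u)) (z := z) (t := t)
      (c := ![lam + 2 * mu, lam + mu, lam + mu, mu, mu])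
      (F := ![dx (dx u), dy (dx v), dz (dx w), dy (dy u), dz (dz u)])
      (fun i => by
        fin_cases i
        exacts [h.decay_u.tame_pd_pd norm_e₁ norm_e₁, h.decay_v.tame_pd_pd norm_e₁ norm_e₂,
          h.decay_w.tame_pd_pd norm_e₁ norm_e₃, h.decay_u.tame_pd_pd norm_e₂ norm_e₂,
          h.decay_u.tame_pd_pd norm_e₃ norm_e₃]) hz.le ht.le
      (fun x y => by
        have := (h.equations x y z t hz ht).1
        simp only [Fin.sum_univ_five, Matrix.cons_val_zero, Matrix.cons_val_one, Matrix.cons_val]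
        linarith) k l
    simp only [Fin.sum_univ_five, Matrix.cons_val_zero, Matrix.cons_val_one, Matrix.cons_val] at this
    rw [h.decay_u.layer_dx_pd norm_e₁ k l hz.le ht.le, h.decay_u.layer_dx k l hz.le ht.le,
      h.decay_v.layer_dy_pd norm_e₁ k l hz.le ht.le, h.decay_v.layer_dx k l hz.le ht.le,
      h.decay_w.layer_dz_dx k l hz ht.le, h.decay_u.layer_dy_pd norm_e₂ k l hz.le ht.le,
      h.decay_u.layer_dy k l hz.le ht.le] at this
    simp only [ClassicalDecaying.halfLine]
    rw [this]
    push_cast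
    ring_nf
    simp only [I_sq]
    ring
  eq_v z t hz ht := by
    have := layer_eq_sum (n := 5) (g := dt (dt v)) (z := z) (t := t)
      (c := ![lam + 2 * mu, lam + mu, lam + mu, mu, mu])
      (F := ![dy (dy v), dz (dy w), dx (dy u), dz (dz v), dx (dx v)])
      (fun i => by
        fin_cases i
        exacts [h.decay_v.tame_pd_pd norm_e₂ norm_e₂, h.decay_w.tame_pd_pd norm_e₂ norm_e₃,
          h.decay_u.tame_pd_pd norm_e₂ norm_e₁, h.decay_v.tame_pd_pd norm_e₃ norm_e₃,
          h.decay_v.tame_pd_pd norm_e₁ norm_e₁]) hz.le ht.le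
      (fun x y => by
        have := (h.equations x y z t hz ht).2.1
        simp only [Fin.sum_univ_five, Matrix.cons_val_zero, Matrix.cons_val_one, Matrix.cons_val]
        linarith) k l
    simp only [Fin.sum_univ_five, Matrix.cons_val_zero, Matrix.cons_val_one, Matrix.cons_val] at this
    rw [h.decay_v.layer_dy_pd norm_e₂ k l hz.le ht.le, h.decay_v.layer_dy k l hz.le ht.le,
      h.decay_w.layer_dz_dy k l hz ht.le, h.decay_u.layer_dx_pd norm_e₂ k l hz.le ht.le,
      h.decay_u.layer_dy k l hz.le ht.le, h.decay_v.layer_dx_pd norm_e₁ k l hz.le ht.le,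
      h.decay_v.layer_dx k l hz.le ht.le] at this
    simp only [ClassicalDecaying.halfLine]
    rw [this]
    push_cast
    ring_nf
    simp only [I_sq]
    ring
  eq_w z t hz ht := by
    have := layer_eq_sum (n := 5) (g := dt (dt w)) (z := z) (t := t)
      (c := ![lam + 2 * mu, lam + mu, lam + mu, mu, mu])
      (F := ![dz (dz w), dx (dz u), dy (dz v), dx (dx w), dy (dy w)])
      (fun i => by
        fin_cases i
        exacts [h.decay_w.tame_pd_pd norm_e₃ norm_e₃, h.decay_u.tame_pd_pd norm_e₃ norm_e₁,
          h.decay_v.tame_pd_pd norm_e₃ norm_e₂, h.decay_w.tame_pd_pd norm_e₁ norm_e₁,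
          h.decay_w.tame_pd_pd norm_e₂ norm_e₂]) hz.le ht.le
      (fun x y => by
        have := (h.equations x y z t hz ht).2.2
        simp only [Fin.sum_univ_five, Matrix.cons_val_zero, Matrix.cons_val_one, Matrix.cons_val]
        linarith) k l
    simp only [Fin.sum_univ_five, Matrix.cons_val_zero, Matrix.cons_val_one, Matrix.cons_val] at this
    rw [h.decay_u.layer_dx_pd norm_e₃ k l hz.le ht.le, h.decay_v.layer_dy_pd norm_e₃ k l hz.le ht.le,
      h.decay_w.layer_dx_pd norm_e₁ k l hz.le ht.le, h.decay_w.layer_dx k l hz.le ht.le,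
      h.decay_w.layer_dy_pd norm_e₂ k l hz.le ht.le, h.decay_w.layer_dy k l hz.le ht.le] at this
    simp only [ClassicalDecaying.halfLine]
    rw [this]
    push_cast
    ring_nf
    simp only [I_sq]
    ring
  bc_u t ht := by
    have := tilde_eq_layer_sum (n := 2) (g := d.g₁) (t := t) (c := ![1, 1]) (F := ![dz u, dx w])
      (fun i => by
        fin_cases i
        exacts [h.decay_u.tame_pd norm_e₃, h.decay_w.tame_pd norm_e₁]) ht.le
      (fun x y => by
        rw [← (h.stress x y t ht).1]
        simp) k l
    rw [this]
    simp [Fin.sum_univ_two, ClassicalDecaying.halfLine, h.decay_w.layer_dx k l le_rfl ht.le]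
  bc_v t ht := by
    have := tilde_eq_layer_sum (n := 2) (g := d.g₂) (t := t) (c := ![1, 1]) (F := ![dz v, dy w])
      (fun i => by
        fin_cases i
        exacts [h.decay_v.tame_pd norm_e₃, h.decay_w.tame_pd norm_e₂]) ht.le
      (fun x y => by
        rw [← (h.stress x y t ht).2.1]
        simp) k l
    rw [this]
    simp [Fin.sum_univ_two, ClassicalDecaying.halfLine, h.decay_w.layer_dy k l le_rfl ht.le]
  bc_w t ht := by
    have := tilde_eq_layer_sum (n := 3) (g := d.g₃) (t := t)
      (c := ![1, lam / (lam + 2 * mu), lam / (lam + 2 * mu)]) (F := ![dz w, dx u, dy v])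
      (fun i => by
        fin_cases i
        exacts [h.decay_w.tame_pd norm_e₃, h.decay_u.tame_pd norm_e₁,
          h.decay_v.tame_pd norm_e₂]) ht.le
      (fun x y => by
        rw [← (h.stress x y t ht).2.2]
        simp [Fin.sum_univ_three]; ring) k l
    rw [this]
    simp [Fin.sum_univ_three, ClassicalDecaying.halfLine, h.decay_u.layer_dx k l le_rfl ht.le,
      h.decay_v.layer_dy k l le_rfl ht.le]
    ring
  init_u m hm := h.decay_u.init_eq (fun x y z hz => (h.initial x y z hz).1) k l hm
  init_ut m hm := h.decay_u.init_dt_eq (fun x y z hz => (h.initial x y z hz).2.1) k l hm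
  init_v m hm := h.decay_v.init_eq (fun x y z hz => (h.initial x y z hz).2.2.1) k l hm
  init_vt m hm := h.decay_v.init_dt_eq (fun x y z hz => (h.initial x y z hz).2.2.2.1) k l hm
  init_w m hm := h.decay_w.init_eq (fun x y z hz => (h.initial x y z hz).2.2.2.2.1) k l hm
  init_wt m hm := h.decay_w.init_dt_eq (fun x y z hz => (h.initial x y z hz).2.2.2.2.2) k l hm

end HalfSpace

end


noncomputable section

namespace HalfSpace

open Filter Topology Set

/-! ### Bounds for the transforms of the data -/

theorem uniqueDiffOn_halfSpace : UniqueDiffOn ℝ halfSpace := by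
  have hconv : Convex ℝ halfSpace := by
    intro p hp q hq a b ha hb _
    simp only [halfSpace, mem_ofPred_eq] at *
    simp only [Prod.snd_add, Prod.smul_snd, smul_eq_mul]
    nlinarith [mul_nonneg ha hp, mul_nonneg hb hq]
  refine uniqueDiffOn_convex hconv ⟨(0, 0, 1), ?_⟩
  refine mem_interior.2 ⟨{p : ℝ × ℝ × ℝ | 0 < p.2.2}, ?_, ?_, ?_⟩
  · exact fun p (hp : 0 < p.2.2) => hp.le
  · exact isOpen_lt continuous_const
      (f := fun _ => (0 : ℝ)) (g := fun p : ℝ × ℝ × ℝ => p.2.2) (by fun_prop)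
  · simp

/-- Partial derivative in the direction `e` on the closed half-space. -/
def pd₃ (e : ℝ × ℝ × ℝ) (f : ℝ × ℝ × ℝ → ℝ) (p : ℝ × ℝ × ℝ) : ℝ := fderivWithin ℝ f halfSpace p e

/-- The Fourier transform in `(x, y)` of a function on the half-space. -/
def slab (f : ℝ × ℝ × ℝ → ℝ) (k l τ : ℝ) : ℂ := planar (fun q => (f (q.1, q.2, τ) : ℂ)) k l

/-- The product of a weight in the last variable and the weight on the plane. -/
def weight₃ (ω : ℝ → ℝ) (p : ℝ × ℝ × ℝ) : ℝ := ω p.2.2 * weight₂ (p.1, p.2.1)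

/-- Decay of a function on the half-space with its derivatives, for `τ` in the set `R`. -/
abbrev SlabDecays (R : Set ℝ) (ω : ℝ → ℝ) (n : ℕ) (A : ℝ) (f : ℝ × ℝ × ℝ → ℝ) : Prop :=
  Decays halfSpace {p | p.2.2 ∈ R} (weight₃ ω) n A f

theorem norm_f₁ : ‖((1, 0, 0) : ℝ × ℝ × ℝ)‖ ≤ 1 := by simp [Prod.norm_def]
theorem norm_f₂ : ‖((0, 1, 0) : ℝ × ℝ × ℝ)‖ ≤ 1 := by simp [Prod.norm_def]
theorem norm_f₃ : ‖((0, 0, 1) : ℝ × ℝ × ℝ)‖ ≤ 1 := by simp [Prod.norm_def]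

namespace SlabDecays

variable {R : Set ℝ} {ω : ℝ → ℝ} {n : ℕ} {A : ℝ} {f : ℝ × ℝ × ℝ → ℝ}

theorem pd (h : SlabDecays R ω (n + 1) A f) {e : ℝ × ℝ × ℝ} (he : ‖e‖ ≤ 1) :
    SlabDecays R ω n A (pd₃ e f) := Decays.deriv uniqueDiffOn_halfSpace h he

theorem continuous_slice (h : SlabDecays R ω n A f) {τ : ℝ} (hτ : 0 ≤ τ) :
    Continuous fun q : ℝ × ℝ => (f (q.1, q.2, τ) : ℂ) :=
  continuous_ofReal.comp (h.contDiffOn.continuousOn.comp_continuous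
    (f := fun q : ℝ × ℝ => (q.1, q.2, τ)) (by fun_prop) fun _ => hτ)

theorem norm_slice_le (h : SlabDecays R ω n A f) {τ : ℝ} (hτ : 0 ≤ τ) (hR : τ ∈ R) (q : ℝ × ℝ) :
    ‖(f (q.1, q.2, τ) : ℂ)‖ ≤ A * ω τ * weight₂ q := by
  rw [norm_real, mul_assoc]
  exact h.abs_le (p := (q.1, q.2, τ)) hτ hR

theorem integrable_slice (h : SlabDecays R ω n A f) {τ : ℝ} (hτ : 0 ≤ τ) (hR : τ ∈ R) :
    Integrable fun q : ℝ × ℝ => (f (q.1, q.2, τ) : ℂ) :=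
  integrable_of_le_weight₂ (h.continuous_slice hτ) (h.norm_slice_le hτ hR)

theorem norm_slab_le (h : SlabDecays R ω n A f) {τ : ℝ} (hτ : 0 ≤ τ) (hR : τ ∈ R) (k l : ℝ) :
    ‖slab f k l τ‖ ≤ A * (∫ q, weight₂ q) * ω τ := by
  refine (norm_planar_le_of_le_weight₂ (h.norm_slice_le hτ hR) k l).trans_eq ?_
  ring

theorem slab_pd_fst (h : SlabDecays R ω (n + 1) A f) {τ : ℝ} (hτ : 0 ≤ τ) (hR : τ ∈ R) (k l : ℝ) :
    slab (pd₃ (1, 0, 0) f) k l τ = I * k * slab f k l τ :=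
  planar_deriv_fst (A := A * ω τ) (h.continuous_slice hτ) ((h.pd norm_f₁).continuous_slice hτ)
    (h.norm_slice_le hτ hR) ((h.pd norm_f₁).norm_slice_le hτ hR)
    (fun x y => (hasDerivAt_comp_line h.differentiableOn (γ := fun x => (x, y, τ))
      ((hasDerivAt_id x).prodMk (hasDerivAt_const x (y, τ)))
      (Eventually.of_forall fun _ => hτ)).ofReal_comp) k l

theorem slab_pd_snd (h : SlabDecays R ω (n + 1) A f) {τ : ℝ} (hτ : 0 ≤ τ) (hR : τ ∈ R) (k l : ℝ) :
    slab (pd₃ (0, 1, 0) f) k l τ = I * l * slab f k l τ :=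
  planar_deriv_snd (A := A * ω τ) (h.continuous_slice hτ) ((h.pd norm_f₂).continuous_slice hτ)
    (h.norm_slice_le hτ hR) ((h.pd norm_f₂).norm_slice_le hτ hR)
    (fun x y => (hasDerivAt_comp_line h.differentiableOn (γ := fun y => (x, y, τ))
      ((hasDerivAt_const y x).prodMk ((hasDerivAt_id y).prodMk (hasDerivAt_const y τ)))
      (Eventually.of_forall fun _ => hτ)).ofReal_comp) k l

theorem norm_slice_le' (h : SlabDecays R ω n A f) (hA : 0 ≤ A) (hω : ∀ τ, ω τ ≤ 1) {τ : ℝ}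
    (hτ : 0 ≤ τ) (hR : τ ∈ R) (q : ℝ × ℝ) : ‖(f (q.1, q.2, τ) : ℂ)‖ ≤ A * weight₂ q :=
  (h.norm_slice_le hτ hR q).trans (mul_le_mul_of_nonneg_right
    (mul_le_of_le_one_right hA (hω τ)) (weight₂_pos q).le)

theorem continuousOn_slab (h : SlabDecays R ω n A f) (hA : 0 ≤ A) (hω : ∀ τ, ω τ ≤ 1) (k l : ℝ) :
    ContinuousOn (slab f k l) (Ici 0 ∩ R) := by
  refine continuousOn_planar_param (fun q => ?_) (fun τ hτ => h.continuous_slice hτ.1)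
    (fun _ => ⟨A, fun τ hτ _ => h.norm_slice_le' hA hω hτ.1 hτ.2⟩) k l
  exact continuous_ofReal.comp_continuousOn (h.contDiffOn.continuousOn.comp
    (f := fun τ : ℝ => (q.1, q.2, τ)) (Continuous.continuousOn (by fun_prop)) fun τ hτ => hτ.1)

theorem hasDerivAt_slab (h : SlabDecays R ω (n + 1) A f) (hA : 0 ≤ A) (hω : ∀ τ, ω τ ≤ 1) {τ : ℝ}
    (hτ : 0 < τ) (hR : R ∈ 𝓝 τ) (k l : ℝ) :
    HasDerivAt (slab f k l) (slab (pd₃ (0, 0, 1) f) k l τ) τ :=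
  hasDerivAt_planar_param (A := A) (inter_mem (Ioi_mem_nhds hτ) hR)
    (G := fun τ (q : ℝ × ℝ) => (f (q.1, q.2, τ) : ℂ))
    (G' := fun τ (q : ℝ × ℝ) => (pd₃ (0, 0, 1) f (q.1, q.2, τ) : ℂ))
    (fun σ hσ q => (hasDerivAt_comp_line h.differentiableOn (γ := fun τ => (q.1, q.2, τ))
      ((hasDerivAt_const σ q.1).prodMk ((hasDerivAt_const σ q.2).prodMk (hasDerivAt_id σ)))
      ((lt_mem_nhds hσ.1).mono fun _ h => le_of_lt h)).ofReal_comp)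
    (fun _ hσ => h.continuous_slice (le_of_lt hσ.1)) ((h.pd norm_f₃).continuous_slice hτ.le)
    (h.norm_slice_le' hA hω hτ.le (mem_of_mem_nhds hR))
    (fun _ hσ => (h.pd norm_f₃).norm_slice_le' hA hω (le_of_lt hσ.1) hσ.2) k l

/-- The function `f - ∂²f/∂x²` has the transform of `f` multiplied by `1 + k²`. Two derivatives thus
buy one factor `(1 + k²)⁻¹`, and the constant doubles. -/
theorem exists_damp_fst (h : SlabDecays R ω (n + 2) A f) : ∃ F : ℝ × ℝ × ℝ → ℝ,
    SlabDecays R ω n (2 * A) F ∧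
    ∀ k l τ : ℝ, 0 ≤ τ → τ ∈ R → slab F k l τ = (1 + k ^ 2) * slab f k l τ := by
  have h1 : SlabDecays R ω (n + 1) A (pd₃ (1, 0, 0) f) := h.pd norm_f₁
  have h2 := h1.pd norm_f₁
  refine ⟨fun p => f p - pd₃ (1, 0, 0) (pd₃ (1, 0, 0) f) p, ?_, fun k l τ hτ hR => ?_⟩
  · rw [two_mul]
    exact Decays.sub uniqueDiffOn_halfSpace (Decays.mono h (by omega)) h2
  · have e := planar_sub (h.integrable_slice hτ hR) (h2.integrable_slice hτ hR) k l
    have e1 := h1.slab_pd_fst hτ hR k l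
    rw [SlabDecays.slab_pd_fst (n := n + 1) h hτ hR k l] at e1
    simp only [slab] at e1 ⊢
    push_cast
    rw [e, e1]
    linear_combination (-(k : ℂ) ^ 2 * planar (fun q => (f (q.1, q.2, τ) : ℂ)) k l) * I_sq

theorem exists_damp_snd (h : SlabDecays R ω (n + 2) A f) : ∃ F : ℝ × ℝ × ℝ → ℝ,
    SlabDecays R ω n (2 * A) F ∧
    ∀ k l τ : ℝ, 0 ≤ τ → τ ∈ R → slab F k l τ = (1 + l ^ 2) * slab f k l τ := by
  have h1 : SlabDecays R ω (n + 1) A (pd₃ (0, 1, 0) f) := h.pd norm_f₂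
  have h2 := h1.pd norm_f₂
  refine ⟨fun p => f p - pd₃ (0, 1, 0) (pd₃ (0, 1, 0) f) p, ?_, fun k l τ hτ hR => ?_⟩
  · rw [two_mul]
    exact Decays.sub uniqueDiffOn_halfSpace (Decays.mono h (by omega)) h2
  · have e := planar_sub (h.integrable_slice hτ hR) (h2.integrable_slice hτ hR) k l
    have e1 := h1.slab_pd_snd hτ hR k l
    rw [SlabDecays.slab_pd_snd (n := n + 1) h hτ hR k l] at e1
    simp only [slab] at e1 ⊢
    push_cast
    rw [e, e1]
    linear_combination (-(l : ℂ) ^ 2 * planar (fun q => (f (q.1, q.2, τ) : ℂ)) k l) * I_sq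

end SlabDecays

/-- The decay in `(k, l)` of the transforms of the data. -/
def damping (k l : ℝ) : ℝ := ((1 + k ^ 2) ^ 2 * (1 + l ^ 2) ^ 2)⁻¹

theorem damping_pos (k l : ℝ) : 0 < damping k l := by
  rw [damping]; positivity

/-- Two damping steps in each of `x` and `y` use eight derivatives and multiply the constant by
`2⁴`. -/
theorem SlabDecays.exists_damp {R : Set ℝ} {ω : ℝ → ℝ} {n : ℕ} {A : ℝ} {f : ℝ × ℝ × ℝ → ℝ}
    (h : SlabDecays R ω (n + 8) A f) : ∃ F : ℝ × ℝ × ℝ → ℝ, SlabDecays R ω n (16 * A) F ∧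
    ∀ k l τ : ℝ, 0 ≤ τ → τ ∈ R → slab f k l τ = damping k l * slab F k l τ := by
  obtain ⟨F₁, d₁, h₁⟩ := SlabDecays.exists_damp_fst (n := n + 6) h
  obtain ⟨F₂, d₂, h₂⟩ := SlabDecays.exists_damp_fst (n := n + 4) d₁
  obtain ⟨F₃, d₃, h₃⟩ := SlabDecays.exists_damp_snd (n := n + 2) d₂
  obtain ⟨F₄, d₄, h₄⟩ := SlabDecays.exists_damp_snd (n := n) d₃
  refine ⟨F₄, by convert d₄ using 1; ring, fun k l τ hτ hR => ?_⟩
  rw [h₄ k l τ hτ hR, h₃ k l τ hτ hR, h₂ k l τ hτ hR, h₁ k l τ hτ hR, damping]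
  have n1 : (1 + (k : ℂ) ^ 2) ≠ 0 := by
    have : 1 + k ^ 2 ≠ 0 := by positivity
    exact_mod_cast this
  have n2 : (1 + (l : ℂ) ^ 2) ≠ 0 := by
    have : 1 + l ^ 2 ≠ 0 := by positivity
    exact_mod_cast this
  push_cast
  field_simp

/-! #### Even and odd parts of the half-line transform -/

theorem abs_mul_weight_sq_le (z : ℝ) : |z| * weight z ^ 2 ≤ 1 := by
  have h1 : weight z ^ 2 ≤ (1 + |z|)⁻¹ := by
    rw [weight, ← Real.rpow_natCast, ← Real.rpow_mul (by positivity), ← Real.rpow_neg_one]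
    exact Real.rpow_le_rpow_of_exponent_le (by linarith [abs_nonneg z]) (by norm_num)
  calc |z| * weight z ^ 2 ≤ |z| * (1 + |z|)⁻¹ := by gcongr
    _ ≤ 1 := by
      rw [← div_eq_mul_inv, div_le_one (by positivity)]
      linarith

/-- For large `m` two integrations by parts handle the even part and one the odd part. For small `m`
the odd part must vanish linearly, since it will be divided by `m`; this is where decay faster than
one weight is used. -/
theorem norm_lap_even_odd_le {φ φ' φ'' : ℝ → ℂ} {B : ℝ} (hc : ContinuousOn φ (Ici 0))
    (hc' : ContinuousOn φ' (Ici 0)) (hc'' : ContinuousOn φ'' (Ici 0))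
    (hb : ∀ z, 0 ≤ z → ‖φ z‖ ≤ B * weight z ^ 3) (hb' : ∀ z, 0 ≤ z → ‖φ' z‖ ≤ B * weight z ^ 3)
    (hb'' : ∀ z, 0 ≤ z → ‖φ'' z‖ ≤ B * weight z ^ 3)
    (hd : ∀ z, 0 < z → HasDerivAt φ (φ' z) z) (hd' : ∀ z, 0 < z → HasDerivAt φ' (φ'' z) z)
    (m : ℝ) :
    ‖lap φ m + lap φ (-m)‖ ≤ B * (4 * (∫ z in Ioi (0 : ℝ), weight z) + 2) / (1 + m ^ 2) ∧
    ‖lap φ m - lap φ (-m)‖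
      ≤ B * (4 * (∫ z in Ioi (0 : ℝ), weight z) + 2) / (1 + m ^ 2) * |m| := by
  set C : ℝ := ∫ z in Ioi (0 : ℝ), weight z with hC
  have hC0 : 0 ≤ C := integral_nonneg fun z => (weight_pos z).le
  have hw : ∀ z, weight z ^ 3 ≤ weight z := fun z => by
    have h0 := (weight_pos z).le
    have h1 := weight_le_one z
    calc weight z ^ 3 = weight z * (weight z * weight z) := by ring
      _ ≤ weight z * 1 := by
        gcongr
        exact mul_le_one₀ h1 h0 h1
      _ = weight z := mul_one _
  have hB : 0 ≤ B := by
    have := (norm_nonneg _).trans (hb 0 le_rfl)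
    exact nonneg_of_mul_nonneg_left this (pow_pos (weight_pos 0) 3)
  have b : ∀ z, 0 ≤ z → ‖φ z‖ ≤ B * weight z := fun z hz =>
    (hb z hz).trans (mul_le_mul_of_nonneg_left (hw z) hB)
  have b' : ∀ z, 0 ≤ z → ‖φ' z‖ ≤ B * weight z := fun z hz =>
    (hb' z hz).trans (mul_le_mul_of_nonneg_left (hw z) hB)
  have b'' : ∀ z, 0 ≤ z → ‖φ'' z‖ ≤ B * weight z := fun z hz =>
    (hb'' z hz).trans (mul_le_mul_of_nonneg_left (hw z) hB)
  have z0 : ‖φ 0‖ ≤ B := (b 0 le_rfl).trans (mul_le_of_le_one_right hB (weight_le_one 0))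
  have z0' : ‖φ' 0‖ ≤ B := (b' 0 le_rfl).trans (mul_le_of_le_one_right hB (weight_le_one 0))
  have i1 : (m : ℂ).im ≤ 0 := by simp
  have i2 : (-m : ℂ).im ≤ 0 := by simp
  have l1 := lap_deriv hc b hc' b' hd i1
  have l2 := lap_deriv hc b hc' b' hd i2
  have l1' := lap_deriv hc' b' hc'' b'' hd' i1
  have l2' := lap_deriv hc' b' hc'' b'' hd' i2
  have n1 := norm_lap_le b i1
  have n2 := norm_lap_le b i2
  have n1' := norm_lap_le b' i1
  have n2' := norm_lap_le b' i2
  have n1'' := norm_lap_le b'' i1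
  have n2'' := norm_lap_le b'' i2
  have hpos : 0 < 1 + m ^ 2 := by positivity
  constructor
  · rw [le_div_iff₀ hpos]
    have e : (m : ℂ) ^ 2 * (lap φ m + lap φ (-m)) = -(2 * φ' 0 + lap φ'' m + lap φ'' (-m)) := by
      rw [l1', l2', l1, l2]
      linear_combination ((m : ℂ) ^ 2 * (lap φ m + lap φ (-m))) * I_sq
    have e' : m ^ 2 * ‖lap φ m + lap φ (-m)‖ ≤ 2 * B + B * C + B * C := by
      have : m ^ 2 * ‖lap φ m + lap φ (-m)‖ = ‖(m : ℂ) ^ 2 * (lap φ m + lap φ (-m))‖ := by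
        rw [norm_mul, norm_pow, norm_real, Real.norm_eq_abs, sq_abs]
      rw [this, e, norm_neg]
      refine norm_add_le_of_le (norm_add_le_of_le ?_ n1'') n2''
      rw [norm_mul, norm_ofNat]
      linarith
    have e2 := norm_add_le_of_le n1 n2
    nlinarith
  · rw [div_mul_eq_mul_div, le_div_iff₀ hpos]
    have e : I * m * (lap φ m - lap φ (-m)) = 2 * φ 0 + lap φ' m + lap φ' (-m) := by
      rw [l1, l2]; ring
    have e' : |m| * ‖lap φ m - lap φ (-m)‖ ≤ 2 * B + B * C + B * C := by
      have : |m| * ‖lap φ m - lap φ (-m)‖ = ‖I * m * (lap φ m - lap φ (-m))‖ := by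
        rw [norm_mul, norm_mul, norm_I, norm_real, Real.norm_eq_abs, one_mul]
      rw [this, e]
      refine norm_add_le_of_le (norm_add_le_of_le ?_ n1') n2'
      rw [norm_mul, norm_ofNat]
      linarith
    -- The difference is the integral of `-2i sin(mz) φ(z)`, and `|sin(mz)| ≤ |m| |z|`. Two of the
    -- three weights absorb `|z|`, leaving an integrable one.
    have e2 : ‖lap φ m - lap φ (-m)‖ ≤ 2 * |m| * B * C := by
      rw [lap, lap, ← integral_sub (integrableOn_lap hc b i1) (integrableOn_lap hc b i2), hC,
        ← integral_const_mul]
      refine norm_integral_le_of_norm_le ((integrable_weight.const_mul _).integrableOn) ?_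
      rw [ae_restrict_iff' measurableSet_Ioi]
      refine Eventually.of_forall fun z hz => ?_
      have hz' : (0 : ℝ) ≤ z := le_of_lt hz
      have hsin : exp (-(I * m * z)) * φ z - exp (-(I * -m * z)) * φ z
          = -(2 * I) * ((Real.sin (m * z) : ℝ) : ℂ) * φ z := by
        rw [ofReal_sin, ofReal_mul, sin]
        have e1 : -((m : ℂ) * z) * I = -(I * m * z) := by ring
        have e2 : (m : ℂ) * z * I = -(I * -m * z) := by ring
        rw [e1, e2]
        linear_combination ((exp (-(I * m * z)) - exp (-(I * -m * z))) * φ z) * I_sq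
      rw [hsin, norm_mul, norm_mul, norm_neg, norm_mul, norm_I, norm_ofNat, norm_real, mul_one]
      have hs : ‖Real.sin (m * z)‖ ≤ |m| * |z| := by
        rw [Real.norm_eq_abs, ← abs_mul]
        exact Real.abs_sin_le_abs
      calc 2 * ‖Real.sin (m * z)‖ * ‖φ z‖ ≤ 2 * (|m| * |z|) * (B * weight z ^ 3) := by
            gcongr
            exact hb z hz'
        _ = 2 * |m| * B * weight z * (|z| * weight z ^ 2) := by ring
        _ ≤ 2 * |m| * B * weight z * 1 := by
            have := (weight_pos z).le
            gcongr
            exact abs_mul_weight_sq_le z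
        _ = 2 * |m| * B * weight z := mul_one _
    have e3 : m ^ 2 * ‖lap φ m - lap φ (-m)‖ ≤ |m| * (2 * B + B * C + B * C) := by
      rw [← sq_abs, sq, mul_assoc]
      exact mul_le_mul_of_nonneg_left e' (abs_nonneg m)
    nlinarith

theorem lap_const_mul_of_eq {φ ψ : ℝ → ℂ} {c : ℂ} (h : ∀ z, 0 ≤ z → φ z = c * ψ z) (m : ℂ) :
    lap φ m = c * lap ψ m := by
  rw [lap, lap, ← integral_const_mul]
  refine setIntegral_congr_fun measurableSet_Ioi fun z hz => ?_
  simp only [h z (le_of_lt hz)]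
  ring

/-! ### Decay in `(k, l, m)` of the transforms of the initial and boundary data -/

theorem SmoothDecayingInitial.slabDecays {f : ℝ × ℝ × ℝ → ℝ} (hf : SmoothDecayingInitial 12 f) :
    ∃ A : ℝ, 0 ≤ A ∧ SlabDecays univ (fun z => weight z ^ 3) 12 A f := by
  obtain ⟨A, hA⟩ := hf.2
  refine ⟨max A 0, le_max_right _ _, hf.1, fun j hj p hp _ => ?_⟩
  obtain ⟨x, y, z⟩ := p
  refine (hA x y z hp j hj).trans ?_
  have h1 := inv_pow_eq_rpow (S := |x| + |y| + |z|) (by positivity) 3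
  have hx := rpow_le_weight (x := x) (S := |x| + |y| + |z|) (by linarith [abs_nonneg y, abs_nonneg z])
  have hy := rpow_le_weight (x := y) (S := |x| + |y| + |z|) (by linarith [abs_nonneg x, abs_nonneg z])
  have hz := rpow_le_weight (x := z) (S := |x| + |y| + |z|) (by linarith [abs_nonneg y, abs_nonneg x])
  have hσ : 0 < (1 + (|x| + |y| + |z|)) ^ (-(4 / 3) : ℝ) := by positivity
  have hσ1 := (hx.trans (weight_le_one x))
  set σ := (1 + (|x| + |y| + |z|)) ^ (-(4 / 3) : ℝ)
  -- Decay of order `12` provides nine factors of exponent `4/3`, of which five are used: three in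
  -- `z` and one each in `x` and `y`.
  have h2 : 1 / (1 + |x| + |y| + |z|) ^ 12 = σ ^ 9 := by
    rw [← show 4 * 3 = 12 from rfl, ← show 3 * 3 = 9 from rfl, ← h1]; congr 2; ring
  rw [div_eq_mul_one_div, h2]
  have h3 : σ ^ 9 ≤ weight₃ (fun z => weight z ^ 3) (x, y, z) := by
    calc σ ^ 9 = σ ^ 5 * σ ^ 4 := by ring
      _ ≤ σ ^ 5 := mul_le_of_le_one_right (by positivity) (pow_le_one₀ hσ.le hσ1)
      _ = σ ^ 3 * (σ * σ) := by ring
      _ ≤ _ := by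
        rw [weight₃, weight₂]
        exact mul_le_mul (pow_le_pow_left₀ hσ.le hz 3) (mul_le_mul hx hy hσ.le (weight_pos _).le)
          (by positivity) (pow_pos (weight_pos _) 3).le
  exact mul_le_mul (le_max_left _ _) h3 (by positivity) (le_max_right _ _)

theorem SmoothDecayingBoundary.slabDecays {g : ℝ × ℝ × ℝ → ℝ} (hg : SmoothDecayingBoundary 12 g)
    (T : ℝ) : ∃ A : ℝ, 0 ≤ A ∧ SlabDecays (Iic T) (fun _ => 1) 12 A g := by
  obtain ⟨A, hA⟩ := hg.2 T
  refine ⟨max A 0, le_max_right _ _, hg.1, fun j hj p hp hr => ?_⟩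
  obtain ⟨x, y, t⟩ := p
  refine (hA x y t hp hr j hj).trans ?_
  have h1 := inv_pow_eq_rpow (S := |x| + |y|) (by positivity) 3
  have hx := rpow_le_weight (x := x) (S := |x| + |y|) (by linarith [abs_nonneg y])
  have hy := rpow_le_weight (x := y) (S := |x| + |y|) (by linarith [abs_nonneg x])
  have hσ : 0 < (1 + (|x| + |y|)) ^ (-(4 / 3) : ℝ) := by positivity
  have hσ1 := (hx.trans (weight_le_one x))
  set σ := (1 + (|x| + |y|)) ^ (-(4 / 3) : ℝ)
  have h2 : 1 / (1 + |x| + |y|) ^ 12 = σ ^ 9 := by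
    rw [← show 4 * 3 = 12 from rfl, ← show 3 * 3 = 9 from rfl, ← h1]; congr 2; ring
  rw [div_eq_mul_one_div, h2]
  have h3 : σ ^ 9 ≤ weight₃ (fun _ => 1) (x, y, t) := by
    calc σ ^ 9 = σ ^ 2 * σ ^ 7 := by ring
      _ ≤ σ ^ 2 := mul_le_of_le_one_right (by positivity) (pow_le_one₀ hσ.le hσ1)
      _ = σ * σ := by ring
      _ ≤ _ := by
        rw [weight₃, weight₂, one_mul]
        exact mul_le_mul hx hy hσ.le (weight_pos _).le
  exact mul_le_mul (le_max_left _ _) h3 (by positivity) (le_max_right _ _)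

theorem weight_cube_le_one (z : ℝ) : weight z ^ 3 ≤ 1 :=
  pow_le_one₀ (weight_pos z).le (weight_le_one z)

/-- Eight horizontal derivatives pay for the damping in `(k, l)` and two further derivatives in `z`
for the decay in `m`. -/
theorem SmoothDecayingInitial.exists_bound_hat {f : ℝ × ℝ × ℝ → ℝ}
    (hf : SmoothDecayingInitial 12 f) : ∃ B : ℝ, 0 ≤ B ∧ ∀ k l m : ℝ,
      ‖hat f k l m + hat f k l (-m)‖ ≤ B * (damping k l / (1 + m ^ 2)) ∧
      ‖hat f k l m - hat f k l (-m)‖ ≤ B * (damping k l / (1 + m ^ 2)) * |m| := by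
  obtain ⟨A, hA, h⟩ := hf.slabDecays
  have h' : SlabDecays univ (fun z => weight z ^ 3) (4 + 8) A f := h
  obtain ⟨F, hF, hFf⟩ := h'.exists_damp
  have d0 : SlabDecays univ (fun z => weight z ^ 3) (1 + 1) (16 * A) F := hF.mono (by norm_num)
  have d1 : SlabDecays univ (fun z => weight z ^ 3) (0 + 1) (16 * A) (pd₃ (0, 0, 1) F) :=
    d0.pd norm_f₃
  have d2 := d1.pd norm_f₃
  have hA' : 0 ≤ 16 * A := by positivity
  set J := ∫ q, weight₂ q
  have hJ : 0 ≤ J := integral_weight₂_nonneg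
  set C : ℝ := ∫ z in Ioi (0 : ℝ), weight z
  have hC : 0 ≤ C := integral_nonneg fun z => (weight_pos z).le
  have hw := weight_cube_le_one
  refine ⟨16 * A * J * (4 * C + 2), by positivity, fun k l m => ?_⟩
  have hhat : ∀ m : ℂ, m.im ≤ 0 → hat f k l m = damping k l * lap (slab F k l) m := by
    intro m hm
    rw [hat_eq_lap h.contDiffOn.continuousOn (A := A) ?_ k l hm]
    · exact lap_const_mul_of_eq (fun z hz => hFf k l z hz (mem_univ z)) m
    · intro x y z hz
      have := h.abs_le (p := (x, y, z)) hz (mem_univ z)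
      refine this.trans ?_
      rw [weight₃, ← mul_assoc]
      have hw2 := (weight₂_pos (x, y)).le
      have h0 := (weight_pos z).le
      have h1 := weight_le_one z
      gcongr
      calc weight z ^ 3 = weight z * weight z ^ 2 := by ring
        _ ≤ weight z := mul_le_of_le_one_right h0 (pow_le_one₀ h0 h1)
  have hcont : ∀ {n : ℕ} {G : ℝ × ℝ × ℝ → ℝ},
      SlabDecays univ (fun z => weight z ^ 3) n (16 * A) G → ContinuousOn (slab G k l) (Ici 0) := by
    intro n G hG
    have := hG.continuousOn_slab hA' hw k l
    rwa [inter_univ] at this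
  obtain ⟨p1, p2⟩ := norm_lap_even_odd_le (φ := slab F k l) (φ' := slab (pd₃ (0, 0, 1) F) k l)
    (φ'' := slab (pd₃ (0, 0, 1) (pd₃ (0, 0, 1) F)) k l) (B := 16 * A * J)
    (hcont d0) (hcont d1) (hcont d2)
    (fun z hz => d0.norm_slab_le hz (mem_univ z) k l)
    (fun z hz => d1.norm_slab_le hz (mem_univ z) k l)
    (fun z hz => d2.norm_slab_le hz (mem_univ z) k l)
    (fun z hz => d0.hasDerivAt_slab hA' hw hz univ_mem k l)
    (fun z hz => d1.hasDerivAt_slab hA' hw hz univ_mem k l) m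
  have hD := (damping_pos k l).le
  have hn : ‖(damping k l : ℂ)‖ = damping k l := by
    rw [norm_real, Real.norm_of_nonneg hD]
  rw [hhat m (by simp), hhat (-m) (by simp), ← mul_add, ← mul_sub, norm_mul, norm_mul, hn]
  constructor
  · refine (mul_le_mul_of_nonneg_left p1 hD).trans_eq ?_
    ring
  · refine (mul_le_mul_of_nonneg_left p2 hD).trans_eq ?_
    ring

/-- Eight horizontal derivatives give the damping in `(k, l)`; one time derivative, through
integration by parts in `s`, gives the decay in `m`. -/
theorem SmoothDecayingBoundary.exists_bound_timeTransform {g : ℝ × ℝ × ℝ → ℝ}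
    (hg : SmoothDecayingBoundary 12 g) {t c : ℝ} (ht : 0 ≤ t) (hc : 0 < c) :
    ∃ B : ℝ, 0 ≤ B ∧ ∀ (k l m : ℝ) (om : ℂ), m ≠ 0 → om ^ 2 = c * (k ^ 2 + l ^ 2 + m ^ 2) →
      ‖timeTransform om (tilde g k l) t‖ ≤ B * (damping k l / (1 + m ^ 2)) := by
  obtain ⟨A, hA, h⟩ := hg.slabDecays t
  have h' : SlabDecays (Iic t) (fun _ => 1) (4 + 8) A g := h
  obtain ⟨F, hF, hFf⟩ := h'.exists_damp
  have d0 : SlabDecays (Iic t) (fun _ => 1) (0 + 1) (16 * A) F := hF.mono (by norm_num)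
  have d1 := d0.pd norm_f₃
  have hA' : 0 ≤ 16 * A := by positivity
  set J := ∫ q, weight₂ q
  have hJ : 0 ≤ J := integral_weight₂_nonneg
  refine ⟨(t ^ 2 + t + 2) * (16 * A * J) * ((1 + c) / c), by positivity,
    fun k l m om hm hom => ?_⟩
  have hI : Icc 0 t = Ici 0 ∩ Iic t := rfl
  have htil : ∀ s, 0 < s → s ≤ t → tilde g k l s = damping k l * slab F k l s := by
    intro s hs hst
    rw [← hFf k l s hs.le hst]
    exact tilde_eq_planar (fun x y => rfl) (h.integrable_slice hs.le hst) k l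
  rw [timeTransform_congr ht (fun s hs hst => htil s hs hst), timeTransform_const_mul, norm_mul,
    norm_real, Real.norm_of_nonneg (damping_pos k l).le]
  have key := norm_timeTransform_le_of_sq (φ := slab F k l) (φ' := slab (pd₃ (0, 0, 1) F) k l) ht
    (by rw [hI]; exact d0.continuousOn_slab hA' (fun _ => le_rfl) k l)
    (by rw [hI]; exact d1.continuousOn_slab hA' (fun _ => le_rfl) k l)
    (fun s hs => d0.hasDerivAt_slab hA' (fun _ => le_rfl) hs.1 (Iic_mem_nhds hs.2) k l)
    (M := 16 * A * J)
    (fun s hs => (d0.norm_slab_le hs.1 hs.2 k l).trans_eq (mul_one _))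
    (fun s hs => (d1.norm_slab_le hs.1 hs.2 k l).trans_eq (mul_one _)) hc hm hom
  refine (mul_le_mul_of_nonneg_left key (damping_pos k l).le).trans_eq ?_
  ring

end HalfSpace

end


noncomputable section

namespace HalfSpace

open Filter Topology Set

/-! ### Measurability of the integrands -/

theorem measurable_integral_param {α β : Type*} [MeasurableSpace α] [MeasurableSpace β]
    {ν : Measure β} [SFinite ν] {F : α → β → ℂ} (h : Measurable (Function.uncurry F)) :
    Measurable fun a => ∫ b, F a b ∂ν :=
  (h.stronglyMeasurable.integral_prod_right (f := F)).measurable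

/-- A continuous extension to the whole space makes the integrands measurable, while the transforms
only use the values inside. -/
theorem continuous_extend {f : ℝ × ℝ × ℝ → ℝ} (hf : ContinuousOn f halfSpace) :
    Continuous fun p : ℝ × ℝ × ℝ => f (p.1, p.2.1, max p.2.2 0) :=
  hf.comp_continuous (f := fun p : ℝ × ℝ × ℝ => (p.1, p.2.1, max p.2.2 0)) (by fun_prop)
    fun p => (le_max_right p.2.2 0 : (0 : ℝ) ≤ max p.2.2 0)

section measurability

variable {α : Type*} [MeasurableSpace α] {k l : α → ℝ} {m : α → ℂ}

theorem measurable_hat {f : ℝ × ℝ × ℝ → ℝ} (hf : ContinuousOn f halfSpace) (hk : Measurable k)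
    (hl : Measurable l) (hm : Measurable m) : Measurable fun a => hat f (k a) (l a) (m a) := by
  have e : ∀ a, hat f (k a) (l a) (m a)
      = hat (fun p => f (p.1, p.2.1, max p.2.2 0)) (k a) (l a) (m a) := fun a =>
    hat_congr (fun x y z hz => by simp [max_eq_left hz.le]) _ _ _
  rw [funext e]
  simp only [hat]
  have hc := (continuous_extend hf).measurable
  refine measurable_integral_param (F := fun a (x : ℝ) => ∫ y : ℝ, ∫ z in Ioi (0 : ℝ),
    exp (-(I * k a * x) - I * l a * y - I * m a * z) * (f (x, y, max z 0) : ℂ)) ?_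
  refine measurable_integral_param (F := fun (p : α × ℝ) (y : ℝ) => ∫ z in Ioi (0 : ℝ),
    exp (-(I * k p.1 * p.2) - I * l p.1 * y - I * m p.1 * z) * (f (p.2, y, max z 0) : ℂ)) ?_
  refine measurable_integral_param (F := fun (p : (α × ℝ) × ℝ) (z : ℝ) =>
    exp (-(I * k p.1.1 * p.1.2) - I * l p.1.1 * p.2 - I * m p.1.1 * z)
      * (f (p.1.2, p.2, max z 0) : ℂ)) ?_
  have h1 : Measurable fun p : ((α × ℝ) × ℝ) × ℝ => f (p.1.1.2, p.1.2, max p.2 0) :=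
    hc.comp (f := fun p : ((α × ℝ) × ℝ) × ℝ => (p.1.1.2, p.1.2, p.2)) (by fun_prop)
  simp only [Function.uncurry_def]
  exact Measurable.mul (by fun_prop) (measurable_ofReal.comp h1)

theorem measurable_timeTransform {g : ℝ × ℝ × ℝ → ℝ} (hg : ContinuousOn g halfSpace)
    (hk : Measurable k) (hl : Measurable l) {om : α → ℂ} (hom : Measurable om) {t : ℝ}
    (ht : 0 ≤ t) : Measurable fun a => timeTransform (om a) (tilde g (k a) (l a)) t := by
  have e : ∀ a, timeTransform (om a) (tilde g (k a) (l a)) t = timeTransform (om a)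
      (tilde (fun p => g (p.1, p.2.1, max p.2.2 0)) (k a) (l a)) t := fun a =>
    timeTransform_congr ht (fun s hs _ => by simp [tilde, max_eq_left hs.le]) _
  have hc := (continuous_extend hg).measurable
  have htilde : Measurable fun p : α × ℝ =>
      tilde (fun p => g (p.1, p.2.1, max p.2.2 0)) (k p.1) (l p.1) p.2 := by
    simp only [tilde]
    refine measurable_integral_param (F := fun (p : α × ℝ) (x : ℝ) => ∫ y : ℝ,
      exp (-(I * k p.1 * x) - I * l p.1 * y) * (g (x, y, max p.2 0) : ℂ)) ?_
    refine measurable_integral_param (F := fun (p : (α × ℝ) × ℝ) (y : ℝ) =>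
      exp (-(I * k p.1.1 * p.2) - I * l p.1.1 * y) * (g (p.2, y, max p.1.2 0) : ℂ)) ?_
    have h1 : Measurable fun p : ((α × ℝ) × ℝ) × ℝ => g (p.1.2, p.2, max p.1.1.2 0) :=
      hc.comp (f := fun p : ((α × ℝ) × ℝ) × ℝ => (p.1.2, p.2, p.1.1.2)) (by fun_prop)
    simp only [Function.uncurry_def]
    exact Measurable.mul (by fun_prop) (measurable_ofReal.comp h1)
  rw [funext e]
  simp only [timeTransform, intervalIntegral.integral_of_le ht]
  have i1 : Measurable fun a => ∫ s in Ioc 0 t, exp (I * om a * s) *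
      tilde (fun p => g (p.1, p.2.1, max p.2.2 0)) (k a) (l a) s := by
    refine measurable_integral_param (F := fun a (s : ℝ) => exp (I * om a * s) *
      tilde (fun p => g (p.1, p.2.1, max p.2.2 0)) (k a) (l a) s) ?_
    simp only [Function.uncurry_def]
    fun_prop
  have i2 : Measurable fun a => ∫ s in Ioc 0 t, exp (-(I * om a * s)) *
      tilde (fun p => g (p.1, p.2.1, max p.2.2 0)) (k a) (l a) s := by
    refine measurable_integral_param (F := fun a (s : ℝ) => exp (-(I * om a * s)) *
      tilde (fun p => g (p.1, p.2.1, max p.2.2 0)) (k a) (l a) s) ?_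
    simp only [Function.uncurry_def]
    fun_prop
  fun_prop

theorem measurable_root (hk : Measurable k) (hl : Measurable l) (hm : Measurable m) :
    Measurable fun a => root (k a) (l a) (m a) := by
  simp only [root]
  fun_prop

variable {lam mu : ℝ} {d : Data} {N : ℕ} {t : ℝ}

theorem measurable_NP (hd : d.SmoothDecaying N) (ht : 0 ≤ t) (hk : Measurable k)
    (hl : Measurable l) (hm : Measurable m) :
    Measurable fun a => NP lam mu d (k a) (l a) (m a) t := by
  have ho : Measurable fun a => omega1 lam mu (k a) (l a) (m a) :=
    (measurable_root hk hl hm).const_mul _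
  have g1 := measurable_timeTransform hd.g₁.1.continuousOn hk hl ho ht
  have g2 := measurable_timeTransform hd.g₂.1.continuousOn hk hl ho ht
  have g3 := measurable_timeTransform hd.g₃.1.continuousOn hk hl ho ht
  have a0 := measurable_hat hd.u₀.1.continuousOn hk hl hm
  have b0 := measurable_hat hd.v₀.1.continuousOn hk hl hm
  have c0 := measurable_hat hd.w₀.1.continuousOn hk hl hm
  have a1 := measurable_hat hd.u₁.1.continuousOn hk hl hm
  have b1 := measurable_hat hd.v₁.1.continuousOn hk hl hm
  have c1 := measurable_hat hd.w₁.1.continuousOn hk hl hm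
  simp only [NP, transP, freeEvolution]
  fun_prop

theorem measurable_NQ (hd : d.SmoothDecaying N) (ht : 0 ≤ t) (hk : Measurable k)
    (hl : Measurable l) (hm : Measurable m) :
    Measurable fun a => NQ lam mu d (k a) (l a) (m a) t := by
  have ho : Measurable fun a => omega2 mu (k a) (l a) (m a) :=
    (measurable_root hk hl hm).const_mul _
  have g2 := measurable_timeTransform hd.g₂.1.continuousOn hk hl ho ht
  have g3 := measurable_timeTransform hd.g₃.1.continuousOn hk hl ho ht
  have b0 := measurable_hat hd.v₀.1.continuousOn hk hl hm
  have c0 := measurable_hat hd.w₀.1.continuousOn hk hl hm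
  have b1 := measurable_hat hd.v₁.1.continuousOn hk hl hm
  have c1 := measurable_hat hd.w₁.1.continuousOn hk hl hm
  simp only [NQ, transQ, freeEvolution]
  fun_prop

theorem measurable_NR (hd : d.SmoothDecaying N) (ht : 0 ≤ t) (hk : Measurable k)
    (hl : Measurable l) (hm : Measurable m) :
    Measurable fun a => NR lam mu d (k a) (l a) (m a) t := by
  have ho : Measurable fun a => omega2 mu (k a) (l a) (m a) :=
    (measurable_root hk hl hm).const_mul _
  have g1 := measurable_timeTransform hd.g₁.1.continuousOn hk hl ho ht
  have g3 := measurable_timeTransform hd.g₃.1.continuousOn hk hl ho ht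
  have a0 := measurable_hat hd.u₀.1.continuousOn hk hl hm
  have c0 := measurable_hat hd.w₀.1.continuousOn hk hl hm
  have a1 := measurable_hat hd.u₁.1.continuousOn hk hl hm
  have c1 := measurable_hat hd.w₁.1.continuousOn hk hl hm
  simp only [NR, transR, freeEvolution]
  fun_prop

end measurability

theorem measurable_real_integrands {lam mu : ℝ} {d : Data} {N : ℕ} {t : ℝ}
    (hd : d.SmoothDecaying N) (ht : 0 ≤ t) (x y z : ℝ) :
    Measurable (fun q : ℝ × ℝ × ℝ => realU lam mu d x y z t q.1 q.2.1 q.2.2) ∧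
    Measurable (fun q : ℝ × ℝ × ℝ => realV lam mu d x y z t q.1 q.2.1 q.2.2) ∧
    Measurable (fun q : ℝ × ℝ × ℝ => realW lam mu d x y z t q.1 q.2.1 q.2.2) := by
  have hk : Measurable fun q : ℝ × ℝ × ℝ => q.1 := by fun_prop
  have hl : Measurable fun q : ℝ × ℝ × ℝ => q.2.1 := by fun_prop
  have hm : Measurable fun q : ℝ × ℝ × ℝ => (q.2.2 : ℂ) := by fun_prop
  have hm' : Measurable fun q : ℝ × ℝ × ℝ => -(q.2.2 : ℂ) := by fun_prop
  have p := measurable_NP (lam := lam) (mu := mu) hd ht hk hl hm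
  have p' := measurable_NP (lam := lam) (mu := mu) hd ht hk hl hm'
  have q := measurable_NQ (lam := lam) (mu := mu) hd ht hk hl hm
  have q' := measurable_NQ (lam := lam) (mu := mu) hd ht hk hl hm'
  have r := measurable_NR (lam := lam) (mu := mu) hd ht hk hl hm
  have r' := measurable_NR (lam := lam) (mu := mu) hd ht hk hl hm'
  simp only [realU, realV, realW, kernel]
  refine ⟨?_, ?_, ?_⟩ <;> fun_prop

end HalfSpace

end


noncomputable section

namespace HalfSpace

open Filter Topology Set

/-! ### Bounds for the integrands over the real space -/

theorem freeEvolution_add (om X₀ X₁ Y₀ Y₁ : ℂ) (t : ℝ) :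
    freeEvolution om X₀ X₁ t + freeEvolution om Y₀ Y₁ t
      = freeEvolution om (X₀ + Y₀) (X₁ + Y₁) t := by
  simp only [freeEvolution]; ring

theorem freeEvolution_sub (om X₀ X₁ Y₀ Y₁ : ℂ) (t : ℝ) :
    freeEvolution om X₀ X₁ t - freeEvolution om Y₀ Y₁ t
      = freeEvolution om (X₀ - Y₀) (X₁ - Y₁) t := by
  simp only [freeEvolution]; ring

theorem norm_freeEvolution_le {om : ℂ} {c : ℝ} (hc : 0 < c) (hom : om ^ 2 = (c : ℂ)) {t : ℝ}
    (ht : 0 ≤ t) (X₀ X₁ : ℂ) : ‖freeEvolution om X₀ X₁ t‖ ≤ ‖X₀‖ + t * ‖X₁‖ := by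
  have hr : om ^ 2 = ((√c : ℝ) : ℂ) ^ 2 := by
    rw [hom, ← ofReal_pow, Real.sq_sqrt hc.le]
  have hs := Real.sqrt_pos.2 hc
  rw [freeEvolution_eq_of_sq hr, freeEvolution_eq, ← ofReal_mul, ← ofReal_cos, ← ofReal_sin,
    ← ofReal_div]
  refine norm_add_le_of_le ?_ ?_
  · rw [norm_mul, norm_real]
    exact mul_le_of_le_one_left (norm_nonneg _) (Real.abs_cos_le_one _)
  · rw [norm_mul, norm_real, Real.norm_eq_abs, abs_div, abs_of_pos hs]
    refine mul_le_mul_of_nonneg_right ?_ (norm_nonneg _)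
    rw [div_le_iff₀ hs]
    refine Real.abs_sin_le_abs.trans_eq ?_
    rw [abs_of_nonneg (by positivity), mul_comm]

/-- Bounds for the even and the odd part of the transform of an initial value. -/
def HatBound (f : ℝ × ℝ × ℝ → ℝ) (k l m δ : ℝ) : Prop :=
  ‖hat f k l m + hat f k l (-m)‖ ≤ δ ∧ ‖hat f k l m - hat f k l (-m)‖ ≤ δ * |m|

section trans

variable {a b c : ℝ × ℝ × ℝ → ℝ} {k l m δ : ℝ}

theorem norm_real_mul_le {X : ℂ} {β : ℝ} (x : ℝ) (h : ‖X‖ ≤ β) : ‖(x : ℂ) * X‖ ≤ |x| * β := by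
  rw [norm_mul, norm_real, Real.norm_eq_abs]
  exact mul_le_mul_of_nonneg_left h (abs_nonneg x)

theorem norm_transP_add_le (ha : HatBound a k l m δ) (hb : HatBound b k l m δ)
    (hc : HatBound c k l m δ) :
    ‖transP a b c k l m + transP a b c k l (-m)‖ ≤ δ * (|k| + |l| + m ^ 2) := by
  have e : transP a b c k l m + transP a b c k l (-m)
      = k * (hat a k l m + hat a k l (-m)) + l * (hat b k l m + hat b k l (-m))
        + m * (hat c k l m - hat c k l (-m)) := by
    simp only [transP]; ring
  rw [e]
  refine (norm_add_le_of_le (norm_add_le_of_le (norm_real_mul_le k ha.1) (norm_real_mul_le l hb.1))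
    (norm_real_mul_le m hc.2)).trans_eq ?_
  rw [← sq_abs m]; ring

theorem norm_transP_sub_le (ha : HatBound a k l m δ) (hb : HatBound b k l m δ)
    (hc : HatBound c k l m δ) :
    ‖transP a b c k l m - transP a b c k l (-m)‖ ≤ δ * (|m| * (1 + |k| + |l|)) := by
  have e : transP a b c k l m - transP a b c k l (-m)
      = k * (hat a k l m - hat a k l (-m)) + l * (hat b k l m - hat b k l (-m))
        + m * (hat c k l m + hat c k l (-m)) := by
    simp only [transP]; ring
  rw [e]
  refine (norm_add_le_of_le (norm_add_le_of_le (norm_real_mul_le k ha.2) (norm_real_mul_le l hb.2))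
    (norm_real_mul_le m hc.1)).trans_eq ?_
  ring

theorem norm_transQ_add_le (hb : HatBound b k l m δ) (hc : HatBound c k l m δ) :
    ‖transQ a b c k l m + transQ a b c k l (-m)‖ ≤ δ * (|l| + m ^ 2) := by
  have e : transQ a b c k l m + transQ a b c k l (-m)
      = m * (hat b k l m - hat b k l (-m)) - l * (hat c k l m + hat c k l (-m)) := by
    simp only [transQ]; ring
  rw [e]
  refine (norm_sub_le_of_le (norm_real_mul_le m hb.2) (norm_real_mul_le l hc.1)).trans_eq ?_
  rw [← sq_abs m]; ring

theorem norm_transQ_sub_le (hb : HatBound b k l m δ) (hc : HatBound c k l m δ) :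
    ‖transQ a b c k l m - transQ a b c k l (-m)‖ ≤ δ * (|m| * (1 + |l|)) := by
  have e : transQ a b c k l m - transQ a b c k l (-m)
      = m * (hat b k l m + hat b k l (-m)) - l * (hat c k l m - hat c k l (-m)) := by
    simp only [transQ]; ring
  rw [e]
  refine (norm_sub_le_of_le (norm_real_mul_le m hb.1) (norm_real_mul_le l hc.2)).trans_eq ?_
  ring

theorem norm_transR_add_le (ha : HatBound a k l m δ) (hc : HatBound c k l m δ) :
    ‖transR a b c k l m + transR a b c k l (-m)‖ ≤ δ * (|k| + m ^ 2) := by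
  have e : transR a b c k l m + transR a b c k l (-m)
      = k * (hat c k l m + hat c k l (-m)) - m * (hat a k l m - hat a k l (-m)) := by
    simp only [transR]; ring
  rw [e]
  refine (norm_sub_le_of_le (norm_real_mul_le k hc.1) (norm_real_mul_le m ha.2)).trans_eq ?_
  rw [← sq_abs m]; ring

theorem norm_transR_sub_le (ha : HatBound a k l m δ) (hc : HatBound c k l m δ) :
    ‖transR a b c k l m - transR a b c k l (-m)‖ ≤ δ * (|m| * (1 + |k|)) := by
  have e : transR a b c k l m - transR a b c k l (-m)
      = k * (hat c k l m - hat c k l (-m)) - m * (hat a k l m + hat a k l (-m)) := by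
    simp only [transR]; ring
  rw [e]
  refine (norm_sub_le_of_le (norm_real_mul_le k hc.2) (norm_real_mul_le m ha.1)).trans_eq ?_
  ring

end trans

/-- Bounds for the transforms of all the data at `(k, l, m)`. -/
structure DataBound (lam mu : ℝ) (d : Data) (t k l m δ : ℝ) : Prop where
  nonneg : 0 ≤ δ
  u₀ : HatBound d.u₀ k l m δ
  v₀ : HatBound d.v₀ k l m δ
  w₀ : HatBound d.w₀ k l m δ
  u₁ : HatBound d.u₁ k l m δ
  v₁ : HatBound d.v₁ k l m δ
  w₁ : HatBound d.w₁ k l m δ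
  G₁ : ‖timeTransform (omega1 lam mu k l m) (tilde d.g₁ k l) t‖ ≤ δ
  F₁ : ‖timeTransform (omega1 lam mu k l m) (tilde d.g₂ k l) t‖ ≤ δ
  E₁ : ‖timeTransform (omega1 lam mu k l m) (tilde d.g₃ k l) t‖ ≤ δ
  G₂ : ‖timeTransform (omega2 mu k l m) (tilde d.g₁ k l) t‖ ≤ δ
  F₂ : ‖timeTransform (omega2 mu k l m) (tilde d.g₂ k l) t‖ ≤ δ
  E₂ : ‖timeTransform (omega2 mu k l m) (tilde d.g₃ k l) t‖ ≤ δ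

namespace DataBound

variable {lam mu : ℝ} {d : Data} {t k l m δ : ℝ}

theorem norm_imag_mul_le {X : ℂ} {β : ℝ} {x : ℝ} (hx : 0 ≤ x) (h : ‖X‖ ≤ β) :
    ‖2 * I * x * X‖ ≤ 2 * x * β := by
  rw [norm_mul, norm_mul, norm_mul, norm_I, norm_ofNat, norm_real, Real.norm_of_nonneg hx, mul_one]
  gcongr

theorem norm_evolution_le {om : ℂ} {c : ℝ} (hc : 0 < c) (hom : om ^ 2 = (c : ℂ))
    (ht : 0 ≤ t) {X₀ X₁ : ℂ} {p : ℝ} (h₀ : ‖X₀‖ ≤ δ * p) (h₁ : ‖X₁‖ ≤ δ * p) :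
    ‖freeEvolution om X₀ X₁ t‖ ≤ (1 + t) * (δ * p) := by
  refine (norm_freeEvolution_le hc hom ht X₀ X₁).trans ?_
  have := mul_le_mul_of_nonneg_left h₁ ht
  linarith

/-- The squared frequencies are even in `m`, so the time transforms at `m` and `-m` agree. In a sum
or difference the boundary terms of one parity cancel and the others double. Every difference
retains a factor `|m|`, which later compensates `1/m`. -/
theorem norm_N_le (h : DataBound lam mu d t k l m δ) (hmu : 0 < mu) (hlm : 0 < lam + mu)
    (ht : 0 ≤ t) (hm : m ≠ 0) {K : ℝ} (hK : K = 2 * mu + 2 * (lam + 2 * mu) + (1 + t)) :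
    ‖NP lam mu d k l m t + NP lam mu d k l (-m) t‖ ≤ K * δ * (|k| + |l| + m ^ 2) ∧
    ‖NP lam mu d k l m t - NP lam mu d k l (-m) t‖ ≤ K * δ * (|m| * (1 + |k| + |l|)) ∧
    ‖NQ lam mu d k l m t + NQ lam mu d k l (-m) t‖ ≤ K * δ * (|l| + m ^ 2) ∧
    ‖NQ lam mu d k l m t - NQ lam mu d k l (-m) t‖ ≤ K * δ * (|m| * (1 + |l|)) ∧
    ‖NR lam mu d k l m t + NR lam mu d k l (-m) t‖ ≤ K * δ * (|k| + m ^ 2) ∧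
    ‖NR lam mu d k l m t - NR lam mu d k l (-m) t‖ ≤ K * δ * (|m| * (1 + |k|)) := by
  have hδ := h.nonneg
  have hmc : (m : ℂ) ≠ 0 := by exact_mod_cast hm
  have hl2 : 0 < lam + 2 * mu := by linarith
  have hκ : 0 < k ^ 2 + l ^ 2 + m ^ 2 := by positivity
  have hc1 : 0 < (lam + 2 * mu) * (k ^ 2 + l ^ 2 + m ^ 2) := by positivity
  have hc2 : 0 < mu * (k ^ 2 + l ^ 2 + m ^ 2) := by positivity
  have s1 : omega1 lam mu k l m ^ 2 = (((lam + 2 * mu) * (k ^ 2 + l ^ 2 + m ^ 2) : ℝ) : ℂ) := by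
    rw [omega1_sq k l hmu hlm hmc]; push_cast; ring
  have s2 : omega2 mu k l m ^ 2 = ((mu * (k ^ 2 + l ^ 2 + m ^ 2) : ℝ) : ℂ) := by
    rw [omega2_sq k l hmu hmc]; push_cast; ring
  have o1 : omega1 lam mu k l (-m) ^ 2 = omega1 lam mu k l m ^ 2 := by
    rw [omega1_sq k l hmu hlm (neg_ne_zero.2 hmc), omega1_sq k l hmu hlm hmc, neg_sq]
  have o2 : omega2 mu k l (-m) ^ 2 = omega2 mu k l m ^ 2 := by
    rw [omega2_sq k l hmu (neg_ne_zero.2 hmc), omega2_sq k l hmu hmc, neg_sq]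
  have hKk : 0 ≤ 2 * mu + 2 * (lam + 2 * mu) := by positivity
  have ak := abs_nonneg k
  have al := abs_nonneg l
  have am := abs_nonneg m
  have m2 := sq_nonneg m
  have dk : 0 ≤ δ * |k| := by positivity
  have dl : 0 ≤ δ * |l| := by positivity
  have dm : 0 ≤ δ * |m| := by positivity
  have dm2 : 0 ≤ δ * m ^ 2 := by positivity
  have dmk : 0 ≤ δ * (|m| * |k|) := by positivity
  have dml : 0 ≤ δ * (|m| * |l|) := by positivity
  simp only [NP, NQ, NR, timeTransform_eq_of_sq o1, timeTransform_eq_of_sq o2,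
    freeEvolution_eq_of_sq o1, freeEvolution_eq_of_sq o2]
  set G₁ := timeTransform (omega1 lam mu k l m) (tilde d.g₁ k l) t
  set F₁ := timeTransform (omega1 lam mu k l m) (tilde d.g₂ k l) t
  set E₁ := timeTransform (omega1 lam mu k l m) (tilde d.g₃ k l) t
  set G₂ := timeTransform (omega2 mu k l m) (tilde d.g₁ k l) t
  set F₂ := timeTransform (omega2 mu k l m) (tilde d.g₂ k l) t
  set E₂ := timeTransform (omega2 mu k l m) (tilde d.g₃ k l) t
  refine ⟨?_, ?_, ?_, ?_, ?_, ?_⟩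
  · have e := norm_add_le_of_le (norm_add_le_of_le
      (norm_imag_mul_le hmu.le (norm_real_mul_le (-k) h.G₁))
      (norm_imag_mul_le hmu.le (norm_real_mul_le (-l) h.F₁)))
      (norm_evolution_le hc1 s1 ht (norm_transP_add_le h.u₀ h.v₀ h.w₀)
        (norm_transP_add_le h.u₁ h.v₁ h.w₁))
    rw [← freeEvolution_add] at e
    simp only [abs_neg, ofReal_neg] at e
    refine (le_of_eq ?_).trans (e.trans ?_)
    · congr 1; ring
    · rw [hK]; nlinarith
  · have e := norm_add_le_of_le (norm_imag_mul_le hl2.le (norm_real_mul_le (-m) h.E₁))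
      (norm_evolution_le hc1 s1 ht (norm_transP_sub_le h.u₀ h.v₀ h.w₀)
        (norm_transP_sub_le h.u₁ h.v₁ h.w₁))
    rw [← freeEvolution_sub] at e
    simp only [abs_neg, ofReal_neg] at e
    refine (le_of_eq ?_).trans (e.trans ?_)
    · congr 1; push_cast; ring
    · rw [hK]; nlinarith
  · have e := norm_add_le_of_le (norm_imag_mul_le hl2.le (norm_real_mul_le l h.E₂))
      (norm_evolution_le hc2 s2 ht (norm_transQ_add_le (a := d.u₀) h.v₀ h.w₀)
        (norm_transQ_add_le (a := d.u₁) h.v₁ h.w₁))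
    rw [← freeEvolution_add] at e
    refine (le_of_eq ?_).trans (e.trans ?_)
    · congr 1; push_cast; ring
    · rw [hK]; nlinarith
  · have e := norm_add_le_of_le (norm_imag_mul_le hmu.le (norm_real_mul_le (-m) h.F₂))
      (norm_evolution_le hc2 s2 ht (norm_transQ_sub_le (a := d.u₀) h.v₀ h.w₀)
        (norm_transQ_sub_le (a := d.u₁) h.v₁ h.w₁))
    rw [← freeEvolution_sub] at e
    simp only [abs_neg, ofReal_neg] at e
    refine (le_of_eq ?_).trans (e.trans ?_)
    · congr 1; ring
    · rw [hK]; nlinarith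
  · have e := norm_add_le_of_le (norm_imag_mul_le hl2.le (norm_real_mul_le (-k) h.E₂))
      (norm_evolution_le hc2 s2 ht (norm_transR_add_le (b := d.v₀) h.u₀ h.w₀)
        (norm_transR_add_le (b := d.v₁) h.u₁ h.w₁))
    rw [← freeEvolution_add] at e
    simp only [abs_neg, ofReal_neg] at e
    refine (le_of_eq ?_).trans (e.trans ?_)
    · congr 1; push_cast; ring
    · rw [hK]; nlinarith
  · have e := norm_add_le_of_le (norm_imag_mul_le hmu.le (norm_real_mul_le m h.G₂))
      (norm_evolution_le hc2 s2 ht (norm_transR_sub_le (b := d.v₀) h.u₀ h.w₀)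
        (norm_transR_sub_le (b := d.v₁) h.u₁ h.w₁))
    rw [← freeEvolution_sub] at e
    refine (le_of_eq ?_).trans (e.trans ?_)
    · congr 1; ring
    · rw [hK]; nlinarith

theorem norm_kernel (x y z k l m : ℝ) : ‖kernel x y z k l m‖ = (k ^ 2 + l ^ 2 + m ^ 2)⁻¹ := by
  have e1 : ((k : ℂ) ^ 2 + l ^ 2 + m ^ 2) = ((k ^ 2 + l ^ 2 + m ^ 2 : ℝ) : ℂ) := by push_cast; ring
  have e2 : ‖exp (I * k * x + I * l * y + I * m * z)‖ = 1 := by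
    rw [norm_exp]; simp
  rw [kernel, norm_div, e2, e1, norm_real, Real.norm_of_nonneg (by positivity), one_div]

/-- The odd combinations carry a factor `|m|` that cancels the `1/m` from eliminating the third curl
component. -/
theorem norm_inv_mul_le {m : ℝ} (hm : m ≠ 0) {X : ℂ} {β p : ℝ} (c : ℝ) (h : ‖X‖ ≤ β * (|m| * p)) :
    ‖1 / (m : ℂ) * (c * X)‖ ≤ |c| * (β * p) := by
  rw [norm_mul, norm_mul, norm_div, norm_one, norm_real, norm_real, Real.norm_eq_abs,
    Real.norm_eq_abs]
  have : 0 < |m| := abs_pos.2 hm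
  calc 1 / |m| * (|c| * ‖X‖) ≤ 1 / |m| * (|c| * (β * (|m| * p))) := by gcongr
    _ = |c| * (β * p) := by field_simp

/-- The polynomial factors of the integrands vanish quadratically at the origin, apart from harmless
growth in `|k|` and `|l|`; hence the singularity of `1 / (k² + l² + m²)` is cancelled. -/
theorem weights_le {a b : ℝ} (ha : 0 ≤ a) (hb : 0 ≤ b) (m : ℝ) :
    a * (a + b + m ^ 2) + a * b * (1 + b) + (m ^ 2 + b ^ 2) * (1 + a)
      ≤ 4 * ((1 + a) * (1 + b)) * (a ^ 2 + b ^ 2 + m ^ 2) ∧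
    b * (a + b + m ^ 2) + (a ^ 2 + m ^ 2) * (1 + b) + a * b * (1 + a)
      ≤ 4 * ((1 + a) * (1 + b)) * (a ^ 2 + b ^ 2 + m ^ 2) ∧
    m ^ 2 * (1 + a + b) + b * (b + m ^ 2) + a * (a + m ^ 2)
      ≤ 4 * ((1 + a) * (1 + b)) * (a ^ 2 + b ^ 2 + m ^ 2) := by
  have hab := sq_nonneg (a - b)
  have h1 := mul_nonneg ha hab
  have h2 := mul_nonneg hb hab
  have hm := sq_nonneg m
  have h3 := mul_nonneg ha hm
  have h4 := mul_nonneg hb hm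
  have h5 : 0 ≤ a * b * (a ^ 2 + b ^ 2 + m ^ 2) := by positivity
  have h6 : 0 ≤ a ^ 3 := by positivity
  have h7 : 0 ≤ b ^ 3 := by positivity
  have h8 : 0 ≤ a * b ^ 2 := by positivity
  have h9 : 0 ≤ b * a ^ 2 := by positivity
  have h10 := sq_nonneg a
  have h11 := sq_nonneg b
  refine ⟨?_, ?_, ?_⟩ <;> nlinarith

theorem norm_real_le (h : DataBound lam mu d t k l m δ) (hmu : 0 < mu) (hlm : 0 < lam + mu)
    (ht : 0 ≤ t) (hm : m ≠ 0) {K : ℝ} (hK : K = 2 * mu + 2 * (lam + 2 * mu) + (1 + t))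
    (x y z : ℝ) :
    ‖realU lam mu d x y z t k l m‖ ≤ 4 * K * δ * ((1 + |k|) * (1 + |l|)) ∧
    ‖realV lam mu d x y z t k l m‖ ≤ 4 * K * δ * ((1 + |k|) * (1 + |l|)) ∧
    ‖realW lam mu d x y z t k l m‖ ≤ 4 * K * δ * ((1 + |k|) * (1 + |l|)) := by
  obtain ⟨p1, p2, q1, q2, r1, r2⟩ := h.norm_N_le hmu hlm ht hm hK
  have hδ := h.nonneg
  have hK0 : 0 ≤ K := by rw [hK]; nlinarith
  have hβ : 0 ≤ K * δ := by positivity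
  set β := K * δ with hβdef
  have hκ : 0 < k ^ 2 + l ^ 2 + m ^ 2 := by positivity
  have ak := abs_nonneg k
  have al := abs_nonneg l
  have hkl : |k * l| = |k| * |l| := abs_mul k l
  have fin : ∀ {X : ℂ} {p : ℝ}, ‖X‖ ≤ β * p →
      p ≤ 4 * ((1 + |k|) * (1 + |l|)) * (k ^ 2 + l ^ 2 + m ^ 2) →
      ‖kernel x y z k l m * X‖ ≤ 4 * K * δ * ((1 + |k|) * (1 + |l|)) := by
    intro X p hX hp
    rw [norm_mul, norm_kernel, inv_mul_le_iff₀ hκ]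
    refine hX.trans ((mul_le_mul_of_nonneg_left hp hβ).trans_eq ?_)
    rw [hβdef]; ring
  obtain ⟨w1, w2, w3⟩ := weights_le ak al m
  rw [sq_abs, sq_abs] at w1 w2 w3
  refine ⟨?_, ?_, ?_⟩
  · refine fin (p := |k| * (|k| + |l| + m ^ 2) + |k| * |l| * (1 + |l|)
      + (m ^ 2 + l ^ 2) * (1 + |k|)) ?_ ?_
    · have e := norm_sub_le_of_le (norm_sub_le_of_le (norm_real_mul_le k p1)
        (norm_inv_mul_le hm (k * l) q2)) (norm_inv_mul_le hm (m ^ 2 + l ^ 2) r2)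
      refine (le_of_eq ?_).trans (e.trans_eq ?_)
      · congr 1; push_cast; ring
      · rw [hkl, abs_of_nonneg (by positivity : 0 ≤ m ^ 2 + l ^ 2)]; ring
    · exact w1
  · refine fin (p := |l| * (|k| + |l| + m ^ 2) + (k ^ 2 + m ^ 2) * (1 + |l|)
      + |k| * |l| * (1 + |k|)) ?_ ?_
    · have e := norm_add_le_of_le (norm_add_le_of_le (norm_real_mul_le l p1)
        (norm_inv_mul_le hm (k ^ 2 + m ^ 2) q2)) (norm_inv_mul_le hm (k * l) r2)
      refine (le_of_eq ?_).trans (e.trans_eq ?_)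
      · congr 1; push_cast; ring
      · rw [hkl, abs_of_nonneg (by positivity : 0 ≤ k ^ 2 + m ^ 2)]; ring
    · exact w2
  · refine fin (p := m ^ 2 * (1 + |k| + |l|) + |l| * (|l| + m ^ 2) + |k| * (|k| + m ^ 2)) ?_ ?_
    · have e := norm_add_le_of_le (norm_sub_le_of_le (norm_real_mul_le m p2)
        (norm_real_mul_le l q1)) (norm_real_mul_le k r1)
      refine e.trans_eq ?_
      rw [← sq_abs m]; ring
    · exact w3

end DataBound

theorem Data.SmoothDecaying.exists_dataBound {lam mu : ℝ} {d : Data} (hd : d.SmoothDecaying 12)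
    (hmu : 0 < mu) (hlm : 0 < lam + mu) {t : ℝ} (ht : 0 ≤ t) : ∃ B : ℝ, 0 ≤ B ∧ ∀ k l m : ℝ, m ≠ 0 →
      DataBound lam mu d t k l m (B * (damping k l / (1 + m ^ 2))) := by
  have hl2 : 0 < lam + 2 * mu := by linarith
  obtain ⟨b1, n1, h1⟩ := hd.u₀.exists_bound_hat
  obtain ⟨b2, n2, h2⟩ := hd.v₀.exists_bound_hat
  obtain ⟨b3, n3, h3⟩ := hd.w₀.exists_bound_hat
  obtain ⟨b4, n4, h4⟩ := hd.u₁.exists_bound_hat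
  obtain ⟨b5, n5, h5⟩ := hd.v₁.exists_bound_hat
  obtain ⟨b6, n6, h6⟩ := hd.w₁.exists_bound_hat
  obtain ⟨b7, n7, h7⟩ := hd.g₁.exists_bound_timeTransform ht hl2
  obtain ⟨b8, n8, h8⟩ := hd.g₂.exists_bound_timeTransform ht hl2
  obtain ⟨b9, n9, h9⟩ := hd.g₃.exists_bound_timeTransform ht hl2
  obtain ⟨b10, n10, h10⟩ := hd.g₁.exists_bound_timeTransform ht hmu
  obtain ⟨b11, n11, h11⟩ := hd.g₂.exists_bound_timeTransform ht hmu
  obtain ⟨b12, n12, h12⟩ := hd.g₃.exists_bound_timeTransform ht hmu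
  refine ⟨b1 + b2 + b3 + b4 + b5 + b6 + b7 + b8 + b9 + b10 + b11 + b12, by positivity,
    fun k l m hm => ?_⟩
  set B := b1 + b2 + b3 + b4 + b5 + b6 + b7 + b8 + b9 + b10 + b11 + b12 with hB
  have hmc : (m : ℂ) ≠ 0 := by exact_mod_cast hm
  have hD : 0 ≤ damping k l / (1 + m ^ 2) := by
    have := damping_pos k l
    positivity
  have s1 : omega1 lam mu k l m ^ 2 = ((lam + 2 * mu : ℝ) : ℂ) * (k ^ 2 + l ^ 2 + m ^ 2) := by
    rw [omega1_sq k l hmu hlm hmc]; push_cast; ring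
  have s2 := omega2_sq k l hmu hmc
  have lift : ∀ {X : ℂ} {b : ℝ}, b ≤ B → ‖X‖ ≤ b * (damping k l / (1 + m ^ 2)) →
      ‖X‖ ≤ B * (damping k l / (1 + m ^ 2)) := fun hb hX =>
    hX.trans (mul_le_mul_of_nonneg_right hb hD)
  have lift' : ∀ {X : ℂ} {b : ℝ}, b ≤ B → ‖X‖ ≤ b * (damping k l / (1 + m ^ 2)) * |m| →
      ‖X‖ ≤ B * (damping k l / (1 + m ^ 2)) * |m| := fun hb hX =>
    hX.trans (mul_le_mul_of_nonneg_right (mul_le_mul_of_nonneg_right hb hD) (abs_nonneg m))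
  exact
  { nonneg := by positivity
    u₀ := ⟨lift (by linarith) (h1 k l m).1, lift' (by linarith) (h1 k l m).2⟩
    v₀ := ⟨lift (by linarith) (h2 k l m).1, lift' (by linarith) (h2 k l m).2⟩
    w₀ := ⟨lift (by linarith) (h3 k l m).1, lift' (by linarith) (h3 k l m).2⟩
    u₁ := ⟨lift (by linarith) (h4 k l m).1, lift' (by linarith) (h4 k l m).2⟩
    v₁ := ⟨lift (by linarith) (h5 k l m).1, lift' (by linarith) (h5 k l m).2⟩
    w₁ := ⟨lift (by linarith) (h6 k l m).1, lift' (by linarith) (h6 k l m).2⟩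
    G₁ := lift (by linarith) (h7 k l m _ hm s1)
    F₁ := lift (by linarith) (h8 k l m _ hm s1)
    E₁ := lift (by linarith) (h9 k l m _ hm s1)
    G₂ := lift (by linarith) (h10 k l m _ hm s2)
    F₂ := lift (by linarith) (h11 k l m _ hm s2)
    E₂ := lift (by linarith) (h12 k l m _ hm s2) }

/-- The damping has order four in each of `k` and `l`; this absorbs the polynomial growth and leaves
an integrable product. -/
theorem one_add_abs_mul_damping_le (k l : ℝ) :
    (1 + |k|) * (1 + |l|) * damping k l ≤ 4 * ((1 + k ^ 2)⁻¹ * (1 + l ^ 2)⁻¹) := by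
  have h : ∀ x : ℝ, (1 + |x|) ≤ 2 * (1 + x ^ 2) := fun x => by
    rw [← sq_abs]; nlinarith [sq_nonneg (|x| - 1)]
  calc (1 + |k|) * (1 + |l|) * damping k l
      ≤ (2 * (1 + k ^ 2)) * (2 * (1 + l ^ 2)) * damping k l := by
        have := (damping_pos k l).le
        gcongr
        · exact h k
        · exact h l
    _ = _ := by
        rw [damping]
        field_simp
        norm_num

/-- The integrals over the real space converge. -/
theorem Data.SmoothDecaying.integrable_real {lam mu : ℝ} {d : Data} (hd : d.SmoothDecaying 12)
    (hmu : 0 < mu) (hlm : 0 < lam + mu) {t : ℝ} (ht : 0 ≤ t) (x y z : ℝ) :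
    Integrable (fun q : ℝ × ℝ × ℝ => realU lam mu d x y z t q.1 q.2.1 q.2.2) ∧
    Integrable (fun q : ℝ × ℝ × ℝ => realV lam mu d x y z t q.1 q.2.1 q.2.2) ∧
    Integrable (fun q : ℝ × ℝ × ℝ => realW lam mu d x y z t q.1 q.2.1 q.2.2) := by
  obtain ⟨B, hB, hb⟩ := hd.exists_dataBound hmu hlm ht
  obtain ⟨mU, mV, mW⟩ := measurable_real_integrands (lam := lam) (mu := mu) hd ht x y z
  set K : ℝ := 2 * mu + 2 * (lam + 2 * mu) + (1 + t) with hK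
  have hK0 : 0 ≤ K := by rw [hK]; nlinarith
  have hmaj : Integrable fun q : ℝ × ℝ × ℝ =>
      (16 * K * B) * ((1 + q.1 ^ 2)⁻¹ * ((1 + q.2.1 ^ 2)⁻¹ * (1 + q.2.2 ^ 2)⁻¹)) :=
    (integrable_inv_one_add_sq.mul_prod
      (integrable_inv_one_add_sq.mul_prod integrable_inv_one_add_sq)).const_mul _
  -- On the null set `m = 0` the integrands take conventional values (`1/m`, `root`), so the bounds
  -- are claimed off it.
  have hne : ∀ᵐ q : ℝ × ℝ × ℝ, q.2.2 ≠ 0 := by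
    have h0 : ∀ᵐ m : ℝ, m ≠ 0 := by
      filter_upwards [compl_mem_ae_iff.2 (measure_singleton (0 : ℝ))] with m hm using hm
    have h1 : ∀ᵐ p : ℝ × ℝ, p.2 ≠ 0 :=
      (Measure.quasiMeasurePreserving_snd (μ := (volume : Measure ℝ))
        (ν := (volume : Measure ℝ))).ae h0
    exact (Measure.quasiMeasurePreserving_snd (μ := (volume : Measure ℝ))
      (ν := (volume : Measure (ℝ × ℝ)))).ae h1
  have hle : ∀ q : ℝ × ℝ × ℝ, 4 * K * (B * (damping q.1 q.2.1 / (1 + q.2.2 ^ 2)))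
      * ((1 + |q.1|) * (1 + |q.2.1|))
      ≤ (16 * K * B) * ((1 + q.1 ^ 2)⁻¹ * ((1 + q.2.1 ^ 2)⁻¹ * (1 + q.2.2 ^ 2)⁻¹)) := by
    intro q
    have h1 := mul_le_mul_of_nonneg_left (one_add_abs_mul_damping_le q.1 q.2.1)
      (by positivity : 0 ≤ 4 * K * B * (1 + q.2.2 ^ 2)⁻¹)
    refine (le_of_eq ?_).trans (h1.trans_eq ?_)
    · rw [div_eq_mul_inv]; ring
    · ring
  refine ⟨hmaj.mono' mU.aestronglyMeasurable ?_, hmaj.mono' mV.aestronglyMeasurable ?_,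
    hmaj.mono' mW.aestronglyMeasurable ?_⟩
  · filter_upwards [hne] with q hq
    exact ((hb q.1 q.2.1 q.2.2 hq).norm_real_le hmu hlm ht hq hK x y z).1.trans (hle q)
  · filter_upwards [hne] with q hq
    exact ((hb q.1 q.2.1 q.2.2 hq).norm_real_le hmu hlm ht hq hK x y z).2.1.trans (hle q)
  · filter_upwards [hne] with q hq
    exact ((hb q.1 q.2.1 q.2.2 hq).norm_real_le hmu hlm ht hq hK x y z).2.2.trans (hle q)

end HalfSpace

end


noncomputable section

namespace HalfSpace

open Filter Topology Set

/-! ### The solution formulae -/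

/-- The contours may vary with `(k, l)` in an arbitrary, even nonmeasurable way. Integrability of
the contour integrals in `(k, l)` is nevertheless clear: by `hinv` each equals the transform of the
solution minus the inner real integral, and both are integrable without reference to `h`. The
constant is `8π³ = 2π · 4π²`, from the inversions in `m` and in `(k, l)`. -/
theorem isGivenBy_of_inversion {h : ℝ → ℝ → ℝ → ℝ} {f : ℝ → ℝ → ℂ → ℂ} {g : ℝ → ℝ → ℝ → ℂ}
    {X : ℝ → ℝ → ℂ} {x y a : ℝ}
    (hinv : ∀ k l, Integrable (pullback (h k l) (f k l)) ∧ Integrable (g k l) ∧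
      contourIntegral (h k l) (f k l) + ∫ m, g k l m
        = exp (I * k * x + I * l * y) * (2 * Real.pi * X k l))
    (hreal : Integrable fun q : ℝ × ℝ × ℝ => g q.1 q.2.1 q.2.2)
    (hX : Integrable fun q : ℝ × ℝ => X q.1 q.2)
    (hval : ∫ q : ℝ × ℝ, exp (I * q.1 * x + I * q.2 * y) * X q.1 q.2 = 4 * Real.pi ^ 2 * (a : ℂ)) :
    IsGivenBy h f g a := by
  have hG : Integrable fun q : ℝ × ℝ => ∫ m, g q.1 q.2 m := by
    -- Regrouping the variables as `((k, l), m)` lets Fubini give integrability in `(k, l)` of the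
    -- inner integral.
    have h1 : Integrable (fun p : (ℝ × ℝ) × ℝ => g p.1.1 p.1.2 p.2) :=
      (volume_preserving_prodAssoc (α₁ := ℝ) (β₁ := ℝ) (γ₁ := ℝ)).integrable_comp_of_integrable hreal
    exact h1.integral_prod_left
  have hE : Integrable fun q : ℝ × ℝ => exp (I * q.1 * x + I * q.2 * y) * X q.1 q.2 := by
    refine hX.bdd_mul (c := 1) (Continuous.aestronglyMeasurable (by fun_prop))
      (Eventually.of_forall fun q => ?_)
    rw [norm_exp]; simp
  have hC : ∀ k l, contourIntegral (h k l) (f k l)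
      = 2 * Real.pi * (exp (I * k * x + I * l * y) * X k l) - ∫ m, g k l m := fun k l => by
    rw [eq_sub_iff_add_eq, (hinv k l).2.2]; ring
  have hO : Integrable fun q : ℝ × ℝ => contourIntegral (h q.1 q.2) (f q.1 q.2) := by
    simp only [hC]
    exact (hE.const_mul _).sub hG
  refine ⟨fun k l => (hinv k l).1, hO, hreal, ?_⟩
  have e1 : ∫ k : ℝ, ∫ l : ℝ, contourIntegral (h k l) (f k l)
      = ∫ q : ℝ × ℝ, contourIntegral (h q.1 q.2) (f q.1 q.2) := (integral_prod _ hO).symm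
  have e2 : ∫ k : ℝ, ∫ l : ℝ, ∫ m : ℝ, g k l m = ∫ q : ℝ × ℝ, ∫ m, g q.1 q.2 m :=
    (integral_prod _ hG).symm
  rw [e1, e2, ← mul_add, ← integral_add hO hG]
  have e3 : ∫ q : ℝ × ℝ, (contourIntegral (h q.1 q.2) (f q.1 q.2) + ∫ m, g q.1 q.2 m)
      = 2 * Real.pi * (4 * Real.pi ^ 2 * (a : ℂ)) := by
    rw [← hval, ← integral_const_mul]
    refine integral_congr_ae (Eventually.of_forall fun q => ?_)
    simp only [(hinv q.1 q.2).2.2]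
    ring
  rw [e3]
  have hpi : (Real.pi : ℂ) ≠ 0 := by exact_mod_cast Real.pi_ne_zero
  field_simp
  ring

end HalfSpace

end

/-! ### The solution formulae -/

theorem proposition1 :
    ∃ N : ℕ, ∀ (lam mu : ℝ), 0 < mu → 0 < lam + mu →
      (∀ k l : ℝ, ∃ h : ℝ → ℝ, HalfSpace.IsAdmissible lam mu k l h) ∧
      ∀ (d : HalfSpace.Data), d.SmoothDecaying N →
      ∀ (u v w : ℝ × ℝ × ℝ × ℝ → ℝ), HalfSpace.IsDecayingSolution lam mu d u v w →
      ∀ (h : ℝ → ℝ → ℝ → ℝ), (∀ k l : ℝ, HalfSpace.IsAdmissible lam mu k l (h k l)) →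
      ∀ x y z t : ℝ, 0 < z → 0 < t →
        HalfSpace.IsGivenBy h (HalfSpace.contourU lam mu d x y z t)
          (HalfSpace.realU lam mu d x y z t) (u (x, y, z, t)) ∧
        HalfSpace.IsGivenBy h (HalfSpace.contourV lam mu d x y z t)
          (HalfSpace.realV lam mu d x y z t) (v (x, y, z, t)) ∧
        HalfSpace.IsGivenBy h (HalfSpace.contourW lam mu d x y z t)
          (HalfSpace.realW lam mu d x y z t) (w (x, y, z, t)) := by
  -- The order `12` serves only the absolute convergence over real `(k, l, m)` and is not sharp: the
  -- estimates use ten derivatives of the initial values, nine of the boundary values, and five of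
  -- the nine available decay factors.
  refine ⟨12, fun lam mu hmu hlm => ⟨fun k l => HalfSpace.exists_isAdmissible k l hmu hlm, ?_⟩⟩
  intro d hd u v w hs h hA x y z t hz ht
  obtain ⟨rU, rV, rW⟩ := hd.integrable_real hmu hlm ht.le x y z
  have half := hs.isHalfLineSolution
  exact ⟨HalfSpace.isGivenBy_of_inversion
      (fun k l => (half k l).inversion_u hmu hlm (hA k l) x y hz ht.le) rU
      (hs.decay_u.integrable_layer hz.le ht.le) (hs.decay_u.layer_inversion hz.le ht.le x y),
    HalfSpace.isGivenBy_of_inversion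
      (fun k l => (half k l).inversion_v hmu hlm (hA k l) x y hz ht.le) rV
      (hs.decay_v.integrable_layer hz.le ht.le) (hs.decay_v.layer_inversion hz.le ht.le x y),
    HalfSpace.isGivenBy_of_inversion
      (fun k l => (half k l).inversion_w hmu hlm (hA k l) x y hz ht.le) rW
      (hs.decay_w.integrable_layer hz.le ht.le) (hs.decay_w.layer_inversion hz.le ht.le x y)⟩
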